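/- **Setting.** Let $L$ be a finite extension of $\mathbf{Q}_p$ for some prime $p$, with ring of integers $O_L$ and residue field of order $q$. Let $L^c$ be an algebraic closure of $L$ and $\Omega_L=\mathrm{Gal}(L^c/L)$. Fix a uniformiser $\varpi$ of $L$, a compatible system $\{\zeta_m\}_{m\ge 1}$ of primitive $m$-th roots of unity in $L^c$ (so $(\zeta_{mn})^m=\zeta_n$), and a compatible system $\{\varpi^{1/m}\}_{m\ge 1}$ of roots of $\varpi$ (so $(\varpi^{1/mn})^m=\varpi^{1/n}$ and $\varpi^{1/1}=\varpi$). For a rational number $a/b$ in lowest terms put $\varpi^{a/b}=(\varpi^{1/b})^a$. Let $\sigma$ be the topological generator of $\mathrm{Gal}(L^t/L^{nr})$ (where $L^t$, $L^{nr}$ are the maximal tamely ramified and maximal unramified extensions of $L$) with $\sigma(\varpi^{1/m})=\zeta_m\varpi^{1/m}$ and $\sigma(\zeta_m)=\zeta_m$ for all $m$ prime to $q$. Let $G$ be a finite group and $\pi:\Omega_L\to G$ a continuous homomorphism. Let $L_\pi$ be the associated $G$-Galois algebra, that is, the $L$-algebra of functions $a:G\to L^c$ such that $a(\pi(\omega)h)=\omega(a(h))$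 for all $\omega\in\Omega_L$, $h\in G$, with $G$-action $a^g(h)=a(hg)$. Let $O_\pi$ be the integral closure of $O_L$ in $L_\pi$. The resolvend of $a$ is $\mathbf r_G(a)=\sum_{g\in G}a(g)g^{-1}\in L^cG$. Assume that $L_\pi/L$ is at most tamely ramified; then $\pi$ factors through $\mathrm{Gal}(L^t/L)$, and we put $s:=\pi(\sigma)$. Let $R_G$ be the group of virtual $L^c$-valued characters of $G$, on which $\Omega_L$ acts by $(\omega\circ\chi)(g)=\omega(\chi(g))$. Let $\psi_2$ be the second Adams operation on $R_G$, $\psi_2(\chi)(g)=\chi(g^2)$. Let $\langle\chi,s\rangle_G\in\mathbf Q$ be the Stickelberger pairing: it is additive in $\chi\in R_G$, it depends only on the restriction of $\chi$ to $\langle s\rangle$, and an irreducible character $\chi$ of $\langle s\rangle$ with $\chi(s)=\zeta_{|s|}^{\,r}$ contributes the fractional part $\{r/|s|\}\in[0,1)$. For $a\in (L^cG)^\times$, the homomorphism $\mathrm{Det}(a)\in\mathrm{Hom}(R_G,(L^c)^\times)$ sends the character of a representation $T$ to $\det T(a)$. Let $K_0(O_LG,\Lambda)$ be the relative algebraic $K$-group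 for extension of scalars from $O_L$ to $\Lambda$: it is generated by the classes $[M,N;\xi]$ of triples consisting of finitely generated projective $O_LG$-modules $M,N$ and a $\Lambda G$-isomorphism $\xi:M\otimes_{O_L}\Lambda\to N\otimes_{O_L}\Lambda$, subject to additivity on short exact sequences of triples and to $[M,P;\eta\xi]=[M,N;\xi]+[N,P;\eta]$. **Corollary.** Suppose that $L_\pi/L$ is at most tamely ramified and that $s=\pi(\sigma)$ has odd order. Then the inverse different of $L_\pi/L$ has a unique square root $A(\pi)$ among the fractional ideals of $O_\pi$, and the classes $[A(\pi),O_LG;\mathbf r_G]$ and $[O_\pi,O_LG;\mathbf r_G]$ in $K_0(O_LG,L^c)$ are defined. Their difference $$\mathfrak c(\pi)=[A(\pi),O_LG;\mathbf r_G]-[O_\pi,O_LG;\mathbf r_G]$$ comes from a class in $K_0(O_LG,L)$ that, under the isomorphism $$K_0(O_LG,L)\simeq \mathrm{Hom}_{\Omega_L}(R_G,(L^c)^\times)/\mathrm{Det}(O_LG)^\times ,$$ is represented by the homomorphism $f_\pi\in\mathrm{Hom}_{\Omega_L}(R_G,(L^c)^\times)$ given by $$f_\pi(\chi)=\varpi^{\langle\psi_2(\chi)-2\chi,\,s\rangle_G}.$$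 Here the isomorphism is the one that sends $[O_LG,O_LG;1\mapsto x]$ to the class of $\mathrm{Det}(x)$ for $x\in (LG)^\times$. That $f_\pi$ represents the class means: the class is of the form $[O_LG,O_LG;1\mapsto x]$ for some $x\in(LG)^\times$, and for every such $x$ one has $\mathrm{Det}(x)\in f_\pi\cdot\mathrm{Det}(O_LG)^\times$. -/

import Mathlib

open scoped TensorProduct ValuativeRel
universe w u v
noncomputable section
namespace GaloisStructure

/-! ### Relative algebraic K-theory -/

/-- A finitely generated projective (left) module over the `R`-algebra `𝔄`. -/
structure ProjMod (R : Type u) (𝔄 : Type w) [CommRing R] [Ring 𝔄] [Algebra R 𝔄] where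
  carrier : Type w
  [addCommGroup : AddCommGroup carrier]
  [module : Module 𝔄 carrier]
  [baseModule : Module R carrier]
  [isScalarTower : IsScalarTower R 𝔄 carrier]
  [finite : Module.Finite 𝔄 carrier]
  [projective : Module.Projective 𝔄 carrier]

attribute [instance] ProjMod.addCommGroup ProjMod.module ProjMod.baseModule
  ProjMod.isScalarTower ProjMod.finite ProjMod.projective

instance (R : Type u) (𝔄 : Type w) [CommRing R] [Ring 𝔄] [Algebra R 𝔄] :
    CoeSort (ProjMod R 𝔄) (Type w) := ⟨ProjMod.carrier⟩

section
variable {R : Type u} {𝔄 : Type w} [CommRing R] [Ring 𝔄] [Algebra R 𝔄]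
variable (Λ : Type v) [CommRing Λ] [Algebra R Λ]

/-- The action of `a : 𝔄` on the `Λ ⊗[R] 𝔄`-module `Λ ⊗[R] M`. -/
def act (M : Type w) [AddCommGroup M] [Module 𝔄 M] [Module R M] [IsScalarTower R 𝔄 M] (a : 𝔄) :
    Λ ⊗[R] M →ₗ[Λ] Λ ⊗[R] M :=
  (Algebra.lsmul R R M a).baseChange Λ

/-- The extension of scalars `Λ ⊗[R] M → Λ ⊗[R] N` of an `𝔄`-linear map. -/
def ext (M N : ProjMod R 𝔄) (i : M →ₗ[𝔄] N) : Λ ⊗[R] M →ₗ[Λ] Λ ⊗[R] N :=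
  (i.restrictScalars R).baseChange Λ

/-- An isomorphism `Λ ⊗[R] M ≃ Λ ⊗[R] N` of `Λ ⊗[R] 𝔄`-modules: a `Λ`-linear bijection
commuting with the action of `𝔄`. -/
structure LatIso (M N : ProjMod R 𝔄) where
  toEquiv : Λ ⊗[R] M ≃ₗ[Λ] Λ ⊗[R] N
  map_act : ∀ (a : 𝔄) (x : Λ ⊗[R] M), toEquiv (act Λ M a x) = act Λ N a (toEquiv x)

variable {Λ}
/-- Composition `η ∘ ξ`. -/
def LatIso.comp {M N P : ProjMod R 𝔄} (η : LatIso Λ N P) (ξ : LatIso Λ M N) : LatIso Λ M P where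
  toEquiv := ξ.toEquiv.trans η.toEquiv
  map_act a x := by simp [ξ.map_act, η.map_act]

variable (R 𝔄 Λ) in
/-- A triple `[M, N; ξ]`. -/
structure Triple where
  M : ProjMod R 𝔄
  N : ProjMod R 𝔄
  ξ : LatIso Λ M N

/-- The defining relations of relative algebraic `K₀`: additivity on short exact sequences of
triples, and `[M, P; η ∘ ξ] = [M, N; ξ] + [N, P; η]`. -/
inductive Relator : FreeAbelianGroup (Triple R 𝔄 Λ) → Prop
  | exact (T' T T'' : Triple R 𝔄 Λ)
      (i : T'.M →ₗ[𝔄] T.M) (p : T.M →ₗ[𝔄] T''.M) (j : T'.N →ₗ[𝔄] T.N) (q : T.N →ₗ[𝔄] T''.N)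
      (hi : Function.Injective i) (hip : Function.Exact i p) (hp : Function.Surjective p)
      (hj : Function.Injective j) (hjq : Function.Exact j q) (hq : Function.Surjective q)
      (h' : ∀ x, T.ξ.toEquiv (ext Λ _ _ i x) = ext Λ _ _ j (T'.ξ.toEquiv x))
      (h'' : ∀ x, T''.ξ.toEquiv (ext Λ _ _ p x) = ext Λ _ _ q (T.ξ.toEquiv x)) :
      Relator (.of T - (.of T' + .of T''))
  | comp (M N P : ProjMod R 𝔄) (ξ : LatIso Λ M N) (η : LatIso Λ N P) :
      Relator (.of ⟨M, P, η.comp ξ⟩ - (.of ⟨M, N, ξ⟩ + .of ⟨N, P, η⟩))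

variable (R 𝔄 Λ) in
/-- The relative algebraic `K`-group `K₀(𝔄, Λ)` attached to extension of scalars along `R → Λ`. -/
def K0 : Type _ :=
  FreeAbelianGroup (Triple R 𝔄 Λ) ⧸ AddSubgroup.closure {x | Relator (R := R) (𝔄 := 𝔄) (Λ := Λ) x}

instance : AddCommGroup (K0 R 𝔄 Λ) := inferInstanceAs (AddCommGroup (_ ⧸ _))

/-- The class of a triple in `K₀(𝔄, Λ)`. -/
def K0.mk (T : Triple R 𝔄 Λ) : K0 R 𝔄 Λ := QuotientAddGroup.mk (FreeAbelianGroup.of T)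

variable (R 𝔄) in
/-- The free module `𝔄` of rank one. -/
def ProjMod.self : ProjMod R 𝔄 where
  carrier := 𝔄

variable (R) in
/-- Right multiplication by a unit, as a `Λ`-linear automorphism. -/
def mulRightEquiv (x : (Λ ⊗[R] 𝔄)ˣ) : Λ ⊗[R] 𝔄 ≃ₗ[Λ] Λ ⊗[R] 𝔄 where
  __ := LinearMap.mulRight Λ (x : Λ ⊗[R] 𝔄)
  invFun y := y * ((x⁻¹ : (Λ ⊗[R] 𝔄)ˣ) : Λ ⊗[R] 𝔄)
  left_inv y := by simp
  right_inv y := by simp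

theorem act_self (a : 𝔄) (z : Λ ⊗[R] 𝔄) : act Λ 𝔄 a z = (1 ⊗ₜ a) * z := by
  induction z with
  | zero => simp
  | add z w hz hw => simp [mul_add, hz, hw]
  | tmul l b => simp [act]

theorem mulRightEquiv_act (x : (Λ ⊗[R] 𝔄)ˣ) (a : 𝔄) (y : Λ ⊗[R] 𝔄) :
    mulRightEquiv R x (act Λ 𝔄 a y) = act Λ 𝔄 a (mulRightEquiv R x y) := by
  rw [act_self, act_self]
  exact mul_assoc _ _ _

/-- Right multiplication by a unit `x` of `Λ ⊗[R] 𝔄`: the automorphism of the free left module of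
rank one that sends the basis `1` to `x`. -/
def rightMul (x : (Λ ⊗[R] 𝔄)ˣ) : LatIso Λ (ProjMod.self R 𝔄) (ProjMod.self R 𝔄) where
  toEquiv := @mulRightEquiv R 𝔄 _ _ _ Λ _ _ x
  map_act := @mulRightEquiv_act R 𝔄 _ _ _ Λ _ _ x

/-- The boundary map `(Λ ⊗[R] 𝔄)ˣ → K₁(Λ ⊗[R] 𝔄) → K₀(𝔄, Λ)`, `x ↦ [𝔄, 𝔄; 1 ↦ x]`. -/
def boundary (x : (Λ ⊗[R] 𝔄)ˣ) : K0 R 𝔄 Λ :=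
  K0.mk ⟨ProjMod.self R 𝔄, ProjMod.self R 𝔄, rightMul x⟩

section
variable (Λ' : Type*) [CommRing Λ'] [Algebra R Λ'] [Algebra Λ Λ'] [IsScalarTower R Λ Λ']

theorem act_cancel (M : Type w) [AddCommGroup M] [Module 𝔄 M] [Module R M] [IsScalarTower R 𝔄 M]
    (a : 𝔄) (x : Λ' ⊗[R] M) :
    (TensorProduct.AlgebraTensorModule.cancelBaseChange R Λ Λ' Λ' M).symm (act Λ' M a x) =
      (act Λ M a).baseChange Λ'
        ((TensorProduct.AlgebraTensorModule.cancelBaseChange R Λ Λ' Λ' M).symm x) := by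
  induction x with
  | zero => simp
  | add z w hz hw => simp only [map_add, hz, hw]
  | tmul l b => simp [act]

theorem ext_cancel (M N : ProjMod R 𝔄) (i : M →ₗ[𝔄] N) (x : Λ' ⊗[R] M) :
    (TensorProduct.AlgebraTensorModule.cancelBaseChange R Λ Λ' Λ' N).symm (ext Λ' M N i x) =
      (ext Λ M N i).baseChange Λ'
        ((TensorProduct.AlgebraTensorModule.cancelBaseChange R Λ Λ' Λ' M).symm x) := by
  induction x with
  | zero => simp
  | add z w hz hw => simp only [map_add, hz, hw]
  | tmul l b => simp [ext]

/-- Extension of scalars of an isomorphism from `Λ` to `Λ'`. -/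
def LatIso.baseChange {M N : ProjMod R 𝔄} (ξ : LatIso Λ M N) : LatIso Λ' M N where
  toEquiv := (TensorProduct.AlgebraTensorModule.cancelBaseChange R Λ Λ' Λ' M).symm ≪≫ₗ
    ξ.toEquiv.baseChange Λ Λ' _ _ ≪≫ₗ
    TensorProduct.AlgebraTensorModule.cancelBaseChange R Λ Λ' Λ' N
  map_act a x := by
    apply (TensorProduct.AlgebraTensorModule.cancelBaseChange R Λ Λ' Λ' N).symm.injective
    simp only [LinearEquiv.trans_apply, act_cancel (Λ := Λ), LinearEquiv.symm_apply_apply]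
    generalize (TensorProduct.AlgebraTensorModule.cancelBaseChange R Λ Λ' Λ' M).symm x = y
    induction y with
    | zero => simp
    | add z w hz hw => simp only [map_add, hz, hw]
    | tmul l b => simp [ξ.map_act]


theorem LatIso.baseChange_spec {M N : ProjMod R 𝔄} (ξ : LatIso Λ M N) (x : Λ' ⊗[R] M) :
    (TensorProduct.AlgebraTensorModule.cancelBaseChange R Λ Λ' Λ' N).symm
      ((ξ.baseChange Λ').toEquiv x) = ξ.toEquiv.baseChange Λ Λ' _ _
        ((TensorProduct.AlgebraTensorModule.cancelBaseChange R Λ Λ' Λ' M).symm x) := by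
  simp [LatIso.baseChange]

theorem LatIso.baseChange_compat {M N M' N' : ProjMod R 𝔄} (ξ : LatIso Λ M N)
    (ξ' : LatIso Λ M' N') (i : M →ₗ[𝔄] M') (j : N →ₗ[𝔄] N')
    (h : ∀ x, ξ'.toEquiv (ext Λ _ _ i x) = ext Λ _ _ j (ξ.toEquiv x)) (x : Λ' ⊗[R] M) :
    (ξ'.baseChange Λ').toEquiv (ext Λ' _ _ i x) =
      ext Λ' _ _ j ((ξ.baseChange Λ').toEquiv x) := by
  apply (TensorProduct.AlgebraTensorModule.cancelBaseChange R Λ Λ' Λ' N').symm.injective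
  rw [LatIso.baseChange_spec, ext_cancel (Λ := Λ), ext_cancel (Λ := Λ), LatIso.baseChange_spec]
  generalize (TensorProduct.AlgebraTensorModule.cancelBaseChange R Λ Λ' Λ' M).symm x = y
  induction y with
  | zero => simp
  | add z w hz hw => simp only [map_add, hz, hw]
  | tmul l b => simp [h]

theorem LatIso.baseChange_comp {M N P : ProjMod R 𝔄} (η : LatIso Λ N P) (ξ : LatIso Λ M N) :
    (η.comp ξ).baseChange Λ' = (η.baseChange Λ').comp (ξ.baseChange Λ') := by
  have : ((η.comp ξ).baseChange Λ').toEquiv =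
      ((η.baseChange Λ').comp (ξ.baseChange Λ')).toEquiv := by
    ext1 x
    apply (TensorProduct.AlgebraTensorModule.cancelBaseChange R Λ Λ' Λ' P).symm.injective
    change _ = (TensorProduct.AlgebraTensorModule.cancelBaseChange R Λ Λ' Λ' P).symm
      ((η.baseChange Λ').toEquiv ((ξ.baseChange Λ').toEquiv x))
    rw [LatIso.baseChange_spec, LatIso.baseChange_spec, LatIso.baseChange_spec]
    generalize (TensorProduct.AlgebraTensorModule.cancelBaseChange R Λ Λ' Λ' M).symm x = y
    induction y with
    | zero => simp
    | add z w hz hw => simp only [map_add, hz, hw]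
    | tmul l b => simp [LatIso.comp]
  cases h1 : (η.comp ξ).baseChange Λ'
  cases h2 : (η.baseChange Λ').comp (ξ.baseChange Λ')
  simp_all

/-- `[M, N; ξ] ↦ [M, N; ξ_{Λ'}]`. -/
def Triple.baseChange (T : Triple R 𝔄 Λ) : Triple R 𝔄 Λ' := ⟨T.M, T.N, T.ξ.baseChange Λ'⟩

/-- The natural map `K₀(𝔄, Λ) → K₀(𝔄, Λ')`. -/
def K0.baseChange : K0 R 𝔄 Λ →+ K0 R 𝔄 Λ' :=
  QuotientAddGroup.map _ _ (FreeAbelianGroup.map (Triple.baseChange Λ')) <| by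
    rw [AddSubgroup.closure_le]
    rintro _ (⟨T', T, T'', i, p, j, q, hi, hip, hp, hj, hjq, hq, h', h''⟩ | ⟨M, N, P, ξ, η⟩)
    · apply AddSubgroup.subset_closure
      simp only [map_sub, map_add, FreeAbelianGroup.map_of_apply, Set.mem_ofPred_eq]
      exact Relator.exact (T'.baseChange Λ') (T.baseChange Λ') (T''.baseChange Λ') i p j q
        hi hip hp hj hjq hq (LatIso.baseChange_compat Λ' _ _ i j h')
        (LatIso.baseChange_compat Λ' _ _ p q h'')
    · apply AddSubgroup.subset_closure
      simp only [map_sub, map_add, FreeAbelianGroup.map_of_apply, Set.mem_ofPred_eq,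
        Triple.baseChange, LatIso.baseChange_comp]
      exact Relator.comp M N P _ _
end
end

/-! ### Virtual characters, `Det`, Adams operation, Stickelberger pairing -/

section CharacterTheory
open Module


section det
variable {K : Type*} [Field K]
open scoped Classical in

theorem trace_pow_eq [IsAlgClosed K] {V : Type*} [AddCommGroup V] [Module K V] [FiniteDimensional K V]
    (f : End K V) (s : Finset K) (hs : f.charpoly.roots.toFinset ⊆ s) (k : ℕ) :
    LinearMap.trace K V (f ^ k) = ∑ μ ∈ s, (f.charpoly.rootMultiplicity μ : K) * μ ^ k := by
  classical
  have hint : DirectSum.IsInternal f.maxGenEigenspace :=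
    DirectSum.isInternal_submodule_of_iSupIndep_of_iSup_eq_top
      f.independent_maxGenEigenspace (End.iSup_maxGenEigenspace_eq_top f)
  have hfin : {μ | f.maxGenEigenspace μ ≠ ⊥}.Finite :=
    WellFoundedGT.finite_ne_bot_of_iSupIndep f.independent_maxGenEigenspace
  have hf : ∀ μ, Set.MapsTo (f ^ k) (f.maxGenEigenspace μ) (f.maxGenEigenspace μ) := fun μ =>
    f.mapsTo_maxGenEigenspace_of_comm ((Commute.refl f).pow_right k) μ
  have key : ∀ μ, LinearMap.trace K _ ((f ^ k).restrict (hf μ)) =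
      (f.charpoly.rootMultiplicity μ : K) * μ ^ k := by
    intro μ
    have hf1 := f.mapsTo_maxGenEigenspace_of_comm (Commute.refl f) μ
    set g := f.restrict hf1 with hg
    have hn : IsNilpotent (g - algebraMap K (End K (f.maxGenEigenspace μ)) μ) := by
      have := f.isNilpotent_restrict_maxGenEigenspace_sub_algebraMap μ
      convert this using 1
      ext x
      rfl
    have hgk : (f ^ k).restrict (hf μ) = g ^ k := by
      exact (Module.End.pow_restrict k hf1 (hf μ)).symm
    have hn2 : IsNilpotent (g ^ k - algebraMap K (End K (f.maxGenEigenspace μ)) μ ^ k) := by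
      have hc : Commute g (algebraMap K (End K (f.maxGenEigenspace μ)) μ) :=
        Algebra.commutes' μ g |>.symm
      obtain ⟨c, hc'⟩ : ∃ c, g ^ k - algebraMap K (End K (f.maxGenEigenspace μ)) μ ^ k =
          c * (g - algebraMap K (End K (f.maxGenEigenspace μ)) μ) ∧
          Commute c (g - algebraMap K (End K (f.maxGenEigenspace μ)) μ) :=
        ⟨_, (hc.geom_sum₂_mul k).symm, by
          apply Commute.sum_left
          intro i _
          apply Commute.mul_left <;> apply Commute.pow_left
          · exact (Commute.refl g).sub_right hc
          · exact hc.symm.sub_right (Commute.refl _)⟩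
      rw [hc'.1]
      exact hc'.2.isNilpotent_mul_left hn
    have h0 := (LinearMap.isNilpotent_trace_of_isNilpotent hn2).eq_zero
    rw [map_sub, sub_eq_zero, ← map_pow, Algebra.algebraMap_eq_smul_one, map_smul,
      LinearMap.trace_one, LinearMap.finrank_maxGenEigenspace_eq] at h0
    rw [hgk, h0, smul_eq_mul, mul_comm]
  rw [LinearMap.trace_eq_sum_trace_restrict' hint hfin hf]
  simp_rw [key]
  apply Finset.sum_subset_zero_on_sdiff
  · intro μ hμ
    apply hs
    simp only [Set.Finite.mem_toFinset, Set.mem_ofPred_eq] at hμ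
    rw [Multiset.mem_toFinset, ← Multiset.count_pos, Polynomial.count_roots,
      ← LinearMap.finrank_maxGenEigenspace_eq, Module.finrank_pos_iff]
    exact (Submodule.nontrivial_iff_ne_bot).2 hμ
  · intro μ hμ
    simp only [Finset.mem_sdiff, Set.Finite.mem_toFinset, Set.mem_ofPred_eq, not_not] at hμ
    rw [← LinearMap.finrank_maxGenEigenspace_eq, hμ.2]
    simp
  · simp

theorem linInd_pow (s : Finset K) (c : K → K) (h : ∀ k : ℕ, ∑ μ ∈ s, c μ * μ ^ k = 0) :
    ∀ μ ∈ s, c μ = 0 := by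
  classical
  have := linearIndependent_iff'.1 ((linearIndependent_monoidHom (Multiplicative ℕ) K).comp
    (powersHom K) (powersHom K).injective) s c (by
      ext k
      simpa [powersHom_apply] using h k.toAdd)
  exact this

theorem det_eq_of_trace_pow_eq [IsAlgClosed K] [CharZero K] {V W : Type*} [AddCommGroup V] [Module K V]
    [FiniteDimensional K V] [AddCommGroup W] [Module K W] [FiniteDimensional K W]
    (f : End K V) (g : End K W)
    (h : ∀ k : ℕ, LinearMap.trace K V (f ^ k) = LinearMap.trace K W (g ^ k)) :
    LinearMap.det f = LinearMap.det g := by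
  classical
  set s := f.charpoly.roots.toFinset ∪ g.charpoly.roots.toFinset
  have h1 : ∀ μ ∈ s, f.charpoly.rootMultiplicity μ = g.charpoly.rootMultiplicity μ := by
    intro μ hμ
    have := linInd_pow s (fun μ => (f.charpoly.rootMultiplicity μ : K) -
      (g.charpoly.rootMultiplicity μ : K)) (fun k => by
        simp only [sub_mul, Finset.sum_sub_distrib]
        rw [← trace_pow_eq f s Finset.subset_union_left, ← trace_pow_eq g s
          Finset.subset_union_right, h k, sub_self]) μ hμ
    exact_mod_cast sub_eq_zero.1 this
  have h2 : f.charpoly.roots = g.charpoly.roots := by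
    ext μ
    rw [Polynomial.count_roots, Polynomial.count_roots]
    by_cases hμ : μ ∈ s
    · exact h1 μ hμ
    · simp only [s, Finset.mem_union, Multiset.mem_toFinset, not_or] at hμ
      rw [← Polynomial.count_roots, ← Polynomial.count_roots, Multiset.count_eq_zero_of_notMem hμ.1,
        Multiset.count_eq_zero_of_notMem hμ.2]
  rw [Module.End.det_eq_prod_roots_charpoly_of_splits (IsAlgClosed.splits _),
    Module.End.det_eq_prod_roots_charpoly_of_splits (IsAlgClosed.splits _), h2]
end det

section chars
open MonoidAlgebra
variable (G : Type v) [Group G] (K : Type u) [Field K]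

/-- Characters of finite-dimensional (matrix) representations of `G` over `K`. -/
def characters : Set (G → K) :=
  {χ | ∃ (n : ℕ) (ρ : G →* Matrix (Fin n) (Fin n) K), χ = fun g => (ρ g).trace}

/-- The additive group `R_G` of virtual `K`-valued characters of `G`. -/
def VirtualChar : AddSubgroup (G → K) := AddSubgroup.closure (characters G K)

variable {G K}

theorem mem_characters {ι : Type} [Fintype ι] [DecidableEq ι] (ρ : G →* Matrix ι ι K) :
    (fun g => (ρ g).trace) ∈ characters G K := by
  refine ⟨Fintype.card ι, ((Matrix.reindexAlgEquiv K K (Fintype.equivFin ι) :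
    Matrix ι ι K ≃ₐ[K] _) : Matrix ι ι K →* _).comp ρ, ?_⟩
  ext g
  simp [Matrix.trace, Matrix.diag]
  exact ((Fintype.equivFin ι).symm.sum_comp (fun i => ρ g i i)).symm

theorem mem_characters_end {V : Type*} [AddCommGroup V] [Module K V] [FiniteDimensional K V]
    (ρ : G →* End K V) : (fun g => LinearMap.trace K V (ρ g)) ∈ characters G K := by
  let b := Module.finBasis K V
  refine ⟨_, ((LinearMap.toMatrixAlgEquiv b).toAlgHom.toRingHom.toMonoidHom).comp ρ, ?_⟩
  ext g
  exact LinearMap.trace_eq_matrix_trace K b (ρ g)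

/-- The direct sum of two matrix representations. -/
def directSum {n m : ℕ} (ρ : G →* Matrix (Fin n) (Fin n) K) (τ : G →* Matrix (Fin m) (Fin m) K) :
    G →* Matrix (Fin n ⊕ Fin m) (Fin n ⊕ Fin m) K where
  toFun g := Matrix.fromBlocks (ρ g) 0 0 (τ g)
  map_one' := by simp
  map_mul' g h := by simp [Matrix.fromBlocks_multiply]

theorem add_mem_characters {χ χ' : G → K} (h : χ ∈ characters G K) (h' : χ' ∈ characters G K) :
    χ + χ' ∈ characters G K := by
  obtain ⟨n, ρ, rfl⟩ := h
  obtain ⟨m, τ, rfl⟩ := h'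
  convert mem_characters (directSum ρ τ) using 1
  ext g
  simp [directSum, Matrix.trace, Fintype.sum_sum_type]

theorem exists_sub {χ : G → K} (h : χ ∈ VirtualChar G K) :
    ∃ χ₁ ∈ characters G K, ∃ χ₂ ∈ characters G K, χ = χ₁ - χ₂ := by
  have h0 : (0 : G → K) ∈ characters G K := ⟨0, 1, by ext g; simp [Matrix.trace]⟩
  induction h using AddSubgroup.closure_induction with
  | mem x hx => exact ⟨x, hx, 0, h0, by simp⟩
  | zero => exact ⟨0, h0, 0, h0, by simp⟩
  | add x y _ _ hx hy =>
    obtain ⟨a, ha, b, hb, rfl⟩ := hx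
    obtain ⟨c, hc, d, hd, rfl⟩ := hy
    exact ⟨a + c, add_mem_characters ha hc, b + d, add_mem_characters hb hd, by abel⟩
  | neg x _ hx =>
    obtain ⟨a, ha, b, hb, rfl⟩ := hx
    exact ⟨b, hb, a, ha, by abel⟩

/-- `a ↦ det (T(a))` for a matrix representation `T`, extended linearly to the group algebra. -/
def detRep {ι : Type} [Fintype ι] [DecidableEq ι] (ρ : G →* Matrix ι ι K) :
    (MonoidAlgebra K G)ˣ →* Kˣ :=
  Units.map (Matrix.detMonoidHom.comp (lift K (Matrix ι ι K) G ρ).toRingHom.toMonoidHom)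

theorem trace_lift {ι : Type} [Fintype ι] [DecidableEq ι] (ρ : G →* Matrix ι ι K)
    (a : MonoidAlgebra K G) :
    (lift K (Matrix ι ι K) G ρ a).trace = a.coeff.sum fun g c => c * (ρ g).trace := by
  rw [lift_apply, Finsupp.sum, Matrix.trace_sum]
  simp [Finsupp.sum]

theorem detRep_eq [IsAlgClosed K] [CharZero K] {ι κ : Type} [Fintype ι] [DecidableEq ι]
    [Fintype κ] [DecidableEq κ] (ρ : G →* Matrix ι ι K) (τ : G →* Matrix κ κ K)
    (h : ∀ g, (ρ g).trace = (τ g).trace) : detRep ρ = detRep τ := by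
  ext a
  change (lift K (Matrix ι ι K) G ρ a).det = (lift K (Matrix κ κ K) G τ a).det
  rw [← LinearMap.det_toLin', ← LinearMap.det_toLin']
  apply det_eq_of_trace_pow_eq
  intro k
  rw [← Matrix.toLin'_pow, ← Matrix.toLin'_pow, Matrix.trace_toLin'_eq, Matrix.trace_toLin'_eq, ← map_pow, ← map_pow, trace_lift, trace_lift]
  simp [h]

theorem detRep_directSum {n m : ℕ} (ρ : G →* Matrix (Fin n) (Fin n) K)
    (τ : G →* Matrix (Fin m) (Fin m) K) : detRep (directSum ρ τ) = detRep ρ * detRep τ := by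
  ext a
  change (lift K _ G (directSum ρ τ) a).det = (lift K _ G ρ a).det * (lift K _ G τ a).det
  rw [← Matrix.det_fromBlocks_zero₂₁ _ 0]
  congr 1
  rw [lift_apply, lift_apply, lift_apply, Finsupp.sum, Finsupp.sum, Finsupp.sum]
  ext i j
  rcases i with i | i <;> rcases j with j | j <;> simp [directSum, Matrix.sum_apply]


variable (G K) in
/-- The group `Hom(R_G, Kˣ)`. -/
abbrev HomR : Type _ := Multiplicative (VirtualChar G K) →* Kˣ

theorem char_mem {χ : G → K} (h : χ ∈ characters G K) : χ ∈ VirtualChar G K :=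
  AddSubgroup.subset_closure h

theorem detRep_quot_eq [IsAlgClosed K] [CharZero K] {n₁ n₂ n₃ n₄ : ℕ}
    (ρ₁ : G →* Matrix (Fin n₁) (Fin n₁) K) (ρ₂ : G →* Matrix (Fin n₂) (Fin n₂) K)
    (ρ₃ : G →* Matrix (Fin n₃) (Fin n₃) K) (ρ₄ : G →* Matrix (Fin n₄) (Fin n₄) K)
    (h : ∀ g, (ρ₁ g).trace - (ρ₂ g).trace = (ρ₃ g).trace - (ρ₄ g).trace)
    (a : (MonoidAlgebra K G)ˣ) :
    detRep ρ₁ a / detRep ρ₂ a = detRep ρ₃ a / detRep ρ₄ a := by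
  rw [div_eq_div_iff_mul_eq_mul, ← MonoidHom.mul_apply, ← MonoidHom.mul_apply,
    ← detRep_directSum, ← detRep_directSum]
  refine congrArg (fun d : (MonoidAlgebra K G)ˣ →* Kˣ => d a) (detRep_eq _ _ ?_)
  intro g
  simp only [directSum, Matrix.trace, Matrix.diag, Fintype.sum_sum_type, MonoidHom.coe_mk,
    OneHom.coe_mk, Matrix.fromBlocks_apply₁₁, Matrix.fromBlocks_apply₂₂]
  have := h g
  simp only [Matrix.trace, Matrix.diag] at this
  linear_combination this

theorem exists_det [IsAlgClosed K] [CharZero K] (χ : VirtualChar G K) (a : (MonoidAlgebra K G)ˣ) :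
    ∃ d : Kˣ, ∀ (n m : ℕ) (ρ : G →* Matrix (Fin n) (Fin n) K)
      (τ : G →* Matrix (Fin m) (Fin m) K), (∀ g, χ.1 g = (ρ g).trace - (τ g).trace) →
        d = detRep ρ a / detRep τ a := by
  obtain ⟨_, ⟨n, ρ, rfl⟩, _, ⟨m, τ, rfl⟩, h⟩ := exists_sub χ.2
  refine ⟨detRep ρ a / detRep τ a, fun n' m' ρ' τ' h' => ?_⟩
  apply detRep_quot_eq
  intro g
  rw [← h' g, h]
  rfl

/-- The value `Det(a)(χ)`: it is `det T₁(a) / det T₂(a)` whenever `χ` is the difference of the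
characters of the representations `T₁` and `T₂`. -/
def detAt [IsAlgClosed K] [CharZero K] (χ : VirtualChar G K) (a : (MonoidAlgebra K G)ˣ) : Kˣ :=
  (exists_det χ a).choose

theorem detAt_eq [IsAlgClosed K] [CharZero K] (χ : VirtualChar G K) (a : (MonoidAlgebra K G)ˣ) {n m : ℕ}
    (ρ : G →* Matrix (Fin n) (Fin n) K)
    (τ : G →* Matrix (Fin m) (Fin m) K) (h : ∀ g, χ.1 g = (ρ g).trace - (τ g).trace) :
    detAt χ a = detRep ρ a / detRep τ a :=
  (exists_det χ a).choose_spec n m ρ τ h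

theorem detAt_mul [IsAlgClosed K] [CharZero K] (χ : VirtualChar G K) (a b : (MonoidAlgebra K G)ˣ) :
    detAt χ (a * b) = detAt χ a * detAt χ b := by
  obtain ⟨_, ⟨n, ρ, rfl⟩, _, ⟨m, τ, rfl⟩, h⟩ := exists_sub χ.2
  rw [detAt_eq χ _ ρ τ (congrFun h), detAt_eq χ _ ρ τ (congrFun h),
    detAt_eq χ _ ρ τ (congrFun h), map_mul, map_mul, div_mul_div_comm]

theorem detAt_add [IsAlgClosed K] [CharZero K] (χ χ' : VirtualChar G K) (a : (MonoidAlgebra K G)ˣ) :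
    detAt (χ + χ') a = detAt χ a * detAt χ' a := by
  obtain ⟨_, ⟨n, ρ, rfl⟩, _, ⟨m, τ, rfl⟩, h⟩ := exists_sub χ.2
  obtain ⟨_, ⟨n', ρ', rfl⟩, _, ⟨m', τ', rfl⟩, h'⟩ := exists_sub χ'.2
  obtain ⟨k₁, ρ₁, h₁⟩ := mem_characters (directSum ρ ρ')
  obtain ⟨k₂, ρ₂, h₂⟩ := mem_characters (directSum τ τ')
  replace h₁ := congrFun h₁
  replace h₂ := congrFun h₂
  rw [detAt_eq χ a ρ τ (congrFun h), detAt_eq χ' a ρ' τ' (congrFun h'),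
    detAt_eq (χ + χ') a ρ₁ ρ₂, ← detRep_eq (directSum ρ ρ') ρ₁ h₁, ← detRep_eq _ ρ₂ h₂,
    detRep_directSum, detRep_directSum, div_mul_div_comm]
  · rfl
  intro g
  rw [← h₁, ← h₂]
  have e1 := congrFun h g
  have e2 := congrFun h' g
  simp only [Pi.sub_apply] at e1 e2
  simp [directSum, Matrix.trace, Fintype.sum_sum_type] at e1 e2 ⊢
  rw [e1, e2]
  ring

/-- The homomorphism `Det : (K[G])ˣ → Hom(R_G, Kˣ)`, determined by `Det(a)(φ) = det (T(a))` for
every representation `T` with character `φ`. -/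
def Det [IsAlgClosed K] [CharZero K] : (MonoidAlgebra K G)ˣ →* HomR G K :=
  MonoidHom.mk' (fun a => MonoidHom.mk' (fun χ => detAt χ.toAdd a)
      (fun χ χ' => by rw [toAdd_mul, detAt_add])) (fun a b => by
    refine MonoidHom.ext fun χ => ?_
    exact detAt_mul _ a b)

theorem Det_apply_char [IsAlgClosed K] [CharZero K] (a : (MonoidAlgebra K G)ˣ) {n : ℕ}
    (ρ : G →* Matrix (Fin n) (Fin n) K) (χ : VirtualChar G K) (h : ∀ g, χ.1 g = (ρ g).trace) :
    (Det a (Multiplicative.ofAdd χ) : K) = (lift K (Matrix (Fin n) (Fin n) K) G ρ a).det := by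
  have := detAt_eq χ a ρ (1 : G →* Matrix (Fin 0) (Fin 0) K) (by simp [h, Matrix.trace])
  change (detAt χ a : K) = _
  have h : detRep (1 : G →* Matrix (Fin 0) (Fin 0) K) a = 1 := by
    apply Units.ext
    exact Matrix.det_isEmpty (A := lift K (Matrix (Fin 0) (Fin 0) K) G 1 a.1)
  rw [this, h, div_one]
  rfl

/-- The action `(ω ∘ χ)(g) = ω(χ(g))` of field endomorphisms on virtual characters. -/
def conj (ω : K →+* K) : VirtualChar G K →+ VirtualChar G K where
  toFun χ := ⟨fun g => ω (χ.1 g), by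
    obtain ⟨_, ⟨n, ρ, rfl⟩, _, ⟨m, τ, rfl⟩, h⟩ := exists_sub χ.2
    have key : ∀ (n : ℕ) (ρ : G →* Matrix (Fin n) (Fin n) K),
        (fun g => ω (ρ g).trace) ∈ VirtualChar G K := fun n ρ => by
      refine char_mem ⟨n, (ω.mapMatrix (m := Fin n)).toMonoidHom.comp ρ, ?_⟩
      ext g
      simp [Matrix.trace]
    convert (VirtualChar G K).sub_mem (key n ρ) (key m τ) using 1
    ext g
    rw [h]
    simp⟩
  map_zero' := by ext; simp
  map_add' χ χ' := by ext; simp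

theorem trace_involution_mem [CharZero K] {ι : Type} [Fintype ι] [DecidableEq ι]
    (ρ : G →* Matrix ι ι K) (S : Matrix ι ι K) (hS : S * S = 1)
    (hc : ∀ g, S * ρ g = ρ g * S) : (fun g => (S * ρ g).trace) ∈ VirtualChar G K := by
  set f : End K (ι → K) := Matrix.toLin' S with hf
  have hff : f * f = 1 := by
    rw [hf, Module.End.mul_eq_comp, ← Matrix.toLin'_mul, hS, Matrix.toLin'_one]; rfl
  have hff' : ∀ x, f (f x) = x := fun x => congrArg (fun h : End K (ι → K) => h x) hff
  set r : G →* End K (ι → K) := (Matrix.toLinAlgEquiv').toAlgHom.toRingHom.toMonoidHom.comp ρ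
    with hr
  have hr' : ∀ g, r g = Matrix.toLin' (ρ g) := fun g => rfl
  have hcom : ∀ g x, f (r g x) = r g (f x) := fun g x => by
    have : f * r g = r g * f := by
      rw [hr', hf, Module.End.mul_eq_comp, Module.End.mul_eq_comp, ← Matrix.toLin'_mul,
        ← Matrix.toLin'_mul, hc]
    exact congrArg (fun h : End K (ι → K) => h x) this
  let N : Bool → Submodule K (ι → K) := fun b =>
    LinearMap.ker (f - algebraMap K _ (bif b then 1 else -1))
  have hN : ∀ b x, x ∈ N b ↔ f x = (bif b then (1 : K) else -1) • x := fun b x => by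
    simp only [N, LinearMap.mem_ker, LinearMap.sub_apply, sub_eq_zero]
    rfl
  have hint : DirectSum.IsInternal N := by
    rw [DirectSum.isInternal_submodule_iff_isCompl N (i := true) (j := false) (by simp) (by
      ext b; cases b <;> simp)]
    constructor
    · rw [Submodule.disjoint_def]
      intro x h1 h2
      rw [hN] at h1 h2
      simp only [cond_true, cond_false] at h1 h2
      rw [h1] at h2
      have : (2 : K) • x = 0 := by
        rw [two_smul]; nth_rw 1 [← one_smul K x, h2]; simp
      exact (smul_eq_zero.1 this).resolve_left two_ne_zero
    · rw [codisjoint_iff, eq_top_iff]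
      intro x _
      rw [Submodule.mem_sup]
      refine ⟨(2 : K)⁻¹ • (x + f x), ?_, (2 : K)⁻¹ • (x - f x), ?_, ?_⟩
      · rw [hN]; simp [hff', add_comm]
      · rw [hN]; simp [hff', ← smul_neg]
      · rw [← smul_add]; simp [← two_smul K x, smul_smul]
  have hmap : ∀ b g, ∀ x ∈ N b, r g x ∈ N b := fun b g x hx => by
    rw [hN] at hx ⊢; rw [hcom, hx, map_smul]
  let rb : ∀ b, G →* End K (N b) := fun b =>
    { toFun := fun g => (r g).restrict (hmap b g)
      map_one' := by ext x; simp
      map_mul' := fun g h => by ext x; simp }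
  have hmap' : ∀ g b, Set.MapsTo (f * r g) (N b) (N b) := fun g b x hx => by
    have h1 := hmap b g x hx
    have h2 := (hN _ _).1 h1
    change f (r g x) ∈ N b
    rw [h2]
    exact (N b).smul_mem _ h1
  have key : (fun g => (S * ρ g).trace) = (fun g => LinearMap.trace K _ (rb true g)) -
      (fun g => LinearMap.trace K _ (rb false g)) := by
    ext g
    rw [← Matrix.trace_toLin'_eq, Matrix.toLin'_mul, ← hr', ← hf, ← Module.End.mul_eq_comp,
      LinearMap.trace_eq_sum_trace_restrict hint (hmap' g), Fintype.sum_bool, Pi.sub_apply,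
      sub_eq_add_neg, ← map_neg]
    congr 2
    · ext1 x
      apply Subtype.ext
      have := (hN _ _).1 (hmap _ g _ x.2)
      rw [cond_true, one_smul] at this
      exact this
    · ext1 x
      apply Subtype.ext
      have := (hN _ _).1 (hmap _ g _ x.2)
      rw [cond_false, neg_one_smul] at this
      exact this
  rw [key]
  exact (VirtualChar G K).sub_mem (char_mem (mem_characters_end _)) (char_mem (mem_characters_end _))

open Kronecker in
theorem adams_mem [CharZero K] {n : ℕ} (ρ : G →* Matrix (Fin n) (Fin n) K) :
    (fun g => (ρ (g ^ 2)).trace) ∈ VirtualChar G K := by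
  let τ : G →* Matrix (Fin n × Fin n) (Fin n × Fin n) K :=
    { toFun := fun g => ρ g ⊗ₖ ρ g
      map_one' := by simp
      map_mul' := fun g h => by simp [Matrix.mul_kronecker_mul] }
  let S : Matrix (Fin n × Fin n) (Fin n × Fin n) K :=
    Matrix.of fun i j => if i = j.swap then 1 else 0
  have hSa : ∀ i j, S i j = if i = j.swap then 1 else 0 := fun i j => rfl
  have h1 : ∀ (M : Matrix (Fin n × Fin n) (Fin n × Fin n) K) i j, (S * M) i j = M i.swap j := by
    intro M i j
    rw [Matrix.mul_apply, Finset.sum_eq_single i.swap]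
    · simp [hSa]
    · intro b _ hb
      rw [hSa, if_neg, zero_mul]
      rintro rfl
      exact hb (Prod.swap_swap b).symm
    · simp
  have h2 : ∀ (M : Matrix (Fin n × Fin n) (Fin n × Fin n) K) i j, (M * S) i j = M i j.swap := by
    intro M i j
    rw [Matrix.mul_apply, Finset.sum_eq_single j.swap]
    · simp [hSa]
    · intro b _ hb
      rw [hSa, if_neg hb, mul_zero]
    · simp
  convert trace_involution_mem τ S ?_ ?_ using 1
  · ext g
    simp only [Matrix.trace, Matrix.diag, h1]
    simp [pow_two, τ, Matrix.mul_apply, Fintype.sum_prod_type, mul_comm]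
  · ext i j
    rw [h1]
    simp only [hSa, Prod.swap_inj, Matrix.one_apply]
  · intro g
    ext i j
    rw [h1, h2]
    simp [τ, mul_comm]

/-- The second Adams operation `ψ₂(χ)(g) = χ(g²)`. -/
def psi2 [CharZero K] : VirtualChar G K →+ VirtualChar G K where
  toFun χ := ⟨fun g => χ.1 (g ^ 2), by
    obtain ⟨_, ⟨n, ρ, rfl⟩, _, ⟨m, τ, rfl⟩, h⟩ := exists_sub χ.2
    rw [h]
    exact (VirtualChar G K).sub_mem (adams_mem ρ) (adams_mem τ)⟩
  map_zero' := by ext; simp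
  map_add' χ χ' := by ext; simp


/-- Write `e` for the order of `s` and let `z` be a primitive `e`-th root of unity. This is the
inner product over `⟨s⟩` of the restriction of `χ` to `⟨s⟩` with the irreducible character `ξ ^ j`,
where `ξ(s ^ i) = z ^ i`. -/
def eigenMult (z : K) (s : G) (j : ℕ) (χ : G → K) : K :=
  (orderOf s : K)⁻¹ * ∑ i ∈ Finset.range (orderOf s), χ (s ^ i) * (z⁻¹ ^ j) ^ i

theorem exists_nat_of_char [CharZero K] {z : K} {s : G} (hs : orderOf s ≠ 0)
    (hz : z ^ orderOf s = 1) (j n : ℕ) (ρ : G →* Matrix (Fin n) (Fin n) K) :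
    ∃ m : ℕ, eigenMult z s j (fun g => (ρ g).trace) = m := by
  set e := orderOf s with he
  have heK : (e : K) ≠ 0 := by exact_mod_cast hs
  set B : Matrix (Fin n) (Fin n) K := z⁻¹ ^ j • ρ s with hB
  have hBe : B ^ e = 1 := by
    rw [hB, smul_pow, ← map_pow, he, pow_orderOf_eq_one, ← he, ← pow_mul, mul_comm, pow_mul,
      inv_pow, hz]
    simp
  set T : Matrix (Fin n) (Fin n) K := ∑ i ∈ Finset.range e, B ^ i with hT
  have hBT : B * T = T := by
    have h1 : T * (B - 1) = 0 := by rw [hT, geom_sum_mul, hBe, sub_self]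
    have h2 : Commute T B := Commute.sum_left _ _ _ fun i _ => (Commute.refl B).pow_left i
    rw [← h2.eq]
    rwa [mul_sub, mul_one, sub_eq_zero] at h1
  have hBiT : ∀ i, B ^ i * T = T := fun i => by
    induction i with
    | zero => simp
    | succ i ih => rw [pow_succ, mul_assoc, hBT, ih]
  have hTT : T * T = (e : K) • T := by
    nth_rw 1 [hT]
    rw [Finset.sum_mul, Finset.sum_congr rfl fun i _ => hBiT i]
    simp [← Nat.cast_smul_eq_nsmul K]
  set P : Matrix (Fin n) (Fin n) K := (e : K)⁻¹ • T with hP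
  have hPP : IsIdempotentElem P := by
    rw [IsIdempotentElem, hP, smul_mul_smul_comm, hTT, smul_smul]
    congr 1
    field_simp
  have hPP' : IsIdempotentElem (Matrix.toLin' P) := by
    rw [IsIdempotentElem, Module.End.mul_eq_comp, ← Matrix.toLin'_mul, hPP]
  refine ⟨finrank K (LinearMap.range (Matrix.toLin' P)), ?_⟩
  rw [← LinearMap.IsProj.trace (LinearMap.IsIdempotentElem.isProj_range _ hPP'),
    Matrix.trace_toLin'_eq, hP, Matrix.trace_smul, hT, Matrix.trace_sum, eigenMult, smul_eq_mul]
  congr 1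
  refine Finset.sum_congr rfl fun i _ => ?_
  rw [hB, smul_pow, Matrix.trace_smul, ← map_pow, smul_eq_mul, mul_comm]

theorem exists_int [CharZero K] {z : K} {s : G} (hs : orderOf s ≠ 0)
    (hz : z ^ orderOf s = 1) (j : ℕ) (χ : VirtualChar G K) :
    ∃ m : ℤ, (m : K) = eigenMult z s j χ.1 := by
  obtain ⟨_, ⟨n, ρ, rfl⟩, _, ⟨m, τ, rfl⟩, h⟩ := exists_sub χ.2
  obtain ⟨a, ha⟩ := exists_nat_of_char hs hz j n ρ
  obtain ⟨b, hb⟩ := exists_nat_of_char hs hz j m τ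
  refine ⟨(a : ℤ) - b, ?_⟩
  push_cast
  rw [← ha, ← hb, h]
  simp [eigenMult, sub_mul, mul_sub]

/-- The multiplicity of `ξ ^ j` in the restriction of `χ` to `⟨s⟩`, as an integer. -/
def multiplicity (z : K) (s : G) (j : ℕ) (χ : VirtualChar G K) : ℤ :=
  Function.invFun (fun m : ℤ => (m : K)) (eigenMult z s j χ.1)

theorem multiplicity_spec [CharZero K] {z : K} {s : G} (hs : orderOf s ≠ 0)
    (hz : z ^ orderOf s = 1) (j : ℕ) (χ : VirtualChar G K) :
    (multiplicity z s j χ : K) = eigenMult z s j χ.1 :=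
  Function.invFun_eq (exists_int hs hz j χ)

/-- The Stickelberger pairing `⟨χ, s⟩_G`, formed with the root of unity `z` of order `e = |s|`.
The irreducible characters of `⟨s⟩` are the `ξ ^ j`, `0 ≤ j < e`, with `ξ(s) = z`; one has
`⟨ξ ^ j, s⟩ = {j / e}`, and this is extended linearly and precomposed with restriction to `⟨s⟩`. -/
def stickelberger (z : K) (s : G) (χ : VirtualChar G K) : ℚ :=
  ∑ j ∈ Finset.range (orderOf s), multiplicity z s j χ * Int.fract ((j : ℚ) / orderOf s)

theorem stickelberger_add [CharZero K] {z : K} {s : G} (hs : orderOf s ≠ 0)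
    (hz : z ^ orderOf s = 1) (χ χ' : VirtualChar G K) :
    stickelberger z s (χ + χ') = stickelberger z s χ + stickelberger z s χ' := by
  simp only [stickelberger]
  rw [← Finset.sum_add_distrib]
  refine Finset.sum_congr rfl fun j _ => ?_
  rw [← add_mul]
  congr 1
  have : multiplicity z s j (χ + χ') = multiplicity z s j χ + multiplicity z s j χ' := by
    apply Int.cast_injective (α := K)
    rw [Int.cast_add, multiplicity_spec hs hz, multiplicity_spec hs hz, multiplicity_spec hs hz]
    simp [eigenMult, add_mul, Finset.sum_add_distrib, mul_add]
  exact_mod_cast this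

theorem stickelberger_of_pow [CharZero K] {z : K} {s : G} (hs : orderOf s ≠ 0)
    (hz : IsPrimitiveRoot z (orderOf s)) (χ : VirtualChar G K) (r : ℤ)
    (hχ : ∀ i : ℕ, χ.1 (s ^ i) = (z ^ r) ^ i) :
    stickelberger z s χ = Int.fract ((r : ℚ) / orderOf s) := by
  set e := orderOf s with he
  have he0 : (e : ℤ) ≠ 0 := by exact_mod_cast hs
  have hz0 : z ≠ 0 := hz.ne_zero hs
  set r' := (r % e).toNat with hr'
  have hrr : (r' : ℤ) = r % e := Int.toNat_of_nonneg (Int.emod_nonneg _ he0)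
  have hlt : r' < e := by
    have := Int.emod_lt_of_pos r (b := e) (by positivity)
    omega
  have hzr : z ^ r = z ^ r' := by
    rw [← zpow_natCast z r', hrr]
    nth_rw 1 [← Int.emod_add_mul_ediv r e]
    rw [zpow_add₀ hz0, zpow_mul, zpow_natCast, hz.pow_eq_one, one_zpow, mul_one]
  have hm : ∀ j ∈ Finset.range e, multiplicity z s j χ = if j = r' then 1 else 0 := by
    intro j hj
    apply Int.cast_injective (α := K)
    rw [multiplicity_spec (by rwa [← he]) (by rw [← he]; exact hz.pow_eq_one), eigenMult]
    simp only [hχ, ← mul_pow, ← he, hzr]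
    split_ifs with h
    · subst h
      simp [hz0, hs]
    · have hne : z ^ r' * z⁻¹ ^ j ≠ 1 := by
        intro h'
        apply h
        apply hz.pow_inj (Finset.mem_range.1 hj) hlt
        rw [inv_pow] at h'
        field_simp at h'
        exact h'.symm
      have h1 : (z ^ r' * z⁻¹ ^ j) ^ e = 1 := by
        rw [mul_pow, ← pow_mul, ← pow_mul, mul_comm r', mul_comm j, pow_mul, pow_mul, inv_pow,
          hz.pow_eq_one]
        simp
      have h2 := mul_geom_sum (z ^ r' * z⁻¹ ^ j) e
      rw [h1, sub_self] at h2
      rw [(mul_eq_zero.1 h2).resolve_left (sub_ne_zero.2 hne)]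
      simp
  rw [stickelberger, ← he, Finset.sum_congr rfl fun j hj => by rw [hm j hj]]
  simp only [Int.cast_ite, Int.cast_one, Int.cast_zero, ite_mul, one_mul, zero_mul]
  rw [Finset.sum_ite_eq' _ r', if_pos (Finset.mem_range.2 hlt), Int.fract_eq_fract]
  refine ⟨-(r / e), ?_⟩
  have : (r : ℚ) = (r' : ℚ) + e * ((r / e : ℤ) : ℚ) := by
    have := (Int.emod_add_mul_ediv r e).symm
    rw [← hrr] at this
    exact_mod_cast this
  rw [this]
  have : (e : ℚ) ≠ 0 := by exact_mod_cast hs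
  field_simp
  push_cast
  ring

end chars
end CharacterTheory

/-! ### Galois algebras over a local field -/

section
variable {L Lc : Type u} [Field L] [Field Lc] [Algebra L Lc] {G : Type v} [Group G]

/-- The Galois algebra `L_π`: the functions `a : G → Lᶜ` that are equivariant for the action
`h ↦ π(ω) h` of the absolute Galois group on `G`. -/
def galoisAlgebra (π : (Lc ≃ₐ[L] Lc) →* G) : Subalgebra L (G → Lc) where
  carrier := {a | ∀ (ω : Lc ≃ₐ[L] Lc) (h : G), a (π ω * h) = ω (a h)}
  mul_mem' ha hb ω h := by simp [ha ω h, hb ω h]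
  add_mem' ha hb ω h := by simp [ha ω h, hb ω h]
  algebraMap_mem' r ω h := by simp

variable (π : (Lc ≃ₐ[L] Lc) →* G)

/-- The action `(a ^ g)(h) = a(h g)` of `G` on `L_π`. -/
instance : DistribMulAction G (galoisAlgebra π) where
  smul g a := ⟨fun h => a.1 (h * g), fun ω h => by
    simpa [mul_assoc] using a.2 ω (h * g)⟩
  one_smul a := Subtype.ext <| funext fun h => congrArg a.1 (mul_one h)
  mul_smul g g' a := Subtype.ext <| funext fun h => congrArg a.1 (mul_assoc h g g').symm
  smul_zero _ := rfl
  smul_add _ _ _ := rfl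

theorem smul_apply (g : G) (a : galoisAlgebra π) (h : G) : (g • a).1 h = a.1 (h * g) := rfl

variable [ValuativeRel L]

instance : SMulCommClass G 𝒪[L] (galoisAlgebra π) where
  smul_comm _ _ _ := rfl

/-- `L_π` as a module over the group ring of `G` over the ring of integers. -/
instance : Module (MonoidAlgebra 𝒪[L] G) (galoisAlgebra π) :=
  Module.compHom _ (MonoidAlgebra.lift 𝒪[L] (Module.End 𝒪[L] (galoisAlgebra π)) G
    (DistribMulAction.toModuleEnd 𝒪[L] (galoisAlgebra π))).toRingHom

theorem single_smul (g : G) (r : 𝒪[L]) (a : galoisAlgebra π) :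
    MonoidAlgebra.single g r • a = r • g • a := by
  change MonoidAlgebra.lift 𝒪[L] (Module.End 𝒪[L] (galoisAlgebra π)) G
    (DistribMulAction.toModuleEnd 𝒪[L] (galoisAlgebra π)) (MonoidAlgebra.single g r) a = _
  rw [MonoidAlgebra.lift_single]
  rfl

instance : IsScalarTower 𝒪[L] (MonoidAlgebra 𝒪[L] G) (galoisAlgebra π) where
  smul_assoc r x a := by
    change MonoidAlgebra.lift 𝒪[L] (Module.End 𝒪[L] (galoisAlgebra π)) G
      (DistribMulAction.toModuleEnd 𝒪[L] (galoisAlgebra π)) (r • x) a =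
      r • MonoidAlgebra.lift 𝒪[L] (Module.End 𝒪[L] (galoisAlgebra π)) G
      (DistribMulAction.toModuleEnd 𝒪[L] (galoisAlgebra π)) x a
    rw [map_smul]
    rfl

/-- `O_π`, the integral closure of `O_L` in `L_π`. -/
abbrev integers : Subalgebra 𝒪[L] (galoisAlgebra π) := integralClosure 𝒪[L] (galoisAlgebra π)

/-- The inverse different of `L_π / L`: the dual of `O_π` for the trace form. -/
def codifferent : Submodule (integers π) (galoisAlgebra π) where
  carrier := {x | ∀ y : integers π, Algebra.trace L (galoisAlgebra π) (x * y) ∈ 𝒪[L]}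
  zero_mem' y := by simp
  add_mem' {a b} ha hb y := by rw [add_mul, map_add]; exact add_mem (ha y) (hb y)
  smul_mem' c x hx y := by
    have := hx (c * y)
    rwa [MulMemClass.coe_mul, ← mul_assoc, mul_comm x] at this

/-- The resolvend `∑ a(g) g⁻¹`. -/
def resolvend [Fintype G] (a : G → Lc) : MonoidAlgebra Lc G :=
  ∑ g : G, MonoidAlgebra.single g⁻¹ (a g)

/-- The field `L^π` fixed by the kernel of `π`; `L_π` is a product of copies of it. -/
def splitField : IntermediateField L Lc := IntermediateField.fixedField π.ker

/-- `L_π / L` is at most tamely ramified: the ramification index of `L^π / L` is prime to the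
residue characteristic. -/
def IsTame : Prop :=
  ∀ P : Ideal (integralClosure 𝒪[L] (splitField π)), P.IsMaximal →
    (P.ramificationIdx 𝒪[L]).Coprime (Nat.card 𝓀[L])
end

section
variable {L Lc : Type u} [Field L] [Field Lc] [Algebra L Lc] {G : Type v} [Group G]

variable (R Λ : Type*) [CommRing R] [CommRing Λ] [Algebra R Λ] in
/-- The canonical isomorphism `Λ[G] → Λ ⊗[R] R[G]`, `g ↦ 1 ⊗ g`. -/
def tensorOf : MonoidAlgebra Λ G →ₐ[Λ] Λ ⊗[R] MonoidAlgebra R G :=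
  MonoidAlgebra.lift Λ (Λ ⊗[R] MonoidAlgebra R G) G
    ((Algebra.TensorProduct.includeRight :
      MonoidAlgebra R G →ₐ[R] Λ ⊗[R] MonoidAlgebra R G).toRingHom.toMonoidHom.comp
        (MonoidAlgebra.of R G))

variable (L G Lc) in
/-- The subgroup `Hom_{Ω_L}(R_G, (Lᶜ)ˣ)` of Galois-equivariant homomorphisms. -/
def EquivariantHom : Subgroup (HomR G Lc) where
  carrier := {f | ∀ (ω : Lc ≃ₐ[L] Lc) (χ : VirtualChar G Lc),
    (f (Multiplicative.ofAdd (conj (ω : Lc →+* Lc) χ)) : Lc) =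
      ω (f (Multiplicative.ofAdd χ))}
  one_mem' ω χ := by simp
  mul_mem' hf hg ω χ := by simp [hf ω χ, hg ω χ]
  inv_mem' hf ω χ := by simp [hf ω χ]

variable (Lc) in
/-- The inclusion of unit groups `(L[G])ˣ → (Lᶜ[G])ˣ`. -/
def extendUnits : (MonoidAlgebra L G)ˣ →* (MonoidAlgebra Lc G)ˣ :=
  Units.map (MonoidAlgebra.mapRingHom G (algebraMap L Lc)).toMonoidHom

theorem detRep_conj (ω : Lc ≃ₐ[L] Lc) (x : (MonoidAlgebra L G)ˣ) {n : ℕ}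
    (ρ : G →* Matrix (Fin n) (Fin n) Lc) :
    (detRep (((ω : Lc →+* Lc).mapMatrix (m := Fin n)).toMonoidHom.comp ρ)
      (extendUnits Lc x) : Lc) = ω (detRep ρ (extendUnits Lc x)) := by
  change (MonoidAlgebra.lift Lc (Matrix (Fin n) (Fin n) Lc) G _
      (MonoidAlgebra.mapRingHom G (algebraMap L Lc) x.1)).det =
    (ω : Lc →+* Lc) (MonoidAlgebra.lift Lc (Matrix (Fin n) (Fin n) Lc) G ρ
      (MonoidAlgebra.mapRingHom G (algebraMap L Lc) x.1)).det
  rw [RingHom.map_det]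
  congr 1
  generalize x.1 = y
  induction y using MonoidAlgebra.induction_linear with
  | zero => simp
  | add a b ha hb => simp only [map_add, ha, hb]
  | single g r =>
    rw [MonoidAlgebra.mapRingHom_single, MonoidAlgebra.lift_single, MonoidAlgebra.lift_single]
    ext i j
    simp
    rw [Algebra.smul_def]

theorem Det_mem [IsAlgClosed Lc] [CharZero Lc] (x : (MonoidAlgebra L G)ˣ) :
    Det (extendUnits Lc x) ∈ EquivariantHom L Lc G := by
  intro ω χ
  obtain ⟨_, ⟨n, ρ, rfl⟩, _, ⟨m, τ, rfl⟩, h⟩ := exists_sub χ.2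
  change (detAt (conj _ χ) (extendUnits Lc x) : Lc) = ω (detAt χ (extendUnits Lc x))
  rw [detAt_eq χ _ ρ τ (congrFun h), detAt_eq (conj _ χ) _
    (((ω : Lc →+* Lc).mapMatrix (m := Fin n)).toMonoidHom.comp ρ)
    (((ω : Lc →+* Lc).mapMatrix (m := Fin m)).toMonoidHom.comp τ),
    Units.val_div_eq_div_val, Units.val_div_eq_div_val, detRep_conj, detRep_conj, map_div₀]
  intro g
  change ω (χ.1 g) = _
  rw [h]
  simp [Matrix.trace]

variable (L Lc G) in
/-- `Det : (L[G])ˣ → Hom_{Ω_L}(R_G, (Lᶜ)ˣ)`. -/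
def DetL [IsAlgClosed Lc] [CharZero Lc] : (MonoidAlgebra L G)ˣ →* EquivariantHom L Lc G :=
  (Det.comp (extendUnits Lc)).codRestrict (EquivariantHom L Lc G) Det_mem

variable [ValuativeRel L]

variable (L Lc G) in
/-- The subgroup `Det((O_L[G])ˣ)` of `Hom_{Ω_L}(R_G, (Lᶜ)ˣ)`. -/
def detIntegralUnits [IsAlgClosed Lc] [CharZero Lc] : Subgroup (EquivariantHom L Lc G) :=
  ((DetL L Lc G).comp
    (Units.map (MonoidAlgebra.mapRingHom G (algebraMap 𝒪[L] L)).toMonoidHom)).range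

/-- The boundary map `∂ : (L[G])ˣ → K₁(L[G]) → K₀(O_L[G], L)`, `x ↦ [O_L[G], O_L[G]; 1 ↦ x]`. -/
def boundaryL (x : (MonoidAlgebra L G)ˣ) : K0 𝒪[L] (MonoidAlgebra 𝒪[L] G) L :=
  boundary (Units.map (tensorOf (G := G) 𝒪[L] L).toRingHom.toMonoidHom x)

/-- The class `c` in `K₀(O_L[G], L)` is represented by the equivariant homomorphism `f`. The
isomorphism `K₀(O_L[G], L) ≃ Hom_{Ω_L}(R_G, (Lᶜ)ˣ) / Det((O_L[G])ˣ)` is the one that sends `∂ x`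
to the class of `Det x` for all units `x` of `L[G]`; so `f` represents `c` when `c` is of the form
`∂ x` and, for every such `x`, the image of `c`, i.e. the class of `Det x`, is the class of `f`. -/
def IsRepresentedBy [IsAlgClosed Lc] [CharZero Lc] (c : K0 𝒪[L] (MonoidAlgebra 𝒪[L] G) L)
    (f : EquivariantHom L Lc G) : Prop :=
  (∃ x : (MonoidAlgebra L G)ˣ, boundaryL x = c) ∧
  ∀ x : (MonoidAlgebra L G)ˣ, boundaryL x = c →
    (QuotientGroup.mk (DetL L Lc G x) : EquivariantHom L Lc G ⧸ detIntegralUnits L Lc G) =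
      QuotientGroup.mk f

/-- `c` is the class `[M, O_L[G]; r_G]` in `K₀(O_L[G], Lᶜ)` of an `O_L`-submodule `M` of `L_π`.
This includes the assertions that `M` is stable under `G`, that it is a finitely generated projective
`O_L[G]`-module and that the resolvend map induces an isomorphism `Lᶜ ⊗ M ≃ Lᶜ[G]`. -/
def IsResolvendClass [Fintype G] (π : (Lc ≃ₐ[L] Lc) →* G)
    (M : Submodule 𝒪[L] (galoisAlgebra π)) (c : K0 𝒪[L] (MonoidAlgebra 𝒪[L] G) Lc) : Prop :=
  ∃ 𝓜 : Submodule (MonoidAlgebra 𝒪[L] G) (galoisAlgebra π), 𝓜.restrictScalars 𝒪[L] = M ∧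
  ∃ (_ : Module.Finite (MonoidAlgebra 𝒪[L] G) 𝓜) (_ : Module.Projective (MonoidAlgebra 𝒪[L] G) 𝓜)
    (ξ : LatIso Lc (⟨𝓜⟩ : ProjMod 𝒪[L] (MonoidAlgebra 𝒪[L] G))
      (ProjMod.self 𝒪[L] (MonoidAlgebra 𝒪[L] G))),
    (∀ m : 𝓜, ξ.toEquiv (1 ⊗ₜ[𝒪[L]] m) = tensorOf 𝒪[L] Lc (resolvend m.1.1)) ∧
    c = K0.mk ⟨_, _, ξ⟩

/-- A compatible system of roots of unity `ζ_m`: each `ζ_m` is primitive of order `m`, and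
`(ζ_{mn}) ^ m = ζ_n`. -/
def IsCompatibleRootsOfUnity (ζ : ℕ → Lc) : Prop :=
  (∀ m, 0 < m → IsPrimitiveRoot (ζ m) m) ∧ ∀ m n, 0 < m → 0 < n → ζ (m * n) ^ m = ζ n

/-- A compatible system of roots `ϖ^{1/m}` of `ϖ`: `ϖ^{1/1} = ϖ` and
`(ϖ^{1/(mn)}) ^ m = ϖ^{1/n}`. -/
def IsCompatibleRoots (ϖ : Lc) (root : ℕ → Lc) : Prop :=
  root 1 = ϖ ∧ ∀ m n, 0 < m → 0 < n → root (m * n) ^ m = root n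

/-- `σ` acts on the maximal tamely ramified extension of `L` as the topological generator of the
tame inertia group that is determined by the compatible systems of roots. -/
def IsTameGenerator (ζ root : ℕ → Lc) (σ : Lc ≃ₐ[L] Lc) : Prop :=
  ∀ m : ℕ, m.Coprime (Nat.card 𝓀[L]) → σ (root m) = ζ m * root m ∧ σ (ζ m) = ζ m

/-- The rational power `ϖ ^ r`, formed with a compatible system of roots of `ϖ`. -/
def ratPow (root : ℕ → Lc) (r : ℚ) : Lc := root r.den ^ r.num
end

end GaloisStructure
end

/-! Put `e = |s|`, `r = ϖ^{1/e}`, `z = ζ_e`, and let `ε_j` be the idempotent of the group algebra of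
`⟨s⟩` on which `s` acts as `z ^ j`. Tameness provides a Frobenius `F` that fixes `r` and satisfies
`π(F) s π(F)⁻¹ = s ^ q`, while an inertia element `ω` with `π(ω) = s ^ k` sends `r` to `z ^ k r`
(`exists_isTameDatum`). For an integer `n` let `w_n` be the sum of the `r ^ k ε_j`, where `k` is the
representative of `j` modulo `e` in `[n, n + e)`. Then `ω(w_n) = w_n π(ω)` on inertia. A unit `u`
which, like its inverse, has integral coefficients, is fixed by inertia and satisfies `F(u) = u
π(F)` (`exists_normal_unit`) takes care of Frobenius: `b_n = u w_n` satisfies `ω(b_n) = b_n π(ω)`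
for all `ω`, so it is the resolvend of an element of `L_π`. That element generates freely over
`O_L[G]` the ideal of all `a` with `v(a(h)) ≤ v(r) ^ n` (`exists_intMap_mul_eq`,
`gnorm_mul_weight`).

The case `n = 0` is `O_π`, and the trace form shows that the inverse different is the case `n = -(e
- 1)` (`codifferent_eq`). If `e = 2d + 1`, its unique square root is the case `n = -d`. The
difference of the two classes is the boundary of `b_{-d} b_0⁻¹ = u (w_{-d} w_0⁻¹) u⁻¹`, which is
Galois invariant and so lies in `L[G]`. Determinants forget the conjugation by `u`, and `w_{-d}
w_0⁻¹` acts on the image of `ε_j` as `1` if `2j < e` and as `r ^ (-e) = ϖ⁻¹` otherwise. On the other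
side `{2j/e} - 2{j/e}` is `0` or `-1` in the same two cases (`stickelberger_psi2_sub`), so the
determinant is `f_π` itself.

It remains to see that units of `L[G]` with equal boundaries have determinants that differ by a unit
of `O_L[G]`. The relative `K`-group maps to a group of stable classes of triples, in which
automorphisms with integral determinants count as trivial (`K0.toStable`). An automorphism with
trivial class becomes, after adding an identity and up to such automorphisms, the extension of
scalars of an automorphism of a projective `O_L[G]`-module. As `O_L[G]` has stable range one,
elementary operations reduce the latter to units of `O_L[G]` (`hasIntegralDet`). -/

noncomputable section
namespace GaloisStructure

/-! ### Stable range one -/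

/-- `A` has stable range one: a unimodular row `(a, I)` with a left ideal `I` as second entry
can be shortened to a unit. -/
def HasStableRangeOne (A : Type*) [Ring A] : Prop :=
  ∀ (a : A) (I : Ideal A), Ideal.span {a} ⊔ I = ⊤ → ∃ i ∈ I, IsUnit (a + i)

/-- The pair is pushed down and shortened in `B`; surjectivity lifts the correction into `I`, and
locality reflects the unit back to `A`. -/
theorem HasStableRangeOne.of_isLocalHom {A B : Type*} [Ring A] [Ring B] (f : A →+* B)
    (hf : Function.Surjective f) [IsLocalHom f] (hB : HasStableRangeOne B) :
    HasStableRangeOne A := by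
  intro a I h
  have h1 : Ideal.span {f a} ⊔ I.map f = ⊤ := by
    rw [← Set.image_singleton, ← Ideal.map_span, ← Ideal.map_sup, h, Ideal.map_top]
  obtain ⟨j, hj, hu⟩ := hB _ _ h1
  obtain ⟨i, hi, rfl⟩ := (Ideal.mem_map_iff_of_surjective f hf).1 hj
  refine ⟨i, hi, ?_⟩
  rw [← map_add] at hu
  exact isUnit_of_map_unit f _ hu

/-- Over a finite ring the number of maps to a simple module can replace its multiplicity, so that
cancellation in direct sums becomes division of natural numbers. -/
theorem card_hom_of_isCompl {A : Type*} [Ring A] {M S : Type*} [AddCommGroup M]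
    [Module A M] [AddCommGroup S] [Module A S] {p q : Submodule A M} (h : IsCompl p q) :
    Nat.card (M →ₗ[A] S) = Nat.card (p →ₗ[A] S) * Nat.card (q →ₗ[A] S) := by
  rw [← Nat.card_prod]
  refine Nat.card_congr (((Submodule.prodEquivOfIsCompl p q h).congrLeft S ℕ).symm.toEquiv.trans
    (LinearMap.coprodEquiv ℕ).symm.toEquiv)

theorem card_hom_range_ker {A : Type*} [Ring A] [IsSemisimpleRing A] {M N S : Type*}
    [AddCommGroup M] [Module A M] [AddCommGroup N] [Module A N] [AddCommGroup S] [Module A S]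
    (r : M →ₗ[A] N) : Nat.card (M →ₗ[A] S) =
      Nat.card (LinearMap.ker r →ₗ[A] S) * Nat.card (LinearMap.range r →ₗ[A] S) := by
  obtain ⟨C, hC⟩ := exists_isCompl (LinearMap.ker r)
  rw [card_hom_of_isCompl hC]
  congr 1
  exact Nat.card_congr (((Submodule.quotientEquivOfIsCompl _ _ hC).symm.trans
    r.quotKerEquivRange).congrLeft S ℕ).toEquiv

/-- Among the left ideals `A(a + i)` take one, `A b`, of maximal cardinality. If it is proper, a
complement `I'` of it inside `I` contains a simple module `S`. Since `A` is both `A b ⊕ I'` and, up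
to isomorphism, the sum of `A b` and the kernel of right multiplication by `b`, this kernel also
maps onto `S`. Adding such a map to right multiplication by `b` enlarges the image, against
maximality. -/
theorem hasStableRangeOne_of_finite_semisimple (A : Type*) [Ring A] [Finite A]
    [IsSemisimpleRing A] : HasStableRangeOne A := by
  intro a I h
  obtain ⟨⟨i₀, hi₀⟩, hmax⟩ := Finite.exists_max
    (fun i : I => Nat.card (Ideal.span {a + (i : A)} : Ideal A))
  refine ⟨i₀, hi₀, ?_⟩
  set b := a + i₀ with hb
  let r : A →ₗ[A] A := LinearMap.toSpanSingleton A A b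
  have hr : LinearMap.range r = Ideal.span {b} := LinearMap.range_toSpanSingleton b
  have hsup : Ideal.span {b} ⊔ I = ⊤ := by
    rw [eq_top_iff, ← h, sup_le_iff]
    refine ⟨?_, le_sup_right⟩
    rw [Ideal.span_singleton_le_iff_mem]
    have : a = b - i₀ := by simp [hb]
    rw [this]
    exact sub_mem (Ideal.mem_sup_left (Ideal.mem_span_singleton_self b))
      (Ideal.mem_sup_right hi₀)
  by_cases htop : (Ideal.span {b} : Ideal A) = ⊤
  · have h1 : (1 : A) ∈ (Ideal.span {b} : Ideal A) := htop ▸ trivial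
    obtain ⟨y, hy⟩ := Ideal.mem_span_singleton'.1 h1
    -- A left inverse suffices in a finite ring.
    exact IsUnit.of_mul_eq_one_right y hy
  · exfalso
    -- The part inside `I` of a complement of `A b ⊓ I` is, by the modular law, a complement of `A
    -- b` in all of `A`.
    obtain ⟨C, hC⟩ := exists_isCompl (Ideal.span {b} ⊓ I)
    set I' := C ⊓ I with hI'
    have hcompl : IsCompl (Ideal.span {b} : Ideal A) I' := by
      constructor
      · rw [disjoint_iff, hI', inf_comm C, ← inf_assoc, hC.inf_eq_bot]
      · rw [codisjoint_iff, eq_top_iff, ← hsup, sup_le_iff]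
        refine ⟨le_sup_left, ?_⟩
        have : I = (Ideal.span {b} ⊓ I) ⊔ I' := by
          rw [hI', ← sup_inf_assoc_of_le C (inf_le_right : Ideal.span {b} ⊓ I ≤ I),
            hC.sup_eq_top, top_inf_eq]
        calc I = (Ideal.span {b} ⊓ I) ⊔ I' := this
          _ ≤ _ := sup_le_sup_right inf_le_left _
    have hne : I' ≠ ⊥ := by
      intro h0
      rw [h0] at hcompl
      exact htop (by simpa using hcompl.sup_eq_top)
    obtain ⟨S, hS, hSI⟩ := (IsAtomic.eq_bot_or_exists_atom_le I').resolve_left hne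
    have hsimple : IsSimpleModule A S := isSimpleModule_iff_isAtom.2 hS
    have hfin : ∀ (p : Submodule A A), Finite (p →ₗ[A] S) := fun p =>
      Finite.of_injective (fun f => (f : p → S)) DFunLike.coe_injective
    have e1 := card_hom_of_isCompl (S := S) hcompl
    have e2 := card_hom_range_ker (S := S) r
    rw [hr, mul_comm] at e2
    rw [e2] at e1
    -- Cancelling the factor for `A b` leaves as many maps to `S` from `I'` as from `ker r`.
    have e3 := Nat.eq_of_mul_eq_mul_left (Nat.card_pos) e1
    obtain ⟨D, hD⟩ := exists_isCompl S
    have : ∃ φ : LinearMap.ker r →ₗ[A] S, φ ≠ 0 := by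
      have h2 : Nontrivial (I' →ₗ[A] S) := by
        refine ⟨(Submodule.projectionOnto S D hD).comp I'.subtype, 0, ?_⟩
        intro h0
        obtain ⟨x, hx, hx0⟩ := S.ne_bot_iff.1 hS.1
        have h4 := LinearMap.congr_fun h0 ⟨x, hSI hx⟩
        have h5 : Submodule.projectionOnto S D hD x = 0 := h4
        rw [Submodule.projectionOnto_apply_eq_zero_iff] at h5
        exact hx0 (Submodule.disjoint_def.1 hD.disjoint x hx h5)
      have h3 : Nontrivial (LinearMap.ker r →ₗ[A] S) := by
        rw [← Finite.one_lt_card_iff_nontrivial] at h2 ⊢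
        rwa [e3]
      exact exists_ne 0
    obtain ⟨φ, hφ⟩ := this
    have hφs : Function.Surjective φ := LinearMap.surjective_of_ne_zero hφ
    obtain ⟨K', hK'⟩ := exists_isCompl (LinearMap.ker r)
    let p := Submodule.projectionOnto _ K' hK'
    -- Left linear maps from `A` to itself are right multiplications; `i₁` is the element that
    -- represents `φ ∘ p`.
    set i₁ : A := (φ (p 1)).1 with hi₁
    have hi₁I : i₁ ∈ I := (hSI (φ (p 1)).2).2
    have hmul : ∀ x, x * (b + i₁) = x * b + φ (p x) := fun x => by
      rw [mul_add, hi₁, ← smul_eq_mul x (φ (p 1) : A), ← Submodule.coe_smul, ← map_smul,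
        ← map_smul, smul_eq_mul, mul_one]
    have hrx : ∀ x, r x = x * b := fun x => rfl
    have hle1 : S ≤ Ideal.span {b + i₁} := by
      intro y hy
      obtain ⟨x, hx⟩ := hφs ⟨y, hy⟩
      rw [Ideal.mem_span_singleton']
      refine ⟨x, ?_⟩
      have h1 : r x.1 = 0 := x.2
      rw [hmul, ← hrx, h1, zero_add, Submodule.projectionOnto_apply_left, hx]
    have hle2 : Ideal.span {b} ≤ Ideal.span {b + i₁} := by
      rw [Ideal.span_singleton_le_iff_mem, Ideal.mem_span_singleton']
      have h1 : (1 : A) ∈ LinearMap.ker r ⊔ K' := hK'.sup_eq_top ▸ trivial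
      obtain ⟨x, hx, y, hy, hxy⟩ := Submodule.mem_sup.1 h1
      refine ⟨y, ?_⟩
      have h2 : p y = 0 := (Submodule.projectionOnto_apply_eq_zero_iff hK').2 hy
      have h3 : r x = 0 := hx
      rw [hmul, h2, ← hrx, map_zero, Submodule.coe_zero, add_zero, ← zero_add (r y), ← h3, ← map_add, hxy,
        hrx, one_mul]
    have hlt : (Ideal.span {b} : Ideal A) < Ideal.span {b + i₁} := by
      refine lt_of_le_of_ne hle2 fun heq => hS.1 ?_
      rw [eq_bot_iff, ← hcompl.inf_eq_bot]
      exact le_inf (heq ▸ hle1) hSI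
    have := hmax ⟨i₀ + i₁, I.add_mem hi₀ hi₁I⟩
    simp only [← add_assoc, ← hb] at this
    exact absurd this (not_le.2 (Set.ncard_lt_ncard (s := (Ideal.span {b} : Set A))
      (t := (Ideal.span {b + i₁} : Set A)) hlt (Set.toFinite _)))

/-- The hypothesis is used twice: a left inverse `z` of `a` again has a unit as its image, so `z`
has a left inverse, which can only be `a`. -/
theorem isUnit_of_forall_exists_mul_eq_one {A B : Type*} [Ring A] [Ring B] (f : A →+* B)
    (h : ∀ a, IsUnit (f a) → ∃ z, z * a = 1) : IsLocalHom f := by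
  refine ⟨fun a ha => ?_⟩
  obtain ⟨z, hz⟩ := h a ha
  have h1 : f z * f a = 1 := by rw [← map_mul, hz, map_one]
  obtain ⟨b, hb⟩ := ha
  have h2 : f z = (b⁻¹ : Bˣ) := by
    rw [← hb] at h1
    rw [← mul_one (f z), ← b.mul_inv, ← mul_assoc, h1, one_mul]
  obtain ⟨w, hw⟩ := h z (h2 ▸ Units.isUnit _)
  have h3 : w = a := by rw [← mul_one w, ← hz, ← mul_assoc, hw, one_mul]
  exact ⟨⟨a, z, by rw [← h3, hw], hz⟩, rfl⟩

theorem isLocalHom_mk_jacobson (A : Type*) [Ring A] :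
    IsLocalHom (Ideal.Quotient.mk (Ring.jacobson A)) := by
  refine isUnit_of_forall_exists_mul_eq_one _ fun a ha => ?_
  obtain ⟨b, hb⟩ := ha.exists_left_inv
  obtain ⟨b, rfl⟩ := Ideal.Quotient.mk_surjective b
  rw [← map_mul, ← map_one (Ideal.Quotient.mk (Ring.jacobson A)), Ideal.Quotient.eq,
    ← Ideal.jacobson_bot] at hb
  obtain ⟨s, hs⟩ := Ideal.exists_mul_add_sub_mem_of_mem_jacobson _ hb
  rw [sub_add_cancel, Ideal.mem_bot, sub_eq_zero, ← mul_assoc] at hs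
  exact ⟨_, hs⟩

theorem hasStableRangeOne_of_finite (A : Type*) [Ring A] [Finite A] : HasStableRangeOne A := by
  have : IsSemisimpleRing (A ⧸ Ring.jacobson A) := IsSemiprimaryRing.isSemisimpleRing
  have : Finite (A ⧸ Ring.jacobson A) := Finite.of_surjective _ Ideal.Quotient.mk_surjective
  have := isLocalHom_mk_jacobson A
  exact (hasStableRangeOne_of_finite_semisimple (A ⧸ Ring.jacobson A)).of_isLocalHom
    (Ideal.Quotient.mk _) Ideal.Quotient.mk_surjective

/-- Units lift along a surjection from a finite algebra over a local ring whose kernel lies in the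
extension of the maximal ideal. -/
theorem isLocalHom_of_ker_le {R A B : Type*} [CommRing R] [IsLocalRing R] [Ring A] [Algebra R A]
    [Module.Finite R A] [Ring B] (f : A →+* B) (hf : Function.Surjective f)
    (hker : ∀ x, f x = 0 → x ∈ IsLocalRing.maximalIdeal R • (⊤ : Submodule R A)) :
    IsLocalHom f := by
  refine isUnit_of_forall_exists_mul_eq_one _ fun a ha => ?_
  obtain ⟨b, hb⟩ := ha.exists_left_inv
  -- Nakayama: the image of `a` is a unit, so the range of right multiplication by `a` together with
  -- the multiples of the maximal ideal fills `A`.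
  have key : (⊤ : Submodule R A) ≤ LinearMap.range (LinearMap.mulRight R a) := by
    refine Submodule.le_of_le_smul_of_le_jacobson_bot (I := IsLocalRing.maximalIdeal R)
      Module.Finite.fg_top (IsLocalRing.maximalIdeal_le_jacobson ⊥) fun x _ => ?_
    obtain ⟨y, hy⟩ := hf (f x * b)
    rw [Submodule.mem_sup]
    refine ⟨y * a, ⟨y, rfl⟩, x - y * a, hker _ ?_, by abel⟩
    rw [map_sub, map_mul, hy, mul_assoc, hb, mul_one, sub_self]
  exact key (x := 1) trivial

section
variable (R : Type*) [CommRing R] [IsLocalRing R] (G : Type*) [Group G]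

theorem surjective_mapRingHom_residue :
    Function.Surjective (MonoidAlgebra.mapRingHom G (IsLocalRing.residue R)) := by
  exact MonoidAlgebra.map_surjective _ IsLocalRing.residue_surjective

instance isLocalHom_mapRingHom_residue [Finite G] :
    IsLocalHom (MonoidAlgebra.mapRingHom G (IsLocalRing.residue R)) := by
  refine isLocalHom_of_ker_le (R := R) _ (surjective_mapRingHom_residue R G) fun x hx => ?_
  have h1 : x = ∑ g ∈ x.coeff.support, x.coeff g • MonoidAlgebra.single g (1 : R) := by
    conv_lhs => rw [← MonoidAlgebra.sum_coeff_single x]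
    simp [Finsupp.sum]
  rw [h1]
  refine Submodule.sum_mem _ fun g _ => Submodule.smul_mem_smul ?_ trivial
  have h2 := congrArg (fun z : MonoidAlgebra _ G => z.coeff g) hx
  simp only [MonoidAlgebra.coeff_mapRingHom, MonoidAlgebra.coeff_zero, Finsupp.coe_zero,
    Pi.zero_apply] at h2
  exact (IsLocalRing.residue_eq_zero_iff _).1 h2

theorem hasStableRangeOne_monoidAlgebra [Finite G] [Finite (IsLocalRing.ResidueField R)] :
    HasStableRangeOne (MonoidAlgebra R G) := by
  have : Finite (MonoidAlgebra (IsLocalRing.ResidueField R) G) :=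
    Finite.of_injective (fun x => (x.coeff : G → _)) 
      (DFunLike.coe_injective.comp MonoidAlgebra.coeff_injective)
  exact (hasStableRangeOne_of_finite _).of_isLocalHom _ (surjective_mapRingHom_residue R G)
end

end GaloisStructure
end

noncomputable section
namespace GaloisStructure

/-! ### Determinants of automorphisms after extension of scalars -/

section LatticeIso
variable {R : Type u} {𝔄 : Type w} [CommRing R] [Ring 𝔄] [Algebra R 𝔄]
variable {Λ : Type v} [CommRing Λ] [Algebra R Λ]

theorem LatIso.ext' {M N : ProjMod R 𝔄} {ξ η : LatIso Λ M N}
    (h : ∀ x, ξ.toEquiv x = η.toEquiv x) : ξ = η := by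
  cases ξ
  cases η
  congr
  exact LinearEquiv.ext h

theorem ext_comp {M N P : ProjMod R 𝔄} (i : M →ₗ[𝔄] N) (j : N →ₗ[𝔄] P) (x : Λ ⊗[R] M) :
    ext Λ N P j (ext Λ M N i x) = ext Λ M P (j ∘ₗ i) x := by
  induction x with
  | zero => simp
  | add z w hz hw => simp only [map_add, hz, hw]
  | tmul l b => simp [ext]

theorem ext_id {M : ProjMod R 𝔄} (x : Λ ⊗[R] M) : ext Λ M M LinearMap.id x = x := by
  induction x with
  | zero => simp
  | add z w hz hw => simp only [map_add, hz, hw]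
  | tmul l b => simp [ext]

theorem ext_add {M N : ProjMod R 𝔄} (i j : M →ₗ[𝔄] N) (x : Λ ⊗[R] M) :
    ext Λ M N (i + j) x = ext Λ M N i x + ext Λ M N j x := by
  induction x with
  | zero => simp
  | add z w hz hw => simp only [map_add, hz, hw]; abel
  | tmul l b => simp [ext]

theorem ext_zero {M N : ProjMod R 𝔄} (x : Λ ⊗[R] M) :
    ext Λ M N 0 x = 0 := by
  induction x with
  | zero => simp
  | add z w hz hw => simp only [map_add, hz, hw, add_zero]
  | tmul l b => simp [ext]

theorem ext_act {M N : ProjMod R 𝔄} (i : M →ₗ[𝔄] N) (a : 𝔄) (x : Λ ⊗[R] M) :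
    ext Λ M N i (act Λ M a x) = act Λ N a (ext Λ M N i x) := by
  induction x with
  | zero => simp
  | add z w hz hw => simp only [map_add, hz, hw]
  | tmul l b => simp [ext, act]

/-- The extension of scalars of an isomorphism of `𝔄`-modules. -/
def LatIso.ofEquiv {M N : ProjMod R 𝔄} (α : M ≃ₗ[𝔄] N) : LatIso Λ M N where
  toEquiv := LinearEquiv.ofLinearMap (ext Λ M N α) (ext Λ N M α.symm)
    (LinearMap.ext fun x => by
      rw [LinearMap.comp_apply, ext_comp, LinearEquiv.comp_symm, ext_id, LinearMap.id_apply])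
    (LinearMap.ext fun x => by
      rw [LinearMap.comp_apply, ext_comp, LinearEquiv.symm_comp, ext_id, LinearMap.id_apply])
  map_act := ext_act _

theorem LatIso.ofEquiv_apply {M N : ProjMod R 𝔄} (α : M ≃ₗ[𝔄] N) (x : Λ ⊗[R] M) :
    (LatIso.ofEquiv α).toEquiv x = ext Λ M N α x := rfl

/-- The inverse isomorphism. -/
def LatIso.symm {M N : ProjMod R 𝔄} (ξ : LatIso Λ M N) : LatIso Λ N M where
  toEquiv := ξ.toEquiv.symm
  map_act a x := by rw [LinearEquiv.symm_apply_eq, ξ.map_act, LinearEquiv.apply_symm_apply]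

theorem LatIso.comp_apply {M N P : ProjMod R 𝔄} (η : LatIso Λ N P) (ξ : LatIso Λ M N)
    (x : Λ ⊗[R] M) : (η.comp ξ).toEquiv x = η.toEquiv (ξ.toEquiv x) := rfl

theorem LatIso.symm_apply_apply {M N : ProjMod R 𝔄} (ξ : LatIso Λ M N) (x : Λ ⊗[R] M) :
    ξ.symm.toEquiv (ξ.toEquiv x) = x := ξ.toEquiv.symm_apply_apply x

theorem LatIso.apply_symm_apply {M N : ProjMod R 𝔄} (ξ : LatIso Λ M N) (x : Λ ⊗[R] N) :
    ξ.toEquiv (ξ.symm.toEquiv x) = x := ξ.toEquiv.apply_symm_apply x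

instance (M : ProjMod R 𝔄) : Group (LatIso Λ M M) where
  mul := LatIso.comp
  one := ⟨LinearEquiv.refl _ _, fun _ _ => rfl⟩
  inv := LatIso.symm
  mul_assoc _ _ _ := rfl
  one_mul _ := rfl
  mul_one _ := rfl
  inv_mul_cancel ξ := LatIso.ext' ξ.symm_apply_apply

theorem LatIso.mul_apply {M : ProjMod R 𝔄} (ξ η : LatIso Λ M M) (x : Λ ⊗[R] M) :
    (ξ * η).toEquiv x = ξ.toEquiv (η.toEquiv x) := rfl

theorem LatIso.one_apply {M : ProjMod R 𝔄} (x : Λ ⊗[R] M) :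
    (1 : LatIso Λ M M).toEquiv x = x := rfl

/-- The direct sum of two projective modules. -/
def ProjMod.prod (M N : ProjMod R 𝔄) : ProjMod R 𝔄 where
  carrier := M × N

variable (R 𝔄) in
/-- The zero module. -/
def ProjMod.zero : ProjMod R 𝔄 where
  carrier := PUnit

section Prod
variable (M N : ProjMod R 𝔄)

/-- The first inclusion into a direct sum. -/
def ProjMod.inl : M →ₗ[𝔄] M.prod N := LinearMap.inl 𝔄 M N

/-- The second inclusion into a direct sum. -/
def ProjMod.inr : N →ₗ[𝔄] M.prod N := LinearMap.inr 𝔄 M N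

/-- The first projection of a direct sum. -/
def ProjMod.fst : M.prod N →ₗ[𝔄] M := LinearMap.fst 𝔄 M N

/-- The second projection of a direct sum. -/
def ProjMod.snd : M.prod N →ₗ[𝔄] N := LinearMap.snd 𝔄 M N

theorem ProjMod.fst_inl : ProjMod.fst M N ∘ₗ ProjMod.inl M N = LinearMap.id := rfl
theorem ProjMod.snd_inr : ProjMod.snd M N ∘ₗ ProjMod.inr M N = LinearMap.id := rfl
theorem ProjMod.fst_inr : ProjMod.fst M N ∘ₗ ProjMod.inr M N = 0 := rfl
theorem ProjMod.snd_inl : ProjMod.snd M N ∘ₗ ProjMod.inl M N = 0 := rfl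

theorem ProjMod.inl_fst_add_inr_snd :
    ProjMod.inl M N ∘ₗ ProjMod.fst M N + ProjMod.inr M N ∘ₗ ProjMod.snd M N = LinearMap.id :=
  LinearMap.ext fun x => Prod.fst_add_snd (M := M) (N := N) x

variable {M N}
theorem ext_fst_inl (x : Λ ⊗[R] M) :
    ext Λ _ _ (ProjMod.fst M N) (ext Λ _ _ (ProjMod.inl M N) x) = x := by
  rw [ext_comp, ProjMod.fst_inl, ext_id]

theorem ext_snd_inr (x : Λ ⊗[R] N) :
    ext Λ _ _ (ProjMod.snd M N) (ext Λ _ _ (ProjMod.inr M N) x) = x := by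
  rw [ext_comp, ProjMod.snd_inr, ext_id]

theorem ext_fst_inr (x : Λ ⊗[R] N) :
    ext Λ _ _ (ProjMod.fst M N) (ext Λ _ _ (ProjMod.inr M N) x) = 0 := by
  rw [ext_comp, ProjMod.fst_inr, ext_zero]

theorem ext_snd_inl (x : Λ ⊗[R] M) :
    ext Λ _ _ (ProjMod.snd M N) (ext Λ _ _ (ProjMod.inl M N) x) = 0 := by
  rw [ext_comp, ProjMod.snd_inl, ext_zero]

theorem ext_inl_fst_add (x : Λ ⊗[R] M.prod N) :
    ext Λ _ _ (ProjMod.inl M N) (ext Λ _ _ (ProjMod.fst M N) x) +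
      ext Λ _ _ (ProjMod.inr M N) (ext Λ _ _ (ProjMod.snd M N) x) = x := by
  rw [ext_comp, ext_comp, ← ext_add, ProjMod.inl_fst_add_inr_snd, ext_id]

/-- Permits arguments in coordinates on the tensor product without identifying it with a direct sum
of two tensor products. -/
theorem prod_induction {motive : Λ ⊗[R] (M.prod N) → Prop}
    (h : ∀ x y, motive (ext Λ _ _ (ProjMod.inl M N) x + ext Λ _ _ (ProjMod.inr M N) y)) (z) :
    motive z := by
  rw [← ext_inl_fst_add z]
  exact h _ _

variable {M' N' : ProjMod R 𝔄}

/-- The direct sum of two isomorphisms. -/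
def LatIso.prod (ξ : LatIso Λ M M') (η : LatIso Λ N N') :
    LatIso Λ (M.prod N) (M'.prod N') where
  toEquiv := LinearEquiv.ofLinearMap
    (ext Λ _ _ (ProjMod.inl M' N') ∘ₗ ξ.toEquiv ∘ₗ ext Λ _ _ (ProjMod.fst M N) +
      ext Λ _ _ (ProjMod.inr M' N') ∘ₗ η.toEquiv ∘ₗ ext Λ _ _ (ProjMod.snd M N))
    (ext Λ _ _ (ProjMod.inl M N) ∘ₗ ξ.symm.toEquiv ∘ₗ ext Λ _ _ (ProjMod.fst M' N') +
      ext Λ _ _ (ProjMod.inr M N) ∘ₗ η.symm.toEquiv ∘ₗ ext Λ _ _ (ProjMod.snd M' N'))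
    (LinearMap.ext fun x => by
      induction x using prod_induction with
      | h x y =>
        simp [ext_fst_inl, ext_fst_inr, ext_snd_inl, ext_snd_inr, LatIso.apply_symm_apply])
    (LinearMap.ext fun x => by
      induction x using prod_induction with
      | h x y =>
        simp [ext_fst_inl, ext_fst_inr, ext_snd_inl, ext_snd_inr, LatIso.symm_apply_apply])
  map_act a x := by simp [ext_act, ξ.map_act, η.map_act]

theorem LatIso.prod_apply (ξ : LatIso Λ M M') (η : LatIso Λ N N') (x : Λ ⊗[R] M)
    (y : Λ ⊗[R] N) : (ξ.prod η).toEquiv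
      (ext Λ _ _ (ProjMod.inl M N) x + ext Λ _ _ (ProjMod.inr M N) y) =
        ext Λ _ _ (ProjMod.inl M' N') (ξ.toEquiv x) +
          ext Λ _ _ (ProjMod.inr M' N') (η.toEquiv y) := by
  simp [LatIso.prod, ext_fst_inl, ext_fst_inr, ext_snd_inl, ext_snd_inr]

/-- The direct sum of two isomorphisms of modules. -/
def ProjMod.prodCongr (α : M ≃ₗ[𝔄] M') (β : N ≃ₗ[𝔄] N') : M.prod N ≃ₗ[𝔄] M'.prod N' :=
  (LinearEquiv.prodCongr α β : (M × N) ≃ₗ[𝔄] (M' × N'))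

theorem ProjMod.prodCongr_inl (α : M ≃ₗ[𝔄] M') (β : N ≃ₗ[𝔄] N') :
    (ProjMod.prodCongr α β).toLinearMap ∘ₗ ProjMod.inl M N = ProjMod.inl M' N' ∘ₗ α :=
  LinearMap.ext fun m => by
    change ((α m, β 0) : M' × N') = (α m, 0)
    rw [map_zero]

theorem ProjMod.prodCongr_inr (α : M ≃ₗ[𝔄] M') (β : N ≃ₗ[𝔄] N') :
    (ProjMod.prodCongr α β).toLinearMap ∘ₗ ProjMod.inr M N = ProjMod.inr M' N' ∘ₗ β :=
  LinearMap.ext fun m => by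
    change ((α 0, β m) : M' × N') = (0, β m)
    rw [map_zero]

theorem LatIso.ofEquiv_prodCongr (α : M ≃ₗ[𝔄] M') (β : N ≃ₗ[𝔄] N') :
    LatIso.ofEquiv (Λ := Λ) (ProjMod.prodCongr α β) =
      (LatIso.ofEquiv α).prod (LatIso.ofEquiv β) := by
  refine LatIso.ext' fun x => ?_
  induction x using prod_induction with
  | h x y =>
    rw [LatIso.prod_apply]
    simp only [LatIso.ofEquiv_apply, map_add, ext_comp, ProjMod.prodCongr_inl,
      ProjMod.prodCongr_inr]
end Prod
end LatticeIso

/-! ### Determinants of automorphisms, read off from equivariant maps to representations -/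

section Determinant
variable {R : Type u} {𝔄 : Type w} [CommRing R] [Ring 𝔄] [Algebra R 𝔄]
set_option linter.unusedSectionVars false
variable {Λ : Type v} [Field Λ] [Algebra R Λ]
variable {K : Type*} [Field K] [Algebra R K] [Algebra Λ K] [IsScalarTower R Λ K]
variable [Module.Finite R 𝔄]
variable {n : ℕ} (ρ : 𝔄 →ₐ[R] Module.End K (Fin n → K))

/-- The submodule of `𝔄`-equivariant maps among the `Λ`-linear maps from `Λ ⊗[R] M` to a
representation. -/
def dualSubmodule (M : ProjMod R 𝔄) : Submodule K (Λ ⊗[R] M →ₗ[Λ] (Fin n → K)) where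
  carrier := {f | ∀ a x, f (act Λ M a x) = ρ a (f x)}
  add_mem' hf hg a x := by simp [hf a x, hg a x]
  zero_mem' a x := by simp
  smul_mem' c f hf a x := by simp [hf a x]

/-- The space of `𝔄`-equivariant `Λ`-linear maps from `Λ ⊗[R] M` to a representation. -/
def dualSpace (M : ProjMod R 𝔄) : Type _ := dualSubmodule (Λ := Λ) ρ M

instance (M : ProjMod R 𝔄) : AddCommGroup (dualSpace (Λ := Λ) ρ M) :=
  inferInstanceAs (AddCommGroup (dualSubmodule (Λ := Λ) ρ M))

instance (M : ProjMod R 𝔄) : Module K (dualSpace (Λ := Λ) ρ M) :=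
  inferInstanceAs (Module K (dualSubmodule (Λ := Λ) ρ M))

variable {ρ} in
/-- The linear map underlying an element of the dual space. -/
def dualSpace.hom {M : ProjMod R 𝔄} (f : dualSpace (Λ := Λ) ρ M) :
    Λ ⊗[R] M →ₗ[Λ] (Fin n → K) := f.1

theorem dualSpace.hom_act {M : ProjMod R 𝔄} (f : dualSpace (Λ := Λ) ρ M) (a : 𝔄)
    (x : Λ ⊗[R] M) : f.hom (act Λ M a x) = ρ a (f.hom x) := f.2 a x

theorem dualSpace.hom_add {M : ProjMod R 𝔄} (f g : dualSpace (Λ := Λ) ρ M) :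
    (f + g).hom = f.hom + g.hom := rfl

theorem dualSpace.hom_sub {M : ProjMod R 𝔄} (f g : dualSpace (Λ := Λ) ρ M) :
    (f - g).hom = f.hom - g.hom := rfl

theorem dualSpace.hom_zero {M : ProjMod R 𝔄} :
    (0 : dualSpace (Λ := Λ) ρ M).hom = 0 := rfl

theorem dualSpace.hom_smul {M : ProjMod R 𝔄} (c : K) (f : dualSpace (Λ := Λ) ρ M) :
    (c • f).hom = c • f.hom := rfl

theorem dualSpace_ext {M : ProjMod R 𝔄} {f g : dualSpace (Λ := Λ) ρ M}
    (h : ∀ x, f.hom x = g.hom x) : f = g := Subtype.ext (LinearMap.ext h)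

/-- Pull-back of equivariant maps along an isomorphism. -/
def pull {M N : ProjMod R 𝔄} (ξ : LatIso Λ M N) :
    dualSpace (Λ := Λ) ρ N →ₗ[K] dualSpace (Λ := Λ) ρ M where
  toFun f := ⟨f.hom ∘ₗ ξ.toEquiv.toLinearMap, fun a x => by
    simpa [ξ.map_act] using f.hom_act ρ a (ξ.toEquiv x)⟩
  map_add' _ _ := rfl
  map_smul' _ _ := rfl

theorem pull_apply {M N : ProjMod R 𝔄} (ξ : LatIso Λ M N) (f : dualSpace (Λ := Λ) ρ N)
    (x : Λ ⊗[R] M) : (pull ρ ξ f).hom x = f.hom (ξ.toEquiv x) := rfl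

/-- The determinant of an automorphism acting on the equivariant maps to a representation. -/
def repDet (M : ProjMod R 𝔄) : LatIso Λ M M →* K where
  toFun θ := LinearMap.det (M := dualSpace (Λ := Λ) ρ M) (A := K) (pull ρ θ)
  map_one' := LinearMap.det_id
  map_mul' θ θ' := by
    -- Pull-back reverses the order of composition, which determinants do not notice.
    rw [mul_comm]
    exact LinearMap.det_comp (M := dualSpace (Λ := Λ) ρ M) (A := K) (pull ρ θ') (pull ρ θ)

theorem repDet_apply {M : ProjMod R 𝔄} (θ : LatIso Λ M M) :
    repDet ρ M θ = LinearMap.det (M := dualSpace (Λ := Λ) ρ M) (A := K) (pull ρ θ) := rfl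

theorem repDet_conj {M N : ProjMod R 𝔄} (η : LatIso Λ M N) (θ : LatIso Λ M M) :
    repDet ρ N (η.comp (LatIso.comp θ η.symm)) = repDet ρ M θ := by
  let e : dualSpace (Λ := Λ) ρ M ≃ₗ[K] dualSpace (Λ := Λ) ρ N :=
    LinearEquiv.ofLinearMap (pull ρ η.symm) (pull ρ η)
      (LinearMap.ext fun f => dualSpace_ext ρ fun x => by
        simp [pull_apply, LatIso.apply_symm_apply])
      (LinearMap.ext fun f => dualSpace_ext ρ fun x => by
        simp [pull_apply, LatIso.symm_apply_apply])
  exact LinearMap.det_conj (A := K) (M := dualSpace (Λ := Λ) ρ M)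
    (N := dualSpace (Λ := Λ) ρ N) (pull ρ θ) e

instance (M : ProjMod R 𝔄) : FiniteDimensional K (dualSpace (Λ := Λ) ρ M) :=
  have : Module.Finite R M := Module.Finite.trans 𝔄 M
  have : Module.Finite K (Λ ⊗[R] M →ₗ[Λ] (Fin n → K)) := Module.Finite.linearMap Λ K _ _
  inferInstanceAs (FiniteDimensional K (dualSubmodule (Λ := Λ) ρ M))

/-- The hypothesis amounts to `(θ - 1)² = 0`, so `1 - p` is nilpotent and its characteristic
polynomial is a power of `X`. The value of that polynomial at `1` is the determinant of `p`. -/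
theorem repDet_eq_one {M : ProjMod R 𝔄} (θ : LatIso Λ M M)
    (h : ∀ x, θ.toEquiv (θ.toEquiv x - x) = θ.toEquiv x - x) : repDet ρ M θ = 1 := by
  let p : Module.End K (dualSpace (Λ := Λ) ρ M) := pull ρ θ
  have hp : ∀ f x, (p f).hom x = f.hom (θ.toEquiv x) := fun f x => rfl
  have hnil : IsNilpotent (1 - p) := by
    refine ⟨2, LinearMap.ext fun f => dualSpace_ext ρ fun x => ?_⟩
    have := congrArg f.hom (h x)
    simp only [map_sub] at this
    have h2 : f.hom x - f.hom (θ.toEquiv x) -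
        (f.hom (θ.toEquiv x) - f.hom (θ.toEquiv (θ.toEquiv x))) = 0 := by
      rw [← neg_sub (f.hom (θ.toEquiv (θ.toEquiv x))), this]
      abel
    simpa [pow_two, hp, dualSpace.hom_sub, dualSpace.hom_zero] using h2
  have h1 := LinearMap.eval_charpoly (1 - p) 1
  rw [hnil.charpoly_eq_X_pow_finrank] at h1
  simpa [repDet_apply] using h1.symm

variable {ρ} in
/-- An equivariant map, as an element of the dual space. -/
def dualSpace.mk {M : ProjMod R 𝔄} (f : Λ ⊗[R] M →ₗ[Λ] (Fin n → K))
    (hf : ∀ a x, f (act Λ M a x) = ρ a (f x)) : dualSpace (Λ := Λ) ρ M := ⟨f, hf⟩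

theorem dualSpace.hom_mk {M : ProjMod R 𝔄} (f : Λ ⊗[R] M →ₗ[Λ] (Fin n → K))
    (hf : ∀ a x, f (act Λ M a x) = ρ a (f x)) : (dualSpace.mk f hf).hom = f := rfl

/-- The dual space of a direct sum. -/
def dualSpaceProd (M N : ProjMod R 𝔄) :
    (dualSpace (Λ := Λ) ρ M × dualSpace (Λ := Λ) ρ N) ≃ₗ[K] dualSpace (Λ := Λ) ρ (M.prod N) where
  toFun f := dualSpace.mk (f.1.hom ∘ₗ ext Λ _ _ (ProjMod.fst M N) +
        f.2.hom ∘ₗ ext Λ _ _ (ProjMod.snd M N)) fun a x => by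
      simp [ext_act, dualSpace.hom_act]
  map_add' f g := dualSpace_ext ρ fun x => by
    simp only [dualSpace.hom_mk, dualSpace.hom_add, Prod.fst_add, Prod.snd_add,
      LinearMap.add_apply, LinearMap.comp_apply]
    abel
  map_smul' c f := dualSpace_ext ρ fun x => by
    simp [dualSpace.hom_mk, dualSpace.hom_smul]
  invFun f := (dualSpace.mk (f.hom ∘ₗ ext Λ _ _ (ProjMod.inl M N)) fun a x => by
      simp [ext_act, dualSpace.hom_act],
    dualSpace.mk (f.hom ∘ₗ ext Λ _ _ (ProjMod.inr M N)) fun a x => by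
      simp [ext_act, dualSpace.hom_act])
  left_inv f := Prod.ext
    (dualSpace_ext ρ fun x => by
      simp [dualSpace.hom_mk, ext_fst_inl, ext_snd_inl]) (dualSpace_ext ρ fun x => by
      simp [dualSpace.hom_mk, ext_fst_inr, ext_snd_inr])
  right_inv f := dualSpace_ext ρ fun x => by
    simp only [dualSpace.hom_mk, LinearMap.add_apply, LinearMap.comp_apply]
    rw [← map_add, ext_inl_fst_add]

theorem dualSpaceProd_apply {M N : ProjMod R 𝔄}
    (f : dualSpace (Λ := Λ) ρ M × dualSpace (Λ := Λ) ρ N) (x : Λ ⊗[R] M.prod N) :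
    (dualSpaceProd ρ M N f).hom x = f.1.hom (ext Λ _ _ (ProjMod.fst M N) x) +
        f.2.hom (ext Λ _ _ (ProjMod.snd M N) x) := rfl

theorem dualSpaceProd_symm_fst {M N : ProjMod R 𝔄}
    (f : dualSpace (Λ := Λ) ρ (M.prod N)) (x : Λ ⊗[R] M) :
    ((dualSpaceProd ρ M N).symm f).1.hom x = f.hom (ext Λ _ _ (ProjMod.inl M N) x) := rfl

theorem dualSpaceProd_symm_snd {M N : ProjMod R 𝔄}
    (f : dualSpace (Λ := Λ) ρ (M.prod N)) (x : Λ ⊗[R] N) :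
    ((dualSpaceProd ρ M N).symm f).2.hom x = f.hom (ext Λ _ _ (ProjMod.inr M N) x) := rfl

theorem repDet_prod {M N : ProjMod R 𝔄} (θ : LatIso Λ M M) (θ' : LatIso Λ N N) :
    repDet ρ (M.prod N) (θ.prod θ') = repDet ρ M θ * repDet ρ N θ' := by
  rw [repDet_apply, repDet_apply, repDet_apply, ← LinearMap.det_prodMap]
  refine Eq.trans ?_ (LinearMap.det_conj (A := K)
    (M := dualSpace (Λ := Λ) ρ M × dualSpace (Λ := Λ) ρ N)
    (N := dualSpace (Λ := Λ) ρ (M.prod N)) (LinearMap.prodMap (pull ρ θ) (pull ρ θ'))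
    (dualSpaceProd ρ M N))
  congr 1
  refine LinearMap.ext fun f => dualSpace_ext ρ fun x => ?_
  induction x using prod_induction with
  | h x y =>
    rw [pull_apply, LatIso.prod_apply]
    refine Eq.trans ?_ (dualSpaceProd_apply ρ (LinearMap.prodMap (pull ρ θ) (pull ρ θ')
      ((dualSpaceProd ρ M N).symm f)) _).symm
    simp only [LinearMap.prodMap_apply, map_add, ext_fst_inl, ext_fst_inr, ext_snd_inl,
      ext_snd_inr, add_zero, zero_add, pull_apply, dualSpaceProd_symm_fst,
      dualSpaceProd_symm_snd]

/-- The extension of a representation to `Λ ⊗[R] 𝔄`. -/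
def extendRep : Λ ⊗[R] 𝔄 →ₐ[Λ] Module.End K (Fin n → K) :=
  Algebra.TensorProduct.lift (Algebra.ofId _ _) ρ fun l a =>
    (show Commute (algebraMap Λ (Module.End K (Fin n → K)) l) (ρ a) from Algebra.commutes l (ρ a))

theorem extendRep_tmul (l : Λ) (a : 𝔄) (v : Fin n → K) :
    extendRep ρ (l ⊗ₜ[R] a) v = l • ρ a v := by
  have h : extendRep ρ (l ⊗ₜ[R] a) = algebraMap Λ (Module.End K (Fin n → K)) l * ρ a :=
    Algebra.TensorProduct.lift_tmul ..
  rw [h, ← Algebra.smul_def]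
  rfl

/-- An equivariant map is determined by its value at `1 ⊗ 1`, and this value can be any vector.
Evaluation there turns pull-back along right multiplication by `x` into the action of `x`. -/
theorem repDet_rightMul (x : (Λ ⊗[R] 𝔄)ˣ) :
    repDet ρ (ProjMod.self R 𝔄) (rightMul x) = LinearMap.det (extendRep (Λ := Λ) ρ x) := by
  have hact : ∀ (f : dualSpace (Λ := Λ) ρ (ProjMod.self R 𝔄)) (a : 𝔄) (x : Λ ⊗[R] 𝔄),
      f.hom (((1 : Λ) ⊗ₜ[R] a) * x : Λ ⊗[R] 𝔄) = ρ a (f.hom x) := by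
    intro f a x
    rw [← act_self]
    exact f.hom_act ρ a x
  have key : ∀ (f : dualSpace (Λ := Λ) ρ (ProjMod.self R 𝔄)) (x : Λ ⊗[R] 𝔄),
      f.hom x = extendRep ρ x (f.hom ((1 : Λ) ⊗ₜ[R] (1 : 𝔄) : Λ ⊗[R] 𝔄)) := by
    intro f x
    induction x with
    | zero => rw [map_zero, LinearMap.zero_apply]; exact map_zero f.hom
    | add z w hz hw => rw [map_add, LinearMap.add_apply, ← hz, ← hw]; exact map_add f.hom z w
    | tmul l a =>
      have h1 := hact f a ((1 : Λ) ⊗ₜ[R] (1 : 𝔄))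
      rw [Algebra.TensorProduct.tmul_mul_tmul, mul_one, mul_one] at h1
      have h3 : l ⊗ₜ[R] a = l • ((1 : Λ) ⊗ₜ[R] a) := by simp [TensorProduct.smul_tmul']
      rw [extendRep_tmul, ← h1, h3]
      exact map_smul f.hom l ((1 : Λ) ⊗ₜ[R] a : Λ ⊗[R] 𝔄)
  let F : (Fin n → K) → Λ ⊗[R] 𝔄 →ₗ[Λ] (Fin n → K) := fun v =>
    (LinearMap.applyₗ v).restrictScalars Λ ∘ₗ (extendRep ρ).toLinearMap
  have hF : ∀ v a (x : Λ ⊗[R] 𝔄), F v (act Λ 𝔄 a x) = ρ a (F v x) := fun v a x => by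
    rw [act_self]
    change extendRep ρ (_ * x) v = ρ a (extendRep ρ x v)
    rw [map_mul]
    exact (extendRep_tmul ρ _ _ _).trans (one_smul _ _)
  let e : dualSpace (Λ := Λ) ρ (ProjMod.self R 𝔄) ≃ₗ[K] (Fin n → K) :=
    { toFun := fun f => f.hom ((1 : Λ) ⊗ₜ[R] (1 : 𝔄) : Λ ⊗[R] 𝔄)
      map_add' := fun f g => rfl
      map_smul' := fun c f => rfl
      invFun := fun v => ⟨F v, hF v⟩
      left_inv := fun f => dualSpace_ext ρ fun x => (key f x).symm
      right_inv := fun v => by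
        change extendRep ρ ((1 : Λ) ⊗ₜ[R] (1 : 𝔄)) v = v
        rw [← Algebra.TensorProduct.one_def, map_one, Module.End.one_apply] }
  rw [repDet_apply]
  refine (LinearMap.det_conj (A := K) (M := dualSpace (Λ := Λ) ρ (ProjMod.self R 𝔄))
    (N := Fin n → K) (pull ρ (rightMul x)) e).symm.trans ?_
  congr 1
  refine LinearMap.ext fun v => ?_
  change extendRep ρ (((1 : Λ) ⊗ₜ[R] (1 : 𝔄)) * (x : Λ ⊗[R] 𝔄)) v = _
  rw [← Algebra.TensorProduct.one_def, one_mul]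

end Determinant
end GaloisStructure
end

noncomputable section
namespace GaloisStructure

/-! ### Automorphisms whose determinants come from units of the order -/

section IntegralAutomorphisms
set_option linter.unusedSectionVars false
variable {R : Type u} {𝔄 : Type w} [CommRing R] [Ring 𝔄] [Algebra R 𝔄] [Module.Finite R 𝔄]
variable {Λ : Type v} [Field Λ] [Algebra R Λ]
variable (K : Type*) [Field K] [Algebra R K] [Algebra Λ K] [IsScalarTower R Λ K]

/-- The automorphisms of `Λ ⊗[R] M` whose determinants on all representations agree with those
of a unit of `𝔄`. -/
def intDet (M : ProjMod R 𝔄) : Subgroup (LatIso Λ M M) where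
  carrier := {θ | ∃ u : 𝔄ˣ, ∀ (n : ℕ) (ρ : 𝔄 →ₐ[R] Module.End K (Fin n → K)),
    repDet ρ M θ = LinearMap.det (ρ u)}
  one_mem' := ⟨1, fun n ρ => by simp⟩
  mul_mem' := by
    rintro θ θ' ⟨u, hu⟩ ⟨u', hu'⟩
    exact ⟨u * u', fun n ρ => by simp [hu, hu']⟩
  inv_mem' := by
    rintro θ ⟨u, hu⟩
    refine ⟨u⁻¹, fun n ρ => ?_⟩
    have h1 : repDet ρ M θ⁻¹ * repDet ρ M θ = 1 := by rw [← map_mul, inv_mul_cancel, map_one]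
    have h2 : LinearMap.det (ρ ((u⁻¹ : 𝔄ˣ) : 𝔄)) * LinearMap.det (ρ u) = 1 := by
      rw [← map_mul, ← map_mul, Units.inv_mul, map_one, map_one]
    rw [hu] at h1
    exact mul_right_cancel₀ (right_ne_zero_of_mul_eq_one h2) (h1.trans h2.symm)

variable {K}
theorem mem_intDet_of_unipotent {M : ProjMod R 𝔄} (θ : LatIso Λ M M)
    (h : ∀ x, θ.toEquiv (θ.toEquiv x - x) = θ.toEquiv x - x) : θ ∈ intDet K M :=
  ⟨1, fun n ρ => by simp [repDet_eq_one ρ θ h]⟩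

theorem prod_mem_intDet {M N : ProjMod R 𝔄} {θ : LatIso Λ M M} {θ' : LatIso Λ N N}
    (h : θ ∈ intDet K M) (h' : θ' ∈ intDet K N) : θ.prod θ' ∈ intDet K (M.prod N) := by
  obtain ⟨u, hu⟩ := h
  obtain ⟨u', hu'⟩ := h'
  exact ⟨u * u', fun n ρ => by simp [repDet_prod, hu, hu']⟩

theorem mem_intDet_of_prod_one {M N : ProjMod R 𝔄} {θ : LatIso Λ M M}
    (h : θ.prod (1 : LatIso Λ N N) ∈ intDet K (M.prod N)) : θ ∈ intDet K M := by
  obtain ⟨u, hu⟩ := h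
  exact ⟨u, fun n ρ => by simpa [repDet_prod] using hu n ρ⟩

theorem conj_mem_intDet {M N : ProjMod R 𝔄} (η : LatIso Λ M N) {θ : LatIso Λ M M} :
    η.comp (LatIso.comp θ η.symm) ∈ intDet K N ↔ θ ∈ intDet K M := by
  constructor
  · rintro ⟨u, hu⟩
    exact ⟨u, fun n ρ => by rw [← hu, repDet_conj]⟩
  · rintro ⟨u, hu⟩
    exact ⟨u, fun n ρ => by rw [← hu, repDet_conj]⟩

theorem rightMul_mem_intDet (u : 𝔄ˣ) :
    rightMul (Units.map (Algebra.TensorProduct.includeRight :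
      𝔄 →ₐ[R] Λ ⊗[R] 𝔄).toRingHom.toMonoidHom u) ∈ intDet K (ProjMod.self R 𝔄) := by
  refine ⟨u, fun n ρ => ?_⟩
  rw [repDet_rightMul]
  congr 1
  exact LinearMap.ext fun v => (extendRep_tmul ρ 1 u.1 v).trans (one_smul _ _)

theorem LatIso.ofEquiv_trans {M N P : ProjMod R 𝔄} (α : M ≃ₗ[𝔄] N) (β : N ≃ₗ[𝔄] P) :
    LatIso.ofEquiv (Λ := Λ) (α.trans β) = (LatIso.ofEquiv β).comp (LatIso.ofEquiv α) :=
  LatIso.ext' fun x => by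
    rw [LatIso.comp_apply, LatIso.ofEquiv_apply, LatIso.ofEquiv_apply, LatIso.ofEquiv_apply,
      ext_comp, LinearEquiv.coe_trans]

theorem LatIso.ofEquiv_symm {M N : ProjMod R 𝔄} (α : M ≃ₗ[𝔄] N) :
    LatIso.ofEquiv (Λ := Λ) α.symm = (LatIso.ofEquiv α).symm := rfl

theorem LatIso.ofEquiv_refl {M : ProjMod R 𝔄} :
    LatIso.ofEquiv (Λ := Λ) (LinearEquiv.refl 𝔄 M) = 1 := LatIso.ext' ext_id

/-- The automorphism `1 + n` attached to an endomorphism `n` of square zero. -/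
def oneAddEquiv {A M : Type*} [Ring A] [AddCommGroup M] [Module A M] (n : M →ₗ[A] M)
    (hn : ∀ x, n (n x) = 0) : M ≃ₗ[A] M :=
  LinearEquiv.ofLinearMap (LinearMap.id + n) (LinearMap.id - n)
    (LinearMap.ext fun x => by simp [hn]) (LinearMap.ext fun x => by simp [hn])

theorem oneAddEquiv_apply {A M : Type*} [Ring A] [AddCommGroup M] [Module A M] (n : M →ₗ[A] M)
    (hn : ∀ x, n (n x) = 0) (x : M) : oneAddEquiv n hn x = x + n x := rfl

theorem ofEquiv_oneAddEquiv_mem {M : ProjMod R 𝔄} (n : M →ₗ[𝔄] M) (hn : ∀ x, n (n x) = 0) :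
    LatIso.ofEquiv (Λ := Λ) (oneAddEquiv n hn) ∈ intDet K M := by
  have h1 : ∀ x, (LatIso.ofEquiv (Λ := Λ) (oneAddEquiv n hn)).toEquiv x =
      x + ext Λ M M n x := fun x => by
    rw [LatIso.ofEquiv_apply]
    have : (oneAddEquiv n hn : M →ₗ[𝔄] M) = LinearMap.id + n := rfl
    rw [this, ext_add, ext_id]
  refine mem_intDet_of_unipotent _ fun x => ?_
  rw [h1 x, add_sub_cancel_left, h1, ext_comp]
  have : n ∘ₗ n = 0 := LinearMap.ext hn
  rw [this, ext_zero, add_zero]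

/-- The automorphisms of `M` act with the determinants of units of `𝔄`. -/
def HasIntegralDet (K : Type*) [Field K] [Algebra R K] [Algebra Λ K] [IsScalarTower R Λ K]
    (M : ProjMod R 𝔄) : Prop := ∀ α : M ≃ₗ[𝔄] M, LatIso.ofEquiv (Λ := Λ) α ∈ intDet K M

theorem HasIntegralDet.of_equiv {M N : ProjMod R 𝔄} (h : HasIntegralDet (Λ := Λ) K M)
    (β : M ≃ₗ[𝔄] N) : HasIntegralDet (Λ := Λ) K N := fun α => by
  have := (conj_mem_intDet (LatIso.ofEquiv β)).2 (h (β.trans (α.trans β.symm)))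
  rw [← LatIso.ofEquiv_symm, ← LatIso.ofEquiv_trans, ← LatIso.ofEquiv_trans] at this
  convert this
  ext x
  simp

theorem HasIntegralDet.of_prod {M N : ProjMod R 𝔄}
    (h : HasIntegralDet (Λ := Λ) K (M.prod N)) : HasIntegralDet (Λ := Λ) K M := fun α => by
  have := h (ProjMod.prodCongr α (LinearEquiv.refl 𝔄 N))
  rw [LatIso.ofEquiv_prodCongr, LatIso.ofEquiv_refl] at this
  exact mem_intDet_of_prod_one this

theorem HasIntegralDet.zero : HasIntegralDet (Λ := Λ) K (ProjMod.zero R 𝔄) := fun α => by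
  have : α = LinearEquiv.refl 𝔄 _ := LinearEquiv.ext fun x => Subsingleton.elim (α := PUnit) _ _
  rw [this, LatIso.ofEquiv_refl]
  exact one_mem _

/-- View `α` as a two by two matrix. Its first row `(a, φ)` is unimodular because `α` is onto, so
stable range one lets a shear turn the corner entry into a unit `u = a + φ f₀`. Two more shears, by
`g` and `f'`, clear the rest of the first row and column. -/
theorem exists_elementary_reduction (hA : HasStableRangeOne 𝔄) {F : Type*} [AddCommGroup F]
    [Module 𝔄 F] (α : (𝔄 × F) ≃ₗ[𝔄] (𝔄 × F)) :
    ∃ (f f' : 𝔄 →ₗ[𝔄] F) (g : F →ₗ[𝔄] 𝔄) (u : 𝔄ˣ) (δ : F →ₗ[𝔄] F), ∀ x y,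
      ((α (x + g y, y + f (x + g y))).1,
        (α (x + g y, y + f (x + g y))).2 + f' (α (x + g y, y + f (x + g y))).1) =
        (x * u, δ y) := by
  set a := (α (1, 0)).1 with ha
  let φ : F →ₗ[𝔄] 𝔄 := LinearMap.fst 𝔄 𝔄 F ∘ₗ α.toLinearMap ∘ₗ LinearMap.inr 𝔄 𝔄 F
  have hα : ∀ x y, (α (x, y)).1 = x * a + φ y := by
    intro x y
    have : ((x, y) : 𝔄 × F) = x • (1, 0) + (0, y) := by simp
    rw [this, map_add, map_smul]
    rfl
  obtain ⟨i, ⟨f₀, rfl⟩, u, hu⟩ := hA a (LinearMap.range φ) (by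
    rw [eq_top_iff]
    intro z _
    have h1 := hα (α.symm (z, 0)).1 (α.symm (z, 0)).2
    rw [Prod.mk.eta, LinearEquiv.apply_symm_apply] at h1
    change z = _ at h1
    rw [h1]
    exact Submodule.add_mem_sup (Ideal.mul_mem_left _ _ (Ideal.subset_span rfl)) ⟨_, rfl⟩)
  let f : 𝔄 →ₗ[𝔄] F := LinearMap.toSpanSingleton 𝔄 F f₀
  let w := (α (1, f₀)).2
  let f' : 𝔄 →ₗ[𝔄] F := LinearMap.toSpanSingleton 𝔄 F (-(((u⁻¹ : 𝔄ˣ) : 𝔄) • w))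
  let ru : 𝔄 →ₗ[𝔄] 𝔄 := LinearMap.toSpanSingleton 𝔄 𝔄 ((u⁻¹ : 𝔄ˣ) : 𝔄)
  let g : F →ₗ[𝔄] 𝔄 := -(ru ∘ₗ φ)
  let δ : F →ₗ[𝔄] F := LinearMap.snd 𝔄 𝔄 F ∘ₗ α.toLinearMap ∘ₗ LinearMap.inr 𝔄 𝔄 F +
    (f' ∘ₗ φ)
  have h1 : ∀ x, α (x, f x) = (x * u, x • w) := by
    intro x
    have : ((x, f x) : 𝔄 × F) = x • (1, f₀) := by simp [f]
    rw [this, map_smul]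
    refine Prod.ext ?_ rfl
    change x * (α (1, f₀)).1 = _
    rw [hα, one_mul, hu]
  refine ⟨f, f', g, u, δ + (LinearMap.toSpanSingleton 𝔄 F w ∘ₗ g) +
    f' ∘ₗ (LinearMap.toSpanSingleton 𝔄 𝔄 (u : 𝔄) ∘ₗ g), fun x y => ?_⟩
  have h2 : α (x + g y, y + f (x + g y)) =
      ((x + g y) * u + φ y, (x + g y) • w + (α (0, y)).2) := by
    have : ((x + g y, y + f (x + g y)) : 𝔄 × F) = (x + g y, f (x + g y)) + (0, y) := by
      rw [Prod.mk_add_mk, add_zero, add_comm y]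
    rw [this, map_add, h1]
    rfl
  have h3 : (x + g y) * u + φ y = x * u := by
    simp [g, ru, add_mul, mul_assoc]
  rw [h2]
  refine Prod.ext h3 ?_
  change (x + g y) • w + (α (0, y)).2 + f' ((x + g y) * u + φ y) = ((α (0, y)).2 + f' (φ y)) +
    g y • w + f' (g y * u)
  have h4 : f' (x * u) = - (x • w) := by
    simp [f', ← mul_smul]
  rw [add_mul, add_assoc (x * (u : 𝔄)), map_add, h4, map_add, add_smul]
  abel

/-- Shears are unipotent and have determinant one in each representation. After
`exists_elementary_reduction` only the diagonal automorphism `(u, δ)` is left; its first entry is a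
unit of `𝔄`, and its second is covered by the hypothesis on `F`. -/
theorem HasIntegralDet.self_prod (hA : HasStableRangeOne 𝔄) {F : ProjMod R 𝔄}
    (hF : HasIntegralDet (Λ := Λ) K F) :
    HasIntegralDet (Λ := Λ) K ((ProjMod.self R 𝔄).prod F) := by
  intro α
  obtain ⟨f, f', g, u, δ, h⟩ := exists_elementary_reduction (F := F) hA α
  let P := (ProjMod.self R 𝔄).prod F
  let n₁ : P →ₗ[𝔄] P := LinearMap.inl 𝔄 𝔄 F ∘ₗ g ∘ₗ LinearMap.snd 𝔄 𝔄 F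
  let n₂ : P →ₗ[𝔄] P := LinearMap.inr 𝔄 𝔄 F ∘ₗ f ∘ₗ LinearMap.fst 𝔄 𝔄 F
  let n₃ : P →ₗ[𝔄] P := LinearMap.inr 𝔄 𝔄 F ∘ₗ f' ∘ₗ LinearMap.fst 𝔄 𝔄 F
  have h₁ : ∀ x, n₁ (n₁ x) = 0 := fun x => by
    change ((g 0, 0) : 𝔄 × F) = (0, 0)
    rw [map_zero]
  have h₂ : ∀ x, n₂ (n₂ x) = 0 := fun x => by
    change ((0, f 0) : 𝔄 × F) = (0, 0)
    rw [map_zero]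
  have h₃ : ∀ x, n₃ (n₃ x) = 0 := fun x => by
    change ((0, f' 0) : 𝔄 × F) = (0, 0)
    rw [map_zero]
  let s₁ : P ≃ₗ[𝔄] P := oneAddEquiv n₁ h₁
  let s₂ : P ≃ₗ[𝔄] P := oneAddEquiv n₂ h₂
  let s₃ : P ≃ₗ[𝔄] P := oneAddEquiv n₃ h₃
  let γ : P ≃ₗ[𝔄] P := s₁.trans (s₂.trans (LinearEquiv.trans α s₃))
  have hγ : ∀ (x : 𝔄) (y : F), γ ((x, y) : 𝔄 × F) = ((x * u, δ y) : 𝔄 × F) := by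
    intro x y
    rw [← h x y]
    have e1 : s₁ ((x, y) : 𝔄 × F) = ((x + g y, y) : 𝔄 × F) := by
      change ((x + g y, y + 0) : 𝔄 × F) = (x + g y, y)
      rw [add_zero]
    have e2 : s₂ ((x + g y, y) : 𝔄 × F) = ((x + g y, y + f (x + g y)) : 𝔄 × F) := by
      change ((x + g y + 0, y + f (x + g y)) : 𝔄 × F) = (x + g y, y + f (x + g y))
      rw [add_zero]
    change s₃ (α (s₂ (s₁ ((x, y) : 𝔄 × F)))) = _
    rw [e1, e2]
    exact Prod.ext (add_zero _) rfl
  have hδ : Function.Bijective δ := by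
    constructor
    · intro y y' hy
      have : γ ((0, y) : 𝔄 × F) = γ ((0, y') : 𝔄 × F) := by rw [hγ, hγ, hy]
      exact (Prod.ext_iff.1 (γ.injective this)).2
    · intro z
      obtain ⟨⟨x, y⟩, hxy⟩ := γ.surjective ((0, z) : 𝔄 × F)
      exact ⟨y, (Prod.ext_iff.1 ((hγ x y).symm.trans hxy)).2⟩
  let δ' : F ≃ₗ[𝔄] F := LinearEquiv.ofBijective δ hδ
  have hγ' : LatIso.ofEquiv (Λ := Λ) γ ∈ intDet K P := by
    have := prod_mem_intDet (rightMul_mem_intDet (Λ := Λ) (K := K) u) (hF δ')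
    convert this
    have h5 : ∀ (l : Λ) (b : 𝔄), (rightMul (Units.map (Algebra.TensorProduct.includeRight :
        𝔄 →ₐ[R] Λ ⊗[R] 𝔄).toRingHom.toMonoidHom u)).toEquiv (l ⊗ₜ[R] b : Λ ⊗[R] 𝔄) =
        (l ⊗ₜ[R] (b * u.1) : Λ ⊗[R] 𝔄) := fun l b => by
      change ((l ⊗ₜ[R] b) * ((1 : Λ) ⊗ₜ[R] u.1) : Λ ⊗[R] 𝔄) = _
      rw [Algebra.TensorProduct.tmul_mul_tmul, mul_one]
    have h6 : ∀ b : 𝔄, γ ((b, 0) : 𝔄 × F) = ((b * u.1, 0) : 𝔄 × F) := fun b => by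
      rw [hγ, map_zero]
    refine LatIso.ext' fun x => ?_
    induction x using prod_induction with
    | h x y =>
      rw [LatIso.prod_apply, map_add]
      congr 1
      · rw [LatIso.ofEquiv_apply]
        induction x with
        | zero => simp only [map_zero]
        | add z w hz hw => simp only [map_add, hz, hw]
        | tmul l b =>
          refine Eq.trans ?_ (congrArg (ext Λ _ _ (ProjMod.inl _ _)) (h5 l b)).symm
          exact congrArg (fun z : P => l ⊗ₜ[R] z) (h6 b)
      · rw [LatIso.ofEquiv_apply, LatIso.ofEquiv_apply]
        induction y with
        | zero => simp only [map_zero]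
        | add z w hz hw => simp only [map_add, hz, hw]
        | tmul l b =>
          have h7 : γ ((0, b) : 𝔄 × F) = ((0, δ b) : 𝔄 × F) := by rw [hγ, zero_mul]
          exact congrArg (fun z : P => l ⊗ₜ[R] z) h7
  have hα : LatIso.ofEquiv (Λ := Λ) γ = LatIso.ofEquiv s₃ *
      (LatIso.ofEquiv (M := P) (N := P) α * (LatIso.ofEquiv s₂ * LatIso.ofEquiv s₁)) := by
    change _ = LatIso.comp _ (LatIso.comp _ (LatIso.comp _ _))
    rw [← LatIso.ofEquiv_trans, ← LatIso.ofEquiv_trans, ← LatIso.ofEquiv_trans]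
    rfl
  rw [hα] at hγ'
  rwa [Subgroup.mul_mem_cancel_left _ (ofEquiv_oneAddEquiv_mem n₃ h₃),
    Subgroup.mul_mem_cancel_right _ (mul_mem (ofEquiv_oneAddEquiv_mem n₂ h₂)
      (ofEquiv_oneAddEquiv_mem n₁ h₁))] at hγ'

variable (R 𝔄) in
/-- The free module of rank `n`. -/
def ProjMod.free : ℕ → ProjMod R 𝔄
  | 0 => ProjMod.zero R 𝔄
  | n + 1 => (ProjMod.self R 𝔄).prod (ProjMod.free n)

variable (R 𝔄) in
/-- The free module of rank `n` in coordinates. -/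
def ProjMod.freeEquiv : ∀ n, (Fin n → 𝔄) ≃ₗ[𝔄] ProjMod.free R 𝔄 n
  | 0 => (LinearEquiv.ofSubsingleton (Fin 0 → 𝔄) PUnit.{w + 1} : _ ≃ₗ[𝔄] _)
  | n + 1 => (Fin.consLinearEquiv 𝔄 (fun _ : Fin (n + 1) => 𝔄)).symm.trans
      (LinearEquiv.prodCongr (LinearEquiv.refl 𝔄 𝔄) (ProjMod.freeEquiv n))

theorem HasIntegralDet.free (hA : HasStableRangeOne 𝔄) (n : ℕ) :
    HasIntegralDet (Λ := Λ) K (ProjMod.free R 𝔄 n) := by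
  induction n with
  | zero => exact HasIntegralDet.zero
  | succ n ih => exact ih.self_prod hA

/-- A finitely generated projective module is a summand of a free one, and extending an automorphism
by the identity on the complement changes no determinant. -/
theorem hasIntegralDet (hA : HasStableRangeOne 𝔄) (M : ProjMod R 𝔄) :
    HasIntegralDet (Λ := Λ) K M := by
  obtain ⟨n, f, hf⟩ := Module.Finite.exists_fin' 𝔄 M
  obtain ⟨g, hg⟩ := Module.projective_lifting_property f LinearMap.id hf
  have hfg : ∀ m, f (g m) = m := fun m => LinearMap.congr_fun hg m
  let t : (Fin n → 𝔄) →ₗ[𝔄] LinearMap.ker f :=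
    (LinearMap.id - g ∘ₗ f).codRestrict _ fun x => by simp [hfg]
  have ht : t ∘ₗ (LinearMap.ker f).subtype = LinearMap.id :=
    LinearMap.ext fun x => Subtype.ext (by
      change x.1 - g (f x.1) = x.1
      rw [LinearMap.mem_ker.1 x.2, map_zero, sub_zero])
  have : Module.Finite 𝔄 (LinearMap.ker f) :=
    Module.Finite.of_surjective t fun x => ⟨x, LinearMap.congr_fun ht x⟩
  have : Module.Projective 𝔄 (LinearMap.ker f) := Module.Projective.of_split _ t ht
  let N : ProjMod R 𝔄 := ⟨LinearMap.ker f⟩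
  let e : (Fin n → 𝔄) ≃ₗ[𝔄] (M × LinearMap.ker f) :=
    LinearEquiv.ofLinearMap (f.prod t) (g.coprod (LinearMap.ker f).subtype)
      (LinearMap.ext fun x => Prod.ext (by simp [hfg]) (by
        have h1 : t (g x.1) = 0 := Subtype.ext (by simp [t, hfg])
        have h2 : t x.2 = x.2 := LinearMap.congr_fun ht x.2
        simp [h1, h2]))
      (LinearMap.ext fun x => by
        change g (f x) + (x - g (f x)) = x
        abel)
  have e' : ProjMod.free R 𝔄 n ≃ₗ[𝔄] M.prod N := (ProjMod.freeEquiv R 𝔄 n).symm.trans e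
  exact ((HasIntegralDet.free hA n).of_equiv e').of_prod

end IntegralAutomorphisms
end GaloisStructure
end

noncomputable section
namespace GaloisStructure

/-! ### An invariant of the relative `K`-group -/

section Invariant
set_option linter.unusedSectionVars false
variable {R : Type u} {𝔄 : Type w} [CommRing R] [Ring 𝔄] [Algebra R 𝔄] [Module.Finite R 𝔄]
variable {Λ : Type v} [Field Λ] [Algebra R Λ]
variable (K : Type*) [Field K] [Algebra R K] [Algebra Λ K] [IsScalarTower R Λ K]

/-- Two triples are equivalent if they are isomorphic up to an automorphism with integral
determinants. -/
def TripleRel (T T' : Triple R 𝔄 Λ) : Prop :=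
  ∃ (α : T.M ≃ₗ[𝔄] T'.M) (β : T.N ≃ₗ[𝔄] T'.N) (θ : LatIso Λ T.M T.M), θ ∈ intDet K T.M ∧
    T'.ξ.comp (LatIso.ofEquiv α) = (LatIso.ofEquiv β).comp (T.ξ.comp θ)

variable {K}

theorem LatIso.comp_one {M N : ProjMod R 𝔄} (ξ : LatIso Λ M N) :
    ξ.comp (1 : LatIso Λ M M) = ξ := rfl

theorem LatIso.one_comp {M N : ProjMod R 𝔄} (ξ : LatIso Λ M N) :
    (1 : LatIso Λ N N).comp ξ = ξ := rfl

theorem LatIso.comp_symm_cancel {M N : ProjMod R 𝔄} (ξ : LatIso Λ M N) :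
    ξ.comp ξ.symm = 1 := LatIso.ext' ξ.apply_symm_apply

theorem LatIso.symm_comp_cancel {M N : ProjMod R 𝔄} (ξ : LatIso Λ M N) :
    ξ.symm.comp ξ = 1 := LatIso.ext' ξ.symm_apply_apply

theorem TripleRel.of_eq {T T' : Triple R 𝔄 Λ} (α : T.M ≃ₗ[𝔄] T'.M) (β : T.N ≃ₗ[𝔄] T'.N)
    (h : T'.ξ.comp (LatIso.ofEquiv α) = (LatIso.ofEquiv β).comp T.ξ) : TripleRel K T T' :=
  ⟨α, β, 1, one_mem _, h⟩

theorem TripleRel.refl (T : Triple R 𝔄 Λ) : TripleRel K T T :=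
  .of_eq (LinearEquiv.refl _ _) (LinearEquiv.refl _ _) (by
    rw [LatIso.ofEquiv_refl, LatIso.ofEquiv_refl, LatIso.one_comp, LatIso.comp_one])

theorem TripleRel.symm {T T' : Triple R 𝔄 Λ} (h : TripleRel K T T') : TripleRel K T' T := by
  obtain ⟨α, β, θ, hθ, h⟩ := h
  refine ⟨α.symm, β.symm, (LatIso.ofEquiv α).comp (LatIso.comp θ⁻¹ (LatIso.ofEquiv α).symm),
    (conj_mem_intDet _).2 (inv_mem hθ), LatIso.ext' fun x => ?_⟩
  have h1 : ∀ y, T'.ξ.toEquiv ((LatIso.ofEquiv α).toEquiv y) =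
    (LatIso.ofEquiv β).toEquiv (T.ξ.toEquiv (θ.toEquiv y)) := fun y =>
      congrArg (fun z => LatIso.toEquiv z y) h
  have h2 : ∀ y, θ.toEquiv ((θ⁻¹ : LatIso Λ _ _).toEquiv y) = y := LatIso.apply_symm_apply θ
  simp only [LatIso.comp_apply, h1, h2, LatIso.ofEquiv_symm, LatIso.symm_apply_apply]

theorem TripleRel.trans {T T' T'' : Triple R 𝔄 Λ} (h : TripleRel K T T')
    (h' : TripleRel K T' T'') : TripleRel K T T'' := by
  obtain ⟨α, β, θ, hθ, h⟩ := h
  obtain ⟨α', β', θ', hθ', h'⟩ := h'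
  refine ⟨α.trans α', β.trans β', θ * (LatIso.ofEquiv α).symm.comp
    (LatIso.comp θ' (LatIso.ofEquiv α)), mul_mem hθ ?_, LatIso.ext' fun x => ?_⟩
  · exact (conj_mem_intDet (LatIso.ofEquiv α).symm).2 hθ'
  · have h1 : ∀ y, T'.ξ.toEquiv ((LatIso.ofEquiv α).toEquiv y) =
      (LatIso.ofEquiv β).toEquiv (T.ξ.toEquiv (θ.toEquiv y)) := fun y =>
        congrArg (fun z => LatIso.toEquiv z y) h
    have h2 : ∀ y, T''.ξ.toEquiv ((LatIso.ofEquiv α').toEquiv y) =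
      (LatIso.ofEquiv β').toEquiv (T'.ξ.toEquiv (θ'.toEquiv y)) := fun y =>
        congrArg (fun z => LatIso.toEquiv z y) h'
    simp only [LatIso.comp_apply, LatIso.ofEquiv_trans, LatIso.mul_apply, ← h1,
      LatIso.apply_symm_apply, h2]

/-- The direct sum of two triples. -/
def Triple.add (T T' : Triple R 𝔄 Λ) : Triple R 𝔄 Λ :=
  ⟨T.M.prod T'.M, T.N.prod T'.N, T.ξ.prod T'.ξ⟩

theorem LatIso.prod_comp {M N P M' N' P' : ProjMod R 𝔄} (ξ : LatIso Λ M N) (η : LatIso Λ N P)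
    (ξ' : LatIso Λ M' N') (η' : LatIso Λ N' P') :
    (η.prod η').comp (ξ.prod ξ') = (η.comp ξ).prod (η'.comp ξ') := by
  refine LatIso.ext' fun x => ?_
  induction x using prod_induction with
  | h x y => simp only [LatIso.comp_apply, LatIso.prod_apply]

theorem LatIso.prod_one_one {M N : ProjMod R 𝔄} :
    (1 : LatIso Λ M M).prod (1 : LatIso Λ N N) = 1 := by
  refine LatIso.ext' fun x => ?_
  induction x using prod_induction with
  | h x y => simp only [LatIso.one_apply, LatIso.prod_apply]

theorem TripleRel.add {T T' S S' : Triple R 𝔄 Λ} (h : TripleRel K T T')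
    (h' : TripleRel K S S') : TripleRel K (T.add S) (T'.add S') := by
  obtain ⟨α, β, θ, hθ, h⟩ := h
  obtain ⟨α', β', θ', hθ', h'⟩ := h'
  refine ⟨ProjMod.prodCongr α α', ProjMod.prodCongr β β', θ.prod θ', prod_mem_intDet hθ hθ', ?_⟩
  refine (congrArg (T'.ξ.prod S'.ξ).comp (LatIso.ofEquiv_prodCongr α α')).trans ?_
  refine Eq.trans ?_ (congrArg (fun z => z.comp ((T.ξ.prod S.ξ).comp (θ.prod θ')))
    (LatIso.ofEquiv_prodCongr β β')).symm
  rw [LatIso.prod_comp, LatIso.prod_comp, LatIso.prod_comp, h, h']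

/-- The trivial triple on a module. -/
def Triple.triv (P : ProjMod R 𝔄) : Triple R 𝔄 Λ := ⟨P, P, 1⟩

theorem Triple.triv_add (P Q : ProjMod R 𝔄) :
    (Triple.triv P).add (Triple.triv Q) = Triple.triv (Λ := Λ) (P.prod Q) :=
  congrArg (Triple.mk (P.prod Q) (P.prod Q)) LatIso.prod_one_one

/-- Commutativity of direct sums. -/
def ProjMod.prodComm (M N : ProjMod R 𝔄) : M.prod N ≃ₗ[𝔄] N.prod M :=
  LinearEquiv.prodComm 𝔄 M N

/-- Associativity of direct sums. -/
def ProjMod.prodAssoc (M N P : ProjMod R 𝔄) :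
    (M.prod N).prod P ≃ₗ[𝔄] M.prod (N.prod P) :=
  LinearEquiv.prodAssoc 𝔄 M N P

/-- The zero module is neutral for direct sums. -/
def ProjMod.zeroProd (M : ProjMod R 𝔄) : (ProjMod.zero R 𝔄).prod M ≃ₗ[𝔄] M :=
  (LinearEquiv.uniqueProd : (PUnit.{w + 1} × M) ≃ₗ[𝔄] M)

theorem ext_prodComm (M N : ProjMod R 𝔄) (x : Λ ⊗[R] M) (y : Λ ⊗[R] N) :
    (LatIso.ofEquiv (ProjMod.prodComm M N)).toEquiv (ext Λ _ _ (ProjMod.inl M N) x +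
      ext Λ _ _ (ProjMod.inr M N) y) = ext Λ _ _ (ProjMod.inl N M) y +
        ext Λ _ _ (ProjMod.inr N M) x := by
  have h1 : (ProjMod.prodComm M N).toLinearMap ∘ₗ ProjMod.inl M N = ProjMod.inr N M := rfl
  have h2 : (ProjMod.prodComm M N).toLinearMap ∘ₗ ProjMod.inr M N = ProjMod.inl N M := rfl
  rw [LatIso.ofEquiv_apply, map_add, ext_comp, ext_comp, h1, h2, add_comm]

theorem LatIso.prod_comm {M N M' N' : ProjMod R 𝔄} (ξ : LatIso Λ M N) (ξ' : LatIso Λ M' N') :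
    (ξ'.prod ξ).comp (LatIso.ofEquiv (ProjMod.prodComm M M')) =
      (LatIso.ofEquiv (ProjMod.prodComm N N')).comp (ξ.prod ξ') := LatIso.ext' fun x => by
  induction x using prod_induction with
  | h x y => rw [LatIso.comp_apply, LatIso.comp_apply, ext_prodComm, LatIso.prod_apply,
      LatIso.prod_apply, ext_prodComm]

theorem ext_prodAssoc (M N P : ProjMod R 𝔄) (x : Λ ⊗[R] M) (y : Λ ⊗[R] N) (z : Λ ⊗[R] P) :
    (LatIso.ofEquiv (ProjMod.prodAssoc M N P)).toEquiv
      (ext Λ _ _ (ProjMod.inl (M.prod N) P) (ext Λ _ _ (ProjMod.inl M N) x +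
        ext Λ _ _ (ProjMod.inr M N) y) + ext Λ _ _ (ProjMod.inr (M.prod N) P) z) =
      ext Λ _ _ (ProjMod.inl M (N.prod P)) x + ext Λ _ _ (ProjMod.inr M (N.prod P))
        (ext Λ _ _ (ProjMod.inl N P) y + ext Λ _ _ (ProjMod.inr N P) z) := by
  have h1 : ((ProjMod.prodAssoc M N P).toLinearMap ∘ₗ
    ProjMod.inl (M.prod N) P) ∘ₗ ProjMod.inl M N = ProjMod.inl M (N.prod P) := rfl
  have h2 : ((ProjMod.prodAssoc M N P).toLinearMap ∘ₗ
    ProjMod.inl (M.prod N) P) ∘ₗ ProjMod.inr M N =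
      ProjMod.inr M (N.prod P) ∘ₗ ProjMod.inl N P := rfl
  have h3 : (ProjMod.prodAssoc M N P).toLinearMap ∘ₗ
    ProjMod.inr (M.prod N) P = ProjMod.inr M (N.prod P) ∘ₗ ProjMod.inr N P := rfl
  simp only [LatIso.ofEquiv_apply, map_add]
  rw [ext_comp, ext_comp, ext_comp, ext_comp, ext_comp, ext_comp, ext_comp, h1, h2, h3, add_assoc]

theorem LatIso.prod_assoc {M N M' N' M'' N'' : ProjMod R 𝔄} (ξ : LatIso Λ M N)
    (ξ' : LatIso Λ M' N') (ξ'' : LatIso Λ M'' N'') :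
    (ξ.prod (ξ'.prod ξ'')).comp (LatIso.ofEquiv (ProjMod.prodAssoc M M' M'')) =
      (LatIso.ofEquiv (ProjMod.prodAssoc N N' N'')).comp ((ξ.prod ξ').prod ξ'') :=
  LatIso.ext' fun x => by
    induction x using prod_induction with
    | h x z =>
      induction x using prod_induction with
      | h x y =>
        rw [LatIso.comp_apply, LatIso.comp_apply, ext_prodAssoc, LatIso.prod_apply,
          LatIso.prod_apply, LatIso.prod_apply, LatIso.prod_apply, ext_prodAssoc]

theorem ext_zeroProd (M : ProjMod R 𝔄) (x : Λ ⊗[R] ProjMod.zero R 𝔄) (y : Λ ⊗[R] M) :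
    (LatIso.ofEquiv (ProjMod.zeroProd M)).toEquiv
      (ext Λ _ _ (ProjMod.inl (ProjMod.zero R 𝔄) M) x +
        ext Λ _ _ (ProjMod.inr (ProjMod.zero R 𝔄) M) y) = y := by
  have h1 : (ProjMod.zeroProd M).toLinearMap ∘ₗ ProjMod.inl (ProjMod.zero R 𝔄) M = 0 := rfl
  have h2 : (ProjMod.zeroProd M).toLinearMap ∘ₗ ProjMod.inr (ProjMod.zero R 𝔄) M =
    LinearMap.id := rfl
  rw [LatIso.ofEquiv_apply, map_add, ext_comp, ext_comp, h1, h2, ext_zero, ext_id, zero_add]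

theorem LatIso.zero_prod {M N : ProjMod R 𝔄} (ξ : LatIso Λ M N) :
    ξ.comp (LatIso.ofEquiv (ProjMod.zeroProd M)) = (LatIso.ofEquiv (ProjMod.zeroProd N)).comp
      ((1 : LatIso Λ (ProjMod.zero R 𝔄) (ProjMod.zero R 𝔄)).prod ξ) := LatIso.ext' fun x => by
  induction x using prod_induction with
  | h x y =>
    rw [LatIso.comp_apply, LatIso.comp_apply, ext_zeroProd, LatIso.prod_apply, ext_zeroProd]

theorem TripleRel.add_comm (T S : Triple R 𝔄 Λ) : TripleRel K (T.add S) (S.add T) :=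
  .of_eq (ProjMod.prodComm _ _) (ProjMod.prodComm _ _) (LatIso.prod_comm T.ξ S.ξ)

theorem TripleRel.add_assoc (T S U : Triple R 𝔄 Λ) :
    TripleRel K ((T.add S).add U) (T.add (S.add U)) :=
  .of_eq (ProjMod.prodAssoc _ _ _) (ProjMod.prodAssoc _ _ _) (LatIso.prod_assoc T.ξ S.ξ U.ξ)

theorem TripleRel.zero_add (T : Triple R 𝔄 Λ) :
    TripleRel K ((Triple.triv (ProjMod.zero R 𝔄)).add T) T :=
  .of_eq (ProjMod.zeroProd _) (ProjMod.zeroProd _) (LatIso.zero_prod T.ξ)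

/-- Projectivity splits both sequences. In split coordinates the middle isomorphism differs from the
direct sum of the outer ones by an automorphism `θ` that is the identity on the submodule and on the
quotient, hence is unipotent. -/
theorem TripleRel.of_exact (T' T T'' : Triple R 𝔄 Λ)
    (i : T'.M →ₗ[𝔄] T.M) (p : T.M →ₗ[𝔄] T''.M) (j : T'.N →ₗ[𝔄] T.N) (q : T.N →ₗ[𝔄] T''.N)
    (hi : Function.Injective i) (hip : Function.Exact i p) (hp : Function.Surjective p)
    (hj : Function.Injective j) (hjq : Function.Exact j q) (hq : Function.Surjective q)
    (h' : ∀ x, T.ξ.toEquiv (ext Λ _ _ i x) = ext Λ _ _ j (T'.ξ.toEquiv x))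
    (h'' : ∀ x, T''.ξ.toEquiv (ext Λ _ _ p x) = ext Λ _ _ q (T.ξ.toEquiv x)) :
    TripleRel K (T'.add T'') T := by
  have split : ∀ {M' M M'' : ProjMod R 𝔄} (i : M' →ₗ[𝔄] M) (p : M →ₗ[𝔄] M'')
      (hi : Function.Injective i) (hip : Function.Exact i p) (hp : Function.Surjective p),
      ∃ α : M'.prod M'' ≃ₗ[𝔄] M, α.toLinearMap ∘ₗ ProjMod.inl M' M'' = i ∧
        p ∘ₗ α.toLinearMap = ProjMod.snd M' M'' := by
    intro M' M M'' i p hi hip hp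
    obtain ⟨g, hg⟩ := Module.projective_lifting_property p LinearMap.id hp
    have hpg : ∀ m, p (g m) = m := fun m => LinearMap.congr_fun hg m
    let a : (M' × M'') →ₗ[𝔄] M := i.coprod g
    have ha : Function.Bijective a := by
      constructor
      · rw [injective_iff_map_eq_zero]
        rintro ⟨x, y⟩ hxy
        have h0 : i x + g y = 0 := hxy
        have h1 : y = 0 := by
          have := congrArg p h0
          rwa [map_add, hip.apply_apply_eq_zero, hpg, map_zero, _root_.zero_add] at this
        rw [h1, map_zero, add_zero] at h0
        rw [h1, (injective_iff_map_eq_zero i).1 hi x h0]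
        rfl
      · intro m
        obtain ⟨x, hx⟩ := (hip (m - g (p m))).1 (by rw [map_sub, hpg, sub_self])
        refine ⟨(x, p m), ?_⟩
        change i x + g (p m) = m
        rw [hx]
        abel
    refine ⟨(LinearEquiv.ofBijective a ha : (M' × M'') ≃ₗ[𝔄] M), LinearMap.ext fun x => ?_,
      LinearMap.ext fun x => ?_⟩
    · change i x + g 0 = i x
      rw [map_zero, add_zero]
    · change p (i x.1 + g x.2) = x.2
      rw [map_add, hip.apply_apply_eq_zero, hpg, _root_.zero_add]
  obtain ⟨α, hα, hα'⟩ := split i p hi hip hp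
  obtain ⟨β, hβ, hβ'⟩ := split j q hj hjq hq
  let θ : LatIso Λ (T'.M.prod T''.M) (T'.M.prod T''.M) := (T'.ξ.prod T''.ξ).symm.comp
    ((LatIso.ofEquiv β).symm.comp (T.ξ.comp (LatIso.ofEquiv α)))
  have hθ : ∀ x, (LatIso.ofEquiv β).toEquiv ((T'.ξ.prod T''.ξ).toEquiv (θ.toEquiv x)) =
      T.ξ.toEquiv ((LatIso.ofEquiv α).toEquiv x) := fun x => by
    simp only [θ, LatIso.comp_apply, LatIso.apply_symm_apply]
  have prod_inl : ∀ x, (T'.ξ.prod T''.ξ).toEquiv (ext Λ _ _ (ProjMod.inl _ _) x) =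
      ext Λ _ _ (ProjMod.inl _ _) (T'.ξ.toEquiv x) := fun x => by
    have := LatIso.prod_apply T'.ξ T''.ξ x 0
    rwa [map_zero, map_zero, map_zero, add_zero, add_zero] at this
  have snd_prod : ∀ x, ext Λ _ _ (ProjMod.snd _ _) ((T'.ξ.prod T''.ξ).toEquiv x) =
      T''.ξ.toEquiv (ext Λ _ _ (ProjMod.snd _ _) x) := fun x => by
    induction x using prod_induction with
    | h x y =>
      rw [LatIso.prod_apply, map_add, map_add, ext_snd_inl, ext_snd_inr, ext_snd_inl, ext_snd_inr,
        _root_.zero_add, _root_.zero_add]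
  have hA : ∀ x, θ.toEquiv (ext Λ _ _ (ProjMod.inl _ _) x) = ext Λ _ _ (ProjMod.inl _ _) x := by
    intro x
    apply (T'.ξ.prod T''.ξ).toEquiv.injective
    apply (LatIso.ofEquiv (Λ := Λ) β).toEquiv.injective
    rw [hθ, prod_inl, LatIso.ofEquiv_apply, LatIso.ofEquiv_apply, ext_comp, ext_comp, hα, hβ, h']
  have hB : ∀ x, ext Λ _ _ (ProjMod.snd _ _) (θ.toEquiv x) = ext Λ _ _ (ProjMod.snd _ _) x := by
    intro x
    apply T''.ξ.toEquiv.injective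
    have h1 := congrArg (ext Λ _ _ q) (hθ x)
    rw [LatIso.ofEquiv_apply, LatIso.ofEquiv_apply, ext_comp, hβ', ← h'', ext_comp, hα',
      snd_prod] at h1
    exact h1
  refine ⟨α, β, θ, mem_intDet_of_unipotent θ fun x => ?_, LatIso.ext' fun x => (hθ x).symm⟩
  -- By `hB` the difference `θ x - x` comes from the first summand, where `θ` is the identity by
  -- `hA`.
  have h1 := ext_inl_fst_add (θ.toEquiv x - x)
  rw [map_sub (ext Λ _ _ (ProjMod.snd _ _)), hB, sub_self, map_zero, add_zero] at h1
  rw [← h1, hA]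

/-- The automorphism `1 + n` attached to an endomorphism `n` of square zero. -/
def LatIso.oneAdd {M : ProjMod R 𝔄} (n : Λ ⊗[R] M →ₗ[Λ] Λ ⊗[R] M)
    (hn : ∀ (a : 𝔄) x, n (act Λ M a x) = act Λ M a (n x)) (h : ∀ x, n (n x) = 0) : LatIso Λ M M where
  toEquiv := oneAddEquiv n h
  map_act a x := by simp [oneAddEquiv_apply, hn]

theorem LatIso.oneAdd_apply {M : ProjMod R 𝔄} (n : Λ ⊗[R] M →ₗ[Λ] Λ ⊗[R] M)
    (hn : ∀ (a : 𝔄) x, n (act Λ M a x) = act Λ M a (n x)) (h : ∀ x, n (n x) = 0) (x : Λ ⊗[R] M) :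
    (LatIso.oneAdd n hn h).toEquiv x = x + n x := rfl

theorem LatIso.oneAdd_mem {M : ProjMod R 𝔄} (n : Λ ⊗[R] M →ₗ[Λ] Λ ⊗[R] M)
    (hn : ∀ (a : 𝔄) x, n (act Λ M a x) = act Λ M a (n x)) (h : ∀ x, n (n x) = 0) :
    LatIso.oneAdd n hn h ∈ intDet K M :=
  mem_intDet_of_unipotent _ fun x => by
    rw [LatIso.oneAdd_apply n hn h x, add_sub_cancel_left, LatIso.oneAdd_apply, h, add_zero]

/-- The isomorphism `(x, y) ↦ (-y, x)`. -/
def ProjMod.prodSkew (M N : ProjMod R 𝔄) : M.prod N ≃ₗ[𝔄] N.prod M :=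
  (LinearEquiv.prodComm 𝔄 M N).trans (LinearEquiv.prodCongr (LinearEquiv.neg 𝔄)
    (LinearEquiv.refl 𝔄 M))

/-- Whitehead's lemma: `(x, y) ↦ (ξ⁻¹ y, -ξ x)` is a product of three shears, and following it by
`(η ξ) ⊕ 1` and a signed swap, which is defined over `𝔄`, gives `ξ ⊕ η`. -/
theorem exists_prod_eq (M N P : ProjMod R 𝔄) (ξ : LatIso Λ M N) (η : LatIso Λ N P) :
    ∃ θ ∈ intDet K (M.prod N), ξ.prod η = (LatIso.ofEquiv (ProjMod.prodSkew P N)).comp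
      (((η.comp ξ).prod (1 : LatIso Λ N N)).comp θ) := by
  let n₁ : Λ ⊗[R] M.prod N →ₗ[Λ] Λ ⊗[R] M.prod N :=
    ext Λ _ _ (ProjMod.inl M N) ∘ₗ ξ.symm.toEquiv ∘ₗ ext Λ _ _ (ProjMod.snd M N)
  let n₂ : Λ ⊗[R] M.prod N →ₗ[Λ] Λ ⊗[R] M.prod N :=
    -(ext Λ _ _ (ProjMod.inr M N) ∘ₗ ξ.toEquiv ∘ₗ ext Λ _ _ (ProjMod.fst M N))
  have a₁ : ∀ (a : 𝔄) x, n₁ (act Λ _ a x) = act Λ _ a (n₁ x) := fun a x => by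
    simp [n₁, ext_act, LatIso.map_act]
  have a₂ : ∀ (a : 𝔄) x, n₂ (act Λ _ a x) = act Λ _ a (n₂ x) := fun a x => by
    simp [n₂, ext_act, LatIso.map_act]
  have z₁ : ∀ x, n₁ (n₁ x) = 0 := fun x => by simp [n₁, ext_snd_inl]
  have z₂ : ∀ x, n₂ (n₂ x) = 0 := fun x => by simp [n₂, ext_fst_inr]
  refine ⟨LatIso.oneAdd n₁ a₁ z₁ * (LatIso.oneAdd n₂ a₂ z₂ * LatIso.oneAdd n₁ a₁ z₁), mul_mem (LatIso.oneAdd_mem _ _ _)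
      (mul_mem (LatIso.oneAdd_mem _ _ _) (LatIso.oneAdd_mem _ _ _)), LatIso.ext' fun x => ?_⟩
  induction x using prod_induction with
  | h x y =>
    have key : (LatIso.oneAdd n₁ a₁ z₁ * (LatIso.oneAdd n₂ a₂ z₂ *
        LatIso.oneAdd n₁ a₁ z₁)).toEquiv (ext Λ _ _ (ProjMod.inl M N) x +
          ext Λ _ _ (ProjMod.inr M N) y) = ext Λ _ _ (ProjMod.inl M N) (ξ.symm.toEquiv y) +
            ext Λ _ _ (ProjMod.inr M N) (-ξ.toEquiv x) := by
      simp only [LatIso.mul_apply, LatIso.oneAdd_apply, n₁, n₂, LinearMap.comp_apply, map_add,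
        LinearMap.neg_apply, map_neg, ext_fst_inl, ext_fst_inr, ext_snd_inl, ext_snd_inr,
        LinearEquiv.coe_coe, map_zero, LatIso.apply_symm_apply, LatIso.symm_apply_apply, add_zero,
        neg_zero]
      abel
    have h1 : (ProjMod.prodSkew P N).toLinearMap ∘ₗ ProjMod.inl P N = ProjMod.inr N P :=
      LinearMap.ext fun z => by
        change ((-0, z) : N × P) = (0, z)
        rw [neg_zero]
    have h2 : (ProjMod.prodSkew P N).toLinearMap ∘ₗ ProjMod.inr P N = -ProjMod.inl N P :=
      LinearMap.ext fun z => by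
        change ((-z, 0) : N × P) = -(z, 0)
        rw [Prod.neg_mk, neg_zero]
    have h3 : ∀ z, ext Λ _ _ (-ProjMod.inl N P) z = - ext Λ _ _ (ProjMod.inl N P) z := by
      intro z
      rw [eq_neg_iff_add_eq_zero, ← ext_add, neg_add_cancel, ext_zero]
    rw [LatIso.comp_apply, LatIso.comp_apply, key, LatIso.prod_apply, LatIso.prod_apply, LatIso.ofEquiv_apply, map_add, ext_comp, ext_comp, h1,
      h2, h3, LatIso.one_apply, LatIso.comp_apply, LatIso.apply_symm_apply, map_neg, neg_neg,
      _root_.add_comm]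

/-- The composition relation is obtained here after adding a trivial triple; this is the reason for
passing to stable classes. -/
theorem TripleRel.comp_add (M N P : ProjMod R 𝔄) (ξ : LatIso Λ M N) (η : LatIso Λ N P) :
    TripleRel K (Triple.add ⟨M, P, η.comp ξ⟩ (Triple.triv N)) (Triple.add ⟨M, N, ξ⟩ ⟨N, P, η⟩) := by
  obtain ⟨θ, hθ, h⟩ := exists_prod_eq (K := K) M N P ξ η
  exact ⟨LinearEquiv.refl _ _, ProjMod.prodSkew P N, θ, hθ,
    (congrArg (ξ.prod η).comp LatIso.ofEquiv_refl).trans h⟩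

variable (R 𝔄 Λ K) in
/-- Triples up to equivalence, as an additive monoid. -/
def tripleSetoid : Setoid (Triple R 𝔄 Λ) := ⟨TripleRel K, .refl, .symm, .trans⟩

variable (R 𝔄 Λ K) in
/-- The monoid of equivalence classes of triples. -/
def TripleMonoid : Type _ := Quotient (tripleSetoid R 𝔄 Λ K)

variable (K) in
/-- The class of a triple. -/
def TripleMonoid.mk (T : Triple R 𝔄 Λ) : TripleMonoid R 𝔄 Λ K := Quotient.mk _ T

instance : Add (TripleMonoid R 𝔄 Λ K) :=
  ⟨Quotient.map₂ Triple.add fun _ _ h _ _ h' => h.add h'⟩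

instance : Zero (TripleMonoid R 𝔄 Λ K) :=
  ⟨TripleMonoid.mk K (Triple.triv (ProjMod.zero R 𝔄))⟩

instance : AddCommMonoid (TripleMonoid R 𝔄 Λ K) where
  add_assoc := by
    rintro ⟨T⟩ ⟨S⟩ ⟨U⟩
    exact Quotient.sound (TripleRel.add_assoc T S U)
  zero_add := by
    rintro ⟨T⟩
    exact Quotient.sound (TripleRel.zero_add T)
  add_zero := by
    rintro ⟨T⟩
    exact Quotient.sound ((TripleRel.add_comm _ _).trans (TripleRel.zero_add T))
  add_comm := by
    rintro ⟨T⟩ ⟨S⟩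
    exact Quotient.sound (TripleRel.add_comm T S)
  nsmul := nsmulRec

theorem TripleMonoid.mk_add (T S : Triple R 𝔄 Λ) :
    TripleMonoid.mk K (T.add S) = TripleMonoid.mk K T + TripleMonoid.mk K S := rfl

theorem TripleMonoid.mk_eq {T S : Triple R 𝔄 Λ} :
    TripleMonoid.mk K T = TripleMonoid.mk K S ↔ TripleRel K T S := Quotient.eq

theorem TripleMonoid.mk_triv_add (P Q : ProjMod R 𝔄) :
    TripleMonoid.mk K (Triple.triv (Λ := Λ) P) + TripleMonoid.mk K (Triple.triv Q) =
      TripleMonoid.mk K (Triple.triv (P.prod Q)) := by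
  rw [← TripleMonoid.mk_add, Triple.triv_add]

theorem TripleMonoid.mk_triv_zero :
    TripleMonoid.mk K (Triple.triv (Λ := Λ) (ProjMod.zero R 𝔄)) = 0 := rfl

variable (R 𝔄 Λ K) in
/-- The congruence identifying trivial triples with zero. -/
def stableCon : AddCon (TripleMonoid R 𝔄 Λ K) where
  r a b := ∃ P Q : ProjMod R 𝔄, a + TripleMonoid.mk K (Triple.triv P) =
    b + TripleMonoid.mk K (Triple.triv Q)
  iseqv := ⟨fun a => ⟨ProjMod.zero R 𝔄, ProjMod.zero R 𝔄, rfl⟩,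
    fun ⟨P, Q, h⟩ => ⟨Q, P, h.symm⟩, fun {a b c} ⟨P, Q, h⟩ ⟨P', Q', h'⟩ => by
      refine ⟨P.prod P', Q.prod Q', ?_⟩
      rw [← TripleMonoid.mk_triv_add, ← TripleMonoid.mk_triv_add, ← add_assoc, h, add_right_comm,
        h', add_right_comm, add_assoc]⟩
  add' := fun {a b c d} ⟨P, Q, h⟩ ⟨P', Q', h'⟩ => by
    refine ⟨P.prod P', Q.prod Q', ?_⟩
    rw [← TripleMonoid.mk_triv_add, ← TripleMonoid.mk_triv_add, add_add_add_comm, h, h',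
      add_add_add_comm]

variable (K) in
/-- The stable class of a triple. -/
def stableClass (T : Triple R 𝔄 Λ) : (stableCon R 𝔄 Λ K).Quotient :=
  (TripleMonoid.mk K T : (stableCon R 𝔄 Λ K).Quotient)

theorem stableClass_add (T S : Triple R 𝔄 Λ) :
    stableClass K (T.add S) = stableClass K T + stableClass K S := rfl

theorem stableClass_eq_of_rel {T S : Triple R 𝔄 Λ} (h : TripleRel K T S) :
    stableClass K T = stableClass K S :=
  congrArg (fun z : TripleMonoid R 𝔄 Λ K => (z : (stableCon R 𝔄 Λ K).Quotient))
    (TripleMonoid.mk_eq.2 h)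

theorem stableClass_triv (P : ProjMod R 𝔄) : stableClass K (Triple.triv (Λ := Λ) P) = 0 :=
  (AddCon.eq (stableCon R 𝔄 Λ K)).2 ⟨ProjMod.zero R 𝔄, P, by
    rw [TripleMonoid.mk_triv_zero, zero_add, add_zero]⟩

theorem stableClass_comp (M N P : ProjMod R 𝔄) (ξ : LatIso Λ M N) (η : LatIso Λ N P) :
    stableClass K ⟨M, P, η.comp ξ⟩ = stableClass K ⟨M, N, ξ⟩ + stableClass K ⟨N, P, η⟩ := by
  rw [← stableClass_add, ← stableClass_eq_of_rel (TripleRel.comp_add M N P ξ η), stableClass_add,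
    stableClass_triv, add_zero]

variable (K) in
/-- The stable class of a triple, as an element of an abelian group. -/
def stableUnit (T : Triple R 𝔄 Λ) : AddUnits (stableCon R 𝔄 Λ K).Quotient where
  val := stableClass K T
  neg := stableClass K ⟨T.N, T.M, T.ξ.symm⟩
  val_neg := by
    rw [← stableClass_comp T.M T.N T.M T.ξ T.ξ.symm, LatIso.symm_comp_cancel]
    exact stableClass_triv _
  neg_val := by
    rw [← stableClass_comp T.N T.M T.N T.ξ.symm T.ξ, LatIso.comp_symm_cancel]
    exact stableClass_triv _

variable (R 𝔄 Λ K) in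
/-- The homomorphism from the relative `K`-group to the group of stable classes. -/
def K0.toStable : K0 R 𝔄 Λ →+ AddUnits (stableCon R 𝔄 Λ K).Quotient :=
  QuotientAddGroup.lift _ (FreeAbelianGroup.lift (stableUnit K)) <| by
    rw [AddSubgroup.closure_le]
    rintro _ (⟨T', T, T'', i, p, j, q, hi, hip, hp, hj, hjq, hq, h', h''⟩ | ⟨M, N, P, ξ, η⟩)
    · simp only [SetLike.mem_coe, AddMonoidHom.mem_ker, map_sub, map_add,
        FreeAbelianGroup.lift_apply_of, sub_eq_zero]
      refine AddUnits.ext (Eq.trans ?_ (stableClass_add T' T''))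
      exact (stableClass_eq_of_rel (TripleRel.of_exact T' T T'' i p j q hi hip hp hj hjq hq
        h' h'')).symm
    · simp only [SetLike.mem_coe, AddMonoidHom.mem_ker, map_sub, map_add,
        FreeAbelianGroup.lift_apply_of, sub_eq_zero]
      exact AddUnits.ext (stableClass_comp M N P ξ η)

theorem K0.toStable_mk (T : Triple R 𝔄 Λ) :
    (K0.toStable R 𝔄 Λ K (K0.mk T) : (stableCon R 𝔄 Λ K).Quotient) = stableClass K T := by
  have : K0.toStable R 𝔄 Λ K (K0.mk T) = stableUnit K T := FreeAbelianGroup.lift_apply_of _ _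
  rw [this]
  rfl

theorem K0.mk_comp (M N P : ProjMod R 𝔄) (ξ : LatIso Λ M N) (η : LatIso Λ N P) :
    K0.mk ⟨M, P, η.comp ξ⟩ = K0.mk ⟨M, N, ξ⟩ + K0.mk ⟨N, P, η⟩ := by
  rw [← sub_eq_zero]
  exact (QuotientAddGroup.eq_zero_iff _).2 (AddSubgroup.subset_closure (Relator.comp M N P ξ η))

theorem boundary_mul (x y : (Λ ⊗[R] 𝔄)ˣ) : boundary (x * y) = boundary x + boundary y := by
  rw [boundary, boundary, boundary, ← K0.mk_comp]
  congr 2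
  exact LatIso.ext' fun z => (mul_assoc (G := Λ ⊗[R] 𝔄) z x y).symm

/-- An automorphism whose class in the relative `K`-group vanishes has integral determinants. -/
theorem mem_intDet_of_mk_eq_zero (hA : HasStableRangeOne 𝔄) {M : ProjMod R 𝔄} (θ : LatIso Λ M M)
    (h : K0.mk ⟨M, M, θ⟩ = 0) : θ ∈ intDet K M := by
  have h1 := K0.toStable_mk (K := K) (⟨M, M, θ⟩ : Triple R 𝔄 Λ)
  rw [h, map_zero] at h1
  -- A vanishing class means that `θ ⊕ 1` on `M ⊕ P` is equivalent to the identity of some `Q`.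
  obtain ⟨P, Q, h2⟩ := (AddCon.eq (stableCon R 𝔄 Λ K)).1 h1.symm
  rw [zero_add, ← TripleMonoid.mk_add, TripleMonoid.mk_eq] at h2
  obtain ⟨α, β, θ', hθ', h3⟩ := h2
  let α' : M.prod P ≃ₗ[𝔄] Q := α
  let β' : M.prod P ≃ₗ[𝔄] Q := β
  let ψ : LatIso Λ (M.prod P) (M.prod P) := θ'
  have h4 : LatIso.ofEquiv α' = (LatIso.ofEquiv β').comp ((θ.prod (1 : LatIso Λ P P)).comp ψ) := h3
  -- Solving for `θ ⊕ 1` gives an automorphism of the `𝔄`-module `M ⊕ P`, whose determinants are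
  -- integral by `hasIntegralDet`, times the inverse of an element of `intDet`.
  have h5 : θ.prod (1 : LatIso Λ P P) = LatIso.ofEquiv (α'.trans β'.symm) * ψ⁻¹ := by
    refine LatIso.ext' fun x => ?_
    have h6 : ψ.toEquiv (ψ⁻¹.toEquiv x) = x := LatIso.apply_symm_apply ψ x
    rw [LatIso.mul_apply, LatIso.ofEquiv_trans, h4, LatIso.comp_apply, LatIso.comp_apply,
      LatIso.comp_apply, LatIso.ofEquiv_symm, LatIso.symm_apply_apply, h6]
  apply mem_intDet_of_prod_one (N := P)
  rw [h5]
  exact mul_mem (hasIntegralDet hA _ _) (inv_mem hθ')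

theorem exists_unit_of_boundary_eq (hA : HasStableRangeOne 𝔄) (x y : (Λ ⊗[R] 𝔄)ˣ)
    (h : boundary x = boundary y) : ∃ u : 𝔄ˣ, ∀ (n : ℕ) (ρ : 𝔄 →ₐ[R] Module.End K (Fin n → K)),
      LinearMap.det (extendRep (Λ := Λ) ρ (x * y⁻¹ : (Λ ⊗[R] 𝔄)ˣ)) = LinearMap.det (ρ u) := by
  have h1 : boundary (R := R) (x * y⁻¹) = 0 := by
    have h2 : boundary (R := R) (𝔄 := 𝔄) (Λ := Λ) 1 = 0 := by
      have := boundary_mul (R := R) (𝔄 := 𝔄) (Λ := Λ) 1 1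
      rwa [one_mul, left_eq_add] at this
    rw [boundary_mul, h, ← boundary_mul, mul_inv_cancel, h2]
  obtain ⟨u, hu⟩ := mem_intDet_of_mk_eq_zero (K := K) hA _ h1
  exact ⟨u, fun n ρ => by rw [← hu, repDet_rightMul]⟩

end Invariant
end GaloisStructure
end

noncomputable section
namespace GaloisStructure

/-! ### From equal boundaries to determinants over `L` -/

section BoundaryDet
variable {L Lc : Type u} [Field L] [Field Lc] [Algebra L Lc] {G : Type v} [Group G]

theorem Det_eq_of_detRep [IsAlgClosed Lc] [CharZero Lc] {a b : (MonoidAlgebra Lc G)ˣ}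
    (h : ∀ (n : ℕ) (ρ : G →* Matrix (Fin n) (Fin n) Lc), detRep ρ a = detRep ρ b) :
    Det a = Det b := by
  refine MonoidHom.ext fun χ => ?_
  obtain ⟨_, ⟨n, ρ, rfl⟩, _, ⟨m, τ, rfl⟩, hχ⟩ := exists_sub χ.toAdd.2
  change detAt χ.toAdd a = detAt χ.toAdd b
  rw [detAt_eq _ a ρ τ (congrFun hχ), detAt_eq _ b ρ τ (congrFun hχ), h, h]

variable [ValuativeRel L]

/-- The endomorphism representation of the integral group ring attached to a matrix
representation. -/
def integralRep {n : ℕ} (τ : G →* Matrix (Fin n) (Fin n) Lc) :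
    MonoidAlgebra 𝒪[L] G →ₐ[𝒪[L]] Module.End Lc (Fin n → Lc) :=
  MonoidAlgebra.lift 𝒪[L] (Module.End Lc (Fin n → Lc)) G
    ((Matrix.toLinAlgEquiv' : Matrix (Fin n) (Fin n) Lc ≃ₐ[Lc] _).toAlgHom.toRingHom.toMonoidHom.comp
      τ)

theorem integralRep_single {n : ℕ} (τ : G →* Matrix (Fin n) (Fin n) Lc) (g : G) (r : 𝒪[L])
    (v : Fin n → Lc) : integralRep (L := L) τ (MonoidAlgebra.single g r) v =
      r • Matrix.toLin' (τ g) v := by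
  rw [integralRep, MonoidAlgebra.lift_single]
  rfl

theorem extendRep_integralRep [Finite G] {n : ℕ} (τ : G →* Matrix (Fin n) (Fin n) Lc)
    (z : MonoidAlgebra L G) : extendRep (integralRep (L := L) τ) (tensorOf 𝒪[L] L z) =
      Matrix.toLin' (MonoidAlgebra.lift Lc (Matrix (Fin n) (Fin n) Lc) G τ
        (MonoidAlgebra.mapRingHom G (algebraMap L Lc) z)) := by
  induction z using MonoidAlgebra.induction_linear with
  | zero => simp
  | add a b ha hb => simp only [map_add, ha, hb]
  | single g r =>
    have h1 : tensorOf 𝒪[L] L (MonoidAlgebra.single g r) =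
        r ⊗ₜ[𝒪[L]] (MonoidAlgebra.single g 1 : MonoidAlgebra 𝒪[L] G) := by
      rw [tensorOf, MonoidAlgebra.lift_single]
      change r • ((1 : L) ⊗ₜ[𝒪[L]] (MonoidAlgebra.single g 1 : MonoidAlgebra 𝒪[L] G)) = _
      rw [TensorProduct.smul_tmul', smul_eq_mul, mul_one]
    rw [h1, MonoidAlgebra.mapRingHom_single, MonoidAlgebra.lift_single]
    refine LinearMap.ext fun v => ?_
    rw [extendRep_tmul, integralRep_single, one_smul, map_smul, LinearMap.smul_apply,
      algebraMap_smul]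

theorem integralRep_eq {n : ℕ} (τ : G →* Matrix (Fin n) (Fin n) Lc)
    (z : MonoidAlgebra 𝒪[L] G) : integralRep (L := L) τ z =
      Matrix.toLin' (MonoidAlgebra.lift Lc (Matrix (Fin n) (Fin n) Lc) G τ
        (MonoidAlgebra.mapRingHom G (algebraMap L Lc)
          (MonoidAlgebra.mapRingHom G (algebraMap 𝒪[L] L) z))) := by
  induction z using MonoidAlgebra.induction_linear with
  | zero => simp
  | add a b ha hb => simp only [map_add, ha, hb]
  | single g r =>
    rw [MonoidAlgebra.mapRingHom_single, MonoidAlgebra.mapRingHom_single,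
      MonoidAlgebra.lift_single]
    refine LinearMap.ext fun v => ?_
    rw [integralRep_single, map_smul, LinearMap.smul_apply, algebraMap_smul]
    rfl

/-- Units of `L[G]` with the same boundary have the same determinants up to `Det(O_L[G]ˣ)`. -/
theorem DetL_mk_eq_of_boundaryL_eq [TopologicalSpace L] [IsNonarchimedeanLocalField L]
    [IsAlgClosed Lc] [CharZero Lc] [Finite G]
    {x y : (MonoidAlgebra L G)ˣ} (h : boundaryL x = boundaryL y) :
    (QuotientGroup.mk (DetL L Lc G x) : EquivariantHom L Lc G ⧸ detIntegralUnits L Lc G) =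
      QuotientGroup.mk (DetL L Lc G y) := by
  -- Equality of cosets is tested on the inverse of the first element times the second, so the roles
  -- of `x` and `y` are exchanged.
  obtain ⟨u, hu⟩ := exists_unit_of_boundary_eq (K := Lc) (hasStableRangeOne_monoidAlgebra 𝒪[L] G)
    _ _ h.symm
  refine QuotientGroup.eq.2 ⟨u, ?_⟩
  rw [← map_inv, mul_comm, ← map_mul]
  refine Subtype.ext (Det_eq_of_detRep fun n τ => Units.ext ?_)
  have h1 := hu n (integralRep τ)
  rw [← map_inv, ← map_mul] at h1
  have h2 := extendRep_integralRep τ (y * x⁻¹ : (MonoidAlgebra L G)ˣ).1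
  have h3 := integralRep_eq τ u.1
  rw [h3, LinearMap.det_toLin'] at h1
  exact h1.symm.trans ((congrArg LinearMap.det h2).trans (LinearMap.det_toLin' _))

end BoundaryDet
end GaloisStructure
end

noncomputable section
namespace GaloisStructure

/-! ### The valuation on an algebraic closure -/

section Extension
open scoped NNReal
variable (L : Type u) {Lc : Type u} [Field L] [Field Lc] [Algebra L Lc] [ValuativeRel L]

/-- A real valuation on the algebraic closure whose valuation ring is the integral closure of
`O_L`, and which is invariant under the Galois group. -/
structure IsExtendedValuation (v : Valuation Lc ℝ≥0) : Prop where
  le_one_iff : ∀ x, v x ≤ 1 ↔ IsIntegral 𝒪[L] x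
  map_equiv : ∀ (ω : Lc ≃ₐ[L] Lc) x, v (ω x) = v x

/-- As `O_L` is integrally closed, the minimal polynomial over `O_L` of an integral element is also
its minimal polynomial over `L`. -/
theorem isIntegral_iff_coeff_minpoly [TopologicalSpace L] [IsNonarchimedeanLocalField L]
    [Algebra.IsAlgebraic L Lc] (x : Lc) :
    IsIntegral 𝒪[L] x ↔ ∀ n, (minpoly L x).coeff n ∈ 𝒪[L] := by
  constructor
  · intro h n
    rw [minpoly.isIntegrallyClosed_eq_field_fractions' L h, Polynomial.coeff_map]
    exact ((minpoly 𝒪[L] x).coeff n).2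
  · intro h
    have hx := Algebra.IsIntegral.isIntegral (R := L) x
    have h1 : minpoly L x ∈ Polynomial.lifts (algebraMap 𝒪[L] L) :=
      (Polynomial.lifts_iff_coeff_lifts _).2 fun n => ⟨⟨_, h n⟩, rfl⟩
    obtain ⟨q, hq, -, hmon⟩ := Polynomial.lifts_and_natDegree_eq_and_monic h1 (minpoly.monic hx)
    refine ⟨q, hmon, ?_⟩
    have h2 := minpoly.aeval L x
    rw [← hq, Polynomial.aeval_map_algebraMap] at h2
    exact h2

/-- The spectral norm over the complete field `L` is multiplicative and Galois invariant, and it is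
at most one exactly when the minimal polynomial has integral coefficients. -/
theorem exists_isExtendedValuation [TopologicalSpace L] [IsNonarchimedeanLocalField L]
    [Algebra.IsAlgebraic L Lc] : ∃ v : Valuation Lc ℝ≥0, IsExtendedValuation L v := by
  let := IsTopologicalAddGroup.rightUniformSpace L
  have := isUniformAddGroup_of_addCommGroup (G := L)
  -- A real absolute value comes from embedding the rank one value group of `L` into the nonnegative
  -- reals.
  let : (Valued.v (R := L)).RankOne :=
  { hom' := ValuativeRel.IsRankLeOne.nonempty.some.emb (R := L).comp
      MonoidWithZeroHom.ValueGroup₀.embedding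
    strictMono' := ValuativeRel.IsRankLeOne.nonempty.some.strictMono.comp
        MonoidWithZeroHom.ValueGroup₀.embedding_strictMono }
  let : NontriviallyNormedField L := Valued.toNontriviallyNormedField L (ValuativeRel.ValueGroupWithZero L)
  have hc : CompleteSpace L := inferInstance
  have hu : IsUltrametricDist L := inferInstance
  let v : Valuation Lc ℝ≥0 :=
    { toFun := fun x => ⟨spectralNorm L Lc x, spectralNorm_nonneg x⟩
      map_zero' := NNReal.eq spectralNorm_zero
      map_one' := NNReal.eq spectralNorm_one
      map_mul' := fun x y => NNReal.eq (map_mul (spectralMulAlgNorm L Lc) x y)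
      map_add_le_max' := fun x y => isNonarchimedean_spectralNorm x y }
  refine ⟨v, fun x => ?_, fun ω x => NNReal.eq (spectralNorm_eq_of_equiv ω x).symm⟩
  rw [isIntegral_iff_coeff_minpoly]
  have h1 : v x ≤ 1 ↔ spectralValue (minpoly L x) ≤ 1 := Iff.rfl
  rw [h1, spectralValue_le_one_iff (minpoly.monic (Algebra.IsIntegral.isIntegral x))]
  exact forall_congr' fun n => Valued.toNormedField.norm_le_one_iff

end Extension
end GaloisStructure
end

noncomputable section
namespace GaloisStructure
set_option linter.unusedSectionVars false

/-! ### Integers, residue field and roots of unity -/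

section Residue
open scoped NNReal Pointwise
variable {L Lc : Type u} [Field L] [Field Lc] [Algebra L Lc]

theorem isGalois_of_isAlgClosed [CharZero L] [IsAlgClosed Lc] [Algebra.IsAlgebraic L Lc] :
    IsGalois L Lc :=
  have : IsAlgClosure L Lc := ⟨inferInstance, inferInstance⟩
  have : Normal L Lc := IsAlgClosure.normal L Lc
  {}

variable [ValuativeRel L]

namespace IsExtendedValuation
variable {v : Valuation Lc ℝ≥0} (hv : IsExtendedValuation L v)
include hv

theorem coe_le_one (x : 𝒪[L]) : v (algebraMap 𝒪[L] Lc x) ≤ 1 :=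
  (hv.le_one_iff _).2 isIntegral_algebraMap

theorem algebraMap_le_one_iff [TopologicalSpace L] [IsNonarchimedeanLocalField L] (l : L) :
    v (algebraMap L Lc l) ≤ 1 ↔ l ∈ 𝒪[L] := by
  rw [hv.le_one_iff, isIntegral_algebraMap_iff (algebraMap L Lc).injective]
  constructor
  · intro h
    obtain ⟨y, hy⟩ := IsIntegrallyClosed.isIntegral_iff.1 h
    rw [← hy]
    exact y.2
  · intro h
    exact isIntegral_algebraMap (x := (⟨l, h⟩ : 𝒪[L]))

theorem map_unit {x : 𝒪[L]} (hx : IsUnit x) : v (algebraMap 𝒪[L] Lc x) = 1 := by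
  obtain ⟨u, rfl⟩ := hx
  refine le_antisymm (hv.coe_le_one _) ?_
  have h1 : v (algebraMap 𝒪[L] Lc u) * v (algebraMap 𝒪[L] Lc (u⁻¹ : 𝒪[L]ˣ)) = 1 := by
    rw [← map_mul, ← map_mul, Units.mul_inv, map_one, map_one]
  calc (1 : ℝ≥0) = v (algebraMap 𝒪[L] Lc u) * v (algebraMap 𝒪[L] Lc (u⁻¹ : 𝒪[L]ˣ)) := h1.symm
    _ ≤ v (algebraMap 𝒪[L] Lc u) * 1 := by gcongr; exact hv.coe_le_one _
    _ = _ := mul_one _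

theorem lt_one_iff [TopologicalSpace L] [IsNonarchimedeanLocalField L] (x : 𝒪[L]) :
    v (algebraMap 𝒪[L] Lc x) < 1 ↔ x ∈ IsLocalRing.maximalIdeal 𝒪[L] := by
  rw [IsLocalRing.mem_maximalIdeal, mem_nonunits_iff]
  refine ⟨fun h hx => h.ne (hv.map_unit hx), fun h => lt_of_le_of_ne (hv.coe_le_one x) fun h1 => h ?_⟩
  have h2 : (x : L)⁻¹ ∈ 𝒪[L] := by
    rw [← hv.algebraMap_le_one_iff, map_inv₀, map_inv₀]
    exact (inv_eq_one.2 h1).le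
  have h3 : (x : L) ≠ 0 := fun h0 => by
    have : algebraMap 𝒪[L] Lc x = algebraMap L Lc x := rfl
    rw [this, h0, map_zero, map_zero] at h1
    exact zero_ne_one h1
  exact IsUnit.of_mul_eq_one ⟨_, h2⟩ (Subtype.ext (mul_inv_cancel₀ h3))

theorem natCast_le_one (n : ℕ) : v (n : Lc) ≤ 1 := by
  rw [← map_natCast (algebraMap 𝒪[L] Lc)]
  exact hv.coe_le_one _

theorem map_card_lt_one [TopologicalSpace L] [IsNonarchimedeanLocalField L] :
    v ((Nat.card 𝓀[L] : ℕ) : Lc) < 1 := by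
  rw [← map_natCast (algebraMap 𝒪[L] Lc), hv.lt_one_iff, ← IsLocalRing.residue_eq_zero_iff,
    map_natCast]
  have := Fintype.ofFinite 𝓀[L]
  rw [Nat.card_eq_fintype_card]
  exact FiniteField.cast_card_eq_zero 𝓀[L]

/-- Were the valuation of `n` less than one, a Bézout relation between `n` and `q` would express `1`
as a sum of two elements of valuation less than one. -/
theorem map_natCast_eq_one [TopologicalSpace L] [IsNonarchimedeanLocalField L] {n : ℕ}
    (hn : n.Coprime (Nat.card 𝓀[L])) : v (n : Lc) = 1 := by
  refine le_antisymm (hv.natCast_le_one n) (not_lt.1 fun h => ?_)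
  have h1 := (Nat.isCoprime_iff_coprime.2 hn)
  obtain ⟨a, b, hab⟩ := h1
  have h2 : (a : Lc) * n + b * (Nat.card 𝓀[L] : ℕ) = 1 := by
    have := congrArg (Int.cast : ℤ → Lc) hab
    push_cast at this
    exact this
  have hint : ∀ z : ℤ, v (z : Lc) ≤ 1 := fun z => by
    rw [← map_intCast (algebraMap 𝒪[L] Lc)]
    exact hv.coe_le_one _
  have h3 : v ((a : Lc) * n + b * (Nat.card 𝓀[L] : ℕ)) < 1 := by
    refine v.map_add_lt ?_ ?_
    · rw [map_mul]
      exact mul_lt_one_of_nonneg_of_lt_one_right (hint a) zero_le h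
    · rw [map_mul]
      exact mul_lt_one_of_nonneg_of_lt_one_right (hint b) zero_le hv.map_card_lt_one
  rw [h2, map_one] at h3
  exact lt_irrefl _ h3

theorem exists_zpow_eq [TopologicalSpace L] [IsNonarchimedeanLocalField L] {ϖ : 𝒪[L]}
    (hϖ : Irreducible ϖ) {l : L} (hl : l ≠ 0) :
    ∃ k : ℤ, v (algebraMap L Lc l) = v (algebraMap 𝒪[L] Lc ϖ) ^ k := by
  obtain ⟨a, b, hb, rfl⟩ := IsFractionRing.div_surjective (A := 𝒪[L]) l
  have hb0 : b ≠ 0 := nonZeroDivisors.ne_zero hb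
  have ha0 : a ≠ 0 := by
    rintro rfl
    simp at hl
  have key : ∀ {x : 𝒪[L]}, x ≠ 0 → ∃ n : ℕ, v (algebraMap 𝒪[L] Lc x) =
      v (algebraMap 𝒪[L] Lc ϖ) ^ n := fun {x} hx => by
    obtain ⟨n, u, hu⟩ := IsDiscreteValuationRing.eq_unit_mul_pow_irreducible hx hϖ
    exact ⟨n, by rw [hu, map_mul, map_mul, hv.map_unit u.isUnit, one_mul, map_pow, map_pow]⟩
  obtain ⟨n, hn⟩ := key ha0
  obtain ⟨m, hm⟩ := key hb0
  have hϖ0 : v (algebraMap 𝒪[L] Lc ϖ) ≠ 0 := by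
    rw [Valuation.ne_zero_iff]
    exact fun h => hϖ.ne_zero ((FaithfulSMul.algebraMap_injective 𝒪[L] Lc) (by rw [h, map_zero]))
  refine ⟨n - m, ?_⟩
  rw [map_div₀, map_div₀, ← IsScalarTower.algebraMap_apply, ← IsScalarTower.algebraMap_apply, hn,
    hm, zpow_sub₀ hϖ0, zpow_natCast, zpow_natCast]

/-- The sum `1 + η + ⋯ + η ^ (N - 1)` is congruent to the unit `N`, hence nonzero, while its product
with `η - 1` vanishes. Roots of unity of order prime to `q` are therefore determined by their
residues. -/
theorem sub_one_eq_zero_of_pow_eq_one [TopologicalSpace L] [IsNonarchimedeanLocalField L] {N : ℕ}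
    (hN : N.Coprime (Nat.card 𝓀[L])) {η : Lc} (h : η ^ N = 1) (h1 : v (η - 1) < 1) : η = 1 := by
  have hη : v η ≤ 1 := by
    have := v.map_add (η - 1) 1
    rw [sub_add_cancel, map_one] at this
    exact this.trans (max_le h1.le le_rfl)
  have h2 : v (∑ i ∈ Finset.range N, η ^ i - N) < 1 := by
    have : ∑ i ∈ Finset.range N, η ^ i - N = ∑ i ∈ Finset.range N, (η ^ i - 1) := by simp
    rw [this]
    refine v.map_sum_lt one_ne_zero fun i _ => ?_
    rw [← geom_sum_mul, map_mul]
    refine mul_lt_one_of_nonneg_of_lt_one_right ?_ zero_le h1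
    refine v.map_sum_le fun j _ => ?_
    rw [map_pow]
    exact pow_le_one₀ zero_le hη
  have h3 : ∑ i ∈ Finset.range N, η ^ i ≠ 0 := fun h0 => by
    rw [h0, zero_sub, Valuation.map_neg, hv.map_natCast_eq_one hN] at h2
    exact lt_irrefl _ h2
  have h4 := geom_sum_mul η N
  rw [h, sub_self] at h4
  exact sub_eq_zero.1 ((mul_eq_zero.1 h4).resolve_left h3)

end IsExtendedValuation

/-- The maximal ideal of the ring of integers of the algebraic closure. -/
def extIdeal {v : Valuation Lc ℝ≥0} (hv : IsExtendedValuation L v) :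
    Ideal (integralClosure 𝒪[L] Lc) where
  carrier := {x | v x < 1}
  zero_mem' := by simp
  add_mem' ha hb := v.map_add_lt ha hb
  smul_mem' c x hx := by
    change v ((c : Lc) * x) < 1
    rw [map_mul]
    exact mul_lt_one_of_nonneg_of_lt_one_right ((hv.le_one_iff _).2 c.2) zero_le hx

variable {v : Valuation Lc ℝ≥0} (hv : IsExtendedValuation L v)

theorem mem_extIdeal (x : integralClosure 𝒪[L] Lc) : x ∈ extIdeal hv ↔ v x < 1 := Iff.rfl

instance : (extIdeal hv).IsMaximal := by
  rw [Ideal.isMaximal_iff]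
  refine ⟨by simp [mem_extIdeal], fun J x hJ hx hxJ => ?_⟩
  have h1 : v x = 1 := le_antisymm ((hv.le_one_iff _).2 x.2) (not_lt.1 hx)
  have h2 : IsIntegral 𝒪[L] (x : Lc)⁻¹ := by
    rw [← hv.le_one_iff, map_inv₀, h1, inv_one]
  have h3 : (x : Lc) ≠ 0 := (Valuation.ne_zero_iff v).1 (by rw [h1]; exact one_ne_zero)
  have h4 : (⟨_, h2⟩ : integralClosure 𝒪[L] Lc) * x = 1 := Subtype.ext (inv_mul_cancel₀ h3)
  rw [← h4]
  exact J.mul_mem_left _ hxJ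

instance [TopologicalSpace L] [IsNonarchimedeanLocalField L] :
    (extIdeal hv).LiesOver (IsLocalRing.maximalIdeal 𝒪[L]) := ⟨by
  ext x
  rw [← hv.lt_one_iff, Ideal.under_def, Ideal.mem_comap, mem_extIdeal]
  rfl⟩

/-- The residue field of the algebraic closure. -/
def extResidue : Type u := integralClosure 𝒪[L] Lc ⧸ extIdeal hv

instance : Field (extResidue hv) := Ideal.Quotient.field (extIdeal hv)

/-- The residue map on the ring of integers of the algebraic closure. -/
def resHom : integralClosure 𝒪[L] Lc →+* extResidue hv := Ideal.Quotient.mk (extIdeal hv)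

theorem resHom_surjective : Function.Surjective (resHom hv) := Ideal.Quotient.mk_surjective

theorem resHom_eq_zero_iff (x : integralClosure 𝒪[L] Lc) : resHom hv x = 0 ↔ v x < 1 :=
  Ideal.Quotient.eq_zero_iff_mem

theorem resHom_eq_iff (x y : integralClosure 𝒪[L] Lc) :
    resHom hv x = resHom hv y ↔ v (x - y : Lc) < 1 := by
  rw [← sub_eq_zero, ← map_sub, resHom_eq_zero_iff]
  rfl

/-- An element of the closed unit ball, as an element of the ring of integers. -/
def IsExtendedValuation.lift (x : Lc) (hx : v x ≤ 1) : integralClosure 𝒪[L] Lc :=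
  ⟨x, (hv.le_one_iff x).1 hx⟩

include hv in
theorem IsExtendedValuation.map_coe_le_one (x : integralClosure 𝒪[L] Lc) : v (x : Lc) ≤ 1 :=
  (hv.le_one_iff _).2 x.2

variable [TopologicalSpace L] [IsNonarchimedeanLocalField L]

instance : Algebra 𝓀[L] (extResidue hv) :=
  inferInstanceAs (Algebra (𝒪[L] ⧸ IsLocalRing.maximalIdeal 𝒪[L])
    (integralClosure 𝒪[L] Lc ⧸ extIdeal hv))

instance : Algebra.IsAlgebraic 𝓀[L] (extResidue hv) :=
  have : Algebra.IsIntegral 𝓀[L] (extResidue hv) := ⟨fun z => by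
    obtain ⟨x, rfl⟩ := resHom_surjective hv z
    obtain ⟨p, hp, hp'⟩ := integralClosure.isIntegral x
    refine ⟨p.map (IsLocalRing.residue 𝒪[L]), hp.map _, ?_⟩
    have h : (algebraMap 𝓀[L] (extResidue hv)).comp (IsLocalRing.residue 𝒪[L]) =
      (resHom hv).comp (algebraMap 𝒪[L] (integralClosure 𝒪[L] Lc)) := rfl
    rw [Polynomial.eval₂_map, h, ← Polynomial.hom_eval₂, hp', map_zero]⟩
  inferInstance

open scoped IntermediateField in
theorem exists_mem_finite (z : extResidue hv) :
    ∃ F : IntermediateField 𝓀[L] (extResidue hv), FiniteDimensional 𝓀[L] F ∧ z ∈ F :=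
  ⟨𝓀[L]⟮z⟯, IntermediateField.adjoin.finiteDimensional (Algebra.IsIntegral.isIntegral z),
    IntermediateField.mem_adjoin_simple_self _ _⟩

theorem exists_residue_pow_eq (z : extResidue hv) :
    ∃ d : ℕ, 0 < d ∧ z ^ Nat.card 𝓀[L] ^ d = z := by
  obtain ⟨F, hF, hz⟩ := exists_mem_finite hv z
  have : Finite F := Module.finite_of_finite 𝓀[L]
  have := Fintype.ofFinite F
  refine ⟨Module.finrank 𝓀[L] F, Module.finrank_pos, ?_⟩
  rw [← Module.natCard_eq_pow_finrank (K := 𝓀[L]) (V := F), Nat.card_eq_fintype_card]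
  exact congrArg Subtype.val (FiniteField.pow_card (⟨z, hz⟩ : F))

omit [TopologicalSpace L] [IsNonarchimedeanLocalField L] in
theorem smul_extIdeal (ω : Lc ≃ₐ[L] Lc) :
    ω ∈ MulAction.stabilizer (Lc ≃ₐ[L] Lc) (extIdeal hv) := by
  rw [MulAction.mem_stabilizer_iff]
  ext x
  rw [Ideal.mem_pointwise_smul_iff_inv_smul_mem]
  exact iff_of_eq (congrArg (· < 1) (hv.map_equiv ω⁻¹ x))

/-- The action of the Galois group on the residue field. -/
def resAut : (Lc ≃ₐ[L] Lc) →* (extResidue hv ≃ₐ[𝓀[L]] extResidue hv) :=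
  (Ideal.Quotient.stabilizerHom (extIdeal hv) (IsLocalRing.maximalIdeal 𝒪[L])
    (Lc ≃ₐ[L] Lc)).comp ((MonoidHom.id _).codRestrict _ (smul_extIdeal hv))

theorem resAut_resHom (ω : Lc ≃ₐ[L] Lc) (x : integralClosure 𝒪[L] Lc) :
    resAut hv ω (resHom hv x) = resHom hv (ω • x) := rfl

instance [IsGalois L Lc] :
    Algebra.IsInvariant 𝒪[L] (integralClosure 𝒪[L] Lc) (Lc ≃ₐ[L] Lc) where
  isInvariant b hb := by
    obtain ⟨l, hl⟩ := (InfiniteGalois.mem_bot_iff_fixed (k := L) (K := Lc) (b : Lc)).2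
      fun ω => congrArg Subtype.val (hb ω)
    have h1 : IsIntegral 𝒪[L] l :=
      (isIntegral_algebraMap_iff (algebraMap L Lc).injective).1 (by
        change IsIntegral 𝒪[L] (algebraMap L Lc l); exact hl ▸ b.2)
    obtain ⟨y, rfl⟩ := IsIntegrallyClosed.isIntegral_iff.1 h1
    exact ⟨y, Subtype.ext hl⟩

theorem resAut_surjective [IsGalois L Lc] : Function.Surjective (resAut (L := L) hv) := by
  -- For the discrete topology on the integers the action is continuous, because every element lies
  -- in a finite extension of `L`. This makes the profinite form of the surjectivity onto residual
  -- automorphisms applicable.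
  let : TopologicalSpace (integralClosure 𝒪[L] Lc) := ⊥
  have : DiscreteTopology (integralClosure 𝒪[L] Lc) := ⟨rfl⟩
  have : ContinuousSMul (Lc ≃ₐ[L] Lc) (integralClosure 𝒪[L] Lc) := by
    rw [continuousSMul_iff_stabilizer_isOpen]
    intro x
    have := IntermediateField.adjoin.finiteDimensional (K := L)
      (Algebra.IsIntegral.isIntegral (x : Lc))
    refine Subgroup.isOpen_mono (H₁ := (IntermediateField.adjoin L {(x : Lc)}).fixingSubgroup)
      (fun ω hω => Subtype.ext ?_) (IntermediateField.fixingSubgroup_isOpen _)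
    exact (IntermediateField.mem_fixingSubgroup_iff _ _).1 hω _
      (IntermediateField.mem_adjoin_simple_self _ _)
  intro g
  obtain ⟨⟨ω, _⟩, hω⟩ := Ideal.Quotient.stabilizerHom_surjective_of_profinite
    (G := (Lc ≃ₐ[L] Lc)) (IsLocalRing.maximalIdeal 𝒪[L]) (extIdeal hv) g
  exact ⟨ω, hω⟩

/-- The element lies in a finite field, whose Galois group is generated by Frobenius. The exponent
may depend on the element. -/
theorem resAut_eq_pow (ω : Lc ≃ₐ[L] Lc) (z : extResidue hv) :
    ∃ i, resAut hv ω z = z ^ Nat.card 𝓀[L] ^ i := by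
  obtain ⟨F, hF, hz⟩ := exists_mem_finite hv z
  have : Finite F := Module.finite_of_finite 𝓀[L]
  have := Fintype.ofFinite 𝓀[L]
  obtain ⟨i, hi⟩ := (FiniteField.bijective_frobeniusAlgEquivOfAlgebraic_pow 𝓀[L] F).2
    ((resAut hv ω).restrictNormal F)
  refine ⟨i, ?_⟩
  have h1 := AlgEquiv.restrictNormal_commutes (resAut hv ω) F ⟨z, hz⟩
  rw [← hi] at h1
  change _ = resAut hv ω z at h1
  rw [← h1, AlgEquiv.coe_pow, FiniteField.coe_frobeniusAlgEquivOfAlgebraic_iterate,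
    Nat.card_eq_fintype_card]
  rfl

namespace IsExtendedValuation
include hv

theorem map_eq_one_of_pow_eq_one {N : ℕ} (hN : 0 < N) {η : Lc} (h : η ^ N = 1) : v η = 1 := by
  have := congrArg v h
  rw [map_pow, map_one] at this
  exact (pow_eq_one_iff_of_nonneg zero_le hN.ne').1 this

theorem eq_of_pow_eq_one {N : ℕ} (hN0 : 0 < N) (hN : N.Coprime (Nat.card 𝓀[L])) {a b : Lc}
    (ha : a ^ N = 1) (hb : b ^ N = 1) (h : v (a - b) < 1) : a = b := by
  have hvb := hv.map_eq_one_of_pow_eq_one hN0 hb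
  have hb0 : b ≠ 0 := (Valuation.ne_zero_iff v).1 (by rw [hvb]; exact one_ne_zero)
  rw [← div_eq_one_iff_eq hb0]
  refine hv.sub_one_eq_zero_of_pow_eq_one hN (by rw [div_pow, ha, hb, div_one]) ?_
  rwa [div_sub_one hb0, map_div₀, hvb, div_one]

theorem exists_map_root_eq_pow (ω : Lc ≃ₐ[L] Lc) {N : ℕ} (hN0 : 0 < N)
    (hN : N.Coprime (Nat.card 𝓀[L])) {η : Lc} (h : η ^ N = 1) :
    ∃ i, ω η = η ^ Nat.card 𝓀[L] ^ i := by
  obtain ⟨i, hi⟩ := resAut_eq_pow hv ω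
    (resHom hv (hv.lift η (hv.map_eq_one_of_pow_eq_one hN0 h).le))
  refine ⟨i, hv.eq_of_pow_eq_one hN0 hN (by rw [← map_pow, h, map_one]) ?_ ?_⟩
  · rw [← pow_mul, mul_comm, pow_mul, h, one_pow]
  · rw [resAut_resHom, ← map_pow, resHom_eq_iff] at hi
    exact hi

/-- Any lift of the residual Frobenius works: the congruence between `F η` and `η ^ q` is an
equality, since roots of unity of order prime to `q` are determined by their residues. -/
theorem exists_frobenius [CharZero L] [IsAlgClosed Lc] [Algebra.IsAlgebraic L Lc] :
    ∃ F : Lc ≃ₐ[L] Lc, ∀ N : ℕ, 0 < N → N.Coprime (Nat.card 𝓀[L]) → ∀ η : Lc, η ^ N = 1 →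
      F η = η ^ Nat.card 𝓀[L] := by
  have : IsGalois L Lc := isGalois_of_isAlgClosed
  have := Fintype.ofFinite 𝓀[L]
  obtain ⟨F, hF⟩ := resAut_surjective hv
    (FiniteField.frobeniusAlgEquivOfAlgebraic 𝓀[L] (extResidue hv))
  refine ⟨F, fun N hN0 hN η h => hv.eq_of_pow_eq_one hN0 hN (by rw [← map_pow, h, map_one])
    (by rw [← pow_mul, mul_comm, pow_mul, h, one_pow]) ?_⟩
  have h1 := resAut_resHom hv F (hv.lift η (hv.map_eq_one_of_pow_eq_one hN0 h).le)
  rw [hF, FiniteField.coe_frobeniusAlgEquivOfAlgebraic, ← Nat.card_eq_fintype_card] at h1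
  have h2 := h1.symm
  dsimp only at h2
  rw [← map_pow, resHom_eq_iff] at h2
  exact h2

end IsExtendedValuation

end Residue
end GaloisStructure
end

noncomputable section
namespace GaloisStructure
set_option linter.unusedSectionVars false

/-! ### The maximal unramified extension -/

section Unramified
open scoped NNReal
variable {L Lc : Type u} [Field L] [Field Lc] [Algebra L Lc] [ValuativeRel L]

variable (L Lc) in
/-- The automorphisms that fix all roots of unity of order prime to the residue characteristic. -/
def rootInertia : Subgroup (Lc ≃ₐ[L] Lc) where
  carrier := {ω | ∀ N : ℕ, 0 < N → N.Coprime (Nat.card 𝓀[L]) → ∀ η : Lc, η ^ N = 1 → ω η = η}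
  one_mem' _ _ _ _ _ := rfl
  mul_mem' ha hb N h0 hN η hη := by
    rw [AlgEquiv.mul_apply, hb N h0 hN η hη, ha N h0 hN η hη]
  inv_mem' {a} ha N h0 hN η hη := by
    rw [AlgEquiv.aut_inv, AlgEquiv.symm_apply_eq, ha N h0 hN η hη]

instance : (rootInertia L Lc).Normal where
  conj_mem ω hω g N h0 hN η hη := by
    have h1 : (g⁻¹ η) ^ N = 1 := by rw [← map_pow, hη, map_one]
    rw [AlgEquiv.mul_apply, AlgEquiv.mul_apply, hω N h0 hN _ h1, ← AlgEquiv.mul_apply,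
      mul_inv_cancel]
    rfl

/-- `F` raises roots of unity of order prime to the residue characteristic to the `q`-th power. -/
def IsFrobenius (F : Lc ≃ₐ[L] Lc) : Prop :=
  ∀ N : ℕ, 0 < N → N.Coprime (Nat.card 𝓀[L]) → ∀ η : Lc, η ^ N = 1 → F η = η ^ Nat.card 𝓀[L]

theorem IsFrobenius.pow_apply {F : Lc ≃ₐ[L] Lc} (hF : IsFrobenius F) {N : ℕ} (h0 : 0 < N)
    (hN : N.Coprime (Nat.card 𝓀[L])) {η : Lc} (hη : η ^ N = 1) (i : ℕ) :
    (F ^ i) η = η ^ Nat.card 𝓀[L] ^ i := by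
  induction i with
  | zero => simp
  | succ i ih =>
    rw [pow_succ, AlgEquiv.mul_apply, hF N h0 hN η hη, map_pow, ih, ← pow_mul, pow_succ]

theorem IsFrobenius.mul_rootInertia {F ω : Lc ≃ₐ[L] Lc} (hF : IsFrobenius F)
    (hω : ω ∈ rootInertia L Lc) : IsFrobenius (ω * F) := fun N h0 hN η hη => by
  rw [AlgEquiv.mul_apply, hF N h0 hN η hη, map_pow, hω N h0 hN η hη]

theorem mem_of_forall_fixed [IsGalois L Lc] {x : Lc} (h : ∀ ω : Lc ≃ₐ[L] Lc, ω x = x) :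
    ∃ l, algebraMap L Lc l = x :=
  (InfiniteGalois.mem_bot_iff_fixed (k := L) (K := Lc) x).2 h

theorem mem_adjoin_roots [IsGalois L Lc] {x : Lc} (h : ∀ ω ∈ rootInertia L Lc, ω x = x) :
    x ∈ IntermediateField.adjoin L
      {η : Lc | ∃ N : ℕ, 0 < N ∧ N.Coprime (Nat.card 𝓀[L]) ∧ η ^ N = 1} := by
  rw [← InfiniteGalois.fixedField_fixingSubgroup (IntermediateField.adjoin L
      {η : Lc | ∃ N : ℕ, 0 < N ∧ N.Coprime (Nat.card 𝓀[L]) ∧ η ^ N = 1}),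
    IntermediateField.mem_fixedField_iff]
  intro ω hω
  rw [IntermediateField.mem_fixingSubgroup_iff] at hω
  exact h ω fun N h0 hN η hη => hω η (IntermediateField.subset_adjoin _ _ ⟨N, h0, hN, hη⟩)

omit [ValuativeRel L] in
theorem apply_eq_of_mem_adjoin {S : Set Lc} {g : Lc ≃ₐ[L] Lc} (hg : ∀ s ∈ S, g s = s) {x : Lc}
    (hx : x ∈ IntermediateField.adjoin L S) : g x = x := by
  induction hx using IntermediateField.adjoin_induction with
  | mem x hx => exact hg x hx
  | algebraMap x => exact g.commutes x
  | add x y _ _ hx hy => rw [map_add, hx, hy]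
  | inv x _ hx => rw [map_inv₀, hx]
  | mul x y _ _ hx hy => rw [map_mul, hx, hy]

section
variable [TopologicalSpace L] [IsNonarchimedeanLocalField L] [CharZero L] [CharZero Lc]
  [IsAlgClosed Lc] [Algebra.IsAlgebraic L Lc]
variable {v : Valuation Lc ℝ≥0} (hv : IsExtendedValuation L v)
include hv

/-- The element lies in `L(η)` for a single root of unity `η` of order prime to `q`. Every `ω`
agrees on `η` with a power of `F`, and that power fixes `x`. -/
theorem IsExtendedValuation.mem_of_fixed {F : Lc ≃ₐ[L] Lc} (hF : IsFrobenius F) {x : Lc}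
    (h : ∀ ω ∈ rootInertia L Lc, ω x = x) (hFx : F x = x) : ∃ l, algebraMap L Lc l = x := by
  have : IsGalois L Lc := isGalois_of_isAlgClosed
  refine mem_of_forall_fixed fun ω => ?_
  obtain ⟨T, hT, hx⟩ := IntermediateField.exists_finset_of_mem_adjoin (mem_adjoin_roots h)
  have hT' : ∀ t ∈ T, ∃ N : ℕ, 0 < N ∧ N.Coprime (Nat.card 𝓀[L]) ∧ t ^ N = 1 := fun t ht => hT ht
  choose! n hn0 hn hn1 using hT'
  have h0 : 0 < ∏ t ∈ T, n t := Finset.prod_pos fun t ht => hn0 t ht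
  have hc : (∏ t ∈ T, n t).Coprime (Nat.card 𝓀[L]) :=
    Nat.Coprime.prod_left fun t ht => hn t ht
  set N := ∏ t ∈ T, n t
  have : NeZero N := ⟨h0.ne'⟩
  have : NeZero (N : Lc) := ⟨Nat.cast_ne_zero.2 h0.ne'⟩
  obtain ⟨η, hη⟩ := HasEnoughRootsOfUnity.exists_primitiveRoot Lc N
  obtain ⟨i, hi⟩ := hv.exists_map_root_eq_pow ω h0 hc hη.pow_eq_one
  have h1 : (F ^ i)⁻¹ (ω η) = η := by
    rw [hi, ← hF.pow_apply h0 hc hη.pow_eq_one, AlgEquiv.aut_inv, AlgEquiv.symm_apply_apply]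
  have h2 : ((F ^ i)⁻¹ * ω) x = x := by
    refine apply_eq_of_mem_adjoin (fun t ht => ?_) hx
    have ht1 : t ^ N = 1 := by
      obtain ⟨k, hk⟩ : n t ∣ N := Finset.dvd_prod_of_mem n ht
      rw [hk, pow_mul, hn1 t ht, one_pow]
    obtain ⟨j, _, rfl⟩ := hη.eq_pow_of_pow_eq_one ht1
    rw [AlgEquiv.mul_apply, map_pow, map_pow, h1]
  have h3 : (F ^ i) x = x := by
    clear * - hFx
    induction i with
    | zero => rfl
    | succ i ih => rw [pow_succ, AlgEquiv.mul_apply, hFx, ih]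
  rw [AlgEquiv.mul_apply, AlgEquiv.aut_inv, AlgEquiv.symm_apply_eq, h3] at h2
  exact h2

end

section
variable [TopologicalSpace L] [IsNonarchimedeanLocalField L] [CharZero L] [CharZero Lc]
  [IsAlgClosed Lc] [Algebra.IsAlgebraic L Lc]
variable {v : Valuation Lc ℝ≥0} (hv : IsExtendedValuation L v)

theorem card_pow_sub_one_pos {f : ℕ} (hf : 0 < f) : 0 < Nat.card 𝓀[L] ^ f - 1 :=
  Nat.sub_pos_of_lt (Nat.one_lt_pow hf.ne' Finite.one_lt_card)

theorem coprime_card_pow_sub_one (L : Type u) [Field L] [ValuativeRel L] [TopologicalSpace L]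
    [IsNonarchimedeanLocalField L] {f : ℕ} (hf : 0 < f) :
    (Nat.card 𝓀[L] ^ f - 1).Coprime (Nat.card 𝓀[L]) := by
  have h1 : 1 ≤ Nat.card 𝓀[L] ^ f := Nat.one_le_pow _ _ Nat.card_pos
  refine Nat.Coprime.coprime_dvd_right (dvd_pow_self _ hf.ne') ?_
  exact (Nat.coprime_self_sub_left h1).2 (Nat.coprime_one_left _)

/-- The exponents `q ^ j` with `j < f` have to stay below the order `q ^ f - 1`. This fails for `q =
2` and `f = 1`, whence the lower bound on `f`. -/
theorem resHom_pow_injective {f : ℕ} (hf : 2 ≤ f) {z : Lc}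
    (hz : IsPrimitiveRoot z (Nat.card 𝓀[L] ^ f - 1)) (hz1 : v z ≤ 1) :
    Function.Injective fun j : Fin f => resHom hv (hv.lift z hz1) ^ Nat.card 𝓀[L] ^ (j : ℕ) := by
  have hq : 1 < Nat.card 𝓀[L] := Finite.one_lt_card
  have h0 := card_pow_sub_one_pos (L := L) (f := f) (by omega)
  have hlt : ∀ j : Fin f, Nat.card 𝓀[L] ^ (j : ℕ) < Nat.card 𝓀[L] ^ f - 1 := fun j => by
    have h1 : Nat.card 𝓀[L] ^ (j : ℕ) ≤ Nat.card 𝓀[L] ^ (f - 1) :=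
      Nat.pow_le_pow_right (by omega) (by omega)
    have h2 : Nat.card 𝓀[L] ^ f = Nat.card 𝓀[L] * Nat.card 𝓀[L] ^ (f - 1) := by
      rw [← pow_succ', Nat.sub_add_cancel (by omega)]
    have h3 : 1 < Nat.card 𝓀[L] ^ (f - 1) := Nat.one_lt_pow (by omega) hq
    have h4 : 2 * Nat.card 𝓀[L] ^ (f - 1) ≤ Nat.card 𝓀[L] * Nat.card 𝓀[L] ^ (f - 1) :=
      Nat.mul_le_mul_right _ hq
    omega
  intro i j hij
  dsimp only at hij
  rw [← map_pow, ← map_pow, resHom_eq_iff] at hij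
  have h1 := hv.eq_of_pow_eq_one h0 (coprime_card_pow_sub_one L (by omega))
    (a := z ^ Nat.card 𝓀[L] ^ (i : ℕ)) (b := z ^ Nat.card 𝓀[L] ^ (j : ℕ))
    (by rw [← pow_mul, mul_comm, pow_mul, hz.pow_eq_one, one_pow])
    (by rw [← pow_mul, mul_comm, pow_mul, hz.pow_eq_one, one_pow]) hij
  exact Fin.ext (Nat.pow_right_injective hq (hz.pow_inj (hlt i) (hlt j) h1))

theorem pow_apply_fixed {F : Lc ≃ₐ[L] Lc} {x : Lc} (h : ∀ ω ∈ rootInertia L Lc, ω x = x) (j : ℕ) :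
    ∀ ω ∈ rootInertia L Lc, ω ((F ^ j) x) = (F ^ j) x := fun ω hω => by
  have h1 := h ((F ^ j)⁻¹ * ω * F ^ j) (by
    simpa using Subgroup.Normal.conj_mem inferInstance ω hω (F ^ j)⁻¹)
  rw [AlgEquiv.mul_apply, AlgEquiv.mul_apply, AlgEquiv.aut_inv, AlgEquiv.symm_apply_eq] at h1
  exact h1

theorem apply_sum_pow {F : Lc ≃ₐ[L] Lc} {f : ℕ} {x : Lc} (hx : (F ^ f) x = x) :
    F (∑ j ∈ Finset.range f, (F ^ j) x) = ∑ j ∈ Finset.range f, (F ^ j) x := by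
  rw [map_sum]
  have h1 : ∀ j, F ((F ^ j) x) = (F ^ (j + 1)) x := fun j => by
    rw [pow_succ', AlgEquiv.mul_apply]
  simp only [h1]
  have h2 := Finset.sum_range_succ' (fun j => (F ^ j) x) f
  rw [Finset.sum_range_succ, hx] at h2
  exact (add_right_cancel (h2.trans (by rw [pow_zero, AlgEquiv.one_apply]))).symm

-- Unramified extensions have the same value group as `L`. The sums of the Frobenius conjugates of
-- the `x z ^ i` lie in `L`. Were all of them smaller than `x`, a Vandermonde argument in the
-- residue field would make the residues of the units `F ^ j x / x` vanish.
include hv in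
theorem IsExtendedValuation.exists_zpow_of_fixed {ϖ : 𝒪[L]} (hϖ : Irreducible ϖ)
    {F : Lc ≃ₐ[L] Lc} (hF : IsFrobenius F) {x : Lc} (hx0 : x ≠ 0)
    (h : ∀ ω ∈ rootInertia L Lc, ω x = x) {f : ℕ} (hf : 0 < f) (hFx : (F ^ f) x = x) :
    ∃ k : ℤ, v x = v (algebraMap 𝒪[L] Lc ϖ) ^ k := by
  -- Doubling `f` preserves the hypothesis and secures the bound required by `resHom_pow_injective`.
  wlog hf2 : 2 ≤ f generalizing f
  · refine this (f := f * 2) (by omega) ?_ (by omega)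
    rw [pow_mul, pow_two, AlgEquiv.mul_apply, hFx, hFx]
  have h0 := card_pow_sub_one_pos (L := L) hf
  have hc := coprime_card_pow_sub_one L hf
  set N := Nat.card 𝓀[L] ^ f - 1 with hN
  have : NeZero N := ⟨h0.ne'⟩
  have : NeZero (N : Lc) := ⟨Nat.cast_ne_zero.2 h0.ne'⟩
  obtain ⟨z, hz⟩ := HasEnoughRootsOfUnity.exists_primitiveRoot Lc N
  have hvz := hv.map_eq_one_of_pow_eq_one h0 hz.pow_eq_one
  have hFf : (F ^ f) z = z := by
    rw [hF.pow_apply h0 hc hz.pow_eq_one, ← Nat.sub_add_cancel (Nat.one_le_pow f _ Nat.card_pos),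
      pow_succ, ← hN, hz.pow_eq_one, one_mul]
  have hvx : v x ≠ 0 := (Valuation.ne_zero_iff v).2 hx0
  have hy : ∀ j, v ((F ^ j) x / x) = 1 := fun j => by
    rw [map_div₀, hv.map_equiv, div_self hvx]
  -- the traces of the elements `x z ^ i` lie in `L`
  have key : ∀ i : ℕ, (∑ j ∈ Finset.range f, (F ^ j) (x * z ^ i)) ≠ 0 →
      ∃ k : ℤ, v (∑ j ∈ Finset.range f, (F ^ j) (x * z ^ i)) =
        v (algebraMap 𝒪[L] Lc ϖ) ^ k := fun i hi => by
    obtain ⟨l, hl⟩ := hv.mem_of_fixed hF (x := ∑ j ∈ Finset.range f, (F ^ j) (x * z ^ i))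
      (fun ω hω => by
        rw [map_sum]
        refine Finset.sum_congr rfl fun j _ => pow_apply_fixed (fun τ hτ => ?_) j ω hω
        rw [map_mul, map_pow, h τ hτ, hτ N h0 hc z hz.pow_eq_one])
      (apply_sum_pow (by rw [map_mul, map_pow, hFx, hFf]))
    rw [← hl] at hi ⊢
    exact hv.exists_zpow_eq hϖ (fun h0 => hi (by rw [h0, map_zero]))
  have hex : ∃ i : ℕ, ¬ v ((∑ j ∈ Finset.range f, (F ^ j) (x * z ^ i)) / x) < 1 := by
    by_contra! hcon
    have h1 := Matrix.eq_zero_of_forall_pow_sum_mul_pow_eq_zero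
      (resHom_pow_injective hv hf2 hz hvz.le)
      (v := fun j : Fin f => resHom hv (hv.lift ((F ^ (j : ℕ)) x / x) (hy j).le)) (fun i => by
        have h2 := (resHom_eq_zero_iff hv (hv.lift _ (hcon i).le)).2 (hcon i)
        rw [← h2]
        simp only [← map_pow, ← map_mul, ← map_sum]
        congr 1
        apply Subtype.ext
        simp only [AddSubmonoidClass.coe_finsetSum, MulMemClass.coe_mul, SubmonoidClass.coe_pow]
        change ∑ j : Fin f, (F ^ (j : ℕ)) x / x * (z ^ Nat.card 𝓀[L] ^ (j : ℕ)) ^ (i : ℕ) =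
          (∑ j ∈ Finset.range f, (F ^ j) (x * z ^ (i : ℕ))) / x
        rw [Finset.sum_range, Finset.sum_div]
        refine Finset.sum_congr rfl fun j _ => ?_
        rw [map_mul, map_pow, hF.pow_apply h0 hc hz.pow_eq_one, div_mul_eq_mul_div])
    have h3 := congrFun h1 ⟨0, hf⟩
    rw [Pi.zero_apply, resHom_eq_zero_iff] at h3
    exact h3.ne (hy 0)
  obtain ⟨i, hi⟩ := hex
  have h1 : v (∑ j ∈ Finset.range f, (F ^ j) (x * z ^ i)) ≤ v x := by
    refine v.map_sum_le fun j _ => ?_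
    rw [hv.map_equiv, map_mul, map_pow, hvz, one_pow, mul_one]
  have h2 : v (∑ j ∈ Finset.range f, (F ^ j) (x * z ^ i)) = v x := by
    refine le_antisymm h1 ?_
    rw [not_lt, map_div₀, one_le_div₀ (by positivity)] at hi
    exact hi
  rw [← h2]
  refine key i fun h3 => hvx ?_
  rw [← h2, h3, map_zero]

end
end Unramified
end GaloisStructure
end

noncomputable section
namespace GaloisStructure
set_option linter.unusedSectionVars false

/-! ### Normal elements of finite fields -/

section Normal
open scoped NNReal

/-- The Frobenius conjugates of a normal basis generator span `F`, and the embeddings of `F` are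
linearly independent over `κ`; so the square matrix of the conjugates indexed by `i + k` is
invertible. -/
theorem exists_normal_of_finite {K κ : Type*} [Field K] [Finite K] [Field κ] [Algebra K κ]
    (F : IntermediateField K κ) [FiniteDimensional K F] :
    ∃ z ∈ F, ∀ w : Fin (Module.finrank K F) → κ,
      (∀ k : Fin (Module.finrank K F), ∑ i, w i * z ^ Nat.card K ^ (i + k : ℕ) = 0) → w = 0 := by
  have : Finite F := Module.finite_of_finite K
  have := Fintype.ofFinite K
  obtain ⟨z, hz⟩ : ∃ z : F, LinearIndependent K fun σ : F ≃ₐ[K] F => σ z :=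
    ⟨IsGalois.normalBasis K F 1, by
      simpa only [← IsGalois.normalBasis_apply] using
        (IsGalois.normalBasis K F).linearIndependent⟩
  refine ⟨z, z.2, ?_⟩
  set n := Module.finrank K F with hn
  intro w hw
  set φ := FiniteField.frobeniusAlgEquivOfAlgebraic K F with hφ
  have hφa : ∀ (k : ℕ) (x : F), ((φ ^ k) x : κ) = (x : κ) ^ Nat.card K ^ k := fun k x => by
    rw [AlgEquiv.coe_pow, hφ, FiniteField.coe_frobeniusAlgEquivOfAlgebraic_iterate,
      Nat.card_eq_fintype_card]
    rfl
  have hbij := FiniteField.bijective_frobeniusAlgEquivOfAlgebraic_pow K F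
  have hli : LinearIndependent K fun i : Fin n => (φ ^ (i : ℕ)) z := hz.comp _ hbij.1
  have hspan : Submodule.span K (Set.range fun i : Fin n => (φ ^ (i : ℕ)) z) = ⊤ :=
    hli.span_eq_top_of_card_eq_finrank' (by simp [hn])
  let Φ : Fin n → (F →ₐ[K] κ) := fun k => F.val.comp (φ ^ (k : ℕ) : F ≃ₐ[K] F).toAlgHom
  have hΦ : Function.Injective Φ := fun i j hij => hbij.1 (by
    ext x
    exact congrArg (fun g : F →ₐ[K] κ => g x) hij)
  have hind := (linearIndependent_toLinearMap K F κ).comp Φ hΦ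
  let M : Matrix (Fin n) (Fin n) κ := Matrix.of fun k i => z.1 ^ Nat.card K ^ (i + k : ℕ)
  have hdet : M.det ≠ 0 := by
    intro h0
    obtain ⟨a, ha0, ha⟩ := Matrix.exists_vecMul_eq_zero_iff.2 h0
    apply ha0
    have h1 : ∑ k, a k • (Φ k).toLinearMap = 0 := by
      have h2 : ((∑ k, a k • (Φ k).toLinearMap : F →ₗ[K] κ)) = 0 := by
        refine LinearMap.ext_on_range hspan fun i => ?_
        have h3 := congrFun ha i
        rw [LinearMap.zero_apply, LinearMap.sum_apply]
        refine Eq.trans ?_ h3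
        refine Finset.sum_congr rfl fun k _ => ?_
        change a k * ((φ ^ (k : ℕ)) ((φ ^ (i : ℕ)) z) : κ) = a k * z.1 ^ Nat.card K ^ (i + k : ℕ)
        rw [hφa, hφa, ← pow_mul, ← pow_add]
      exact h2
    exact funext (Fintype.linearIndependent_iff.1 hind a h1)
  refine Matrix.eq_zero_of_mulVec_eq_zero hdet (funext fun k => ?_)
  rw [Pi.zero_apply, ← hw k]
  change ∑ i : Fin n, z.1 ^ Nat.card K ^ (i + k : ℕ) * w i = _
  exact Finset.sum_congr rfl fun i _ => mul_comm _ _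

variable {L Lc : Type u} [Field L] [Field Lc] [Algebra L Lc] [ValuativeRel L]
  [TopologicalSpace L] [IsNonarchimedeanLocalField L] [CharZero L] [CharZero Lc]
  [IsAlgClosed Lc] [Algebra.IsAlgebraic L Lc]
variable {v : Valuation Lc ℝ≥0} (hv : IsExtendedValuation L v)

-- The value `x ^ N - 1` is the product of the differences `x - μ` over all `N`-th roots of unity
-- `μ`. If it is small, then one of the factors is. This takes the place of Hensel's lemma.
include hv in
theorem IsExtendedValuation.exists_root_of_unity_of_pow {x : Lc} (hx : v x = 1) {d : ℕ}
    (hd : 0 < d) (h : v (x ^ Nat.card 𝓀[L] ^ d - x) < 1) :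
    ∃ η : Lc, η ^ (Nat.card 𝓀[L] ^ d - 1) = 1 ∧ v (x - η) < 1 := by
  have hN := card_pow_sub_one_pos (L := L) hd
  have h1' : 1 ≤ Nat.card 𝓀[L] ^ d := Nat.one_le_pow _ _ Nat.card_pos
  set N := Nat.card 𝓀[L] ^ d - 1 with hNdef
  have : NeZero N := ⟨hN.ne'⟩
  have : NeZero (N : Lc) := ⟨Nat.cast_ne_zero.2 hN.ne'⟩
  obtain ⟨η, hη⟩ := HasEnoughRootsOfUnity.exists_primitiveRoot Lc N
  have h1 : v (x ^ N - 1) < 1 := by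
    have h2 : x ^ Nat.card 𝓀[L] ^ d - x = x * (x ^ N - 1) := by
      rw [mul_sub, ← pow_succ', mul_one, Nat.sub_add_cancel h1']
    rwa [h2, map_mul, hx, one_mul] at h
  have h2 := hη.pow_sub_pow_eq_prod_sub_mul x 1 hN
  simp only [one_pow, mul_one] at h2
  rw [h2, map_prod] at h1
  by_contra! hcon
  refine h1.not_ge ?_
  refine Finset.one_le_prod' fun μ hμ => hcon μ ?_
  exact (Polynomial.mem_nthRootsFinset hN _).1 hμ

include hv in
theorem IsExtendedValuation.exists_root_of_unity {x : Lc} (hx : v x = 1) :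
    ∃ d : ℕ, 0 < d ∧ ∃ η : Lc, η ^ (Nat.card 𝓀[L] ^ d - 1) = 1 ∧ v (x - η) < 1 := by
  obtain ⟨d, hd, h⟩ := exists_residue_pow_eq hv (resHom hv (hv.lift x hx.le))
  rw [← map_pow, resHom_eq_iff] at h
  exact ⟨d, hd, hv.exists_root_of_unity_of_pow hx hd h⟩

-- The residue of a primitive root of unity of order `q ^ f - 1` generates the extension of degree
-- `f`: the degree divides `f` because the `f`-th power of Frobenius fixes the residue, and it is
-- not smaller because the first `f` conjugates are distinct. A normal element of this field is then
-- taken.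
open scoped IntermediateField in
theorem exists_normal_residue {f : ℕ} (hf : 2 ≤ f) :
    ∃ z : extResidue hv, z ^ Nat.card 𝓀[L] ^ f = z ∧ ∀ w : Fin f → extResidue hv,
      (∀ k : Fin f, ∑ i, w i * z ^ Nat.card 𝓀[L] ^ (i + k : ℕ) = 0) → w = 0 := by
  have h0 := card_pow_sub_one_pos (L := L) (f := f) (by omega)
  have : NeZero (Nat.card 𝓀[L] ^ f - 1) := ⟨h0.ne'⟩
  have : NeZero ((Nat.card 𝓀[L] ^ f - 1 : ℕ) : Lc) := ⟨Nat.cast_ne_zero.2 h0.ne'⟩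
  obtain ⟨ζ, hζ⟩ := HasEnoughRootsOfUnity.exists_primitiveRoot Lc (Nat.card 𝓀[L] ^ f - 1)
  have hvζ := hv.map_eq_one_of_pow_eq_one h0 hζ.pow_eq_one
  set y := resHom hv (hv.lift ζ hvζ.le) with hy
  have hinj := resHom_pow_injective hv hf hζ hvζ.le
  have h1' : 1 ≤ Nat.card 𝓀[L] ^ f := Nat.one_le_pow _ _ Nat.card_pos
  have hyf : y ^ Nat.card 𝓀[L] ^ f = y := by
    rw [hy, ← map_pow]
    congr 1
    apply Subtype.ext
    change ζ ^ Nat.card 𝓀[L] ^ f = ζ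
    rw [← Nat.sub_add_cancel h1', pow_succ, hζ.pow_eq_one, one_mul]
  let F : IntermediateField 𝓀[L] (extResidue hv) := 𝓀[L]⟮y⟯
  have hyF : y ∈ F := IntermediateField.mem_adjoin_simple_self _ _
  have : FiniteDimensional 𝓀[L] F :=
    IntermediateField.adjoin.finiteDimensional (Algebra.IsIntegral.isIntegral y)
  have : Finite F := Module.finite_of_finite 𝓀[L]
  have := Fintype.ofFinite 𝓀[L]
  set φ := FiniteField.frobeniusAlgEquivOfAlgebraic 𝓀[L] (extResidue hv) with hφ
  have hφa : ∀ (k : ℕ) (x : extResidue hv), (φ ^ k) x = x ^ Nat.card 𝓀[L] ^ k := fun k x => by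
    rw [AlgEquiv.coe_pow, hφ, FiniteField.coe_frobeniusAlgEquivOfAlgebraic_iterate,
      Nat.card_eq_fintype_card]
  have hfix : ∀ x ∈ F, x ^ Nat.card 𝓀[L] ^ f = x := fun x hx => by
    rw [← hφa]
    refine apply_eq_of_mem_adjoin (fun s hs => ?_) hx
    rw [Set.mem_singleton_iff.1 hs, hφa, hyf]
  have hord := FiniteField.orderOf_frobeniusAlgEquivOfAlgebraic 𝓀[L] F
  have hψa : ∀ (k : ℕ) (x : F), (((FiniteField.frobeniusAlgEquivOfAlgebraic 𝓀[L] F) ^ k) x :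
      extResidue hv) = (x : extResidue hv) ^ Nat.card 𝓀[L] ^ k := fun k x => by
    rw [AlgEquiv.coe_pow, FiniteField.coe_frobeniusAlgEquivOfAlgebraic_iterate,
      Nat.card_eq_fintype_card]
    rfl
  have hdvd : Module.finrank 𝓀[L] F ∣ f := by
    rw [← hord, orderOf_dvd_iff_pow_eq_one]
    ext x
    rw [hψa, hfix x x.2]
    rfl
  have hn : 0 < Module.finrank 𝓀[L] F := Module.finrank_pos
  have hfr : Module.finrank 𝓀[L] F = f := by
    refine (Nat.le_of_dvd (by omega) hdvd).antisymm (not_lt.1 fun hlt => ?_)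
    have h1 := hψa (Module.finrank 𝓀[L] F) ⟨y, hyF⟩
    rw [← hord, pow_orderOf_eq_one, hord] at h1
    have h2 := @hinj ⟨0, by omega⟩ ⟨Module.finrank 𝓀[L] F, hlt⟩ (by
      dsimp only
      rw [pow_zero, pow_one]
      exact h1)
    have := congrArg Fin.val h2
    simp only at this
    omega
  obtain ⟨z, hzF, hz⟩ := exists_normal_of_finite F
  rw [hfr] at hz
  exact ⟨z, hfix z hzF, hz⟩

end Normal
end GaloisStructure
end

noncomputable section
namespace GaloisStructure
set_option linter.unusedSectionVars false

/-! ### Tame inertia -/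

section Inertia
open scoped NNReal Pointwise
variable {L Lc : Type u} [Field L] [Field Lc] [Algebra L Lc] [ValuativeRel L]
  [TopologicalSpace L] [IsNonarchimedeanLocalField L]
variable {v : Valuation Lc ℝ≥0} (hv : IsExtendedValuation L v) (E : IntermediateField L Lc)

theorem coe_isIntegral (x : integralClosure 𝒪[L] E) : IsIntegral 𝒪[L] ((x : E) : Lc) :=
  (isIntegral_algebraMap_iff (A := E) (B := Lc) (algebraMap E Lc).injective).2 x.2

/-- The maximal ideal of the ring of integers of an intermediate field. -/
def ballIdeal : Ideal (integralClosure 𝒪[L] E) where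
  carrier := {x | v ((x : E) : Lc) < 1}
  zero_mem' := by simp
  add_mem' ha hb := v.map_add_lt ha hb
  smul_mem' c x hx := by
    change v (((c : E) : Lc) * ((x : E) : Lc)) < 1
    rw [map_mul]
    exact mul_lt_one_of_nonneg_of_lt_one_right ((hv.le_one_iff _).2 (coe_isIntegral E c)) zero_le hx

theorem mem_ballIdeal (x : integralClosure 𝒪[L] E) :
    x ∈ ballIdeal hv E ↔ v ((x : E) : Lc) < 1 := Iff.rfl

instance : (ballIdeal hv E).IsMaximal := by
  rw [Ideal.isMaximal_iff]
  refine ⟨by simp [mem_ballIdeal], fun J x hJ hx hxJ => ?_⟩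
  have h1 : v ((x : E) : Lc) = 1 :=
    le_antisymm ((hv.le_one_iff _).2 (coe_isIntegral E x)) (not_lt.1 hx)
  have h3 : (x : E) ≠ 0 := fun h => by
    rw [h] at h1
    simp at h1
  have h2 : IsIntegral 𝒪[L] (x : E)⁻¹ := by
    rw [← isIntegral_algebraMap_iff (A := E) (B := Lc) (algebraMap E Lc).injective,
      ← hv.le_one_iff, map_inv₀, map_inv₀]
    exact (inv_eq_one.2 h1).le
  have h4 : (⟨_, h2⟩ : integralClosure 𝒪[L] E) * x = 1 := Subtype.ext (inv_mul_cancel₀ h3)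
  rw [← h4]
  exact J.mul_mem_left _ hxJ

instance : (ballIdeal hv E).LiesOver (IsLocalRing.maximalIdeal 𝒪[L]) := ⟨by
  ext x
  rw [← hv.lt_one_iff, Ideal.under_def, Ideal.mem_comap, mem_ballIdeal]
  rfl⟩

/-- Translates tameness, a condition on the ramification index, into one on the order of the inertia
group. Finiteness, hence perfection, of the residue field excludes an inseparable contribution. -/
theorem card_inertia_ballIdeal [CharZero L] [FiniteDimensional L E] [IsGalois L E] :
    Nat.card ((ballIdeal hv E).inertia (E ≃ₐ[L] E)) = (ballIdeal hv E).ramificationIdx 𝒪[L] := by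
  have : IsFractionRing (integralClosure 𝒪[L] E) E :=
    IsIntegralClosure.isFractionRing_of_finite_extension 𝒪[L] L E _
  have : Module.Finite 𝒪[L] (integralClosure 𝒪[L] E) :=
    IsIntegralClosure.finite 𝒪[L] L E _
  have : IsGaloisGroup (E ≃ₐ[L] E) 𝒪[L] (integralClosure 𝒪[L] E) :=
    IsGaloisGroup.of_isFractionRing _ 𝒪[L] (integralClosure 𝒪[L] E) L E 
  have : PerfectField (IsLocalRing.maximalIdeal 𝒪[L]).ResidueField :=
    have : Finite (𝒪[L] ⧸ IsLocalRing.maximalIdeal 𝒪[L]) := inferInstanceAs (Finite 𝓀[L])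
    have : Finite (IsLocalRing.maximalIdeal 𝒪[L]).ResidueField := Finite.of_surjective _
      (Ideal.bijective_algebraMap_quotient_residueField (IsLocalRing.maximalIdeal 𝒪[L])).2
    inferInstance
  have : FaithfulSMul 𝒪[L] E := (faithfulSMul_iff_algebraMap_injective 𝒪[L] E).2 <| by
    rw [IsScalarTower.algebraMap_eq 𝒪[L] L E]
    exact (algebraMap L E).injective.comp Subtype.val_injective
  have : Module.IsTorsionFree 𝒪[L] E := FaithfulSMul.to_isTorsionFree 𝒪[L] E
  have : Module.Free 𝒪[L] (integralClosure 𝒪[L] E) :=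
    IsIntegralClosure.module_free 𝒪[L] L E _
  have : Module.Flat 𝒪[L] (integralClosure 𝒪[L] E) := Module.Flat.of_free
  rw [Ideal.card_inertia_eq_ramificationIdxIn (IsLocalRing.maximalIdeal 𝒪[L]) (ballIdeal hv E),
    Ideal.ramificationIdxIn_eq_ramificationIdx (IsLocalRing.maximalIdeal 𝒪[L]) (ballIdeal hv E)
      (E ≃ₐ[L] E)]

end Inertia
end GaloisStructure
end

noncomputable section
namespace GaloisStructure
set_option linter.unusedSectionVars false

/-! ### Tame inertia acts through roots of the uniformizer -/

section TameInertia
open scoped NNReal Pointwise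
variable {L Lc : Type u} [Field L] [Field Lc] [Algebra L Lc] [ValuativeRel L]
  [TopologicalSpace L] [IsNonarchimedeanLocalField L] [CharZero L] [CharZero Lc]
  [IsAlgClosed Lc] [Algebra.IsAlgebraic L Lc]
variable {v : Valuation Lc ℝ≥0} (hv : IsExtendedValuation L v)

section
include hv

/-- A unit is congruent to a root of unity of order prime to `q`, which `ω` fixes. -/
theorem IsExtendedValuation.map_sub_lt_one {ω : Lc ≃ₐ[L] Lc} (hω : ω ∈ rootInertia L Lc) {x : Lc}
    (hx : v x ≤ 1) : v (ω x - x) < 1 := by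
  rcases hx.lt_or_eq with h | h
  · exact v.map_sub_lt (by rwa [hv.map_equiv]) h
  · obtain ⟨d, hd, η, hη, hxη⟩ := hv.exists_root_of_unity h
    have h1 := hω _ (card_pow_sub_one_pos (L := L) hd) (coprime_card_pow_sub_one L hd) η hη
    have h2 : ω x - x = ω (x - η) - (x - η) := by rw [map_sub, h1]; ring
    rw [h2]
    exact v.map_sub_lt (by rwa [hv.map_equiv]) hxη

variable (E : IntermediateField L Lc) [FiniteDimensional L E] [IsGalois L E]

theorem IsExtendedValuation.restrict_mem_inertia {ω : Lc ≃ₐ[L] Lc} (hω : ω ∈ rootInertia L Lc) :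
    AlgEquiv.restrictNormalHom E ω ∈ (ballIdeal hv E).inertia (E ≃ₐ[L] E) := by
  intro x
  change v (((AlgEquiv.restrictNormalHom E ω (x : E) - x : E) : Lc)) < 1
  have h1 := AlgEquiv.restrictNormal_commutes ω E (x : E)
  have h2 := hv.map_sub_lt_one hω ((hv.le_one_iff _).2 (coe_isIntegral E x))
  have h3 : ((AlgEquiv.restrictNormalHom E ω (x : E) - x : E) : Lc) = ω ((x : E) : Lc) - (x : E) := by
    have h4 : ω ((x : E) : Lc) = ((ω.restrictNormal E (x : E) : E) : Lc) := h1.symm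
    rw [h4]
    rfl
  rw [h3]
  exact h2

/-- The product of the inertia conjugates of `x` has valuation `v x ^ m`. It is fixed by
`rootInertia` and by a power of `F`, so its valuation is also a power of that of `ϖ`, which is `v ρ
^ m`. It remains to take `m`-th roots. -/
theorem IsExtendedValuation.exists_map_eq_zpow {ϖ : 𝒪[L]} (hϖ : Irreducible ϖ) {ρ : Lc}
    (hρ : ρ ^ Nat.card ((ballIdeal hv E).inertia (E ≃ₐ[L] E)) = algebraMap 𝒪[L] Lc ϖ) {x : E}
    (hx : x ≠ 0) : ∃ k : ℤ, v (x : Lc) = v ρ ^ k := by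
  set I := (ballIdeal hv E).inertia (E ≃ₐ[L] E) with hI
  set m := Nat.card I with hm
  have hm0 : m ≠ 0 := Nat.card_pos.ne'
  have := Fintype.ofFinite I
  have : IsGalois L Lc := isGalois_of_isAlgClosed
  obtain ⟨F, hF⟩ := hv.exists_frobenius
  have hcoe : ∀ (ω : Lc ≃ₐ[L] Lc) (y : E),
      ((AlgEquiv.restrictNormalHom E ω y : E) : Lc) = ω (y : Lc) :=
    fun ω y => AlgEquiv.restrictNormal_commutes ω E y
  have hv' : ∀ (τ : E ≃ₐ[L] E) (y : E), v ((τ y : E) : Lc) = v (y : Lc) := fun τ y => by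
    obtain ⟨ω, rfl⟩ := AlgEquiv.restrictNormalHom_surjective (F := L) (K₁ := E) Lc τ
    rw [hcoe, hv.map_equiv]
  let y : E := ∏ τ : I, (τ : E ≃ₐ[L] E) x
  have hy0 : (y : Lc) ≠ 0 := by
    rw [Ne, ZeroMemClass.coe_eq_zero, Finset.prod_eq_zero_iff]
    rintro ⟨τ, _, h⟩
    exact hx ((map_eq_zero _).1 h)
  have hvy : v (y : Lc) = v (x : Lc) ^ m := by
    have : (y : Lc) = ∏ τ : I, (((τ : E ≃ₐ[L] E) x : E) : Lc) :=
      map_prod (algebraMap E Lc) _ _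
    have h1 : ∀ τ : I, v (((τ : E ≃ₐ[L] E) x : E) : Lc) = v (x : Lc) := fun τ => hv' τ x
    rw [this, map_prod, Finset.prod_congr rfl fun τ _ => h1 τ, Finset.prod_const, hm,
      Nat.card_eq_fintype_card, Finset.card_univ]
  obtain ⟨k, hk⟩ := hv.exists_zpow_of_fixed hϖ hF hy0 (fun ω hω => by
      rw [← hcoe]
      congr 1
      have hω' := hv.restrict_mem_inertia E hω
      rw [← hI] at hω'
      change AlgEquiv.restrictNormalHom E ω (∏ τ : I, (τ : E ≃ₐ[L] E) x) = _
      rw [map_prod]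
      exact Fintype.prod_equiv (Equiv.mulLeft (⟨_, hω'⟩ : I)) _ _ fun τ => rfl)
    (f := Nat.card (E ≃ₐ[L] E)) Nat.card_pos (by
      rw [← hcoe, map_pow, pow_card_eq_one']
      rfl)
  refine ⟨k, ?_⟩
  rw [hvy, ← hρ, map_pow, ← zpow_natCast (v ρ ) m, zpow_comm, zpow_natCast] at hk
  exact pow_left_injective hm0 hk

/-- The values of `E` are powers of `v ρ`, and `ω` fixes `ρ`; so for every nonzero `y` in `E` the
difference `ω y - y` is strictly smaller than `y`. If `d = ω x - x` were nonzero, its images under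
`m` successive powers of `ω` would telescope to `0`, since `ω ^ m` is trivial on `E`. But their sum
is also `m d` up to something smaller, and `m` is a unit. -/
theorem IsExtendedValuation.eq_of_fixes_root {ϖ : 𝒪[L]} (hϖ : Irreducible ϖ) {ρ : Lc}
    (hρ : ρ ^ Nat.card ((ballIdeal hv E).inertia (E ≃ₐ[L] E)) = algebraMap 𝒪[L] Lc ϖ)
    (hm : (Nat.card ((ballIdeal hv E).inertia (E ≃ₐ[L] E))).Coprime (Nat.card 𝓀[L]))
    {ω : Lc ≃ₐ[L] Lc} (hω : ω ∈ rootInertia L Lc) (hωρ : ω ρ = ρ) (x : E) :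
    ω (x : Lc) = x := by
  have hcoe : ∀ (ω : Lc ≃ₐ[L] Lc) (y : E),
      ((AlgEquiv.restrictNormalHom E ω y : E) : Lc) = ω (y : Lc) :=
    fun ω y => AlgEquiv.restrictNormal_commutes ω E y
  have hlt : ∀ τ ∈ rootInertia L Lc, τ ρ = ρ → ∀ y : E, y ≠ 0 →
      v (τ (y : Lc) - y) < v (y : Lc) := fun τ hτ hτρ y hy => by
    obtain ⟨k, hk⟩ := hv.exists_map_eq_zpow E hϖ hρ hy
    have hy' : v (y : Lc) ≠ 0 := (Valuation.ne_zero_iff v).2 (by simpa using hy)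
    have hρ0 : ρ ^ k ≠ 0 := by
      rw [← Valuation.ne_zero_iff v, map_zpow₀, ← hk]
      exact hy'
    have h1 : v ((y : Lc) / ρ ^ k) ≤ 1 := by
      rw [map_div₀, map_zpow₀, ← hk, div_self hy']
    have h2 := hv.map_sub_lt_one hτ h1
    rw [map_div₀, map_zpow₀, hτρ, ← sub_div, map_div₀, map_zpow₀, ← hk,
      div_lt_one₀ (zero_lt_iff.2 hy')] at h2
    exact h2
  by_contra hne
  have hcard : (ω ^ Nat.card ((ballIdeal hv E).inertia (E ≃ₐ[L] E))) (x : Lc) = x := by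
    rw [← hcoe, map_pow]
    have h1 : (⟨_, hv.restrict_mem_inertia E hω⟩ : (ballIdeal hv E).inertia (E ≃ₐ[L] E)) ^
      Nat.card ((ballIdeal hv E).inertia (E ≃ₐ[L] E)) = 1 := pow_card_eq_one'
    exact congrArg (fun g : E ≃ₐ[L] E => ((g x : E) : Lc)) (congrArg Subtype.val h1)
  set m := Nat.card ((ballIdeal hv E).inertia (E ≃ₐ[L] E))
  set d : E := AlgEquiv.restrictNormalHom E ω x - x with hd
  have hdc : (d : Lc) = ω (x : Lc) - x := by rw [← hcoe]; rfl
  have hd0 : d ≠ 0 := fun h => hne (by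
    rw [h] at hdc
    exact (sub_eq_zero.1 hdc.symm))
  have hsum : ∑ i ∈ Finset.range m, (ω ^ i) (d : Lc) = 0 := by
    have h1 : ∀ i, (ω ^ i) (d : Lc) = (ω ^ (i + 1)) (x : Lc) - (ω ^ i) (x : Lc) := fun i => by
      rw [hdc, map_sub, pow_succ, AlgEquiv.mul_apply]
    rw [Finset.sum_congr rfl fun i _ => h1 i, Finset.sum_range_sub (fun i => (ω ^ i) (x : Lc)), hcard, pow_zero,
      AlgEquiv.one_apply, sub_self]
  have hd' : v (d : Lc) ≠ 0 := (Valuation.ne_zero_iff v).2 (by simpa using hd0)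
  have h2 : v (∑ i ∈ Finset.range m, ((ω ^ i) (d : Lc) - d)) < v (d : Lc) := by
    refine v.map_sum_lt hd' fun i _ => hlt _ (pow_mem hω i) ?_ d hd0
    clear * - hωρ
    induction i with
    | zero => rfl
    | succ i ih => rw [pow_succ, AlgEquiv.mul_apply, hωρ, ih]
  rw [Finset.sum_sub_distrib, hsum, zero_sub, Valuation.map_neg, Finset.sum_const,
    Finset.card_range, nsmul_eq_mul, map_mul, hv.map_natCast_eq_one hm, one_mul] at h2
  exact lt_irrefl _ h2

end

/-- The arithmetic of a tame homomorphism `π`, relative to a root `r` of the uniformizer, a root of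
unity `z` of order `|s|` and a Frobenius automorphism `F` that fixes `r`. -/
structure IsTameDatum {G : Type*} [Group G] (π : (Lc ≃ₐ[L] Lc) →* G) (s : G) (F : Lc ≃ₐ[L] Lc)
    (z r : Lc) (ϖ : 𝒪[L]) : Prop where
  frobenius : IsFrobenius F
  map_root : F r = r
  root_pow : r ^ orderOf s = algebraMap 𝒪[L] Lc ϖ
  primitive : IsPrimitiveRoot z (orderOf s)
  coprime : (orderOf s).Coprime (Nat.card 𝓀[L])
  inertia : ∀ ω ∈ rootInertia L Lc, ∃ k : ℕ, π ω = s ^ k ∧ ω r = z ^ k * r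
  conj : π F * s * (π F)⁻¹ = s ^ Nat.card 𝓀[L]

theorem pow_rootInertia_apply {ω : Lc ≃ₐ[L] Lc} {z r : Lc} (hz : ω z = z) (hr : ω r = z * r)
    (k : ℕ) : (ω ^ k) r = z ^ k * r := by
  induction k with
  | zero => simp
  | succ k ih => rw [pow_succ, AlgEquiv.mul_apply, hr, map_mul, ih, pow_succ,
      show (ω ^ k) z = z from by
        clear ih
        induction k with
        | zero => rfl
        | succ k ih => rw [pow_succ, AlgEquiv.mul_apply, hz, ih]]; ring

/-- Let `m` be the order of the inertia group of the field cut out by `π`. By tameness an element of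
`rootInertia` is determined on that field by the root of unity through which it moves `root m`, so
its image under `π` is the matching power of `π σ`. The order of `π σ` divides `m`, and the
statements pass from `root m` to its power `root (orderOf (π σ))`. -/
theorem exists_isTameDatum {G : Type v} [Group G] [Finite G] [TopologicalSpace G]
    [DiscreteTopology G]
    (ϖ : 𝒪[L]) (hϖ : Irreducible ϖ)
    (ζ : ℕ → Lc) (hζ : IsCompatibleRootsOfUnity ζ)
    (root : ℕ → Lc) (hroot : IsCompatibleRoots (algebraMap 𝒪[L] Lc ϖ) root)
    (σ : Lc ≃ₐ[L] Lc) (hσ : IsTameGenerator ζ root σ)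
    (π : (Lc ≃ₐ[L] Lc) →* G) (hπ : Continuous π) (htame : IsTame π) :
    ∃ F, IsTameDatum π (π σ) F (ζ (orderOf (π σ))) (root (orderOf (π σ))) ϖ := by
  obtain ⟨v, hv⟩ := exists_isExtendedValuation (Lc := Lc) L
  have : IsGalois L Lc := isGalois_of_isAlgClosed
  -- The kernel is open and normal, so the field cut out by `π` is finite and Galois over `L`.
  have hopen : IsOpen (π.ker : Set (Lc ≃ₐ[L] Lc)) :=
    (isOpen_discrete ({1} : Set G)).preimage hπ
  let H : ClosedSubgroup (Lc ≃ₐ[L] Lc) := ⟨π.ker, Subgroup.isClosed_of_isOpen _ hopen⟩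
  have hfix : (splitField π).fixingSubgroup = π.ker := InfiniteGalois.fixingSubgroup_fixedField H
  have : FiniteDimensional L (splitField π) := by
    rw [← InfiniteGalois.isOpen_iff_finite, hfix]
    exact hopen
  have : IsGalois L (splitField π) := by
    rw [← InfiniteGalois.normal_iff_isGalois, hfix]
    infer_instance
  have hcop := htame (ballIdeal hv (splitField π)) inferInstance
  rw [← card_inertia_ballIdeal hv (splitField π)] at hcop
  have heq := fun ρ hρ ω => hv.eq_of_fixes_root (splitField π) hϖ (ρ := ρ) hρ hcop (ω := ω)
  have hm0 : 0 < Nat.card ((ballIdeal hv (splitField π)).inertia (splitField π ≃ₐ[L] splitField π)) :=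
    Nat.card_pos
  generalize Nat.card ((ballIdeal hv (splitField π)).inertia
    (splitField π ≃ₐ[L] splitField π)) = m at hcop heq hm0
  have hrm : root m ^ m = algebraMap 𝒪[L] Lc ϖ := by
    have := hroot.2 m 1 hm0 one_pos
    rwa [mul_one, hroot.1] at this
  have hϖ0 : algebraMap 𝒪[L] Lc ϖ ≠ 0 := fun h =>
    hϖ.ne_zero ((FaithfulSMul.algebraMap_injective 𝒪[L] Lc) (by rw [h, map_zero]))
  have hrm0 : root m ≠ 0 := fun h => hϖ0 (by rw [← hrm, h, zero_pow hm0.ne'])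
  have hker : ∀ ω ∈ rootInertia L Lc, ω (root m) = root m → π ω = 1 := fun ω hω h => by
    rw [← MonoidHom.mem_ker, ← hfix, IntermediateField.mem_fixingSubgroup_iff]
    exact fun x hx => heq _ hrm ω hω h ⟨x, hx⟩
  have hσI : σ ∈ rootInertia L Lc := fun N h0 hN η hη => by
    have : NeZero N := ⟨h0.ne'⟩
    obtain ⟨j, _, rfl⟩ := (hζ.1 N h0).eq_pow_of_pow_eq_one hη
    rw [map_pow, (hσ N hN).2]
  have hζm := hζ.1 m hm0
  have hσk := pow_rootInertia_apply (hσ m hcop).2 (hσ m hcop).1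
  have hσz : ∀ k, (σ ^ k) (ζ m) = ζ m := fun k =>
    pow_mem hσI k m hm0 hcop _ hζm.pow_eq_one
  have hsm : π σ ^ m = 1 := by
    rw [← map_pow]
    refine hker _ (pow_mem hσI m) ?_
    rw [hσk, hζm.pow_eq_one, one_mul]
  obtain ⟨m', hm'⟩ := orderOf_dvd_of_pow_eq_one hsm
  have he0 : 0 < orderOf (π σ) := orderOf_pos _
  have hm'0 : 0 < m' := Nat.pos_of_ne_zero fun h => by rw [h, mul_zero] at hm'; omega
  have hre : root m ^ m' = root (orderOf (π σ)) := by
    rw [hm', mul_comm, hroot.2 m' _ hm'0 he0]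
  have hze : ζ m ^ m' = ζ (orderOf (π σ)) := by
    rw [hm', mul_comm, hζ.2 m' _ hm'0 he0]
  -- every automorphism moves `root m` by a root of unity
  have hmove : ∀ ω : Lc ≃ₐ[L] Lc, ∃ k, ω (root m) = ζ m ^ k * root m := fun ω => by
    have : NeZero m := ⟨hm0.ne'⟩
    obtain ⟨k, _, hk⟩ := hζm.eq_pow_of_pow_eq_one (ξ := ω (root m) / root m) (by
      have h1 : ω (algebraMap 𝒪[L] Lc ϖ) = algebraMap 𝒪[L] Lc ϖ := ω.commutes (ϖ : L)
      rw [div_pow, ← map_pow, hrm, h1, div_self hϖ0])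
    exact ⟨k, by rw [hk, div_mul_cancel₀ _ hrm0]⟩
  have hinert : ∀ ω ∈ rootInertia L Lc, ∀ k : ℕ, ω (root m) = ζ m ^ k * root m →
      π ω = π σ ^ k := fun ω hω k hk => by
    have h1 := hker ((σ ^ k)⁻¹ * ω) (mul_mem (inv_mem (pow_mem hσI k)) hω) (by
      rw [AlgEquiv.mul_apply, hk, AlgEquiv.aut_inv, AlgEquiv.symm_apply_eq, hσk])
    rw [map_mul, map_inv, map_pow, inv_mul_eq_one] at h1
    exact h1.symm
  -- Any Frobenius moves `root m` by a power of `ζ m`. A power of `σ` undoes this without affecting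
  -- roots of unity of order prime to `q`.
  obtain ⟨F₀, hF₀⟩ := hv.exists_frobenius
  obtain ⟨j, hj⟩ := hmove F₀
  have hF : IsFrobenius ((σ ^ j)⁻¹ * F₀) :=
    IsFrobenius.mul_rootInertia hF₀ (inv_mem (pow_mem hσI j))
  have hFr : ((σ ^ j)⁻¹ * F₀) (root m) = root m := by
    rw [AlgEquiv.mul_apply, hj, AlgEquiv.aut_inv, AlgEquiv.symm_apply_eq, hσk]
  have hFz := hF m hm0 hcop _ hζm.pow_eq_one
  set F := (σ ^ j)⁻¹ * F₀
  refine ⟨F, hF, by rw [← hre, map_pow, hFr], ?_, hζ.1 _ he0, ?_, fun ω hω => ?_, ?_⟩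
  · have := hroot.2 (orderOf (π σ)) 1 he0 one_pos
    rwa [mul_one, hroot.1] at this
  · exact Nat.Coprime.coprime_dvd_left ⟨m', hm'⟩ hcop
  · obtain ⟨k, hk⟩ := hmove ω
    refine ⟨k, hinert ω hω k hk, ?_⟩
    rw [← hre, map_pow, hk, mul_pow, ← hze, pow_right_comm]
  · rw [← map_inv, ← map_mul, ← map_mul]
    -- Since `F` fixes `root m` and raises `ζ m` to the power `q`, the conjugate `F σ F⁻¹` moves
    -- `root m` by `ζ m ^ q`.
    refine hinert _ (Subgroup.Normal.conj_mem inferInstance σ hσI F) _ ?_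
    have h1 : F⁻¹ (root m) = root m := by
      rw [AlgEquiv.aut_inv, AlgEquiv.symm_apply_eq, hFr]
    rw [AlgEquiv.mul_apply, AlgEquiv.mul_apply, h1, (hσ m hcop).1, map_mul, hFz, hFr]

end TameInertia
end GaloisStructure
end

noncomputable section
namespace GaloisStructure
set_option linter.unusedSectionVars false

/-! ### Idempotents of a cyclic group -/

section CyclicIdem
variable {K A : Type*} [Field K] [Ring A] [Algebra K A]

/-- The projection onto the eigenspace of `S` for the eigenvalue `z ^ j`, where `S ^ e = 1`. -/
def cyclicIdem (z : K) (S : A) (e j : ℕ) : A :=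
  (e : K)⁻¹ • ∑ i ∈ Finset.range e, (z⁻¹ ^ j) ^ i • S ^ i

/-- The element that acts on the `z ^ j`-eigenspace of `S` as the scalar `l j`. -/
def cyclicDiag (z : K) (S : A) (e : ℕ) (l : ℕ → K) : A :=
  ∑ j ∈ Finset.range e, l j • cyclicIdem z S e j

variable {z : K} {S : A} {e : ℕ}

theorem commute_cyclicIdem (j : ℕ) : Commute S (cyclicIdem z S e j) := by
  refine Commute.smul_right (Commute.sum_right _ _ _ fun i _ => ?_) _
  exact ((Commute.refl S).pow_right i).smul_right _

theorem commute_cyclicDiag (l : ℕ → K) : Commute S (cyclicDiag z S e l) :=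
  Commute.sum_right _ _ _ fun j _ => (commute_cyclicIdem j).smul_right _

variable (hz : IsPrimitiveRoot z e) (hS : S ^ e = 1) (he : (e : K) ≠ 0)
include hz hS he

omit hS in
theorem ne_zero_of_cast_ne_zero : z ≠ 0 :=
  hz.ne_zero fun h => he (by rw [h, Nat.cast_zero])

theorem mul_cyclicIdem (j : ℕ) : S * cyclicIdem z S e j = z ^ j • cyclicIdem z S e j := by
  have hz0 := ne_zero_of_cast_ne_zero hz he
  have h1 : (z⁻¹ ^ j • S) ^ e = 1 := by
    rw [smul_pow, hS, ← pow_mul, mul_comm, pow_mul, inv_pow, hz.pow_eq_one, inv_one, one_pow,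
      one_smul]
  have h2 := mul_geom_sum (z⁻¹ ^ j • S) e
  rw [h1, sub_self, sub_mul, one_mul, sub_eq_zero] at h2
  simp only [smul_pow] at h2
  rw [smul_mul_assoc] at h2
  rw [cyclicIdem, mul_smul_comm, smul_comm (z ^ j)]
  congr 1
  conv_rhs => rw [← h2]
  rw [smul_smul, ← mul_pow, mul_inv_cancel₀ hz0, one_pow, one_smul]

theorem pow_mul_cyclicIdem (i j : ℕ) :
    S ^ i * cyclicIdem z S e j = (z ^ j) ^ i • cyclicIdem z S e j := by
  induction i with
  | zero => simp
  | succ i ih =>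
    rw [pow_succ, mul_assoc, mul_cyclicIdem hz hS he, mul_smul_comm, ih, smul_smul, pow_succ' (z ^ j)]

/-- The product is the second idempotent times a normalized geometric sum in `z ^ (k - j)`, which
vanishes unless `j = k`. -/
theorem cyclicIdem_mul {j k : ℕ} (hj : j < e) (hk : k < e) :
    cyclicIdem z S e j * cyclicIdem z S e k = if j = k then cyclicIdem z S e k else 0 := by
  have hz0 := ne_zero_of_cast_ne_zero hz he
  conv_lhs => rw [cyclicIdem]
  rw [smul_mul_assoc, Finset.sum_mul]
  simp only [smul_mul_assoc, pow_mul_cyclicIdem hz hS he, smul_smul, ← mul_pow]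
  rw [← Finset.sum_smul, smul_smul]
  split_ifs with h
  · subst h
    simp [hz0, he]
  · have h1 : z⁻¹ ^ j * z ^ k ≠ 1 := fun h1 => h (hz.pow_inj hj hk (by
      rw [inv_pow, inv_mul_eq_one₀ (pow_ne_zero _ hz0)] at h1
      exact h1))
    have h3 : (z⁻¹ ^ j * z ^ k) ^ e = 1 := by
      rw [mul_pow, ← pow_mul, ← pow_mul, mul_comm j, mul_comm k, pow_mul, pow_mul, inv_pow,
        hz.pow_eq_one, inv_one, one_pow, one_pow, one_mul]
    have h2 := mul_geom_sum (z⁻¹ ^ j * z ^ k) e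
    rw [h3, sub_self] at h2
    rw [(mul_eq_zero.1 h2).resolve_left (sub_ne_zero.2 h1), mul_zero, zero_smul]

theorem sum_cyclicIdem : ∑ j ∈ Finset.range e, cyclicIdem z S e j = 1 := by
  have hz0 := ne_zero_of_cast_ne_zero hz he
  have he0 : 0 < e := Nat.pos_of_ne_zero fun h => he (by rw [h, Nat.cast_zero])
  simp only [cyclicIdem]
  rw [← Finset.smul_sum, Finset.sum_comm]
  have h1 : ∀ i ∈ Finset.range e, ∑ j ∈ Finset.range e, (z⁻¹ ^ j) ^ i • S ^ i =
      if i = 0 then (e : K) • (1 : A) else 0 := fun i hi => by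
    rw [← Finset.sum_smul]
    split_ifs with h
    · simp [h]
    · have h1 : z⁻¹ ^ i ≠ 1 := fun h1 => h (hz.pow_inj (Finset.mem_range.1 hi) he0 (by
        rw [inv_pow, inv_eq_one] at h1
        rw [h1, pow_zero]))
      have h3 : (z⁻¹ ^ i) ^ e = 1 := by
        rw [← pow_mul, mul_comm, pow_mul, inv_pow, hz.pow_eq_one, inv_one, one_pow]
      have h2 := mul_geom_sum (z⁻¹ ^ i) e
      rw [h3, sub_self] at h2
      simp only [fun j : ℕ => pow_right_comm z⁻¹ j i]
      rw [(mul_eq_zero.1 h2).resolve_left (sub_ne_zero.2 h1), zero_smul]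
  rw [Finset.sum_congr rfl h1, Finset.sum_ite_eq' _ 0, if_pos (Finset.mem_range.2 he0), smul_smul,
    inv_mul_cancel₀ he, one_smul]

theorem cyclicIdem_mul_cyclicDiag (l : ℕ → K) {j : ℕ} (hj : j < e) :
    cyclicIdem z S e j * cyclicDiag z S e l = l j • cyclicIdem z S e j := by
  rw [cyclicDiag, Finset.mul_sum]
  rw [Finset.sum_congr rfl fun k hk => by
    rw [mul_smul_comm, cyclicIdem_mul hz hS he hj (Finset.mem_range.1 hk), smul_ite, smul_zero]]
  rw [Finset.sum_ite_eq _ j, if_pos (Finset.mem_range.2 hj)]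

theorem cyclicDiag_mul (l l' : ℕ → K) :
    cyclicDiag z S e l * cyclicDiag z S e l' = cyclicDiag z S e (l * l') := by
  rw [cyclicDiag, Finset.sum_mul]
  change _ = ∑ j ∈ Finset.range e, (l * l') j • cyclicIdem z S e j
  refine Finset.sum_congr rfl fun j hj => ?_
  rw [smul_mul_assoc, cyclicIdem_mul_cyclicDiag hz hS he _ (Finset.mem_range.1 hj), smul_smul,
    Pi.mul_apply]

theorem cyclicDiag_one : cyclicDiag z S e 1 = 1 := by
  simpa [cyclicDiag] using sum_cyclicIdem hz hS he

theorem pow_mul_cyclicDiag (i : ℕ) (l : ℕ → K) :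
    S ^ i * cyclicDiag z S e l = cyclicDiag z S e fun j => (z ^ j) ^ i * l j := by
  rw [cyclicDiag, Finset.mul_sum]
  refine Finset.sum_congr rfl fun j _ => ?_
  rw [mul_smul_comm, pow_mul_cyclicIdem hz hS he, smul_smul, mul_comm]

/-- `cyclicDiag` of a nowhere vanishing function is a unit. -/
def cyclicDiagUnit (l : ℕ → K) (hl : ∀ j, l j ≠ 0) : Aˣ where
  val := cyclicDiag z S e l
  inv := cyclicDiag z S e l⁻¹
  val_inv := by
    rw [cyclicDiag_mul hz hS he, ← cyclicDiag_one hz hS he]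
    congr 1
    exact funext fun j => mul_inv_cancel₀ (hl j)
  inv_val := by
    rw [cyclicDiag_mul hz hS he, ← cyclicDiag_one hz hS he]
    congr 1
    exact funext fun j => inv_mul_cancel₀ (hl j)

omit hz hS he

theorem map_cyclicIdem {A' : Type*} [Ring A'] [Algebra K A'] (f : A →ₐ[K] A') (j : ℕ) :
    f (cyclicIdem z S e j) = cyclicIdem z (f S) e j := by
  simp [cyclicIdem, map_smul]

theorem map_cyclicDiag {A' : Type*} [Ring A'] [Algebra K A'] (f : A →ₐ[K] A') (l : ℕ → K) :
    f (cyclicDiag z S e l) = cyclicDiag z (f S) e l := by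
  simp [cyclicDiag, map_smul, map_cyclicIdem]

end CyclicIdem

/-! ### The maximum norm on a group algebra -/

section GroupNorm
open scoped NNReal
variable {K : Type*} [Field K] {G : Type*} [Group G] [Fintype G] (v : Valuation K ℝ≥0)

/-- The maximum of the absolute values of the coefficients. -/
def gnorm (z : MonoidAlgebra K G) : ℝ≥0 := Finset.univ.sup fun h => v (z.coeff h)

variable {v}

theorem le_gnorm (z : MonoidAlgebra K G) (h : G) : v (z.coeff h) ≤ gnorm v z :=
  Finset.le_sup (f := fun h => v (z.coeff h)) (Finset.mem_univ h)

theorem gnorm_le_iff {z : MonoidAlgebra K G} {c : ℝ≥0} :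
    gnorm v z ≤ c ↔ ∀ h, v (z.coeff h) ≤ c := by simp [gnorm]

theorem gnorm_lt_iff {z : MonoidAlgebra K G} {c : ℝ≥0} (hc : 0 < c) :
    gnorm v z < c ↔ ∀ h, v (z.coeff h) < c := by
  simp [gnorm, Finset.sup_lt_iff (show ⊥ < c from hc)]

theorem gnorm_mul_le (x y : MonoidAlgebra K G) : gnorm v (x * y) ≤ gnorm v x * gnorm v y := by
  rw [gnorm_le_iff]
  intro h
  rw [MonoidAlgebra.coeff_mul_apply_left, Finsupp.sum]
  refine v.map_sum_le fun g _ => ?_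
  rw [map_mul]
  exact mul_le_mul' (le_gnorm _ _) (le_gnorm _ _)

theorem gnorm_smul (c : K) (x : MonoidAlgebra K G) : gnorm v (c • x) = v c * gnorm v x := by
  simp only [gnorm, MonoidAlgebra.coeff_smul_apply, smul_eq_mul, map_mul]
  exact (NNReal.mul_finset_sup _ _ _).symm

theorem gnorm_sum_le {ι : Type*} {s : Finset ι} {f : ι → MonoidAlgebra K G} {c : ℝ≥0}
    (h : ∀ i ∈ s, gnorm v (f i) ≤ c) : gnorm v (∑ i ∈ s, f i) ≤ c := by
  rw [gnorm_le_iff]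
  intro g
  rw [MonoidAlgebra.coeff_sum, Finsupp.finsetSum_apply]
  exact v.map_sum_le fun i hi => (le_gnorm _ _).trans (h i hi)

theorem gnorm_single (g : G) (c : K) : gnorm v (MonoidAlgebra.single g c) = v c := by
  classical
  refine le_antisymm (gnorm_le_iff.2 fun h => ?_) ?_
  · rw [MonoidAlgebra.coeff_single, Finsupp.single_apply]
    split_ifs <;> simp
  · have := le_gnorm (v := v) (MonoidAlgebra.single g c) g
    simpa using this

end GroupNorm
end GaloisStructure
end

noncomputable section
namespace GaloisStructure
set_option linter.unusedSectionVars false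

/-! ### The Galois action on the group algebra -/

section GalAct
open scoped NNReal
variable {L Lc : Type u} [Field L] [Field Lc] [Algebra L Lc] {G : Type v} [Group G]

theorem ext_coeff {R : Type*} [Semiring R] {x y : MonoidAlgebra R G}
    (h : ∀ g, x.coeff g = y.coeff g) : x = y := MonoidAlgebra.ext (Finsupp.ext h)

/-- The action of an automorphism on the coefficients of the group algebra. -/
def galAct (G : Type v) [Group G] (ω : Lc ≃ₐ[L] Lc) : MonoidAlgebra Lc G →+* MonoidAlgebra Lc G :=
  MonoidAlgebra.mapRingHom G (ω : Lc →+* Lc)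

theorem coeff_galAct (ω : Lc ≃ₐ[L] Lc) (x : MonoidAlgebra Lc G) (h : G) :
    (galAct G ω x).coeff h = ω (x.coeff h) := MonoidAlgebra.coeff_mapRingHom _ _ _

theorem galAct_single (ω : Lc ≃ₐ[L] Lc) (g : G) (c : Lc) :
    galAct G ω (MonoidAlgebra.single g c) = MonoidAlgebra.single g (ω c) :=
  MonoidAlgebra.mapRingHom_single _ _ _

theorem galAct_of (ω : Lc ≃ₐ[L] Lc) (g : G) :
    galAct G ω (MonoidAlgebra.of Lc G g) = MonoidAlgebra.of Lc G g := by
  rw [MonoidAlgebra.of_apply, galAct_single, map_one]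

theorem galAct_smul (ω : Lc ≃ₐ[L] Lc) (c : Lc) (x : MonoidAlgebra Lc G) :
    galAct G ω (c • x) = ω c • galAct G ω x :=
  ext_coeff fun h => by
    rw [coeff_galAct, MonoidAlgebra.coeff_smul_apply, MonoidAlgebra.coeff_smul_apply, coeff_galAct,
      smul_eq_mul, smul_eq_mul, map_mul]

theorem galAct_mul (ω τ : Lc ≃ₐ[L] Lc) (x : MonoidAlgebra Lc G) :
    galAct G (ω * τ) x = galAct G ω (galAct G τ x) :=
  ext_coeff fun h => by rw [coeff_galAct, coeff_galAct, coeff_galAct]; rfl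

theorem galAct_one (x : MonoidAlgebra Lc G) : galAct G (1 : Lc ≃ₐ[L] Lc) x = x :=
  ext_coeff fun h => by rw [coeff_galAct]; rfl

variable [ValuativeRel L] {v : Valuation Lc ℝ≥0} (hv : IsExtendedValuation L v)

theorem IsExtendedValuation.gnorm_map_le_one [Fintype G] (hv : IsExtendedValuation L v)
    (x : MonoidAlgebra (integralClosure 𝒪[L] Lc) G) :
    gnorm v (MonoidAlgebra.mapRingHom G (algebraMap (integralClosure 𝒪[L] Lc) Lc) x) ≤ 1 := by
  rw [gnorm_le_iff]
  intro h
  rw [MonoidAlgebra.coeff_mapRingHom]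
  exact hv.map_coe_le_one _

theorem IsExtendedValuation.isLocalRing (hv : IsExtendedValuation L v) :
    IsLocalRing (integralClosure 𝒪[L] Lc) := by
  refine IsLocalRing.of_unique_max_ideal ⟨extIdeal hv, inferInstance, fun I hI => ?_⟩
  refine hI.eq_of_le (Ideal.IsMaximal.ne_top inferInstance) fun x hx => ?_
  rw [mem_extIdeal]
  refine lt_of_le_of_ne (hv.map_coe_le_one x) fun h1 => hI.ne_top ?_
  have h2 : IsIntegral 𝒪[L] (x : Lc)⁻¹ := by
    rw [← hv.le_one_iff, map_inv₀, h1, inv_one]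
  have h3 : (x : Lc) ≠ 0 := (Valuation.ne_zero_iff v).1 (by rw [h1]; exact one_ne_zero)
  have h4 : (⟨_, h2⟩ : integralClosure 𝒪[L] Lc) * x = 1 := Subtype.ext (inv_mul_cancel₀ h3)
  rw [Ideal.eq_top_iff_one, ← h4]
  exact I.mul_mem_left _ hx

theorem isUnit_of_forall_mul_eq_zero {k A : Type*} [Field k] [Ring A] [Algebra k A]
    [FiniteDimensional k A] {a : A} (ha : ∀ x, a * x = 0 → x = 0) : IsUnit a := by
  have hinj : Function.Injective (LinearMap.mulLeft k a) :=
    (injective_iff_map_eq_zero _).2 ha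
  obtain ⟨b, hb⟩ := LinearMap.injective_iff_surjective.1 hinj 1
  have hb' : a * b = 1 := hb
  refine ⟨⟨a, b, hb', ?_⟩, rfl⟩
  have h1 : a * (b * a - 1) = 0 := by rw [mul_sub, ← mul_assoc, hb', one_mul, mul_one, sub_self]
  exact sub_eq_zero.1 (ha _ h1)

/-- An element with integral coefficients is an integral unit as soon as left multiplication by its
reduction is injective. -/
theorem isUnit_of_residue [Finite G] (hv : IsExtendedValuation L v)
    {a : MonoidAlgebra (integralClosure 𝒪[L] Lc) G}
    (ha : ∀ x : MonoidAlgebra (extResidue hv) G,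
      MonoidAlgebra.mapRingHom G (resHom hv) a * x = 0 → x = 0) : IsUnit a := by
  have := hv.isLocalRing
  have hloc : IsLocalHom (resHom hv) := ⟨fun x hx => by
    by_contra hn
    rw [← mem_nonunits_iff, ← IsLocalRing.mem_maximalIdeal,
      ← IsLocalRing.eq_maximalIdeal (show (extIdeal hv).IsMaximal from inferInstance)] at hn
    rw [(resHom_eq_zero_iff hv x).2 hn] at hx
    exact hx.ne_zero rfl⟩
  let g : IsLocalRing.ResidueField (integralClosure 𝒪[L] Lc) →+* extResidue hv :=
    IsLocalRing.ResidueField.lift (resHom hv)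
  have hg : g.comp (IsLocalRing.residue _) = resHom hv := IsLocalRing.ResidueField.lift_comp_residue _
  have : FiniteDimensional (IsLocalRing.ResidueField (integralClosure 𝒪[L] Lc))
      (MonoidAlgebra (IsLocalRing.ResidueField (integralClosure 𝒪[L] Lc)) G) :=
    inferInstance
  refine isUnit_of_map_unit (MonoidAlgebra.mapRingHom G (IsLocalRing.residue _)) _
    (isUnit_of_forall_mul_eq_zero
      (k := IsLocalRing.ResidueField (integralClosure 𝒪[L] Lc)) fun x hx => ?_)
  have h1 := congrArg (MonoidAlgebra.mapRingHom G g) hx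
  rw [map_mul, map_zero] at h1
  have h2 : MonoidAlgebra.mapRingHom G g
      (MonoidAlgebra.mapRingHom G (IsLocalRing.residue _) a) =
      MonoidAlgebra.mapRingHom G (resHom hv) a := ext_coeff fun h => by
    rw [MonoidAlgebra.coeff_mapRingHom, MonoidAlgebra.coeff_mapRingHom,
      MonoidAlgebra.coeff_mapRingHom]
    exact congrArg (fun j : _ →+* _ => j (a.coeff h)) hg
  rw [h2] at h1
  have h3 := ha _ h1
  refine ext_coeff fun h => g.injective ?_
  have h4 := congrArg (fun y => MonoidAlgebra.coeff y h) h3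
  simp only [MonoidAlgebra.coeff_mapRingHom, MonoidAlgebra.coeff_zero, Finsupp.coe_zero,
    Pi.zero_apply] at h4
  rw [h4, MonoidAlgebra.coeff_zero, Finsupp.coe_zero, Pi.zero_apply, map_zero]

theorem sum_range_add_of_periodic {M : Type*} [AddCommMonoid M] {g : ℕ → M} {f : ℕ}
    (hg : ∀ i, g (i + f) = g i) (k : ℕ) :
    ∑ i ∈ Finset.range f, g (i + k) = ∑ i ∈ Finset.range f, g i := by
  induction k with
  | zero => rfl
  | succ k ih =>
    rw [← ih]
    rcases f with - | f
    · rfl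
    · rw [Finset.sum_range_succ, Finset.sum_range_succ' (fun i => g (i + k)), zero_add,
        show f + (k + 1) = k + (f + 1) by omega, hg]
      congr 1
      exact Finset.sum_congr rfl fun i _ => by rw [show i + (k + 1) = i + 1 + k by omega]

variable [TopologicalSpace L] [IsNonarchimedeanLocalField L] [CharZero L] [CharZero Lc]
  [IsAlgClosed Lc] [Algebra.IsAlgebraic L Lc]

/-- Take for `u` the sum of the `y ^ (q ^ j) c⁻ʲ` over a period `f` of `c`, with `y` a root of
unity. Then `F` shifts the index by one, which amounts to multiplication by `c`. If the residue of
`y` is normal, the reduction of `u` is invertible, because the equations for an element annihilated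
by it are those of `exists_normal_residue`. -/
theorem IsExtendedValuation.exists_normal_unit [Fintype G] (hv : IsExtendedValuation L v)
    {F : Lc ≃ₐ[L] Lc} (hF : IsFrobenius F) (c : G) :
    ∃ u : (MonoidAlgebra Lc G)ˣ, gnorm v (u : MonoidAlgebra Lc G) ≤ 1 ∧
      gnorm v ((u⁻¹ : (MonoidAlgebra Lc G)ˣ) : MonoidAlgebra Lc G) ≤ 1 ∧
      galAct G F u = u * MonoidAlgebra.of Lc G c ∧
      ∀ ω ∈ rootInertia L Lc, galAct G ω (u : MonoidAlgebra Lc G) = u := by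
  -- The factor `2` keeps `f` at least `2` even for the trivial group.
  set f := 2 * Fintype.card G with hf
  have hG : 0 < Fintype.card G := Fintype.card_pos
  have hcf : c ^ f = 1 := by rw [hf, mul_comm, pow_mul, pow_card_eq_one, one_pow]
  obtain ⟨z, hz, hz'⟩ := exists_normal_residue hv (f := f) (by omega)
  obtain ⟨x, rfl⟩ := resHom_surjective hv z
  have hx1 : v (x : Lc) = 1 := by
    refine le_antisymm (hv.map_coe_le_one x) (not_lt.1 fun h => ?_)
    rw [(resHom_eq_zero_iff hv x).2 h] at hz'
    have h1 := hz' (fun _ => 1) fun k => Finset.sum_eq_zero fun i _ => by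
      rw [zero_pow (pow_ne_zero _ Nat.card_pos.ne'), mul_zero]
    exact one_ne_zero (congrFun h1 ⟨0, by omega⟩)
  rw [← map_pow, resHom_eq_iff] at hz
  -- The lift is replaced by a root of unity with the same residue, on which `F` and `rootInertia`
  -- act in a known way and not only up to congruence.
  obtain ⟨y, hy, hxy⟩ := hv.exists_root_of_unity_of_pow hx1 (by omega) hz
  have h0 := card_pow_sub_one_pos (L := L) (f := f) (by omega)
  have hc := coprime_card_pow_sub_one L (f := f) (by omega)
  have hy1 := hv.map_eq_one_of_pow_eq_one h0 hy
  have hyf : y ^ Nat.card 𝓀[L] ^ f = y := by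
    rw [← Nat.sub_add_cancel (Nat.one_le_pow f _ (Nat.card_pos (α := 𝓀[L]))), pow_succ, hy, one_mul]
  set yb : integralClosure 𝒪[L] Lc := hv.lift y hy1.le with hyb
  have hres : resHom hv x = resHom hv yb := (resHom_eq_iff hv x yb).2 hxy
  rw [hres] at hz'
  let a : MonoidAlgebra (integralClosure 𝒪[L] Lc) G :=
    ∑ j ∈ Finset.range f, MonoidAlgebra.single (c⁻¹ ^ j) (yb ^ Nat.card 𝓀[L] ^ j)
  have ha : IsUnit a := by
    refine isUnit_of_residue hv fun w hw => ext_coeff fun h => ?_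
    have hcoef : ∀ g : G, ∑ j ∈ Finset.range f,
        resHom hv yb ^ Nat.card 𝓀[L] ^ j * w.coeff (c ^ j * g) = 0 := fun g => by
      have h1 := congrArg (fun t => MonoidAlgebra.coeff t g) hw
      simp only [a, map_sum, MonoidAlgebra.mapRingHom_single, Finset.sum_mul,
        MonoidAlgebra.coeff_sum, Finsupp.finsetSum_apply, MonoidAlgebra.coeff_single_mul_apply,
        MonoidAlgebra.coeff_zero, Finsupp.coe_zero, Pi.zero_apply, map_pow, inv_pow, inv_inv] at h1
      exact h1
    -- The coefficient of the vanishing product at `c⁻ᵏ h`, after a shift of the summation index by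
    -- `k`, is the `k`-th equation of normality.
    have h2 := hz' (fun i => w.coeff (c ^ (i : ℕ) * h)) fun k => by
      rw [← hcoef (c⁻¹ ^ (k : ℕ) * h)]
      rw [← sum_range_add_of_periodic (f := f) (g := fun j => resHom hv yb ^ Nat.card 𝓀[L] ^ j *
        w.coeff (c ^ j * (c⁻¹ ^ (k : ℕ) * h))) (fun i => ?_) k, Finset.sum_range]
      · refine Finset.sum_congr rfl fun i _ => ?_
        rw [mul_comm, pow_add c, mul_assoc, ← mul_assoc (c ^ (k : ℕ)), inv_pow,
          mul_inv_cancel, one_mul]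
      · rw [pow_add c, hcf, mul_one, pow_add, pow_mul']
        have h3 : resHom hv yb ^ Nat.card 𝓀[L] ^ f = resHom hv yb := by
          rw [← map_pow]
          exact congrArg _ (Subtype.ext hyf)
        rw [h3]
    have h4 := congrFun h2 ⟨0, by omega⟩
    simpa using h4
  obtain ⟨ua, hua⟩ := ha
  let ι := MonoidAlgebra.mapRingHom G (algebraMap (integralClosure 𝒪[L] Lc) Lc)
  have hu : ((Units.map ι.toMonoidHom ua : (MonoidAlgebra Lc G)ˣ) : MonoidAlgebra Lc G) =
      ∑ j ∈ Finset.range f, MonoidAlgebra.single (c⁻¹ ^ j) (y ^ Nat.card 𝓀[L] ^ j) := by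
    change ι ua = _
    rw [hua]
    simp only [a, ι, map_sum, MonoidAlgebra.mapRingHom_single]
    rfl
  refine ⟨Units.map ι.toMonoidHom ua, hv.gnorm_map_le_one ua.1, hv.gnorm_map_le_one ua⁻¹.1, ?_,
    fun ω hω => ?_⟩
  · rw [hu, map_sum, Finset.sum_mul]
    simp only [galAct_single, MonoidAlgebra.of_apply, MonoidAlgebra.single_mul_single, mul_one]
    rw [← sum_range_add_of_periodic (f := f) (g := fun j =>
      MonoidAlgebra.single (c⁻¹ ^ j * c) (y ^ Nat.card 𝓀[L] ^ j)) (fun i => ?_) 1]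
    · refine Finset.sum_congr rfl fun j _ => ?_
      rw [map_pow, hF _ h0 hc y hy, ← pow_mul, ← pow_succ', pow_succ c⁻¹, mul_assoc, inv_mul_cancel,
        mul_one]
    · rw [pow_add c⁻¹, inv_pow c f, hcf, inv_one, mul_one, pow_add, pow_mul', hyf]
  · rw [hu, map_sum]
    refine Finset.sum_congr rfl fun j _ => ?_
    rw [galAct_single, map_pow, hω _ h0 hc y hy]

end GalAct
end GaloisStructure
end

noncomputable section
namespace GaloisStructure
set_option linter.unusedSectionVars false

/-! ### Galois generators of the fractional ideals -/

section Generators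
open scoped NNReal

/-- Multiplication by `q` permutes the residues modulo `e`. -/
theorem sum_range_mul_of_periodic {M : Type*} [AddCommMonoid M] {g : ℕ → M} {e q : ℕ} (he : 0 < e)
    (hg : ∀ i, g (i + e) = g i) (hq : e.Coprime q) :
    ∑ i ∈ Finset.range e, g (q * i) = ∑ i ∈ Finset.range e, g i := by
  have hmod : ∀ i, g i = g (i % e) := fun i => by
    conv_lhs => rw [← Nat.mod_add_div i e]
    generalize i / e = k
    induction k with
    | zero => rw [mul_zero, add_zero]
    | succ k ih => rw [mul_add, mul_one, ← add_assoc, hg, ih]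
  have hinj : Set.InjOn (fun i => q * i % e) (Finset.range e) := fun i hi j hj hij => by
    have h1 : q * i ≡ q * j [MOD e] := hij
    have h2 : i ≡ j [MOD e] := Nat.ModEq.cancel_left_of_coprime hq h1
    rwa [Nat.ModEq, Nat.mod_eq_of_lt (Finset.mem_range.1 (Finset.mem_coe.1 hi)),
      Nat.mod_eq_of_lt (Finset.mem_range.1 (Finset.mem_coe.1 hj))] at h2
  have himg : (Finset.range e).image (fun i => q * i % e) = Finset.range e :=
    Finset.eq_of_subset_of_card_le
      (Finset.image_subset_iff.2 fun i _ => Finset.mem_range.2 (Nat.mod_lt _ he))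
      (Finset.card_image_of_injOn hinj).ge
  conv_rhs => rw [← himg]
  rw [Finset.sum_image hinj]
  exact Finset.sum_congr rfl fun i _ => hmod _

variable {L Lc : Type u} [Field L] [Field Lc] [Algebra L Lc] {G : Type v} [Group G]
  [ValuativeRel L] [TopologicalSpace L] [IsNonarchimedeanLocalField L] [CharZero L] [CharZero Lc]
  [IsAlgClosed Lc] [Algebra.IsAlgebraic L Lc]

/-- The exponent congruent to `j` modulo `e` in the interval `[n, n + e)`. -/
def expo (e : ℕ) (n : ℤ) (j : ℕ) : ℤ := n + ((j : ℤ) - n) % e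

theorem le_expo {e : ℕ} (he : 0 < e) (n : ℤ) (j : ℕ) : n ≤ expo e n j :=
  le_add_of_nonneg_right (Int.emod_nonneg _ (by omega))

theorem expo_le {e : ℕ} (he : 0 < e) (n : ℤ) (j : ℕ) : expo e n j ≤ n + e - 1 := by
  have := Int.emod_lt_of_pos ((j : ℤ) - n) (b := e) (by omega)
  rw [expo]
  omega

theorem exists_expo_eq (e : ℕ) (n : ℤ) (j : ℕ) : ∃ k : ℤ, expo e n j = j + e * k :=
  ⟨-(((j : ℤ) - n) / e), by
    have := Int.emod_add_mul_ediv ((j : ℤ) - n) e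
    rw [expo]
    linarith⟩

theorem exists_expo_eq_self {e : ℕ} (he : 0 < e) (n : ℤ) : ∃ j < e, expo e n j = n := by
  have h0 := Int.emod_nonneg n (b := e) (by omega)
  have h1 := Int.emod_lt_of_pos n (b := e) (by omega)
  refine ⟨(n % e).toNat, by omega, ?_⟩
  rw [expo, Int.toNat_of_nonneg h0, Int.emod_sub_emod, sub_self, Int.zero_emod, add_zero]

theorem pow_zpow_expo {K : Type*} [Field K] {z : K} {e : ℕ} (hz0 : z ≠ 0) (hz : z ^ e = 1) (n : ℤ)
    (j k : ℕ) : (z ^ k) ^ expo e n j = (z ^ j) ^ k := by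
  obtain ⟨t, ht⟩ := exists_expo_eq e n j
  have h1 : (z ^ k) ^ e = 1 := by rw [pow_right_comm, hz, one_pow]
  rw [ht, zpow_add₀ (pow_ne_zero _ hz0), zpow_mul, zpow_natCast, zpow_natCast, h1, one_zpow, mul_one,
    pow_right_comm]

/-- A closed subgroup of the Galois group that contains a Frobenius automorphism and the
automorphisms that fix all roots of unity of order prime to the residue characteristic is
everything. -/
theorem IsExtendedValuation.eq_top_of_isClosed {v : Valuation Lc ℝ≥0} (hv : IsExtendedValuation L v)
    {F : Lc ≃ₐ[L] Lc} (hF : IsFrobenius F) (H : Subgroup (Lc ≃ₐ[L] Lc))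
    (hH : IsClosed (H : Set (Lc ≃ₐ[L] Lc))) (hFH : F ∈ H) (hI : rootInertia L Lc ≤ H) : H = ⊤ := by
  have : IsGalois L Lc := isGalois_of_isAlgClosed
  have h1 : (IntermediateField.fixedField H).fixingSubgroup = H :=
    InfiniteGalois.fixingSubgroup_fixedField ⟨H, hH⟩
  rw [eq_top_iff, ← h1]
  intro ω _
  rw [IntermediateField.mem_fixingSubgroup_iff]
  intro x hx
  rw [IntermediateField.mem_fixedField_iff] at hx
  obtain ⟨l, rfl⟩ := hv.mem_of_fixed hF (fun τ hτ => hx τ (hI hτ)) (hx F hFH)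
  exact ω.commutes l

/-- The resolvend condition `ω z = z π(ω)`. -/
def IsResolvend (π : (Lc ≃ₐ[L] Lc) →* G) (z : MonoidAlgebra Lc G) : Prop :=
  ∀ ω : Lc ≃ₐ[L] Lc, galAct G ω z = z * MonoidAlgebra.of Lc G (π ω)

theorem isOpen_fixing (T : Finset Lc) :
    ∃ U : Subgroup (Lc ≃ₐ[L] Lc), IsOpen (U : Set (Lc ≃ₐ[L] Lc)) ∧
      ∀ ω ∈ U, ∀ t ∈ T, ω t = t := by
  have : FiniteDimensional L (IntermediateField.adjoin L (T : Set Lc)) :=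
    IntermediateField.finiteDimensional_adjoin fun x _ => Algebra.IsIntegral.isIntegral x
  exact ⟨_, IntermediateField.fixingSubgroup_isOpen (IntermediateField.adjoin L (T : Set Lc)),
    fun ω hω t ht => (IntermediateField.mem_fixingSubgroup_iff _ _).1 hω t
      (IntermediateField.subset_adjoin _ _ ht)⟩

/-- The automorphisms that satisfy the relation form a subgroup. It is open, since it contains those
elements of `ker π` that fix the finitely many coefficients, hence it is closed;
`eq_top_of_isClosed` then applies. -/
theorem IsExtendedValuation.isResolvend [Fintype G] {v : Valuation Lc ℝ≥0}
    (hv : IsExtendedValuation L v) {π : (Lc ≃ₐ[L] Lc) →* G}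
    (hπ : IsOpen (π.ker : Set (Lc ≃ₐ[L] Lc))) {F : Lc ≃ₐ[L] Lc} (hF : IsFrobenius F)
    {z : MonoidAlgebra Lc G} (hFz : galAct G F z = z * MonoidAlgebra.of Lc G (π F))
    (hI : ∀ ω ∈ rootInertia L Lc, galAct G ω z = z * MonoidAlgebra.of Lc G (π ω)) :
    IsResolvend π z := by
  classical
  let H : Subgroup (Lc ≃ₐ[L] Lc) :=
    { carrier := {ω | galAct G ω z = z * MonoidAlgebra.of Lc G (π ω)}
      one_mem' := by
        change galAct G 1 z = _
        rw [galAct_one, map_one, map_one, mul_one]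
      mul_mem' := fun {a b} (ha : galAct G a z = _) (hb : galAct G b z = _) => by
        change galAct G (a * b) z = _
        rw [galAct_mul, hb, map_mul, ha, galAct_of, mul_assoc, ← map_mul, ← map_mul]
      inv_mem' := fun {a} (ha : galAct G a z = _) => by
        change galAct G a⁻¹ z = _
        have h1 := congrArg (galAct G a⁻¹) ha
        rw [← galAct_mul, inv_mul_cancel, galAct_one, map_mul, galAct_of] at h1
        have h2 := congrArg (· * MonoidAlgebra.of Lc G (π a⁻¹)) h1
        rw [mul_assoc, ← map_mul, ← map_mul, mul_inv_cancel, map_one, map_one, mul_one] at h2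
        exact h2.symm }
  obtain ⟨U, hU, hU'⟩ := isOpen_fixing (L := L) (Finset.univ.image fun h => z.coeff h)
  have hopen : IsOpen (H : Set (Lc ≃ₐ[L] Lc)) := by
    refine Subgroup.isOpen_mono (H₁ := U ⊓ π.ker) (fun ω hω => ?_) (hU.inter hπ)
    change galAct G ω z = _
    rw [(MonoidHom.mem_ker.1 hω.2 : π ω = 1), map_one, mul_one]
    refine ext_coeff fun h => ?_
    rw [coeff_galAct]
    exact hU' ω hω.1 _ (Finset.mem_image_of_mem _ (Finset.mem_univ h))
  have := hv.eq_top_of_isClosed hF H (Subgroup.isClosed_of_isOpen H hopen) hFz hI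
  intro ω
  have h1 : ω ∈ H := this ▸ Subgroup.mem_top ω
  exact h1

section
variable {π : (Lc ≃ₐ[L] Lc) →* G} {s : G} {F : Lc ≃ₐ[L] Lc} {z r : Lc} {ϖ : 𝒪[L]}
  (hd : IsTameDatum π s F z r ϖ) {v : Valuation Lc ℝ≥0} (hv : IsExtendedValuation L v)

theorem of_pow_orderOf : MonoidAlgebra.of Lc G s ^ orderOf s = 1 := by
  rw [← map_pow, pow_orderOf_eq_one, map_one]

theorem galAct_cyclicIdem (ω : Lc ≃ₐ[L] Lc) (e j : ℕ) :
    galAct G ω (cyclicIdem z (MonoidAlgebra.of Lc G s) e j) =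
      cyclicIdem (ω z) (MonoidAlgebra.of Lc G s) e j := by
  simp only [cyclicIdem, galAct_smul, map_sum, map_pow, galAct_of, map_inv₀, map_natCast]

theorem galAct_cyclicDiag (ω : Lc ≃ₐ[L] Lc) (e : ℕ) (l : ℕ → Lc) :
    galAct G ω (cyclicDiag z (MonoidAlgebra.of Lc G s) e l) =
      cyclicDiag (ω z) (MonoidAlgebra.of Lc G s) e fun j => ω (l j) := by
  simp only [cyclicDiag, galAct_smul, map_sum, galAct_cyclicIdem]

include hd

theorem IsTameDatum.map_z {ω : Lc ≃ₐ[L] Lc} (hω : ω ∈ rootInertia L Lc) [Finite G] : ω z = z :=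
  hω _ (orderOf_pos s) hd.coprime z hd.primitive.pow_eq_one

theorem IsTameDatum.cast_ne_zero [Finite G] : ((orderOf s : ℕ) : Lc) ≠ 0 :=
  Nat.cast_ne_zero.2 (orderOf_pos s).ne'

/-- Two twists cancel: `F` turns `z` into `z ^ q`, and conjugation by `π F` turns `s` into `s ^ q`.
Multiplying the summation index by `q` absorbs both. -/
theorem IsTameDatum.conj_cyclicIdem [Finite G] (j : ℕ) :
    MonoidAlgebra.of Lc G (π F) * galAct G F (cyclicIdem z (MonoidAlgebra.of Lc G s) (orderOf s) j) =
      cyclicIdem z (MonoidAlgebra.of Lc G s) (orderOf s) j * MonoidAlgebra.of Lc G (π F) := by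
  have hz0 := ne_zero_of_cast_ne_zero hd.primitive hd.cast_ne_zero
  rw [galAct_cyclicIdem, hd.frobenius _ (orderOf_pos s) hd.coprime z hd.primitive.pow_eq_one]
  set q := Nat.card 𝓀[L] with hq
  set C := MonoidAlgebra.of Lc G (π F) with hC
  set S := MonoidAlgebra.of Lc G s with hS
  have h1 : C * S = S ^ q * C := by
    rw [hC, hS, ← map_pow, ← map_mul, ← map_mul, ← hd.conj, inv_mul_cancel_right]
  have h2 : ∀ i, C * S ^ i = S ^ (q * i) * C := fun i => by
    induction i with
    | zero => simp
    | succ i ih => rw [pow_succ, ← mul_assoc, ih, mul_assoc, h1, ← mul_assoc, ← pow_add]; rfl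
  have h3 := sum_range_mul_of_periodic (e := orderOf s) (q := q)
    (g := fun i => (z⁻¹ ^ j) ^ i • S ^ i) (orderOf_pos s) (fun i => by
      rw [pow_add, pow_add, of_pow_orderOf, mul_one, ← pow_mul, ← pow_mul _ j (orderOf s),
        mul_comm j (orderOf s), pow_mul _ (orderOf s) j, inv_pow z (orderOf s),
        hd.primitive.pow_eq_one, inv_one, one_pow, mul_one]) hd.coprime
  rw [cyclicIdem, cyclicIdem, ← h3, mul_smul_comm, smul_mul_assoc, Finset.mul_sum, Finset.sum_mul]
  congr 1
  refine Finset.sum_congr rfl fun i _ => ?_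
  rw [mul_smul_comm, smul_mul_assoc, h2]
  congr 1
  rw [← inv_pow, ← pow_mul, ← pow_mul, ← pow_mul]
  congr 1
  ring

/-- `∑ r ^ k ε_k` over the interval `[n, n + e)`. -/
def weight (s : G) (z r : Lc) (n : ℤ) : MonoidAlgebra Lc G :=
  cyclicDiag z (MonoidAlgebra.of Lc G s) (orderOf s) fun j => r ^ expo (orderOf s) n j

theorem IsTameDatum.galAct_frobenius_weight [Finite G] (n : ℤ) :
    MonoidAlgebra.of Lc G (π F) * galAct G F (weight s z r n) =
      weight s z r n * MonoidAlgebra.of Lc G (π F) := by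
  simp only [weight, cyclicDiag, map_sum, galAct_smul, map_zpow₀, hd.map_root, Finset.mul_sum,
    Finset.sum_mul, mul_smul_comm, smul_mul_assoc, hd.conj_cyclicIdem]

theorem IsTameDatum.root_ne_zero (hϖ : Irreducible ϖ) [Finite G] : r ≠ 0 := fun h => by
  have h1 := hd.root_pow
  rw [h, zero_pow (orderOf_pos s).ne'] at h1
  exact hϖ.ne_zero ((FaithfulSMul.algebraMap_injective 𝒪[L] Lc) (by rw [← h1, map_zero]))

/-- If `π ω = s ^ k`, then `ω` multiplies a power of `r` whose exponent is congruent to `j` by `z ^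
(j k)`, and this is how `s ^ k` acts on the `j`-th idempotent. -/
theorem IsTameDatum.galAct_inertia_weight [Finite G] (n : ℤ)
    {ω : Lc ≃ₐ[L] Lc} (hω : ω ∈ rootInertia L Lc) :
    galAct G ω (weight s z r n) = weight s z r n * MonoidAlgebra.of Lc G (π ω) := by
  obtain ⟨k, hk, hr⟩ := hd.inertia ω hω
  have hz0 := ne_zero_of_cast_ne_zero hd.primitive hd.cast_ne_zero
  rw [hk, map_pow, weight, ((commute_cyclicDiag (z := z) (e := orderOf s)
    (S := MonoidAlgebra.of Lc G s) _).pow_left k).symm.eq,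
    pow_mul_cyclicDiag hd.primitive of_pow_orderOf hd.cast_ne_zero k _, galAct_cyclicDiag,
    hd.map_z hω]
  congr 1
  refine funext fun j => ?_
  rw [map_zpow₀, hr, mul_zpow, pow_zpow_expo hz0 hd.primitive.pow_eq_one]

/-- `weight` as a unit. -/
def IsTameDatum.weightUnit [Finite G] (hϖ : Irreducible ϖ) (n : ℤ) : (MonoidAlgebra Lc G)ˣ :=
  cyclicDiagUnit hd.primitive of_pow_orderOf hd.cast_ne_zero
    (fun j => r ^ expo (orderOf s) n j) fun _ => zpow_ne_zero _ (hd.root_ne_zero hϖ)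

end
end Generators
end GaloisStructure
end

noncomputable section
namespace GaloisStructure
set_option linter.unusedSectionVars false

/-! ### Integrality and norms of the generators -/

section Lattices
open scoped NNReal
variable {L Lc : Type u} [Field L] [Field Lc] [Algebra L Lc] {G : Type v} [Group G]
  [ValuativeRel L] [TopologicalSpace L] [IsNonarchimedeanLocalField L] [CharZero L] [CharZero Lc]
  [IsAlgClosed Lc] [Algebra.IsAlgebraic L Lc]

/-- Extension of scalars from `O_L[G]` to `Lᶜ[G]`. -/
def intMap (L Lc : Type u) [Field L] [Field Lc] [Algebra L Lc] [ValuativeRel L] (G : Type v)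
    [Group G] : MonoidAlgebra 𝒪[L] G →+* MonoidAlgebra Lc G :=
  MonoidAlgebra.mapRingHom G (algebraMap 𝒪[L] Lc)

theorem coeff_intMap (x : MonoidAlgebra 𝒪[L] G) (g : G) :
    (intMap L Lc G x).coeff g = algebraMap 𝒪[L] Lc (x.coeff g) :=
  MonoidAlgebra.coeff_mapRingHom _ _ _

theorem intMap_injective : Function.Injective (intMap L Lc G) := fun x y h =>
  ext_coeff fun g => FaithfulSMul.algebraMap_injective 𝒪[L] Lc (by
    rw [← coeff_intMap, h, coeff_intMap])

variable {v : Valuation Lc ℝ≥0} (hv : IsExtendedValuation L v)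

-- Galois invariance puts the coefficients into `L`, and the bound puts them into `O_L`.
include hv in
theorem IsExtendedValuation.exists_intMap_eq [Fintype G] {x : MonoidAlgebra Lc G}
    (hx : ∀ ω : Lc ≃ₐ[L] Lc, galAct G ω x = x) (hx1 : gnorm v x ≤ 1) :
    ∃ w, intMap L Lc G w = x := by
  have : IsGalois L Lc := isGalois_of_isAlgClosed
  have h1 : ∀ g, ∃ l : 𝒪[L], algebraMap 𝒪[L] Lc l = x.coeff g := fun g => by
    obtain ⟨l, hl⟩ := mem_of_forall_fixed (L := L) (x := x.coeff g) fun ω => by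
      rw [← coeff_galAct, hx]
    have h2 : l ∈ 𝒪[L] := by
      rw [← hv.algebraMap_le_one_iff, hl]
      exact gnorm_le_iff.1 hx1 g
    exact ⟨⟨l, h2⟩, hl⟩
  choose l hl using h1
  refine ⟨⟨Finsupp.equivFunOnFinite.symm l⟩, ext_coeff fun g => ?_⟩
  rw [coeff_intMap, ← hl]
  rfl

variable {π : (Lc ≃ₐ[L] Lc) →* G} {s : G} {F : Lc ≃ₐ[L] Lc} {z r : Lc} {ϖ : 𝒪[L]}
  (hd : IsTameDatum π s F z r ϖ)

/-- The factors `π ω` coming from `x` and from `b` cancel. Quotients of resolvends thus have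
coefficients in `L`. -/
theorem IsResolvend.mul_inv {x : MonoidAlgebra Lc G} (hx : IsResolvend π x)
    {b : (MonoidAlgebra Lc G)ˣ} (hb : IsResolvend π (b : MonoidAlgebra Lc G))
    (ω : Lc ≃ₐ[L] Lc) : galAct G ω (x * b⁻¹ : MonoidAlgebra Lc G) = x * b⁻¹ := by
  have h1 : galAct G ω ((b⁻¹ : (MonoidAlgebra Lc G)ˣ) : MonoidAlgebra Lc G) =
      MonoidAlgebra.of Lc G (π ω)⁻¹ * b⁻¹ := by
    have h2 : galAct G ω ((b⁻¹ : (MonoidAlgebra Lc G)ˣ) : MonoidAlgebra Lc G) *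
        (b * MonoidAlgebra.of Lc G (π ω)) = 1 := by
      rw [← hb ω, ← map_mul, Units.inv_mul, map_one]
    have h3 : (b * MonoidAlgebra.of Lc G (π ω)) * (MonoidAlgebra.of Lc G (π ω)⁻¹ *
        ((b⁻¹ : (MonoidAlgebra Lc G)ˣ) : MonoidAlgebra Lc G)) = 1 := by
      rw [mul_assoc, ← mul_assoc (MonoidAlgebra.of Lc G (π ω)), ← map_mul, mul_inv_cancel, map_one,
        one_mul, Units.mul_inv]
    exact left_inv_eq_right_inv h2 h3
  rw [map_mul, hx ω, h1, mul_assoc, ← mul_assoc (MonoidAlgebra.of Lc G (π ω)), ← map_mul,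
    mul_inv_cancel, map_one, one_mul]

theorem gnorm_of [Fintype G] (g : G) : gnorm v (MonoidAlgebra.of Lc G g) = 1 := by
  rw [MonoidAlgebra.of_apply, gnorm_single, map_one]

theorem gnorm_mul_self_le_one [Fintype G] {x : MonoidAlgebra Lc G} (hx : x ≠ 0) (h : x * x = x) :
    1 ≤ gnorm v x := by
  have h1 : gnorm v x ≤ gnorm v x * gnorm v x := by
    conv_lhs => rw [← h]
    exact gnorm_mul_le x x
  have h2 : gnorm v x ≠ 0 := fun h0 => hx (ext_coeff fun g => by
    have := le_gnorm (v := v) x g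
    rw [h0] at this
    rw [(Valuation.zero_iff v).1 (le_antisymm this zero_le)]
    rfl)
  exact le_of_mul_le_mul_left (by rwa [mul_one]) (pos_iff_ne_zero.2 h2)

include hv hd

theorem IsTameDatum.gnorm_cyclicIdem_le [Fintype G] (j : ℕ) :
    gnorm v (cyclicIdem z (MonoidAlgebra.of Lc G s) (orderOf s) j) ≤ 1 := by
  have hvz := hv.map_eq_one_of_pow_eq_one (orderOf_pos s) hd.primitive.pow_eq_one
  rw [cyclicIdem, gnorm_smul, map_inv₀, hv.map_natCast_eq_one hd.coprime, inv_one, one_mul]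
  refine gnorm_sum_le fun i _ => ?_
  rw [gnorm_smul, map_pow, map_pow, map_inv₀, hvz, inv_one, one_pow, one_pow, one_mul, ← map_pow,
    gnorm_of]

theorem IsTameDatum.cyclicIdem_ne_zero [Fintype G] (j : ℕ) :
    cyclicIdem z (MonoidAlgebra.of Lc G s) (orderOf s) j ≠ 0 := by
  classical
  intro h0
  have h1 := congrArg (fun x => MonoidAlgebra.coeff x 1) h0
  have hpow : ∀ i, (MonoidAlgebra.of Lc G s ^ i).coeff 1 = if s ^ i = 1 then 1 else 0 := fun i => by
    rw [← map_pow, MonoidAlgebra.of_apply, MonoidAlgebra.coeff_single, Finsupp.single_apply]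
  simp only [cyclicIdem, MonoidAlgebra.coeff_smul_apply, MonoidAlgebra.coeff_sum,
    Finsupp.finsetSum_apply, hpow, smul_eq_mul, MonoidAlgebra.coeff_zero, Finsupp.coe_zero,
    Pi.zero_apply] at h1
  rw [Finset.sum_eq_single_of_mem 0 (Finset.mem_range.2 (orderOf_pos s)) fun i hi hi0 => ?_] at h1
  · simp only [pow_zero, if_true, mul_one] at h1
    exact inv_ne_zero hd.cast_ne_zero h1
  · rw [if_neg fun h => hi0 ?_, mul_zero]
    exact Nat.eq_zero_of_dvd_of_lt (orderOf_dvd_of_pow_eq_one h) (Finset.mem_range.1 hi)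

theorem IsTameDatum.map_root_lt_one [Finite G] (hϖ : Irreducible ϖ) : v r < 1 := by
  have h1 : v (algebraMap 𝒪[L] Lc ϖ) < 1 := by
    rw [hv.lt_one_iff, IsLocalRing.mem_maximalIdeal]
    exact hϖ.not_isUnit
  rw [← hd.root_pow, map_pow] at h1
  exact (pow_lt_one_iff (orderOf_pos s).ne').1 h1

theorem IsTameDatum.map_root_pos [Finite G] (hϖ : Irreducible ϖ) : 0 < v r :=
  zero_lt_iff.2 ((Valuation.ne_zero_iff v).2 (hd.root_ne_zero hϖ))

theorem IsTameDatum.gnorm_diag_le [Fintype G] {l : ℕ → Lc} {c : ℝ≥0} (hl : ∀ j, v (l j) ≤ c) :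
    gnorm v (cyclicDiag z (MonoidAlgebra.of Lc G s) (orderOf s) l) ≤ c := by
  refine gnorm_sum_le fun j _ => ?_
  rw [gnorm_smul]
  exact (mul_le_mul' (hl j) (hd.gnorm_cyclicIdem_le hv j)).trans_eq (mul_one c)

theorem IsTameDatum.gnorm_weight_le [Fintype G] (hϖ : Irreducible ϖ) (n : ℤ) :
    gnorm v (weight s z r n) ≤ v r ^ n := by
  refine hd.gnorm_diag_le hv fun j => ?_
  rw [map_zpow₀]
  exact zpow_le_zpow_right_of_le_one₀ (hd.map_root_pos hv hϖ) (hd.map_root_lt_one hv hϖ).le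
    (le_expo (orderOf_pos s) n j)

theorem IsTameDatum.gnorm_weightUnit_inv_le [Fintype G] (hϖ : Irreducible ϖ) (n : ℤ) :
    gnorm v (((hd.weightUnit hϖ n)⁻¹ : (MonoidAlgebra Lc G)ˣ) : MonoidAlgebra Lc G) ≤
      v r ^ (-(n + orderOf s - 1)) := by
  refine hd.gnorm_diag_le hv fun j => ?_
  rw [Pi.inv_apply, map_inv₀, map_zpow₀, ← zpow_neg]
  exact zpow_le_zpow_right_of_le_one₀ (hd.map_root_pos hv hϖ) (hd.map_root_lt_one hv hϖ).le
    (neg_le_neg (expo_le (orderOf_pos s) n j))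

/-- The integrality criterion behind the Galois module structure of the fractional ideals: an
element fixed by the prime-to-`p` root inertia and by a power of Frobenius, whose coefficients are
smaller than the inverse of the uniformizer, is integral. -/
theorem IsExtendedValuation.gnorm_le_one_of_fixed [Fintype G] (hϖ : Irreducible ϖ)
    {x : MonoidAlgebra Lc G} (hI : ∀ ω ∈ rootInertia L Lc, galAct G ω x = x) {f : ℕ} (hf : 0 < f)
    (hFx : galAct G (F ^ f) x = x) (hx : gnorm v x < (v (algebraMap 𝒪[L] Lc ϖ))⁻¹) :
    gnorm v x ≤ 1 := by
  have h1 : v (algebraMap 𝒪[L] Lc ϖ) < 1 := by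
    rw [hv.lt_one_iff, IsLocalRing.mem_maximalIdeal]
    exact hϖ.not_isUnit
  have h0 : 0 < v (algebraMap 𝒪[L] Lc ϖ) := zero_lt_iff.2 ((Valuation.ne_zero_iff v).2 fun h =>
    hϖ.ne_zero ((FaithfulSMul.algebraMap_injective 𝒪[L] Lc) (by rw [h, map_zero])))
  rw [gnorm_le_iff]
  intro g
  by_cases hg : x.coeff g = 0
  · rw [hg, map_zero]; exact zero_le
  obtain ⟨k, hk⟩ := hv.exists_zpow_of_fixed hϖ hd.frobenius hg
    (fun ω hω => by rw [← coeff_galAct, hI ω hω]) hf (by rw [← coeff_galAct, hFx])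
  have h2 := (le_gnorm x g).trans_lt hx
  rw [hk, ← zpow_neg_one, zpow_lt_zpow_iff_right_of_lt_one₀ h0 h1] at h2
  rw [hk]
  exact zpow_le_one₀ h0 h1.le (by omega)

theorem IsTameDatum.galAct_pow_cyclicIdem [Finite G] {f : ℕ} (hf : π F ^ f = 1) (j : ℕ) :
    galAct G (F ^ f) (cyclicIdem z (MonoidAlgebra.of Lc G s) (orderOf s) j) =
      cyclicIdem z (MonoidAlgebra.of Lc G s) (orderOf s) j := by
  have h1 : ∀ i, MonoidAlgebra.of Lc G (π F) ^ i *
      galAct G (F ^ i) (cyclicIdem z (MonoidAlgebra.of Lc G s) (orderOf s) j) =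
      cyclicIdem z (MonoidAlgebra.of Lc G s) (orderOf s) j * MonoidAlgebra.of Lc G (π F) ^ i :=
    fun i => by
      induction i with
      | zero => rw [pow_zero, pow_zero, galAct_one, one_mul, mul_one]
      | succ i ih =>
        have h2 := congrArg (galAct G F) ih
        rw [map_mul, map_mul, map_pow, galAct_of, ← galAct_mul, ← pow_succ'] at h2
        rw [pow_succ', mul_assoc, h2, ← mul_assoc, hd.conj_cyclicIdem, mul_assoc]
  have h2 := h1 f
  rwa [← map_pow, hf, map_one, one_mul, mul_one] at h2

/-- The quotient of `x` by the generator is Galois invariant, so only its integrality is at stake,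
and the factor `u⁻¹` is integral. The rest is split by the idempotents into pieces fixed by
`rootInertia` and by a power of `F`. The nonzero coefficients of such pieces have powers of `v ϖ` as
values, so a strict bound by the value of `ϖ⁻¹` forces integrality. -/
theorem IsTameDatum.exists_intMap_mul_eq [Fintype G] (hϖ : Irreducible ϖ) {u : (MonoidAlgebra Lc G)ˣ}
    (hu : gnorm v ((u⁻¹ : (MonoidAlgebra Lc G)ˣ) : MonoidAlgebra Lc G) ≤ 1) {n : ℤ}
    (hb : IsResolvend π (u * hd.weightUnit hϖ n : MonoidAlgebra Lc G))
    {x : MonoidAlgebra Lc G} (hx : IsResolvend π x) (hxn : gnorm v x < v r ^ (n - 1)) :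
    ∃ w, x = intMap L Lc G w * (u * hd.weightUnit hϖ n) := by
  have hr0 := hd.map_root_pos hv hϖ
  have hr1 := hd.map_root_lt_one hv hϖ
  have hrne := hd.root_ne_zero hϖ
  set b : (MonoidAlgebra Lc G)ˣ := u * hd.weightUnit hϖ n with hbdef
  have hb' : IsResolvend π (b : MonoidAlgebra Lc G) := hb
  have hfix := fun ω => hx.mul_inv hb' ω
  have hcard : 0 < Fintype.card G := Fintype.card_pos
  -- The exponent of `r` is at most `n + e - 1`, with `e` the order of `s`. So the strict bound `v r
  -- ^ (n - 1)` on `x` becomes the strict bound `v r ^ (-e)` on the piece, which is the value of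
  -- `ϖ⁻¹`.
  have hpiece : ∀ j < orderOf s, gnorm v ((r ^ expo (orderOf s) n j)⁻¹ •
      (x * cyclicIdem z (MonoidAlgebra.of Lc G s) (orderOf s) j)) ≤ 1 := fun j hj => by
    refine hv.gnorm_le_one_of_fixed hd hϖ (fun ω hω => ?_) hcard ?_ ?_
    · obtain ⟨k, hk, hr⟩ := hd.inertia ω hω
      have hz0 := ne_zero_of_cast_ne_zero hd.primitive hd.cast_ne_zero
      rw [galAct_smul, map_mul, hx ω, galAct_cyclicIdem, hd.map_z hω, hk, map_pow, mul_assoc,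
        pow_mul_cyclicIdem hd.primitive of_pow_orderOf hd.cast_ne_zero, mul_smul_comm, smul_smul]
      congr 1
      rw [map_inv₀, map_zpow₀, hr, mul_zpow]
      have h1 := pow_zpow_expo hz0 hd.primitive.pow_eq_one n j k
      rw [h1, mul_inv, mul_right_comm, inv_mul_cancel₀ (pow_ne_zero _ (pow_ne_zero _ hz0)), one_mul]
    · have hcG : π F ^ Fintype.card G = 1 := pow_card_eq_one
      rw [galAct_smul, map_mul, hx, hd.galAct_pow_cyclicIdem hv hcG, map_pow, hcG, map_one, mul_one]
      congr 1
      rw [map_inv₀, map_zpow₀]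
      congr 2
      generalize Fintype.card G = i
      induction i with
      | zero => rfl
      | succ i ih => rw [pow_succ, AlgEquiv.mul_apply, hd.map_root, ih]
    · rw [gnorm_smul, map_inv₀, map_zpow₀]
      have h1 : gnorm v (x * cyclicIdem z (MonoidAlgebra.of Lc G s) (orderOf s) j) < v r ^ (n - 1) :=
        (gnorm_mul_le _ _).trans_lt (((mul_le_mul' le_rfl (hd.gnorm_cyclicIdem_le hv j)).trans_eq
          (mul_one _)).trans_lt hxn)
      have h2 : v (algebraMap 𝒪[L] Lc ϖ) = v r ^ (orderOf s : ℤ) := by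
        rw [← hd.root_pow, map_pow, zpow_natCast]
      calc (v r ^ expo (orderOf s) n j)⁻¹ *
            gnorm v (x * cyclicIdem z (MonoidAlgebra.of Lc G s) (orderOf s) j)
          < (v r ^ expo (orderOf s) n j)⁻¹ * v r ^ (n - 1) :=
            mul_lt_mul_of_pos_left h1 (inv_pos.2 (zpow_pos hr0 _))
        _ = v r ^ (-expo (orderOf s) n j + (n - 1)) := by
            rw [← zpow_neg, ← zpow_add₀ hr0.ne']
        _ ≤ v r ^ (-(orderOf s : ℤ)) := by
            refine zpow_le_zpow_right_of_le_one₀ hr0 hr1.le ?_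
            have := expo_le (orderOf_pos s) n j
            omega
        _ = _ := by rw [h2, zpow_neg]
  have hnorm : gnorm v (x * (((hd.weightUnit hϖ n)⁻¹ : (MonoidAlgebra Lc G)ˣ) :
      MonoidAlgebra Lc G)) ≤ 1 := by
    have h1 : (((hd.weightUnit hϖ n)⁻¹ : (MonoidAlgebra Lc G)ˣ) : MonoidAlgebra Lc G) =
      cyclicDiag z (MonoidAlgebra.of Lc G s) (orderOf s) (fun j => r ^ expo (orderOf s) n j)⁻¹ := rfl
    rw [h1, cyclicDiag, Finset.mul_sum]
    refine gnorm_sum_le fun j hj => ?_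
    rw [mul_smul_comm]
    exact hpiece j (Finset.mem_range.1 hj)
  obtain ⟨w, hw⟩ := hv.exists_intMap_eq hfix (by
    rw [hbdef, mul_inv_rev, Units.val_mul, ← mul_assoc]
    exact (gnorm_mul_le _ _).trans ((mul_le_mul' hnorm hu).trans_eq (mul_one 1)))
  refine ⟨w, ?_⟩
  rw [hw]
  change x = x * (b⁻¹ : (MonoidAlgebra Lc G)ˣ) * (b : MonoidAlgebra Lc G)
  rw [mul_assoc, Units.inv_mul, mul_one]

/-- The upper bound is submultiplicativity. For the lower one, let `j` be the index whose exponent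
is exactly `n`: multiplying the generator by `ε u⁻¹` leaves `r ^ n ε`, and a nonzero idempotent has
norm at least one. -/
theorem IsTameDatum.gnorm_mul_weight [Fintype G] (hϖ : Irreducible ϖ) {u : (MonoidAlgebra Lc G)ˣ}
    (hu : gnorm v (u : MonoidAlgebra Lc G) ≤ 1)
    (hu' : gnorm v ((u⁻¹ : (MonoidAlgebra Lc G)ˣ) : MonoidAlgebra Lc G) ≤ 1) (n : ℤ) :
    gnorm v (u * hd.weightUnit hϖ n : MonoidAlgebra Lc G) = v r ^ n := by
  have hr0 := hd.map_root_pos hv hϖ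
  refine le_antisymm ((gnorm_mul_le _ _).trans ((mul_le_mul' hu
    (hd.gnorm_weight_le hv hϖ n)).trans_eq (one_mul _))) ?_
  obtain ⟨j, hj, hjn⟩ := exists_expo_eq_self (orderOf_pos s) n
  set ε := cyclicIdem z (MonoidAlgebra.of Lc G s) (orderOf s) j with hε
  have h1 : (ε * ((u⁻¹ : (MonoidAlgebra Lc G)ˣ) * (u * hd.weightUnit hϖ n) :
      MonoidAlgebra Lc G)) = r ^ n • ε := by
    rw [← mul_assoc (u⁻¹ : (MonoidAlgebra Lc G)ˣ).1, Units.inv_mul, one_mul]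
    have h2 := cyclicIdem_mul_cyclicDiag hd.primitive
      (of_pow_orderOf (Lc := Lc) (s := s)) hd.cast_ne_zero
      (fun j => r ^ expo (orderOf s) n j) hj
    rw [hjn] at h2
    exact h2
  have h2 : 1 ≤ gnorm v ε := gnorm_mul_self_le_one (hd.cyclicIdem_ne_zero hv j) (by
    rw [hε, cyclicIdem_mul hd.primitive of_pow_orderOf hd.cast_ne_zero hj hj, if_pos rfl])
  calc v r ^ n = v r ^ n * 1 := (mul_one _).symm
    _ ≤ v r ^ n * gnorm v ε := mul_le_mul' le_rfl h2
    _ = gnorm v (r ^ n • ε) := by rw [gnorm_smul, map_zpow₀]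
    _ ≤ gnorm v ε * (gnorm v ((u⁻¹ : (MonoidAlgebra Lc G)ˣ) : MonoidAlgebra Lc G) *
        gnorm v (u * hd.weightUnit hϖ n : MonoidAlgebra Lc G)) := by
      rw [← h1]
      exact (gnorm_mul_le _ _).trans (mul_le_mul' le_rfl (gnorm_mul_le _ _))
    _ ≤ 1 * (1 * _) := mul_le_mul' (hd.gnorm_cyclicIdem_le hv j) (mul_le_mul' hu' le_rfl)
    _ = _ := by rw [one_mul, one_mul]

end Lattices
end GaloisStructure
end

noncomputable section
namespace GaloisStructure
set_option linter.unusedSectionVars false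

section GaloisAlgebra
open scoped NNReal
variable {L Lc : Type u} [Field L] [Field Lc] [Algebra L Lc] {G : Type v} [Group G] [Fintype G]
  {π : (Lc ≃ₐ[L] Lc) →* G}

/-! ### Resolvends -/

theorem coeff_resolvend (a : G → Lc) (g : G) : (resolvend a).coeff g = a g⁻¹ := by
  classical
  rw [resolvend, MonoidAlgebra.coeff_sum, Finsupp.finsetSum_apply]
  simp only [MonoidAlgebra.coeff_single, Finsupp.single_apply]
  rw [Finset.sum_eq_single_of_mem g⁻¹ (Finset.mem_univ _) fun b _ hb => if_neg fun h => hb ?_,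
    if_pos (inv_inv g)]
  rw [← h, inv_inv]

theorem resolvend_injective : Function.Injective (resolvend : (G → Lc) → MonoidAlgebra Lc G) :=
  fun a b h => funext fun g => by
    rw [← inv_inv g, ← coeff_resolvend a, h, coeff_resolvend]

/-- The resolvend carries `a g` at `g⁻¹`, so equivariance under left translation by `π ω` becomes
right multiplication by `π ω`. -/
theorem isResolvend_resolvend (a : galoisAlgebra π) : IsResolvend π (resolvend a.1) := fun ω =>
  ext_coeff fun g => by
    rw [coeff_galAct, coeff_resolvend, MonoidAlgebra.of_apply,
      MonoidAlgebra.coeff_mul_single_apply, coeff_resolvend, mul_one, mul_inv_rev, inv_inv, a.2]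

/-- The element of the Galois algebra with a given resolvend. -/
def IsResolvend.toAlgebra {z : MonoidAlgebra Lc G} (hz : IsResolvend π z) : galoisAlgebra π :=
  ⟨fun h => z.coeff h⁻¹, fun ω h => by
    have := congrArg (fun x => MonoidAlgebra.coeff x h⁻¹) (hz ω)
    simp only [coeff_galAct, MonoidAlgebra.of_apply, MonoidAlgebra.coeff_mul_single_apply,
      mul_one] at this
    change z.coeff (π ω * h)⁻¹ = _
    rw [this, mul_inv_rev]⟩

theorem IsResolvend.resolvend_toAlgebra {z : MonoidAlgebra Lc G} (hz : IsResolvend π z) :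
    resolvend hz.toAlgebra.1 = z := ext_coeff fun g => by
  rw [coeff_resolvend]
  change z.coeff g⁻¹⁻¹ = _
  rw [inv_inv]

theorem resolvend_add (a b : G → Lc) : resolvend (a + b) = resolvend a + resolvend b :=
  ext_coeff fun g => by
    rw [coeff_resolvend, MonoidAlgebra.coeff_add, Finsupp.add_apply, coeff_resolvend,
      coeff_resolvend, Pi.add_apply]

theorem resolvend_smul_group (g : G) (a : galoisAlgebra π) :
    resolvend (g • a).1 = MonoidAlgebra.of Lc G g * resolvend a.1 := ext_coeff fun k => by
  rw [coeff_resolvend, smul_apply, MonoidAlgebra.of_apply, MonoidAlgebra.coeff_single_mul_apply,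
    one_mul, coeff_resolvend, mul_inv_rev, inv_inv]

theorem resolvend_smul_base (l : L) (a : galoisAlgebra π) :
    resolvend (l • a).1 = algebraMap L Lc l • resolvend a.1 := ext_coeff fun k => by
  rw [coeff_resolvend, MonoidAlgebra.coeff_smul_apply, coeff_resolvend, smul_eq_mul,
    ← Algebra.smul_def]
  rfl

theorem resolvend_smul [ValuativeRel L] (w : MonoidAlgebra 𝒪[L] G) (a : galoisAlgebra π) :
    resolvend (w • a).1 = intMap L Lc G w * resolvend a.1 := by
  induction w using MonoidAlgebra.induction_linear with
  | zero =>
    rw [zero_smul, map_zero, zero_mul]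
    exact ext_coeff fun g => coeff_resolvend _ _
  | add x y hx hy =>
    rw [add_smul, map_add, add_mul, ← hx, ← hy]
    exact resolvend_add _ _
  | single g r =>
    rw [single_smul, intMap, MonoidAlgebra.mapRingHom_single]
    have h := resolvend_smul_base (r : L) (g • a)
    rw [resolvend_smul_group] at h
    refine h.trans ?_
    rw [MonoidAlgebra.of_apply, ← smul_mul_assoc, MonoidAlgebra.smul_single, smul_eq_mul, mul_one]
    rfl

theorem gnorm_resolvend_le_iff {v : Valuation Lc ℝ≥0} {a : G → Lc} {c : ℝ≥0} :
    gnorm v (resolvend a) ≤ c ↔ ∀ h, v (a h) ≤ c := by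
  rw [gnorm_le_iff]
  refine ⟨fun H h => ?_, fun H h => ?_⟩
  · rw [← inv_inv h, ← coeff_resolvend a]
    exact H _
  · rw [coeff_resolvend]
    exact H _

variable [ValuativeRel L] {v : Valuation Lc ℝ≥0} (hv : IsExtendedValuation L v)

include hv in
/-- An element of the Galois algebra is integral if and only if all its values are. -/
theorem IsExtendedValuation.mem_integers_iff {a : galoisAlgebra π} :
    a ∈ integers π ↔ ∀ h, v (a.1 h) ≤ 1 := by
  rw [mem_integralClosure_iff]
  constructor
  · intro ha h
    rw [hv.le_one_iff]
    exact ha.map (((Pi.evalAlgHom L (fun _ : G => Lc) h).comp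
      (galoisAlgebra π).val).restrictScalars 𝒪[L])
  · intro ha
    have h1 : ∀ h, IsIntegral 𝒪[L] (a.1 h) := fun h => (hv.le_one_iff _).1 (ha h)
    choose p hp hpa using h1
    -- The product of integral equations for the separate values annihilates all of them at once.
    refine ⟨∏ h, p h, Polynomial.monic_prod_of_monic _ _ fun h _ => hp h, ?_⟩
    refine Subtype.ext (funext fun h => ?_)
    let φ : galoisAlgebra π →ₐ[𝒪[L]] Lc := ((Pi.evalAlgHom L (fun _ : G => Lc) h).comp
      (galoisAlgebra π).val).restrictScalars 𝒪[L]
    change φ (Polynomial.aeval a (∏ h, p h)) = 0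
    rw [← Polynomial.aeval_algHom_apply, map_prod]
    exact Finset.prod_eq_zero (Finset.mem_univ h) (hpa h)

/-! ### The trace form -/

section Trace
variable [TopologicalSpace L] [IsNonarchimedeanLocalField L] [CharZero L] [CharZero Lc]
  [IsAlgClosed Lc] [Algebra.IsAlgebraic L Lc]
variable {b : (MonoidAlgebra Lc G)ˣ} (hb : IsResolvend π (b : MonoidAlgebra Lc G))

theorem IsResolvend.linearIndependent :
    LinearIndependent L fun g : G => g • hb.toAlgebra := by
  rw [Fintype.linearIndependent_iff]
  intro l hl g
  have h1 : resolvend (∑ g : G, l g • g • hb.toAlgebra : galoisAlgebra π).1 =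
      (∑ g, MonoidAlgebra.single g (algebraMap L Lc (l g))) * b := by
    rw [Finset.sum_mul]
    have h2 : ∀ S : Finset G, resolvend (∑ g ∈ S, l g • g • hb.toAlgebra : galoisAlgebra π).1 =
        ∑ g ∈ S, MonoidAlgebra.single g (algebraMap L Lc (l g)) * (b : MonoidAlgebra Lc G) :=
      fun S => by
        classical
        induction S using Finset.induction_on with
        | empty => exact ext_coeff fun g => coeff_resolvend _ _
        | insert g S hg ih =>
          rw [Finset.sum_insert hg, Finset.sum_insert hg, ← ih]
          refine (resolvend_add _ _).trans ?_
          rw [resolvend_smul_base, resolvend_smul_group, hb.resolvend_toAlgebra,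
            MonoidAlgebra.of_apply, ← smul_mul_assoc, MonoidAlgebra.smul_single, smul_eq_mul,
            mul_one]
    exact h2 _
  rw [hl] at h1
  have h2 : (∑ g, MonoidAlgebra.single g (algebraMap L Lc (l g)) : MonoidAlgebra Lc G) = 0 := by
    have h3 : resolvend (0 : galoisAlgebra π).1 = 0 := ext_coeff fun g => coeff_resolvend _ _
    rw [h3] at h1
    exact (Units.mul_left_eq_zero b).1 h1.symm
  have h3 := congrArg (fun x => MonoidAlgebra.coeff x g) h2
  classical
  simp only [MonoidAlgebra.coeff_sum, Finsupp.finsetSum_apply, MonoidAlgebra.coeff_single,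
    Finsupp.single_apply] at h3
  rw [Finset.sum_ite_eq' Finset.univ g, if_pos (Finset.mem_univ g)] at h3
  exact (map_eq_zero _).1 h3

/-- The coordinates of `a` are the coefficients of its resolvend times `b⁻¹`, which are Galois
invariant. -/
theorem IsResolvend.span_eq_top :
    ⊤ ≤ Submodule.span L (Set.range fun g : G => g • hb.toAlgebra) := by
  rintro a -
  have : IsGalois L Lc := isGalois_of_isAlgClosed
  have h1 := (isResolvend_resolvend a).mul_inv hb
  have h2 : ∀ g, ∃ l : L, algebraMap L Lc l =
      (resolvend a.1 * ((b⁻¹ : (MonoidAlgebra Lc G)ˣ) : MonoidAlgebra Lc G)).coeff g := fun g =>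
    mem_of_forall_fixed (L := L) fun ω => by rw [← coeff_galAct, h1]
  choose l hl using h2
  have h3 : a = ∑ g, l g • g • hb.toAlgebra := by
    refine Subtype.ext (funext fun k => ?_)
    have h4 : resolvend a.1 =
        (resolvend a.1 * ((b⁻¹ : (MonoidAlgebra Lc G)ˣ) : MonoidAlgebra Lc G)) * b := by
      rw [mul_assoc, Units.inv_mul, mul_one]
    have h5 := congrArg (fun x => MonoidAlgebra.coeff x k⁻¹) h4
    simp only [coeff_resolvend, inv_inv] at h5
    rw [h5, MonoidAlgebra.coeff_mul_apply_left, Finsupp.sum_fintype _ _ fun _ => zero_mul _]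
    have h6 : (∑ g, l g • g • hb.toAlgebra : galoisAlgebra π).1 k =
        ∑ g, (l g • g • hb.toAlgebra : galoisAlgebra π).1 k := by
      have := map_sum ((Pi.evalAlgHom L (fun _ : G => Lc) k).comp (galoisAlgebra π).val)
        (fun g => l g • g • hb.toAlgebra) Finset.univ
      exact this
    rw [h6]
    refine Finset.sum_congr rfl fun g _ => ?_
    rw [← hl]
    change _ = l g • (b : MonoidAlgebra Lc G).coeff (k * g)⁻¹
    rw [Algebra.smul_def, mul_inv_rev]
  rw [h3]
  exact Submodule.sum_mem _ fun g _ => Submodule.smul_mem _ _ (Submodule.subset_span ⟨g, rfl⟩)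

/-- The normal basis of the Galois algebra generated by an element with invertible resolvend. -/
def IsResolvend.basis : Module.Basis G L (galoisAlgebra π) :=
  Module.Basis.mk hb.linearIndependent hb.span_eq_top

theorem IsResolvend.basis_apply (g : G) : hb.basis g = g • hb.toAlgebra :=
  Module.Basis.mk_apply _ _ _

theorem IsResolvend.toAlgebra_mul_apply (k g : G) :
    hb.toAlgebra.1 (k * g) = (b : MonoidAlgebra Lc G).coeff (g⁻¹ * k⁻¹) := by
  rw [← mul_inv_rev]; rfl

/-- The coefficients of `b⁻¹` invert the matrix of values of the conjugates of the generator. This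
is what makes the trace and the inverse different computable. -/
theorem IsResolvend.sum_mul_coeff_inv [DecidableEq G] (k l : G) :
    ∑ g, hb.toAlgebra.1 (k * g) *
      ((b⁻¹ : (MonoidAlgebra Lc G)ˣ) : MonoidAlgebra Lc G).coeff (l * g) =
        if k = l then 1 else 0 := by
  have h1 := congrArg (fun x => MonoidAlgebra.coeff x (l * k⁻¹)) b.inv_mul
  simp only [MonoidAlgebra.coeff_mul_apply_left, MonoidAlgebra.one_def, MonoidAlgebra.coeff_single,
    Finsupp.single_apply] at h1
  rw [Finsupp.sum_fintype _ _ fun _ => zero_mul _, ← Equiv.sum_comp (Equiv.mulLeft l)] at h1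
  simp only [Equiv.coe_mulLeft] at h1
  have h2 : (1 = l * k⁻¹) ↔ k = l := by rw [eq_comm, mul_inv_eq_one, eq_comm]
  rw [if_congr h2 rfl rfl] at h1
  rw [← h1]
  refine Finset.sum_congr rfl fun g _ => ?_
  rw [hb.toAlgebra_mul_apply, mul_comm, mul_inv_rev, mul_assoc, ← mul_assoc l⁻¹,
    inv_mul_cancel, one_mul]

include hb in
/-- The trace of the Galois algebra is the sum of the values. -/
theorem IsResolvend.algebraMap_trace (a : galoisAlgebra π) :
    algebraMap L Lc (Algebra.trace L (galoisAlgebra π) a) = ∑ h, a.1 h := by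
  classical
  rw [Algebra.trace_eq_matrix_trace hb.basis]
  set M := (Algebra.leftMulMatrix hb.basis a).map (algebraMap L Lc) with hM
  set P : Matrix G G Lc := Matrix.of fun k g => hb.toAlgebra.1 (k * g) with hP
  set Q : Matrix G G Lc := Matrix.of fun g l =>
    ((b⁻¹ : (MonoidAlgebra Lc G)ˣ) : MonoidAlgebra Lc G).coeff (l * g) with hQ
  have hPQ : P * Q = 1 := by
    ext k l
    rw [Matrix.mul_apply, Matrix.one_apply]
    exact hb.sum_mul_coeff_inv k l
  -- The matrix of values of the basis diagonalizes multiplication by `a`, with the values of `a` on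
  -- the diagonal.
  have hPM : P * M = Matrix.diagonal a.1 * P := by
    ext k h
    rw [Matrix.mul_apply, Matrix.diagonal_mul]
    have h1 := hb.basis.sum_repr (a * hb.basis h)
    have h2 := congrArg ((Pi.evalAlgHom L (fun _ : G => Lc) k).comp (galoisAlgebra π).val) h1
    rw [map_sum] at h2
    simp only [map_smul, map_mul, hb.basis_apply] at h2
    change ∑ g, _ • hb.toAlgebra.1 (k * g) = a.1 k * hb.toAlgebra.1 (k * h) at h2
    change _ = a.1 k * hb.toAlgebra.1 (k * h)
    rw [← h2]
    refine Finset.sum_congr rfl fun g _ => ?_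
    rw [hM, Matrix.map_apply, Algebra.leftMulMatrix_eq_repr_mul, Algebra.smul_def, mul_comm,
      hb.basis_apply]
    rfl
  have hQP : Q * P = 1 := mul_eq_one_comm.1 hPQ
  have h3 : M.trace = (Matrix.diagonal a.1).trace := by
    calc M.trace = (Q * P * M).trace := by rw [hQP, one_mul]
      _ = (Q * (Matrix.diagonal a.1 * P)).trace := by rw [mul_assoc, hPM]
      _ = (Matrix.diagonal a.1 * P * Q).trace := Matrix.trace_mul_comm _ _
      _ = _ := by rw [mul_assoc, hPQ, mul_one]
  rw [Matrix.trace_diagonal] at h3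
  rw [← h3, hM]
  exact AddMonoidHom.map_trace (algebraMap L Lc).toAddMonoidHom _
end Trace

end GaloisAlgebra
end GaloisStructure
end

noncomputable section
namespace GaloisStructure
set_option linter.unusedSectionVars false

/-! ### Ideals cut out by the valuation, the inverse different and its square root -/

section Ideals
open scoped NNReal
variable {L Lc : Type u} [Field L] [Field Lc] [Algebra L Lc] {G : Type v} [Group G] [Fintype G]
  {π : (Lc ≃ₐ[L] Lc) →* G} [ValuativeRel L] {v : Valuation Lc ℝ≥0} (hv : IsExtendedValuation L v)

theorem galoisAlgebra_sum_apply {ι : Type*} (S : Finset ι) (f : ι → galoisAlgebra π) (k : G) :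
    (∑ i ∈ S, f i).1 k = ∑ i ∈ S, (f i).1 k :=
  map_sum ((Pi.evalAlgHom L (fun _ : G => Lc) k).comp (galoisAlgebra π).val) f S

/-! ### Submodules cut out by the valuation -/

variable (π) in
/-- The elements of the Galois algebra all of whose values are bounded by `c`. -/
def valuationIdeal (c : ℝ≥0) : Submodule (integers π) (galoisAlgebra π) where
  carrier := {x | ∀ h, v (x.1 h) ≤ c}
  zero_mem' h := by
    change v 0 ≤ c
    rw [map_zero]
    exact zero_le
  add_mem' {x y} hx hy h := (v.map_add _ _).trans (max_le (hx h) (hy h))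
  smul_mem' a x hx h := by
    change v (a.1.1 h * x.1 h) ≤ c
    rw [map_mul]
    exact (mul_le_mul' (hv.mem_integers_iff.1 a.2 h) (hx h)).trans_eq (one_mul c)

include hv in
/-- Membership in a submodule over the maximal order can be tested one value at a time. -/
theorem mem_of_forall_exists_le (N : Submodule (integers π) (galoisAlgebra π))
    (x : galoisAlgebra π) (H : ∀ h, ∃ m ∈ N, v (x.1 h) ≤ v (m.1 h)) : x ∈ N := by
  classical
  -- The equivariance condition only relates values on one coset of the range of `π`, so `x` may be
  -- cut down to each coset separately.
  let Q := Quotient (QuotientGroup.rightRel π.range)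
  have hQ : ∀ (ω : Lc ≃ₐ[L] Lc) (k : G), (Quotient.mk _ (π ω * k) : Q) = Quotient.mk _ k :=
    fun ω k => Quotient.sound (QuotientGroup.rightRel_apply.2
      (by rw [mul_inv_rev, mul_inv_cancel_left]; exact ⟨ω⁻¹, map_inv π ω⟩))
  have hQ' : ∀ h k : G, (Quotient.mk _ k : Q) = Quotient.mk _ h → ∃ ω, k = π ω * h :=
    fun h k hk => by
      obtain ⟨ω, hω⟩ := QuotientGroup.rightRel_apply.1 (Quotient.exact hk.symm)
      exact ⟨ω, by rw [hω, inv_mul_cancel_right]⟩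
  let cut : Q → galoisAlgebra π := fun q => ⟨fun k => if Quotient.mk _ k = q then x.1 k else 0,
    fun ω k => by
      simp only [hQ]
      split_ifs
      · exact x.2 ω k
      · exact (map_zero ω).symm⟩
  have hsum : x = ∑ q, cut q := by
    refine Subtype.ext (funext fun k => ?_)
    rw [galoisAlgebra_sum_apply]
    change x.1 k = ∑ q, if Quotient.mk _ k = q then x.1 k else 0
    rw [Finset.sum_ite_eq, if_pos (Finset.mem_univ _)]
  rw [hsum]
  refine Submodule.sum_mem _ fun q _ => ?_
  obtain ⟨h, rfl⟩ := Quotient.exists_rep q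
  obtain ⟨m, hm, hle⟩ := H h
  have hle' : ∀ k : G, (Quotient.mk _ k : Q) = Quotient.mk _ h → v (x.1 k) ≤ v (m.1 k) :=
    fun k hk => by
      obtain ⟨ω, rfl⟩ := hQ' h k hk
      rwa [x.2, m.2, hv.map_equiv, hv.map_equiv]
  -- On one coset the quotient `x / m` is integral, so this piece of `x` is a multiple of `m`. Where
  -- `m` vanishes, so does `x`, and division by zero does no harm.
  let y : galoisAlgebra π := ⟨fun k =>
    if (Quotient.mk _ k : Q) = Quotient.mk _ h then x.1 k / m.1 k else 0, fun ω k => by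
      simp only [hQ]
      split_ifs
      · rw [x.2, m.2, map_div₀]
      · exact (map_zero ω).symm⟩
  have hy : y ∈ integers π := hv.mem_integers_iff.2 fun k => by
    change v (if _ then _ else _) ≤ 1
    split_ifs with hk
    · rw [map_div₀]
      exact div_le_one_of_le₀ (hle' k hk) zero_le
    · rw [map_zero]; exact zero_le
  have : cut (Quotient.mk _ h) = (⟨y, hy⟩ : integers π) • m := by
    refine Subtype.ext (funext fun k => ?_)
    change (if _ then _ else _) = (if _ then _ else _) * m.1 k
    split_ifs with hk
    · by_cases hm0 : m.1 k = 0
      · have := hle' k hk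
        rw [hm0, map_zero] at this
        rw [hm0, mul_zero]
        exact (Valuation.zero_iff v).1 (le_antisymm this zero_le)
      · rw [div_mul_cancel₀ _ hm0]
    · rw [zero_mul]
  rw [this]
  exact N.smul_mem _ hm

variable [TopologicalSpace L] [IsNonarchimedeanLocalField L] [CharZero L] [CharZero Lc]
  [IsAlgClosed Lc] [Algebra.IsAlgebraic L Lc]
variable {s : G} {F : Lc ≃ₐ[L] Lc} {z r : Lc} {ϖ : 𝒪[L]} (hd : IsTameDatum π s F z r ϖ)
  (hϖ : Irreducible ϖ)

include hv hd hϖ in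
/-- Tamely ramified Galois algebras have a unit of the maximal order of the group ring whose
products with all the weights are resolvends. -/
theorem IsTameDatum.exists_isResolvend (hπ : IsOpen (π.ker : Set (Lc ≃ₐ[L] Lc))) :
    ∃ u : (MonoidAlgebra Lc G)ˣ, gnorm v (u : MonoidAlgebra Lc G) ≤ 1 ∧
      gnorm v ((u⁻¹ : (MonoidAlgebra Lc G)ˣ) : MonoidAlgebra Lc G) ≤ 1 ∧
      ∀ n, IsResolvend π ((u * hd.weightUnit hϖ n : (MonoidAlgebra Lc G)ˣ) :
        MonoidAlgebra Lc G) := by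
  obtain ⟨u, hu, hu', huF, huI⟩ := hv.exists_normal_unit hd.frobenius (π F)
  refine ⟨u, hu, hu', fun n => hv.isResolvend hπ hd.frobenius ?_ fun ω hω => ?_⟩
  · have := hd.galAct_frobenius_weight n
    change galAct G F (u * weight s z r n) = u * weight s z r n * _
    rw [map_mul, huF, mul_assoc, this, mul_assoc]
  · have := hd.galAct_inertia_weight n hω
    change galAct G ω (u * weight s z r n) = u * weight s z r n * _
    rw [map_mul, huI ω hω, this, mul_assoc]

variable {u : (MonoidAlgebra Lc G)ˣ} (hu : gnorm v (u : MonoidAlgebra Lc G) ≤ 1)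
  (hu' : gnorm v ((u⁻¹ : (MonoidAlgebra Lc G)ˣ) : MonoidAlgebra Lc G) ≤ 1)
  (hb : ∀ n, IsResolvend π ((u * hd.weightUnit hϖ n : (MonoidAlgebra Lc G)ˣ) :
        MonoidAlgebra Lc G))

include hv hu hu' in
theorem IsTameDatum.map_toAlgebra_le (n : ℤ) (h : G) :
    v ((hb n).toAlgebra.1 h) ≤ v r ^ n := by
  refine gnorm_resolvend_le_iff.1 ?_ h
  rw [(hb n).resolvend_toAlgebra]
  exact (hd.gnorm_mul_weight hv hϖ hu hu' n).le

-- The norm of the resolvend is attained at some coefficient, and translation by `G` carries that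
-- coefficient to the place `h`.
include hv hu hu' in
theorem IsTameDatum.exists_map_smul_eq (n : ℤ) (h : G) :
    ∃ g : G, v ((g • (hb n).toAlgebra).1 h) = v r ^ n := by
  by_contra! H
  have h1 : gnorm v ((u * hd.weightUnit hϖ n : (MonoidAlgebra Lc G)ˣ) : MonoidAlgebra Lc G) <
      v r ^ n := by
    rw [gnorm_lt_iff (zpow_pos (hd.map_root_pos hv hϖ) n)]
    intro k
    refine lt_of_le_of_ne ?_ ?_
    · exact (le_gnorm _ k).trans (hd.gnorm_mul_weight hv hϖ hu hu' n).le
    · have := H (h⁻¹ * k⁻¹)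
      rw [smul_apply, mul_inv_cancel_left] at this
      change v (MonoidAlgebra.coeff _ k⁻¹⁻¹) ≠ _ at this
      rwa [inv_inv] at this
  exact h1.ne (hd.gnorm_mul_weight hv hϖ hu hu' n)

-- Nonzero elements of `L` have integral powers of `v ϖ = v r ^ e` as values, and those with a
-- negative exponent exceed the bound.
include hv hd hϖ in
theorem IsExtendedValuation.mem_integer_of_le {l : L}
    (hl : v (algebraMap L Lc l) ≤ v r ^ (-(orderOf s - 1) : ℤ)) : l ∈ 𝒪[L] := by
  rw [← hv.algebraMap_le_one_iff]
  by_cases hl0 : l = 0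
  · rw [hl0, map_zero, map_zero]; exact zero_le
  obtain ⟨k, hk⟩ := hv.exists_zpow_eq hϖ hl0
  have hr0 := hd.map_root_pos hv hϖ
  have hr1 := hd.map_root_lt_one hv hϖ
  have hs := orderOf_pos s
  rw [hk] at hl ⊢
  rw [← hd.root_pow, map_pow, ← zpow_natCast, ← zpow_mul] at hl ⊢
  rw [zpow_le_zpow_iff_right_of_lt_one₀ hr0 hr1] at hl
  refine zpow_le_one₀ hr0 hr1.le ?_
  have hs' : (0 : ℤ) < orderOf s := by exact_mod_cast hs
  by_contra! h
  have : k ≤ -1 := by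
    by_contra! h'
    exact absurd h (not_lt.2 (mul_nonneg hs'.le (by omega)))
  nlinarith

include hd hϖ hu hu' hb in
/-- The inverse different of a tamely ramified Galois algebra. -/
theorem IsTameDatum.codifferent_eq :
    codifferent π = valuationIdeal π hv (v r ^ (-(orderOf s - 1) : ℤ)) := by
  classical
  ext x
  constructor
  -- The values of `x` are recovered from its traces against the conjugates of an integral
  -- generator. These traces are integral, and the inverse matrix has entries bounded by `v r ^ (-(e
  -- - 1))`, with `e` the order of `s`.
  · intro hx l
    have h1 : ∀ g : G, g • (hb 0).toAlgebra ∈ integers π := fun g =>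
      hv.mem_integers_iff.2 fun h => by
        rw [smul_apply]
        exact (hd.map_toAlgebra_le hv hϖ hu hu' hb 0 _).trans_eq (zpow_zero _)
    have h2 : ∀ g : G, v (∑ k, x.1 k * (hb 0).toAlgebra.1 (k * g)) ≤ 1 := fun g => by
      have := hx ⟨_, h1 g⟩
      rw [← hv.algebraMap_le_one_iff, (hb 0).algebraMap_trace] at this
      exact this
    have h3 : x.1 l = ∑ g, (∑ k, x.1 k * (hb 0).toAlgebra.1 (k * g)) *
        (((u * hd.weightUnit hϖ 0)⁻¹ : (MonoidAlgebra Lc G)ˣ) : MonoidAlgebra Lc G).coeff (l * g) := by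
      simp only [Finset.sum_mul]
      rw [Finset.sum_comm]
      simp only [mul_assoc, ← Finset.mul_sum, (hb 0).sum_mul_coeff_inv]
      simp
    rw [h3]
    refine v.map_sum_le fun g _ => ?_
    rw [map_mul]
    refine (mul_le_mul' (h2 g) (le_gnorm _ _)).trans ?_
    rw [one_mul, mul_inv_rev, Units.val_mul]
    refine (gnorm_mul_le _ _).trans
      ((mul_le_mul' (hd.gnorm_weightUnit_inv_le hv hϖ 0) hu').trans_eq ?_)
    rw [mul_one, zero_add]
  -- A priori the trace only satisfies the bound of the ideal; lying in `L`, it is then integral.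
  · intro hx y
    refine hv.mem_integer_of_le hd hϖ ?_
    rw [(hb 0).algebraMap_trace]
    refine v.map_sum_le fun h _ => ?_
    change v (x.1 h * y.1.1 h) ≤ _
    rw [map_mul]
    exact (mul_le_mul' (hx h) (hv.mem_integers_iff.1 y.2 h)).trans_eq (mul_one _)

-- Multiplication by `ϖ`, a power of `r` with exponent at least `d`, clears the denominators.
include hd hϖ in
theorem IsTameDatum.isFractional_valuationIdeal {d : ℕ} (hdn : d ≤ orderOf s) :
    IsFractional (nonZeroDivisors (integers π)) (valuationIdeal π hv (v r ^ (-d : ℤ))) := by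
  have hr0 := hd.map_root_pos hv hϖ
  have hr1 := hd.map_root_lt_one hv hϖ
  have hϖ0 : algebraMap 𝒪[L] Lc ϖ ≠ 0 := fun h =>
    hϖ.ne_zero ((FaithfulSMul.algebraMap_injective 𝒪[L] Lc) (by rw [h, map_zero]))
  refine ⟨algebraMap 𝒪[L] (integers π) ϖ, ?_, fun x hx => ?_⟩
  · rw [mem_nonZeroDivisors_iff_right]
    intro y hy
    refine Subtype.ext (Subtype.ext (funext fun h => ?_))
    have h1 : y.1.1 h * algebraMap 𝒪[L] Lc ϖ = 0 :=
      congrFun (congrArg (fun a : integers π => a.1.1) hy) h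
    exact (mul_eq_zero.1 h1).resolve_right hϖ0
  · refine ⟨⟨algebraMap 𝒪[L] (integers π) ϖ • x, hv.mem_integers_iff.2 fun h => ?_⟩, rfl⟩
    change v (algebraMap 𝒪[L] Lc ϖ * x.1 h) ≤ 1
    rw [map_mul, ← hd.root_pow, map_pow]
    refine (mul_le_mul' le_rfl (hx h)).trans ?_
    rw [← zpow_natCast, ← zpow_add₀ hr0.ne']
    exact zpow_le_one₀ hr0 hr1.le (by omega)

-- Membership is tested one value at a time. At each place a translate of the generator attains the
-- bound, so its square attains the bound for the product.
include hd hϖ hu hu' hb in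
theorem IsTameDatum.valuationIdeal_mul_self (d : ℤ) {N : Submodule (integers π) (galoisAlgebra π)}
    (hN : N = valuationIdeal π hv (v r ^ d)) : N * N = valuationIdeal π hv (v r ^ (2 * d)) := by
  have hr0 := hd.map_root_pos hv hϖ
  have hsq : v r ^ (2 * d) = v r ^ d * v r ^ d := by rw [two_mul, zpow_add₀ hr0.ne']
  subst hN
  refine le_antisymm (Submodule.mul_le.2 fun x hx y hy h => ?_) fun x hx => ?_
  · change v (x.1 h * y.1 h) ≤ _
    rw [map_mul, hsq]
    exact mul_le_mul' (hx h) (hy h)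
  · refine mem_of_forall_exists_le hv _ x fun h => ?_
    obtain ⟨g, hg⟩ := hd.exists_map_smul_eq hv hϖ hu hu' hb d h
    have h1 : g • (hb d).toAlgebra ∈ valuationIdeal π hv (v r ^ d) := fun k => by
      rw [smul_apply]
      exact hd.map_toAlgebra_le hv hϖ hu hu' hb d _
    refine ⟨_, Submodule.mul_mem_mul h1 h1, (hx h).trans_eq ?_⟩
    change _ = v ((g • (hb d).toAlgebra).1 h * (g • (hb d).toAlgebra).1 h)
    rw [map_mul, hg, hsq]

-- One inclusion follows by squaring elements of `N`. For the other, if the test for membership in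
-- `N` failed at a place `h`, all of `N` would be strictly below `v r ^ d` there, and all of `N * N`
-- strictly below `v r ^ (2 * d)`, although some element of `N * N` attains this value.
include hd hϖ hu hu' hb in
theorem IsTameDatum.eq_of_mul_self_eq (d : ℤ) {N : Submodule (integers π) (galoisAlgebra π)}
    (hN : N * N = valuationIdeal π hv (v r ^ (2 * d))) : N = valuationIdeal π hv (v r ^ d) := by
  have hr0 := hd.map_root_pos hv hϖ
  have hsq : v r ^ (2 * d) = v r ^ d * v r ^ d := by rw [two_mul, zpow_add₀ hr0.ne']
  refine le_antisymm (fun x hx h => ?_) fun x hx => ?_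
  · have h1 : x * x ∈ valuationIdeal π hv (v r ^ (2 * d)) := hN ▸ Submodule.mul_mem_mul hx hx
    have h2 : v (x.1 h * x.1 h) ≤ v r ^ (2 * d) := h1 h
    rw [map_mul, hsq] at h2
    exact le_of_not_gt fun h3 => absurd h2 (not_le.2 (mul_lt_mul'' h3 h3 zero_le zero_le))
  · refine mem_of_forall_exists_le hv _ x fun h => ?_
    by_contra! H
    have h1 : ∀ m ∈ N, v (m.1 h) < v r ^ d := fun m hm => (H m hm).trans_le (hx h)
    have h2 : ∀ m ∈ N * N, v (m.1 h) < v r ^ (2 * d) := fun m hm => by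
      refine Submodule.mul_induction_on hm (fun a ha b hb => ?_) fun a b ha hb =>
        (v.map_add _ _).trans_lt (max_lt ha hb)
      change v (a.1 h * b.1 h) < _
      rw [map_mul, hsq]
      exact mul_lt_mul'' (h1 a ha) (h1 b hb) zero_le zero_le
    obtain ⟨g, hg⟩ := hd.exists_map_smul_eq hv hϖ hu hu' hb (2 * d) h
    have h3 : g • (hb (2 * d)).toAlgebra ∈ N * N := by
      rw [hN]
      intro k
      rw [smul_apply]
      exact hd.map_toAlgebra_le hv hϖ hu hu' hb _ _
    exact (h2 _ h3).ne hg

end Ideals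
end GaloisStructure
end

noncomputable section
namespace GaloisStructure
set_option linter.unusedSectionVars false

/-! ### Classes of free lattices in the relative `K`-group -/

section FreeClass
variable {R : Type u} {𝔄 : Type w} [CommRing R] [Ring 𝔄] [Algebra R 𝔄] [Module.Finite R 𝔄]
variable {Λ : Type v} [Field Λ] [Algebra R Λ]

theorem K0.mk_one (P : ProjMod R 𝔄) : K0.mk (⟨P, P, 1⟩ : Triple R 𝔄 Λ) = 0 := by
  have := K0.mk_comp P P P (1 : LatIso Λ P P) 1
  rwa [LatIso.comp_one, left_eq_add] at this

/-- An exact sequence with first term zero compares the triple with an identity, and identities have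
class zero by the composition relation. -/
theorem K0.mk_ofEquiv {M N : ProjMod R 𝔄} (α : M ≃ₗ[𝔄] N) :
    K0.mk (⟨M, N, LatIso.ofEquiv α⟩ : Triple R 𝔄 Λ) = 0 := by
  have h1 : K0.mk (⟨M, N, LatIso.ofEquiv α⟩ : Triple R 𝔄 Λ) =
      K0.mk ⟨ProjMod.zero R 𝔄, ProjMod.zero R 𝔄, 1⟩ + K0.mk ⟨N, N, 1⟩ := by
    rw [← sub_eq_zero]
    refine (QuotientAddGroup.eq_zero_iff _).2 (AddSubgroup.subset_closure (Relator.exact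
      ⟨ProjMod.zero R 𝔄, ProjMod.zero R 𝔄, 1⟩ ⟨M, N, LatIso.ofEquiv α⟩ ⟨N, N, 1⟩ 0 α.toLinearMap 0
      LinearMap.id (Function.injective_of_subsingleton (α := PUnit) _) ?_ α.surjective
      (Function.injective_of_subsingleton (α := PUnit) _) ?_ Function.surjective_id ?_ ?_))
    · intro x
      refine ⟨fun h => ⟨0, (α.map_eq_zero_iff.1 h).symm⟩, ?_⟩
      rintro ⟨y, rfl⟩
      exact map_zero α
    · intro x
      refine ⟨fun h => ⟨0, h.symm⟩, ?_⟩
      rintro ⟨y, rfl⟩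
      rfl
    · intro x
      rw [ext_zero, ext_zero, map_zero]
    · intro x
      rw [LatIso.one_apply, ext_id]
      rfl
  rw [h1, K0.mk_one, K0.mk_one, add_zero]

theorem boundary_mul_inv (x y : (Λ ⊗[R] 𝔄)ˣ) :
    boundary (x * y⁻¹) = boundary x - boundary y := by
  rw [eq_sub_iff_add_eq, ← boundary_mul, inv_mul_cancel_right]

end FreeClass

/-! ### Boundaries under extension of scalars -/

section Extend
variable (R : Type*) (𝔄 : Type*) [CommRing R] [Ring 𝔄] [Algebra R 𝔄]
variable (Λ : Type*) [CommRing Λ] [Algebra R Λ]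
variable (Λ' : Type*) [CommRing Λ'] [Algebra R Λ'] [Algebra Λ Λ'] [IsScalarTower R Λ Λ']

/-- The extension of scalars `Λ ⊗ 𝔄 → Λ' ⊗ 𝔄`. -/
def tensorExtend : Λ ⊗[R] 𝔄 →ₐ[R] Λ' ⊗[R] 𝔄 :=
  Algebra.TensorProduct.map (IsScalarTower.toAlgHom R Λ Λ') (AlgHom.id R 𝔄)

theorem tensorExtend_tmul (l : Λ) (a : 𝔄) :
    tensorExtend R 𝔄 Λ Λ' (l ⊗ₜ a) = algebraMap Λ Λ' l ⊗ₜ a := rfl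

variable {R 𝔄 Λ}

theorem cancelBaseChange_tmul_mul (l : Λ') (a : 𝔄) (x : Λ ⊗[R] 𝔄) :
    TensorProduct.AlgebraTensorModule.cancelBaseChange R Λ Λ' Λ' 𝔄 (l ⊗ₜ[Λ] ((1 ⊗ₜ a) * x)) =
      (l ⊗ₜ a) * tensorExtend R 𝔄 Λ Λ' x := by
  induction x with
  | zero => rw [mul_zero, TensorProduct.tmul_zero, map_zero, map_zero, mul_zero]
  | add x y hx hy => rw [mul_add, TensorProduct.tmul_add, map_add, map_add, mul_add, hx, hy]
  | tmul m b =>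
    rw [Algebra.TensorProduct.tmul_mul_tmul, tensorExtend_tmul, Algebra.TensorProduct.tmul_mul_tmul,
      TensorProduct.AlgebraTensorModule.cancelBaseChange_tmul, one_mul, Algebra.smul_def, mul_comm]

end Extend

section ExtendBoundary
variable {R : Type u} {𝔄 : Type w} [CommRing R] [Ring 𝔄] [Algebra R 𝔄]
variable {Λ : Type v} [CommRing Λ] [Algebra R Λ]
variable {Λ' : Type*} [CommRing Λ'] [Algebra R Λ'] [Algebra Λ Λ'] [IsScalarTower R Λ Λ']

theorem rightMul_baseChange (X : (Λ ⊗[R] 𝔄)ˣ) (X' : (Λ' ⊗[R] 𝔄)ˣ)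
    (h : tensorExtend R 𝔄 Λ Λ' X = X') : (rightMul X).baseChange Λ' = rightMul X' := by
  refine LatIso.ext' fun y => ?_
  change Λ' ⊗[R] 𝔄 at y
  induction y with
  | zero => exact (map_zero _).trans (map_zero _).symm
  | add x y hx hy =>
    exact (map_add ((rightMul X).baseChange Λ').toEquiv x y).trans
      ((congrArg₂ (· + ·) hx hy).trans (map_add (rightMul X').toEquiv x y).symm)
  | tmul l a =>
    change TensorProduct.AlgebraTensorModule.cancelBaseChange R Λ Λ' Λ' 𝔄
      ((mulRightEquiv R X).baseChange Λ Λ' _ _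
        ((TensorProduct.AlgebraTensorModule.cancelBaseChange R Λ Λ' Λ' 𝔄).symm (l ⊗ₜ a))) =
      (l ⊗ₜ a) * (X' : Λ' ⊗[R] 𝔄)
    rw [← h, ← cancelBaseChange_tmul_mul, TensorProduct.AlgebraTensorModule.cancelBaseChange_symm_tmul]
    rfl

theorem baseChange_boundary (X : (Λ ⊗[R] 𝔄)ˣ) (X' : (Λ' ⊗[R] 𝔄)ˣ)
    (h : tensorExtend R 𝔄 Λ Λ' X = X') : K0.baseChange Λ' (boundary X) = boundary X' :=
  congrArg (fun ξ => K0.mk (⟨_, _, ξ⟩ : Triple R 𝔄 Λ')) (rightMul_baseChange X X' h)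

end ExtendBoundary

/-! ### Resolvend classes of free lattices -/

section ResolvendClass
variable {L Lc : Type u} [Field L] [Field Lc] [Algebra L Lc] {G : Type v} [Group G] [Fintype G]
  {π : (Lc ≃ₐ[L] Lc) →* G} [ValuativeRel L] [TopologicalSpace L] [IsNonarchimedeanLocalField L]
  [CharZero L] [CharZero Lc] [IsAlgClosed Lc] [Algebra.IsAlgebraic L Lc]

theorem tensorOf_intMap (w : MonoidAlgebra 𝒪[L] G) :
    tensorOf 𝒪[L] Lc (intMap L Lc G w) = 1 ⊗ₜ w := by
  induction w using MonoidAlgebra.induction_linear with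
  | zero => rw [map_zero, map_zero, TensorProduct.tmul_zero]
  | add x y hx hy => rw [map_add, map_add, hx, hy, TensorProduct.tmul_add]
  | single g r =>
    rw [intMap, MonoidAlgebra.mapRingHom_single, tensorOf, MonoidAlgebra.lift_single]
    change algebraMap 𝒪[L] Lc r • ((1 : Lc) ⊗ₜ[𝒪[L]] MonoidAlgebra.of 𝒪[L] G g) = _
    rw [algebraMap_smul, ← TensorProduct.tmul_smul, MonoidAlgebra.of_apply,
      MonoidAlgebra.smul_single, smul_eq_mul, mul_one]

/-- The class of a free lattice generated by an element with resolvend `b`. -/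
theorem IsResolvend.isResolvendClass {b : (MonoidAlgebra Lc G)ˣ}
    (hb : IsResolvend π (b : MonoidAlgebra Lc G)) {M : Submodule 𝒪[L] (galoisAlgebra π)}
    (hM : ∀ x ∈ M, ∃ w, resolvend x.1 = intMap L Lc G w * b)
    (hM' : ∀ w : MonoidAlgebra 𝒪[L] G, w • hb.toAlgebra ∈ M) :
    IsResolvendClass π M
      (boundary (Units.map (tensorOf (G := G) 𝒪[L] Lc).toRingHom.toMonoidHom b)) := by
  let φ : MonoidAlgebra 𝒪[L] G →ₗ[MonoidAlgebra 𝒪[L] G] galoisAlgebra π :=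
    LinearMap.toSpanSingleton _ _ hb.toAlgebra
  have hφ : ∀ w, resolvend (φ w).1 = intMap L Lc G w * b := fun w => by
    refine (resolvend_smul w hb.toAlgebra).trans ?_
    rw [hb.resolvend_toAlgebra]
  have hinj : Function.Injective φ := fun w w' h => by
    have h1 := congrArg (fun a : galoisAlgebra π => resolvend a.1) h
    simp only [hφ] at h1
    exact intMap_injective ((Units.mul_left_inj b).1 h1)
  let e := LinearEquiv.ofInjective φ hinj
  have hfin : Module.Finite (MonoidAlgebra 𝒪[L] G) (LinearMap.range φ) := Module.Finite.equiv e
  have hproj : Module.Projective (MonoidAlgebra 𝒪[L] G) (LinearMap.range φ) :=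
    Module.Projective.of_equiv e
  let P : ProjMod 𝒪[L] (MonoidAlgebra 𝒪[L] G) := ⟨LinearMap.range φ⟩
  let α : P ≃ₗ[MonoidAlgebra 𝒪[L] G] ProjMod.self 𝒪[L] (MonoidAlgebra 𝒪[L] G) := e.symm
  let X := Units.map (tensorOf (G := G) 𝒪[L] Lc).toRingHom.toMonoidHom b
  refine ⟨LinearMap.range φ, ?_, hfin, hproj, (rightMul X).comp (LatIso.ofEquiv α), fun m => ?_, ?_⟩
  · refine Submodule.ext fun x => ⟨?_, fun hx => ?_⟩
    · rintro ⟨w, rfl⟩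
      exact hM' w
    · obtain ⟨w, hw⟩ := hM x hx
      exact ⟨w, Subtype.ext (resolvend_injective ((hφ w).trans hw.symm))⟩
  · rw [LatIso.comp_apply, LatIso.ofEquiv_apply]
    obtain ⟨w, rfl⟩ := e.surjective m
    have h1 : ext Lc P (ProjMod.self 𝒪[L] (MonoidAlgebra 𝒪[L] G)) α.toLinearMap
        ((1 : Lc) ⊗ₜ[𝒪[L]] (e w : P)) = (1 : Lc) ⊗ₜ[𝒪[L]] w :=
      congrArg (fun y => (1 : Lc) ⊗ₜ[𝒪[L]] y) (e.symm_apply_apply w)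
    refine (congrArg (rightMul X).toEquiv h1).trans ?_
    change ((1 : Lc) ⊗ₜ[𝒪[L]] w) * tensorOf 𝒪[L] Lc (b : MonoidAlgebra Lc G) =
      tensorOf 𝒪[L] Lc (resolvend (φ w).1)
    rw [hφ, map_mul, tensorOf_intMap]
  · have h1 := K0.mk_comp P _ _ (LatIso.ofEquiv (Λ := Lc) α) (rightMul X)
    rw [K0.mk_ofEquiv, zero_add] at h1
    exact h1.symm

/-- The image of a boundary class under extension of scalars. -/
theorem baseChange_boundaryL (x : (MonoidAlgebra L G)ˣ) :
    K0.baseChange Lc (boundaryL x) = boundary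
      (Units.map (tensorOf (G := G) 𝒪[L] Lc).toRingHom.toMonoidHom (extendUnits Lc x)) := by
  refine baseChange_boundary _ _ ?_
  change tensorExtend 𝒪[L] (MonoidAlgebra 𝒪[L] G) L Lc (tensorOf 𝒪[L] L (x : MonoidAlgebra L G)) =
    tensorOf 𝒪[L] Lc (MonoidAlgebra.mapRingHom G (algebraMap L Lc) (x : MonoidAlgebra L G))
  generalize (x : MonoidAlgebra L G) = y
  induction y using MonoidAlgebra.induction_linear with
  | zero => simp only [map_zero]
  | add a b ha hb => simp only [map_add, ha, hb]
  | single g l =>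
    rw [MonoidAlgebra.mapRingHom_single, tensorOf, tensorOf, MonoidAlgebra.lift_single,
      MonoidAlgebra.lift_single]
    change tensorExtend 𝒪[L] (MonoidAlgebra 𝒪[L] G) L Lc
      (l • ((1 : L) ⊗ₜ[𝒪[L]] MonoidAlgebra.of 𝒪[L] G g)) =
      algebraMap L Lc l • ((1 : Lc) ⊗ₜ[𝒪[L]] MonoidAlgebra.of 𝒪[L] G g)
    rw [TensorProduct.smul_tmul', TensorProduct.smul_tmul', tensorExtend_tmul, smul_eq_mul, mul_one,
      smul_eq_mul, mul_one]

end ResolvendClass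
end GaloisStructure
end

noncomputable section
namespace GaloisStructure
set_option linter.unusedSectionVars false

/-! ### Determinants of diagonal elements -/

section DetCyclic
variable {K : Type u} [Field K] [IsAlgClosed K] [CharZero K] {G : Type v} [Group G]
  {z : K} {s : G}

theorem trace_cyclicIdem {n : ℕ} (ρ : G →* Matrix (Fin n) (Fin n) K) (j : ℕ) :
    (cyclicIdem z (ρ s) (orderOf s) j).trace = eigenMult z s j fun g => (ρ g).trace := by
  rw [cyclicIdem, Matrix.trace_smul, Matrix.trace_sum, eigenMult, smul_eq_mul]
  congr 1
  refine Finset.sum_congr rfl fun i _ => ?_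
  rw [Matrix.trace_smul, smul_eq_mul, map_pow, mul_comm]

theorem cyclicDiag_pow {A : Type*} [Ring A] [Algebra K A] {S : A} {e : ℕ}
    (hz : IsPrimitiveRoot z e) (hS : S ^ e = 1) (he : (e : K) ≠ 0) (l : ℕ → K) (k : ℕ) :
    cyclicDiag z S e l ^ k = cyclicDiag z S e (l ^ k) := by
  induction k with
  | zero => rw [pow_zero, pow_zero, cyclicDiag_one hz hS he]
  | succ k ih => rw [pow_succ, ih, cyclicDiag_mul hz hS he, pow_succ]

/-- In characteristic zero the traces of all powers determine the determinant. Here they agree with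
those of a diagonal matrix in which `l j` is repeated `m j` times. -/
theorem det_cyclicDiag (hs : orderOf s ≠ 0) (hz : IsPrimitiveRoot z (orderOf s)) (l : ℕ → K)
    {n : ℕ} (ρ : G →* Matrix (Fin n) (Fin n) K) {m : ℕ → ℕ}
    (hm : ∀ j, eigenMult z s j (fun g => (ρ g).trace) = m j) :
    (cyclicDiag z (ρ s) (orderOf s) l).det = ∏ j ∈ Finset.range (orderOf s), l j ^ m j := by
  have he : (orderOf s : K) ≠ 0 := Nat.cast_ne_zero.2 hs
  have hS : ρ s ^ orderOf s = 1 := by rw [← map_pow, pow_orderOf_eq_one, map_one]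
  let D : Matrix (Σ j : Fin (orderOf s), Fin (m j)) (Σ j : Fin (orderOf s), Fin (m j)) K :=
    Matrix.diagonal fun i => l i.1
  have h1 : LinearMap.det (Matrix.toLin' (cyclicDiag z (ρ s) (orderOf s) l)) =
      LinearMap.det (Matrix.toLin' D) := by
    refine det_eq_of_trace_pow_eq _ _ fun k => ?_
    rw [← Matrix.toLin'_pow, ← Matrix.toLin'_pow, Matrix.trace_toLin'_eq, Matrix.trace_toLin'_eq,
      cyclicDiag_pow hz hS he, Matrix.diagonal_pow, Matrix.trace_diagonal, cyclicDiag,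
      Matrix.trace_sum, Finset.sum_range, Fintype.sum_sigma]
    refine Finset.sum_congr rfl fun j _ => ?_
    rw [Matrix.trace_smul, trace_cyclicIdem, hm]
    simp [mul_comm]
  rw [LinearMap.det_toLin', LinearMap.det_toLin', Matrix.det_diagonal, Fintype.prod_sigma] at h1
  rw [h1, Finset.prod_range]
  exact Finset.prod_congr rfl fun j _ => by simp

theorem detAt_cyclicDiag (hs : orderOf s ≠ 0) (hz : IsPrimitiveRoot z (orderOf s)) {l : ℕ → K}
    (hl : ∀ j, l j ≠ 0) (χ : VirtualChar G K) {x : (MonoidAlgebra K G)ˣ}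
    (hx : (x : MonoidAlgebra K G) = cyclicDiag z (MonoidAlgebra.of K G s) (orderOf s) l) :
    (detAt χ x : K) = ∏ j ∈ Finset.range (orderOf s), l j ^ multiplicity z s j χ := by
  obtain ⟨_, ⟨n, ρ, rfl⟩, _, ⟨m, τ, rfl⟩, h⟩ := exists_sub χ.2
  have key : ∀ {n : ℕ} (ρ : G →* Matrix (Fin n) (Fin n) K) {m : ℕ → ℕ}
      (_ : ∀ j, eigenMult z s j (fun g => (ρ g).trace) = m j),
      (detRep ρ x : K) = ∏ j ∈ Finset.range (orderOf s), l j ^ m j := fun {n} ρ {m} hm => by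
    change (MonoidAlgebra.lift K (Matrix (Fin n) (Fin n) K) G ρ x.1).det = _
    rw [hx, map_cyclicDiag, MonoidAlgebra.lift_of, det_cyclicDiag hs hz l ρ hm]
  choose a ha using fun j => exists_nat_of_char hs hz.pow_eq_one j n ρ
  choose b hb using fun j => exists_nat_of_char hs hz.pow_eq_one j m τ
  rw [detAt_eq χ x ρ τ (congrFun h), Units.val_div_eq_div_val, key ρ ha, key τ hb,
    ← Finset.prod_div_distrib]
  refine Finset.prod_congr rfl fun j _ => ?_
  have h1 : multiplicity z s j χ = (a j : ℤ) - b j := by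
    apply Int.cast_injective (α := K)
    rw [multiplicity_spec hs hz.pow_eq_one, Int.cast_sub, Int.cast_natCast, Int.cast_natCast, ← ha,
      ← hb, h]
    simp [eigenMult, sub_mul, mul_sub]
  rw [h1, zpow_sub₀ (hl j), zpow_natCast, zpow_natCast]

end DetCyclic

/-! ### The second Adams operation and the Stickelberger pairing -/

section Adams
variable {K : Type u} [Field K] [CharZero K] {G : Type v} [Group G] {z : K} {s : G}

/-- Doubling permutes the residues modulo an odd number. -/
theorem sum_range_two_mul {M : Type*} [AddCommMonoid M] {e : ℕ} (he : Odd e) {f : ℕ → M}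
    (hf : ∀ i, f (i % e) = f i) :
    ∑ i ∈ Finset.range e, f (2 * i) = ∑ i ∈ Finset.range e, f i := by
  have hinj : Set.InjOn (fun i => 2 * i % e) (Finset.range e : Set ℕ) := fun i hi j hj h => by
    have h1 : i ≡ j [MOD e] := Nat.ModEq.cancel_left_of_coprime
      ((Nat.coprime_two_right (n := e)).2 he) h
    exact Nat.ModEq.eq_of_lt_of_lt h1 (Finset.mem_range.1 hi) (Finset.mem_range.1 hj)
  have hmaps : Set.MapsTo (fun i => 2 * i % e) (Finset.range e : Set ℕ) (Finset.range e : Set ℕ) :=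
    fun i _ => Finset.mem_coe.2 (Finset.mem_range.2 (Nat.mod_lt _ he.pos))
  refine Finset.sum_nbij (fun i => 2 * i % e) (fun i hi => hmaps hi) hinj
    (Finset.surjOn_of_injOn_of_card_le _ hmaps hinj le_rfl) fun i _ => (hf _).symm

theorem eigenMult_mod (hz : z ^ orderOf s = 1) (j : ℕ) (χ : G → K) :
    eigenMult z s (j % orderOf s) χ = eigenMult z s j χ := by
  have h1 : z⁻¹ ^ (j % orderOf s) = z⁻¹ ^ j :=
    (pow_eq_pow_mod j (by rw [inv_pow, hz, inv_one])).symm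
  simp only [eigenMult, h1]

/-- Squaring permutes `⟨s⟩` because its order is odd, so the sum over the `s ^ i` that defines a
multiplicity may be taken over the `s ^ (2 * i)`. In effect `ψ₂` carries `ξ ^ j` to `ξ ^ (2 * j)`.
-/
theorem eigenMult_psi2 (hs : Odd (orderOf s)) (hz : z ^ orderOf s = 1) (j : ℕ)
    (χ : VirtualChar G K) : eigenMult z s (2 * j) (psi2 χ).1 = eigenMult z s j χ.1 := by
  have h1 : (z⁻¹ ^ j) ^ orderOf s = 1 := by
    rw [pow_right_comm, inv_pow, hz, inv_one, one_pow]
  rw [eigenMult, eigenMult, ← sum_range_two_mul hs (f := fun i => χ.1 (s ^ i) * (z⁻¹ ^ j) ^ i)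
    fun i => by rw [pow_mod_orderOf, ← pow_eq_pow_mod i h1]]
  congr 1
  refine Finset.sum_congr rfl fun i _ => ?_
  change χ.1 ((s ^ i) ^ 2) * _ = _
  congr 1
  · rw [← pow_mul, mul_comm]
  · rw [← pow_mul, ← pow_mul]
    congr 1
    ring

theorem stickelberger_psi2 (hs : Odd (orderOf s)) (hz : z ^ orderOf s = 1) (χ : VirtualChar G K) :
    stickelberger z s (psi2 χ) =
      ∑ j ∈ Finset.range (orderOf s), multiplicity z s j χ * Int.fract ((2 * j : ℚ) / orderOf s) := by
  have hs0 : (orderOf s : ℚ) ≠ 0 := Nat.cast_ne_zero.2 hs.pos.ne'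
  rw [stickelberger, ← sum_range_two_mul hs (f := fun j => (multiplicity z s j (psi2 χ) : ℚ) *
    Int.fract ((j : ℚ) / orderOf s))]
  · refine Finset.sum_congr rfl fun j _ => ?_
    rw [multiplicity, eigenMult_psi2 hs hz, ← multiplicity]
    push_cast
    rfl
  · intro j
    rw [multiplicity, eigenMult_mod hz, ← multiplicity]
    congr 1
    rw [Int.fract_eq_fract]
    refine ⟨-(j / orderOf s : ℕ), ?_⟩
    have h1 : (j : ℚ) = (j % orderOf s : ℕ) + orderOf s * (j / orderOf s : ℕ) := by
      exact_mod_cast (Nat.mod_add_div j (orderOf s)).symm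
    conv_lhs => rw [h1]
    rw [Int.cast_neg, Int.cast_natCast]
    field_simp
    ring

/-- With `e` the order of `s`, each `ξ ^ j` contributes `{2j/e} - 2{j/e}`, which is `0` if `2j < e`
and `-1` otherwise. In particular the pairing is an integer, so that no proper root of `ϖ` enters.
-/
theorem stickelberger_psi2_sub (hs : Odd (orderOf s)) (hz : z ^ orderOf s = 1)
    (χ : VirtualChar G K) : stickelberger z s (psi2 χ - 2 • χ) =
      ((∑ j ∈ Finset.range (orderOf s),
        multiplicity z s j χ * (if 2 * j < orderOf s then 0 else -1) : ℤ) : ℚ) := by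
  let φ : VirtualChar G K →+ ℚ :=
    AddMonoidHom.mk' (stickelberger z s) (stickelberger_add hs.pos.ne' hz)
  have h1 : φ (psi2 χ - 2 • χ) = φ (psi2 χ) - 2 • φ χ := by rw [map_sub, map_nsmul]
  change stickelberger z s (psi2 χ - 2 • χ) = stickelberger z s (psi2 χ) -
    2 • stickelberger z s χ at h1
  rw [h1, stickelberger_psi2 hs hz, stickelberger, two_smul, ← Finset.sum_add_distrib,
    ← Finset.sum_sub_distrib, Int.cast_sum]
  refine Finset.sum_congr rfl fun j hj => ?_
  have hj' : (j : ℚ) < orderOf s := by exact_mod_cast Finset.mem_range.1 hj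
  have hs0 : (0 : ℚ) < orderOf s := by exact_mod_cast hs.pos
  have h2 : Int.fract ((j : ℚ) / orderOf s) = j / orderOf s :=
    Int.fract_eq_self.2 ⟨by positivity, (div_lt_one hs0).2 hj'⟩
  rw [h2]
  split_ifs with h
  · have h3 : Int.fract ((2 * j : ℚ) / orderOf s) = 2 * j / orderOf s :=
      Int.fract_eq_self.2 ⟨by positivity, (div_lt_one hs0).2 (by exact_mod_cast h)⟩
    rw [h3]
    push_cast
    ring
  · have h3 : Int.fract ((2 * j : ℚ) / orderOf s) = 2 * j / orderOf s - 1 := by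
      rw [Int.fract_eq_iff]
      have h4 : (orderOf s : ℚ) ≤ 2 * j := by exact_mod_cast not_lt.1 h
      refine ⟨sub_nonneg.2 ((one_le_div hs0).2 h4), ?_, 1, by push_cast; ring⟩
      rw [sub_lt_iff_lt_add, div_lt_iff₀ hs0]
      linarith
    rw [h3]
    push_cast
    ring

/-- Passing from the interval `[0, e)` to `[-d, d]` lowers by `e` exactly the exponents greater than
`d`. This is the step function of `stickelberger_psi2_sub`. -/
theorem expo_neg_sub_expo_zero {e d : ℕ} (he : e = 2 * d + 1) {j : ℕ} (hj : j < e) :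
    expo e (-d) j = expo e 0 j + e * (if 2 * j < e then 0 else -1) := by
  have h0 : expo e 0 j = j := by
    rw [expo, sub_zero, zero_add, Int.emod_eq_of_lt (by omega) (by omega)]
  rw [h0, expo, sub_neg_eq_add]
  split_ifs with h
  · rw [Int.emod_eq_of_lt (by omega) (by omega)]
    omega
  · have h1 : ((j : ℤ) + d) % e = j + d - e := by
      rw [show (j + d : ℤ) = j + d - e + e * 1 by ring, Int.add_mul_emod_self_left,
        Int.emod_eq_of_lt (by omega) (by omega)]
      ring
    rw [h1]
    omega

end Adams

theorem ratPow_intCast {K : Type*} [Field K] (root : ℕ → K) (n : ℤ) :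
    ratPow root (n : ℚ) = root 1 ^ n := by
  rw [ratPow, Rat.den_intCast, Rat.num_intCast]

/-! ### Descent of units -/

section Descent
variable {L Lc : Type u} [Field L] [Field Lc] [Algebra L Lc] {G : Type v} [Group G] [Fintype G]
  [ValuativeRel L] [TopologicalSpace L] [IsNonarchimedeanLocalField L] [CharZero L] [CharZero Lc]
  [IsAlgClosed Lc] [Algebra.IsAlgebraic L Lc]

/-- The inverse of a Galois invariant unit is Galois invariant, so both descend to `L[G]`. -/
theorem exists_extendUnits_eq {x : (MonoidAlgebra Lc G)ˣ}
    (hx : ∀ ω : Lc ≃ₐ[L] Lc, galAct G ω (x : MonoidAlgebra Lc G) = x) :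
    ∃ y : (MonoidAlgebra L G)ˣ, extendUnits Lc y = x := by
  have : IsGalois L Lc := isGalois_of_isAlgClosed
  let ι := MonoidAlgebra.mapRingHom G (algebraMap L Lc)
  have hι : Function.Injective ι := fun a b h => ext_coeff fun g =>
    (algebraMap L Lc).injective (by
      rw [← MonoidAlgebra.coeff_mapRingHom, ← MonoidAlgebra.coeff_mapRingHom]
      exact congrArg (fun y => MonoidAlgebra.coeff y g) h)
  have key : ∀ y : MonoidAlgebra Lc G, (∀ ω : Lc ≃ₐ[L] Lc, galAct G ω y = y) → ∃ w, ι w = y :=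
    fun y hy => by
      choose l hl using fun g => mem_of_forall_fixed (L := L) (x := y.coeff g) fun ω => by
        rw [← coeff_galAct, hy]
      refine ⟨⟨Finsupp.equivFunOnFinite.symm l⟩, ext_coeff fun g => ?_⟩
      rw [MonoidAlgebra.coeff_mapRingHom, ← hl]
      rfl
  have hx' : ∀ ω : Lc ≃ₐ[L] Lc, galAct G ω ((x⁻¹ : (MonoidAlgebra Lc G)ˣ) : MonoidAlgebra Lc G) =
      ((x⁻¹ : (MonoidAlgebra Lc G)ˣ) : MonoidAlgebra Lc G) := fun ω => by
    have h1 : Units.map (galAct G ω : MonoidAlgebra Lc G →+* _).toMonoidHom x = x :=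
      Units.ext (hx ω)
    have h2 := map_inv (Units.map (galAct G ω : MonoidAlgebra Lc G →+* _).toMonoidHom) x
    rw [h1] at h2
    exact congrArg Units.val h2
  obtain ⟨a, ha⟩ := key _ hx
  obtain ⟨b, hb⟩ := key _ hx'
  refine ⟨⟨a, b, hι ?_, hι ?_⟩, Units.ext ha⟩
  · rw [map_mul, ha, hb, Units.mul_inv, map_one]
  · rw [map_mul, ha, hb, Units.inv_mul, map_one]

end Descent

/-! ### Classes of the ideals and the determinant of their quotient -/

section SquareRootClass
open scoped NNReal
variable {L Lc : Type u} [Field L] [Field Lc] [Algebra L Lc] {G : Type v} [Group G] [Fintype G]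
  {π : (Lc ≃ₐ[L] Lc) →* G} [ValuativeRel L] [TopologicalSpace L] [IsNonarchimedeanLocalField L]
  [CharZero L] [CharZero Lc] [IsAlgClosed Lc] [Algebra.IsAlgebraic L Lc]
variable {v : Valuation Lc ℝ≥0} (hv : IsExtendedValuation L v)
variable {s : G} {F : Lc ≃ₐ[L] Lc} {z r : Lc} {ϖ : 𝒪[L]} (hd : IsTameDatum π s F z r ϖ)
  (hϖ : Irreducible ϖ)
variable {u : (MonoidAlgebra Lc G)ˣ} (hu : gnorm v (u : MonoidAlgebra Lc G) ≤ 1)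
  (hu' : gnorm v ((u⁻¹ : (MonoidAlgebra Lc G)ˣ) : MonoidAlgebra Lc G) ≤ 1)
  (hb : ∀ n, IsResolvend π ((u * hd.weightUnit hϖ n : (MonoidAlgebra Lc G)ˣ) :
        MonoidAlgebra Lc G))

include hu hu' hb in
theorem IsTameDatum.isResolvendClass_valuationIdeal (n : ℤ) :
    IsResolvendClass π ((valuationIdeal π hv (v r ^ n)).restrictScalars 𝒪[L])
      (boundary (Units.map (tensorOf (G := G) 𝒪[L] Lc).toRingHom.toMonoidHom
        (u * hd.weightUnit hϖ n))) := by
  have hr0 := hd.map_root_pos hv hϖ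
  have hr1 := hd.map_root_lt_one hv hϖ
  refine (hb n).isResolvendClass (fun x hx => ?_) fun w h => ?_
  · refine hd.exists_intMap_mul_eq hv hϖ hu' (hb n) (isResolvend_resolvend x) ?_
    -- Elements of the ideal are bounded by `v r ^ n`, which is strictly less than the required `v r
    -- ^ (n - 1)`.
    refine (gnorm_resolvend_le_iff.2 hx).trans_lt ?_
    rw [zpow_lt_zpow_iff_right_of_lt_one₀ hr0 hr1]
    omega
  · refine gnorm_resolvend_le_iff.1 ?_ h
    rw [resolvend_smul, (hb n).resolvend_toAlgebra]
    refine (gnorm_mul_le _ _).trans ((mul_le_mul' (gnorm_le_iff.2 fun g => ?_)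
      (hd.gnorm_mul_weight hv hϖ hu hu' n).le).trans_eq (one_mul _))
    rw [coeff_intMap]
    exact hv.coe_le_one _

theorem detAt_conj_eq {K : Type u} [Field K] [IsAlgClosed K] [CharZero K] (χ : VirtualChar G K)
    (x y : (MonoidAlgebra K G)ˣ) : detAt χ (x * y * x⁻¹) = detAt χ y := by
  have h1 : detAt χ (x * y * x⁻¹ * x) = detAt χ (x * y) := by rw [inv_mul_cancel_right]
  rw [detAt_mul, detAt_mul χ x, mul_comm] at h1
  exact mul_left_cancel h1

-- The unit `u` enters by conjugation only and drops out of the determinant. What remains is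
-- diagonal in the idempotents, with entries `1` or `r ^ (-e) = ϖ⁻¹`, where `e` is the order of `s`.
include hd hϖ in
theorem IsTameDatum.detAt_weight_mul_inv {d : ℕ} (he : orderOf s = 2 * d + 1)
    (χ : VirtualChar G Lc) :
    (detAt χ (u * hd.weightUnit hϖ (-d) * (u * hd.weightUnit hϖ 0)⁻¹) : Lc) =
      algebraMap 𝒪[L] Lc ϖ ^ (∑ j ∈ Finset.range (orderOf s),
        multiplicity z s j χ * (if 2 * j < orderOf s then 0 else -1) : ℤ) := by
  have hr := hd.root_ne_zero hϖ
  have hϖ0 : algebraMap 𝒪[L] Lc ϖ ≠ 0 := by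
    rw [← hd.root_pow]
    exact pow_ne_zero _ hr
  have h1 : u * hd.weightUnit hϖ (-d) * (u * hd.weightUnit hϖ 0)⁻¹ =
      u * (hd.weightUnit hϖ (-d) * (hd.weightUnit hϖ 0)⁻¹) * u⁻¹ := by
    rw [mul_inv_rev, mul_assoc, mul_assoc, mul_assoc]
  rw [h1, detAt_conj_eq, detAt_cyclicDiag (orderOf_pos s).ne' hd.primitive
    (l := fun j => r ^ expo (orderOf s) (-d) j * (r ^ expo (orderOf s) 0 j)⁻¹)
    (fun j => mul_ne_zero (zpow_ne_zero _ hr) (inv_ne_zero (zpow_ne_zero _ hr))) χ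
    (cyclicDiag_mul hd.primitive of_pow_orderOf hd.cast_ne_zero _ _)]
  have h2 : ∀ S : Finset ℕ, algebraMap 𝒪[L] Lc ϖ ^ (∑ j ∈ S,
      multiplicity z s j χ * (if 2 * j < orderOf s then 0 else -1) : ℤ) =
      ∏ j ∈ S, algebraMap 𝒪[L] Lc ϖ ^
        (multiplicity z s j χ * (if 2 * j < orderOf s then 0 else -1) : ℤ) := fun S => by
    induction S using Finset.induction_on with
    | empty => rw [Finset.sum_empty, Finset.prod_empty, zpow_zero]
    | insert a S ha ih => rw [Finset.sum_insert ha, Finset.prod_insert ha, zpow_add₀ hϖ0, ih]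
  rw [h2]
  refine Finset.prod_congr rfl fun j hj => ?_
  rw [expo_neg_sub_expo_zero he (Finset.mem_range.1 hj), zpow_add₀ hr, mul_right_comm,
    mul_inv_cancel₀ (zpow_ne_zero _ hr), one_mul, zpow_mul, zpow_natCast, hd.root_pow, ← zpow_mul,
    mul_comm]

end SquareRootClass
end GaloisStructure
end

/-! ### The corollary -/

open GaloisStructure in
theorem corollary5p4 {L Lc : Type u} [Field L] [ValuativeRel L] [TopologicalSpace L]
    [IsNonarchimedeanLocalField L] [CharZero L]
    [Field Lc] [CharZero Lc] [Algebra L Lc] [IsAlgClosed Lc] [Algebra.IsAlgebraic L Lc]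
    {G : Type v} [Group G] [Fintype G] [TopologicalSpace G] [DiscreteTopology G]
    (ϖ : 𝒪[L]) (hϖ : Irreducible ϖ)
    (ζ : ℕ → Lc) (hζ : IsCompatibleRootsOfUnity ζ)
    (root : ℕ → Lc) (hroot : IsCompatibleRoots (algebraMap 𝒪[L] Lc ϖ) root)
    (σ : Lc ≃ₐ[L] Lc) (hσ : IsTameGenerator ζ root σ)
    (π : (Lc ≃ₐ[L] Lc) →* G) (hπ : Continuous π) (htame : IsTame π)
    (hodd : Odd (orderOf (π σ))) :
    ∃ A : FractionalIdeal (nonZeroDivisors (integers π)) (galoisAlgebra π),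
      ((A * A : FractionalIdeal _ _) : Submodule (integers π) (galoisAlgebra π)) = codifferent π ∧
      (∀ B : FractionalIdeal (nonZeroDivisors (integers π)) (galoisAlgebra π),
        ((B * B : FractionalIdeal _ _) : Submodule (integers π) (galoisAlgebra π)) =
          codifferent π → B = A) ∧
      ∃ a o : K0 𝒪[L] (MonoidAlgebra 𝒪[L] G) Lc,
        IsResolvendClass π
          ((A : Submodule (integers π) (galoisAlgebra π)).restrictScalars 𝒪[L]) a ∧
        IsResolvendClass π (Subalgebra.toSubmodule (integers π)) o ∧
        ∃ c : K0 𝒪[L] (MonoidAlgebra 𝒪[L] G) L, K0.baseChange Lc c = a - o ∧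
          ∃ f : EquivariantHom L Lc G,
            (∀ χ : VirtualChar G Lc, (f.1 (Multiplicative.ofAdd χ) : Lc) =
              ratPow root (stickelberger (ζ (orderOf (π σ))) (π σ) (psi2 χ - 2 • χ))) ∧
            IsRepresentedBy c f := by
  obtain ⟨F, hd⟩ := exists_isTameDatum ϖ hϖ ζ hζ root hroot σ hσ π hπ htame
  obtain ⟨v, hv⟩ := exists_isExtendedValuation (Lc := Lc) L
  obtain ⟨u, hu, hu', hb⟩ := hd.exists_isResolvend hv hϖ
    ((isOpen_discrete ({1} : Set G)).preimage hπ)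
  obtain ⟨d, he⟩ := hodd
  have hcod := hd.codifferent_eq hv hϖ hu hu' hb
  -- Odd order makes the exponent of the inverse different even; its half `-d` is the exponent of
  -- the square root.
  have hexp : (-(orderOf (π σ) - 1) : ℤ) = 2 * (-d : ℤ) := by rw [he]; push_cast; ring
  rw [hexp] at hcod
  let A : FractionalIdeal (nonZeroDivisors (integers π)) (galoisAlgebra π) :=
    ⟨_, hd.isFractional_valuationIdeal hv hϖ (d := d) (by omega)⟩
  refine ⟨A, ?_, fun B hB => ?_, _,
    boundary (Units.map (tensorOf (G := G) 𝒪[L] Lc).toRingHom.toMonoidHom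
      (u * hd.weightUnit hϖ 0)),
    hd.isResolvendClass_valuationIdeal hv hϖ hu hu' hb (-d), ?_, ?_⟩
  · rw [hcod]
    exact (FractionalIdeal.coe_mul A A).trans
      (hd.valuationIdeal_mul_self hv hϖ hu hu' hb (-d) rfl)
  · rw [FractionalIdeal.coe_mul, hcod] at hB
    exact Subtype.ext (hd.eq_of_mul_self_eq hv hϖ hu hu' hb (-d) hB)
  · have h1 := hd.isResolvendClass_valuationIdeal hv hϖ hu hu' hb 0
    have h2 : (valuationIdeal π hv (v (root (orderOf (π σ))) ^ (0 : ℤ))).restrictScalars 𝒪[L] =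
        Subalgebra.toSubmodule (integers π) := Submodule.ext fun x => by
      rw [zpow_zero]
      exact hv.mem_integers_iff.symm
    rwa [h2] at h1
  -- The quotient of the two generators is Galois invariant, so it is a unit of `L[G]`; its boundary
  -- is the required class and its determinant the required homomorphism.
  · obtain ⟨x, hx⟩ := exists_extendUnits_eq (L := L)
      (x := u * hd.weightUnit hϖ (-d) * (u * hd.weightUnit hϖ 0)⁻¹) fun ω =>
        (hb (-d)).mul_inv (hb 0) ω
    refine ⟨boundaryL x, ?_, DetL L Lc G x, fun χ => ?_, ⟨x, rfl⟩,
      fun y hy => DetL_mk_eq_of_boundaryL_eq hy⟩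
    · rw [baseChange_boundaryL, hx, map_mul, map_inv, boundary_mul_inv]
    -- The exponent is an integer, so `ratPow` only involves `root 1`, which is `ϖ`.
    · rw [stickelberger_psi2_sub ⟨d, he⟩ hd.primitive.pow_eq_one, ratPow_intCast, hroot.1,
        ← hd.detAt_weight_mul_inv hϖ he, ← hx]
      rfl
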